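/- **Setting.** For every security parameter $n$ let $\mathbb F$ be a finite field, $\theta\ge 1$, $E:\mathcal K_E\times\mathcal U\to\mathbb F^\theta$ an embedding function, $H$ a random oracle with values in $\mathbb F^\theta$ on triples $(x,e,k_E)\in\mathcal U\times\mathbb F^\theta\times\mathcal K_E$, $F:\mathcal K\times\mathbb F^\theta\to\{0,1\}^n$ a keyed function, with $\{0,1\}^n$ embedded in $\mathbb F$, and consider a linear $\theta$-out-of-$\theta$ secret-sharing scheme over $\mathbb F$ (a secret $g$ is shared by a uniformly random $(s_1,\dots,s_\theta)$ with $\sum_k a_k s_k=g$, for fixed nonzero $a_k$; for example additive sharing). Elements of $\mathcal K_E,\mathcal U,\mathcal K$ are bit strings of fixed length; these lengths, the length of the codes of field elements and $\theta$ are polynomially bounded in $n$. **Functionalities.** $\mathcal F_{ole}$: on client input $x\in\mathbb F$ and server input $u,v\in\mathbb F$, the client obtains $ux+v$ and the server nothing. $\mathcal F_{IC}$: on client input $y'\in\mathbb F^\theta$ and server input $(k,y)\in\mathcal K\times\mathbb F^\theta$, the client obtains $\gamma=F_k(y')$ if $y'=y$ and $\bot$ otherwise, and the server obtains nothing. **Protocol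 $\Pi_{IC}$.** The client has input $x'\in\mathcal U$; the server has $k_E\in\mathcal K_E$, $k\in\mathcal K$, $y\in\mathbb F^\theta$ and $\gamma=F_k(y)$. The server sends $k_E$, and the client computes $y'=E_{k_E}(x')+H(x',E_{k_E}(x'),k_E)$. The server shares $\gamma$ into $s_1,\dots,s_\theta$ and picks uniform $r_1,\dots,r_\theta\in\mathbb F$. For $k=1,\dots,\theta$, one after the other, the parties run an OLE protocol $\rho$ with client input $y'_k$ and server input $(r_k,\ s_k-r_ky_k)$, so that the client is to learn $s'_k=r_k(y'_k-y_k)+s_k$. The client outputs $\sum_k a_ks'_k$. **Secure realization.** All algorithms are non-uniform polynomial-time and have oracle access to $H$. An environment chooses the inputs of the honest parties, plays the corrupt party if there is one (and may deviate arbitrarily), and outputs a bit; two experiments are indistinguishable if this bit is 1 with the same probability up to a negligible amount, for every environment. A protocol *securely realizes* a functionality that gives output only to the client if 1. (both parties honest) the client's output is indistinguishable from the functionality's output, where for $\mathcal F_{IC}$ the output $\bot$ is replaced by a uniformly random element of $\mathbb F$; 2. (malicious client) there is a polynomial-time simulator that does not rewind the environment and queries the functionality, called on the honest server's input, at most once,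 such that interacting with it is indistinguishable from interacting with the honest server. For $\mathcal F_{IC}$ the key $k_E$ is sent to the client in the plain in the ideal experiment too, before the query; 3. (malicious server) there is a polynomial-time simulator that does not rewind the environment and obtains nothing about the honest client's input, such that interacting with it is indistinguishable from interacting with the honest client (the honest client's output is not part of the corrupt server's view). **Theorem.** Let $\rho$ be a polynomial-time two-party protocol (with a fixed number of rounds for each $n$, possibly using a trusted set-up that deals correlated randomness to the two parties at the start of each run) that securely realizes $\mathcal F_{ole}$. Then $\Pi_{IC}$, with its OLE calls carried out by $\rho$, securely realizes $\mathcal F_{IC}$. In particular the client reconstructs $\gamma$ if $y'=y$, and otherwise obtains a value that is indistinguishable from a uniformly random element of $\mathbb F$; both a malicious server's view and a malicious client's view can be simulated. -/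

import Mathlib

open Finset Filter

noncomputable section

/-! ### Parameters -/

/-- The public parameters at security level `n`: a finite field `F` whose elements are coded by
`codeLen` bits, the number `θ ≥ 1` of coordinates of an authentication token, the lengths of
embedding keys, client inputs and PRF keys, the embedding function, the keyed function (with
outputs in `{0,1}^n`), the identification `tok` of these outputs with field elements (so that they
can be secret-shared over `F`), and the nonzero reconstruction coefficients of a linear
`θ`-out-of-`θ` secret-sharing scheme (all ones: additive sharing). -/
structure Params (n : ℕ) where
  F : Type
  [instField : Field F]
  [instFintype : Fintype F]
  codeLen : ℕ
  code : F ↪ (Fin codeLen → Bool)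
  θ : ℕ
  θ_pos : 0 < θ
  keyLen : ℕ
  inputLen : ℕ
  prfKeyLen : ℕ
  emb : (Fin keyLen → Bool) → (Fin inputLen → Bool) → (Fin θ → F)
  prf : (Fin prfKeyLen → Bool) → (Fin θ → F) → (Fin n → Bool)
  tok : (Fin n → Bool) ↪ F
  coef : Fin θ → F
  coef_ne : ∀ k, coef k ≠ 0

attribute [instance] Params.instField Params.instFintype

/-- The hash function `H`, on triples (client input, embedded input, embedding key). -/
abbrev Params.Oracle {n : ℕ} (P : Params n) : Type :=
  (Fin P.inputLen → Bool) → (Fin P.θ → P.F) → (Fin P.keyLen → Bool) → (Fin P.θ → P.F)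

/-- The random oracle: a uniformly random `H`. -/
def Params.randomOracle {n : ℕ} (P : Params n) : PMF P.Oracle :=
  haveI : Fintype P.Oracle := Fintype.ofFinite _
  PMF.uniformOfFintype P.Oracle

/-- A uniformly random field element. -/
def Params.unif {n : ℕ} (P : Params n) : PMF P.F := PMF.uniformOfFintype P.F

/-- The client's token `y' = E_k(x') + H(x', E_k(x'), k)`. -/
def Params.token {n : ℕ} (P : Params n) (H : P.Oracle) (k : Fin P.keyLen → Bool)
    (x : Fin P.inputLen → Bool) : Fin P.θ → P.F :=
  P.emb k x + H x (P.emb k x) k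

/-- Reconstruction of a secret from all its `θ` shares. -/
def Params.reconstruct {n : ℕ} (P : Params n) (s : Fin P.θ → P.F) : P.F :=
  ∑ k, P.coef k * s k

theorem Params.exists_shares {n : ℕ} (P : Params n) (g : P.F) :
    ∃ s : Fin P.θ → P.F, P.reconstruct s = g := by
  refine ⟨Pi.single ⟨0, P.θ_pos⟩ ((P.coef ⟨0, P.θ_pos⟩)⁻¹ * g), ?_⟩
  unfold Params.reconstruct
  rw [Finset.sum_eq_single ⟨0, P.θ_pos⟩]
  · simp [mul_inv_cancel_left₀ (P.coef_ne _)]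
  · intro b _ hb
    simp [Pi.single_eq_of_ne hb]
  · simp

open Classical in
/-- Secret sharing of `g`: a uniformly random vector among the vectors of `θ` shares that
reconstruct to `g`. -/
def Params.share {n : ℕ} (P : Params n) (g : P.F) : PMF (Fin P.θ → P.F) :=
  PMF.uniformOfFinset (Finset.univ.filter fun s => P.reconstruct s = g)
    (by obtain ⟨s, hs⟩ := P.exists_shares g; exact ⟨s, by simp [hs]⟩)

/-- The functionality `F_ole`: on client input `x` and server input `u, v` the client obtains
`u x + v`. -/
def Params.fOLE {n : ℕ} (P : Params n) (x u v : P.F) : P.F := u * x + v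

open Classical in
/-- The functionality `F_IC`: on client input `y'` and server input `(k, y)` the client obtains
`prf k y'` if `y = y'` and `⊥` otherwise. -/
def Params.fIC {n : ℕ} (P : Params n) (y' : Fin P.θ → P.F) (k : Fin P.prfKeyLen → Bool)
    (y : Fin P.θ → P.F) : Option (Fin n → Bool) :=
  if y = y' then some (P.prf k y') else none

/-! ### Probabilistic programs with a step count -/

/-- A memory: every address carries one bit and one field element. -/
@[ext] structure Memory {n : ℕ} (P : Params n) (A : Type) where
  bit : A → Bool
  fld : A → P.F

namespace Memory

variable {n : ℕ} {P : Params n} {A : Type}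

/-- The memory that is zero everywhere. -/
def blank (P : Params n) (A : Type) : Memory P A := ⟨fun _ => false, fun _ => 0⟩

open Classical in
def setBit (m : Memory P A) (a : A) (b : Bool) : Memory P A := ⟨Function.update m.bit a b, m.fld⟩

open Classical in
def setFld (m : Memory P A) (a : A) (c : P.F) : Memory P A := ⟨m.bit, Function.update m.fld a c⟩

/-- The bits at the addresses `a 0, …, a (k-1)`. -/
def bits (m : Memory P A) (a : ℕ → A) (k : ℕ) : Fin k → Bool := fun i => m.bit (a i)

/-- The field elements at the addresses `a 0, …, a (k-1)`. -/
def flds (m : Memory P A) (a : ℕ → A) (k : ℕ) : Fin k → P.F := fun i => m.fld (a i)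

/-- Write the bits `v` to the addresses `a 0, …, a (k-1)`. -/
def setBits (m : Memory P A) (a : ℕ → A) {k : ℕ} (v : Fin k → Bool) : Memory P A :=
  (List.finRange k).foldl (fun m (i : Fin k) => m.setBit (a i) (v i)) m

/-- Write the field elements `v` to the addresses `a 0, …, a (k-1)`. -/
def setFlds (m : Memory P A) (a : ℕ → A) {k : ℕ} (v : Fin k → P.F) : Memory P A :=
  (List.finRange k).foldl (fun m (i : Fin k) => m.setFld (a i) (v i)) m

end Memory

/-- Elementary instructions; the first argument is the address that is written. There are Boolean
and field operations, random choices, conversions between field elements and their codes, and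
the evaluation of the public functions (embedding, keyed function, random oracle). -/
inductive Instr {n : ℕ} (P : Params n) (A : Type) : Type
  | const (d : A) (b : Bool)
  | nand (d a b : A)
  | coin (d : A)
  | fconst (d : A) (c : P.F)
  | fadd (d a b : A)
  | fmul (d a b : A)
  | fmux (d c a b : A)
  | funif (d : A)
  | toBit (d : A) (i : Fin P.codeLen) (a : A)
  | ofBits (d : A) (a : Fin P.codeLen → A)
  | emb (d : A) (i : Fin P.θ) (k : Fin P.keyLen → A) (x : Fin P.inputLen → A)
  | hash (d : A) (i : Fin P.θ) (x : Fin P.inputLen → A) (e : Fin P.θ → A)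
      (k : Fin P.keyLen → A)
  | prf (d : A) (i : Fin n) (k : Fin P.prfKeyLen → A) (y : Fin P.θ → A)
  | tok (d : A) (g : Fin n → A)

namespace Instr

variable {n : ℕ} {P : Params n} {A B : Type}

/-- Renaming of addresses. -/
def map (f : A → B) : Instr P A → Instr P B
  | const d b => const (f d) b
  | nand d a b => nand (f d) (f a) (f b)
  | coin d => coin (f d)
  | fconst d c => fconst (f d) c
  | fadd d a b => fadd (f d) (f a) (f b)
  | fmul d a b => fmul (f d) (f a) (f b)
  | fmux d c a b => fmux (f d) (f c) (f a) (f b)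
  | funif d => funif (f d)
  | toBit d i a => toBit (f d) i (f a)
  | ofBits d a => ofBits (f d) (f ∘ a)
  | emb d i k x => emb (f d) i (f ∘ k) (f ∘ x)
  | hash d i x e k => hash (f d) i (f ∘ x) (f ∘ e) (f ∘ k)
  | prf d i k y => prf (f d) i (f ∘ k) (f ∘ y)
  | tok d g => tok (f d) (f ∘ g)

/-- The effect of one instruction on the memory. -/
def step (H : P.Oracle) (m : Memory P A) : Instr P A → PMF (Memory P A)
  | const d b => PMF.pure (m.setBit d b)
  | nand d a b => PMF.pure (m.setBit d (!(m.bit a && m.bit b)))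
  | coin d => (PMF.uniformOfFintype Bool).map (m.setBit d)
  | fconst d c => PMF.pure (m.setFld d c)
  | fadd d a b => PMF.pure (m.setFld d (m.fld a + m.fld b))
  | fmul d a b => PMF.pure (m.setFld d (m.fld a * m.fld b))
  | fmux d c a b => PMF.pure (m.setFld d (if m.bit c then m.fld a else m.fld b))
  | funif d => P.unif.map (m.setFld d)
  | toBit d i a => PMF.pure (m.setBit d (P.code (m.fld a) i))
  | ofBits d a => PMF.pure (m.setFld d (Function.invFun P.code (m.bit ∘ a)))
  | emb d i k x => PMF.pure (m.setFld d (P.emb (m.bit ∘ k) (m.bit ∘ x) i))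
  | hash d i x e k => PMF.pure (m.setFld d (H (m.bit ∘ x) (m.fld ∘ e) (m.bit ∘ k) i))
  | prf d i k y => PMF.pure (m.setBit d (P.prf (m.bit ∘ k) (m.fld ∘ y) i))
  | tok d g => PMF.pure (m.setFld d (P.tok (m.bit ∘ g)))

end Instr

/-- A (non-uniform, straight-line) program; its running time is its length. -/
abbrev Prog {n : ℕ} (P : Params n) (A : Type) : Type := List (Instr P A)

/-- Execution of a program. -/
def Prog.run {n : ℕ} {P : Params n} {A : Type} (H : P.Oracle) :
    Prog P A → Memory P A → PMF (Memory P A)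
  | [], m => PMF.pure m
  | i :: p, m => (i.step H m).bind (Prog.run H p)

/-! ### Experiments -/

/-- The addresses of an experiment. -/
inductive Loc : Type
  /-- private registers of the environment -/
  | adv (i : ℕ)
  /-- the channel between the environment and the honest party -/
  | chan (i : ℕ)
  /-- where the environment hands inputs to honest parties and receives their outputs -/
  | top (i : ℕ)
  /-- inputs to the current OLE session (`true`: client, `false`: server) -/
  | inp (c : Bool) (i : ℕ)
  /-- private registers of a party in the current OLE session -/
  | prv (c : Bool) (i : ℕ)
  /-- private registers of the honest party of the implicit check -/
  | work (i : ℕ)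
  /-- private registers of the simulator -/
  | sim (i : ℕ)
  /-- registers shared by the simulator and the ideal functionality -/
  | port (i : ℕ)
  /-- private registers of the ideal functionality -/
  | fn (i : ℕ)

/-- What the environment, who also plays the corrupt party, can address. -/
inductive EReg : Type
  | adv (i : ℕ)
  | chan (i : ℕ)
  | top (i : ℕ)

/-- What an honest party of an OLE protocol can address. -/
inductive PReg : Type
  | inp (i : ℕ)
  | prv (i : ℕ)
  | chan (i : ℕ)

/-- What a simulator can address. -/
inductive SReg : Type
  | sim (i : ℕ)
  | chan (i : ℕ)
  | port (i : ℕ)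

/-- What the trusted set-up of an OLE protocol can address: what is dealt to the client (`true`)
and to the server (`false`), and private registers. -/
inductive DReg : Type
  | part (c : Bool) (i : ℕ)
  | own (i : ℕ)

def EReg.loc : EReg → Loc
  | .adv i => .adv i
  | .chan i => .chan i
  | .top i => .top i

def PReg.loc (c : Bool) : PReg → Loc
  | .inp i => .inp c i
  | .prv i => .prv c i
  | .chan i => .chan i

def SReg.loc : SReg → Loc
  | .sim i => .sim i
  | .chan i => .chan i
  | .port i => .port i

section

variable {n : ℕ} (P : Params n)

/-- One activation of the side of an experiment that faces the environment. -/
abbrev Step : Type := P.Oracle → Memory P Loc → PMF (Memory P Loc)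

/-- What the environment faces: the list of activations, in the order in which they occur. -/
abbrev World : Type := List (Step P)

/-- An environment: the programs that it runs before, between and after the activations. -/
abbrev Env : Type := List (Prog P EReg)

variable {P}

/-- The environment and the world take turns; the environment moves first and last. -/
def World.run (H : P.Oracle) : World P → Env P → Memory P Loc → PMF (Memory P Loc)
  | [], e, m => Prog.run H ((e.headD []).map (Instr.map EReg.loc)) m
  | h :: W, e, m =>
      ((Prog.run H ((e.headD []).map (Instr.map EReg.loc)) m).bind (h H)).bind
        (World.run H W e.tail)

/-- The probability, over the random oracle and all coins, that the environment ends with bit 1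
in its register 0. -/
def World.accept (W : World P) (e : Env P) : ℝ :=
  ((P.randomOracle.bind fun H => W.run H e (Memory.blank P Loc)).map
    (fun m => m.bit (.adv 0)) true).toReal

/-- A simulator: at its activation `t` it runs the first program, then the functionality answers a
request (if there is one), then it runs the second program. -/
abbrev Simulator (P : Params n) : Type := ℕ → Prog P SReg × Prog P SReg

/-- The total running time of a simulator over `T` activations. -/
def Simulator.time (S : Simulator P) (T : ℕ) : ℕ :=
  ∑ t ∈ range T, ((S t).1.length + (S t).2.length)

/-- Activation `t` of a simulator that is connected to the functionality `f`. -/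
def Simulator.act (S : Simulator P) (f : Memory P Loc → Memory P Loc) (t : ℕ) : Step P :=
  fun H m =>
    ((Prog.run H ((S t).1.map (Instr.map SReg.loc)) m).map f).bind
      (Prog.run H ((S t).2.map (Instr.map SReg.loc)))

end

/-! ### Secure realization -/

/-- Polynomially bounded functions. -/
def PolyBounded (f : ℕ → ℕ) : Prop := ∃ p : Polynomial ℕ, ∀ n, f n ≤ p.eval n

/-- Negligible functions. -/
def Negligible (f : ℕ → ℝ) : Prop :=
  Asymptotics.SuperpolynomialDecay atTop (fun n : ℕ => (n : ℝ)) f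

/-- Computational indistinguishability by polynomial-time environments. -/
def Indist (P : ∀ n, Params n) (V W : ∀ n, World (P n)) : Prop :=
  ∀ e : ∀ n, Env (P n), PolyBounded (fun n => (e n).flatten.length) →
    Negligible fun n => |(V n).accept (e n) - (W n).accept (e n)|

/-- The worlds that compare a two-party protocol with a functionality that gives output only to
the client: both parties honest, the client corrupt, the server corrupt. The ideal worlds of the
last two cases depend on a simulator. -/
structure Worlds {n : ℕ} (P : Params n) where
  honestReal : World P
  honestIdeal : World P
  clientReal : World P
  clientIdeal : Simulator P → World P
  serverReal : World P
  serverIdeal : Simulator P → World P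

/-- Secure realization: the output of an honest client is the right one, and there are
polynomial-time simulators of the view of a malicious client and of the view of a malicious
server. -/
def SecurelyRealizes (P : ∀ n, Params n) (T : ∀ n, Worlds (P n)) : Prop :=
  Indist P (fun n => (T n).honestReal) (fun n => (T n).honestIdeal) ∧
  (∃ S : ∀ n, Simulator (P n),
    PolyBounded (fun n => (S n).time (T n).clientReal.length) ∧
    Indist P (fun n => (T n).clientReal) (fun n => (T n).clientIdeal (S n))) ∧
  (∃ S : ∀ n, Simulator (P n),
    PolyBounded (fun n => (S n).time (T n).serverReal.length) ∧
    Indist P (fun n => (T n).serverReal) (fun n => (T n).serverIdeal (S n)))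

/-! ### Protocols for oblivious linear evaluation -/

/-- A two-party protocol: a trusted set-up deals `setupLen` registers to each party (`setupLen = 0`:
no set-up); in round `t < rounds` first the client and then the server runs its program `t`, and the
client ends with its program `rounds`. Inputs are in the registers `inp`, what the set-up has dealt
is initially in the registers `prv`, and the client leaves its output in `prv 0`. -/
structure OLEProtocol {n : ℕ} (P : Params n) where
  setupLen : ℕ
  dealer : Prog P DReg
  rounds : ℕ
  client : ℕ → Prog P PReg
  server : ℕ → Prog P PReg

namespace OLEProtocol

variable {n : ℕ} {P : Params n} (ρ : OLEProtocol P)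

/-- The total running time of the protocol. -/
def time : ℕ :=
  ρ.setupLen + ρ.dealer.length + ρ.rounds + ∑ t ∈ range (ρ.rounds + 1), (ρ.client t).length +
    ∑ t ∈ range ρ.rounds, (ρ.server t).length

/-- The activations of the honest party `c` with its program `t`. -/
def party (c : Bool) (t : ℕ) : Step P := fun H m =>
  Prog.run H (((if c then ρ.client else ρ.server) t).map (Instr.map (PReg.loc c))) m

/-- A run with two honest parties on client input `x` and server input `u, v`, up to the client's
output. -/
def honest (H : P.Oracle) (x u v : P.F) : PMF P.F :=
  (Prog.run H ρ.dealer (Memory.blank P DReg)).bind fun d =>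
    (Prog.run H
      (((List.range ρ.rounds).flatMap fun t =>
          (ρ.client t).map (Instr.map (PReg.loc true)) ++
          (ρ.server t).map (Instr.map (PReg.loc false))) ++
        (ρ.client ρ.rounds).map (Instr.map (PReg.loc true)))
      { bit := fun
          | .prv c i => if i < ρ.setupLen then d.bit (.part c i) else false
          | _ => false
        fld := fun
          | .prv c i => if i < ρ.setupLen then d.fld (.part c i) else 0
          | .inp true 0 => x
          | .inp false 0 => u
          | .inp false 1 => v
          | _ => 0 }).map fun m => m.fld (.prv true 0)

/-- The start of a session in which party `c` is honest and has input `z`, and the other party is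
corrupt: the honest party forgets all earlier sessions, and the set-up deals its output to the
honest party and, over the channel, to the corrupt one. -/
def start (c : Bool) (z : ℕ → P.F) : Step P := fun H m =>
  (Prog.run H ρ.dealer (Memory.blank P DReg)).map fun d =>
    { bit := fun
        | .prv c' i => if c' = c ∧ i < ρ.setupLen then d.bit (.part c i) else false
        | .inp _ _ => false
        | .chan i => if i < ρ.setupLen then d.bit (.part (!c) i) else m.bit (.chan i)
        | a => m.bit a
      fld := fun
        | .prv c' i => if c' = c ∧ i < ρ.setupLen then d.fld (.part c i) else 0
        | .inp c' i => if c' = c then z i else 0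
        | .chan i => if i < ρ.setupLen then d.fld (.part (!c) i) else m.fld (.chan i)
        | a => m.fld a }

/-- A session with honest server and corrupt client; `z` determines the server's input. -/
def serverSession (z : Memory P Loc → P.F × P.F) : World P :=
  (fun H m => ρ.start false (fun | 0 => (z m).1 | 1 => (z m).2 | _ => 0) H m) ::
    (List.range ρ.rounds).map (ρ.party false)

/-- A session with honest client and corrupt server; `z` determines the client's input. -/
def clientSession (z : Memory P Loc → P.F) : World P :=
  (fun H m => ρ.start true (fun | 0 => z m | _ => 0) H m) ::
    (List.range (ρ.rounds + 1)).map (ρ.party true)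

/-- The functionality `F_ole` with the honest server's input in `fn 0` and `fn 1`: the first time
that bit `port 0` is set, it takes `x` from `port 0` and returns `u x + v` in `port 1`. -/
def oleAnswer (m : Memory P Loc) : Memory P Loc :=
  if m.bit (.port 0) && !m.bit (.fn 0) then
    (m.setBit (.fn 0) true).setFld (.port 1)
      (P.fOLE (m.fld (.port 0)) (m.fld (.fn 0)) (m.fld (.fn 1)))
  else m

/-- The worlds for the protocol `ρ` and the functionality `F_ole`. With both parties honest the
environment hands over `x`, `u`, `v` and sees the client's output only. With the client corrupt it
hands over `u`, `v` and plays the client. With the server corrupt it hands over `x` and plays the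
server; as `F_ole` returns nothing to the server, the simulator obtains nothing. -/
def worlds : Worlds P where
  honestReal := [fun H m =>
    (ρ.honest H (m.fld (.top 0)) (m.fld (.top 1)) (m.fld (.top 2))).map (m.setFld (.top 0))]
  honestIdeal := [fun _ m =>
    PMF.pure (m.setFld (.top 0)
      (P.fOLE (m.fld (.top 0)) (m.fld (.top 1)) (m.fld (.top 2))))]
  clientReal := ρ.serverSession fun m => (m.fld (.top 0), m.fld (.top 1))
  clientIdeal S :=
    (fun H m => S.act oleAnswer 0 H
      ((m.setFld (.fn 0) (m.fld (.top 0))).setFld (.fn 1) (m.fld (.top 1)))) ::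
    (List.range ρ.rounds).map fun t => S.act oleAnswer (t + 1)
  serverReal := ρ.clientSession fun m => m.fld (.top 0)
  serverIdeal S := (List.range (ρ.rounds + 2)).map (S.act id)

end OLEProtocol

/-! ### The implicit-check protocol -/

namespace ImplicitCheck

variable {n : ℕ} {P : Params n} (ρ : OLEProtocol P)

/-- The server's randomness: shares `s` of (the field element of) `γ = prf k y`, and masks `r`. -/
def serverRandomness (k : Fin P.prfKeyLen → Bool) (y : Fin P.θ → P.F) :
    PMF ((Fin P.θ → P.F) × (Fin P.θ → P.F)) :=
  haveI : Fintype (Fin P.θ → P.F) := Fintype.ofFinite _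
  (P.share (P.tok (P.prf k y))).bind fun s =>
    (PMF.uniformOfFintype (Fin P.θ → P.F)).map fun r => (s, r)

/-- The sum of `acc` and the terms `coef k * o k`, `k ∈ l`, where `o k` is the client's output of an
OLE session on `y' k` and `(r k, s k - r k * y k)`. -/
def combine (H : P.Oracle) (y' y s r : Fin P.θ → P.F) : List (Fin P.θ) → P.F → PMF P.F
  | [], acc => PMF.pure acc
  | k :: l, acc => (ρ.honest H (y' k) (r k) (s k - r k * y k)).bind fun o =>
      combine H y' y s r l (acc + P.coef k * o)

/-- A run with two honest parties, up to the value that the client reconstructs. -/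
def honest (H : P.Oracle) (x : Fin P.inputLen → Bool) (ke : Fin P.keyLen → Bool)
    (k : Fin P.prfKeyLen → Bool) (y : Fin P.θ → P.F) : PMF P.F :=
  (serverRandomness k y).bind fun sr =>
    combine ρ H (P.token H ke x) y sr.1 sr.2 (List.finRange P.θ) 0

/-- The intended output: the value `γ` of `F_IC`, and a uniformly random element for `⊥`. -/
def honestOutput (H : P.Oracle) (x : Fin P.inputLen → Bool) (ke : Fin P.keyLen → Bool)
    (k : Fin P.prfKeyLen → Bool) (y : Fin P.θ → P.F) : PMF P.F :=
  match P.fIC (P.token H ke x) k y with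
  | some g => PMF.pure (P.tok g)
  | none => P.unif

/-- Where the environment hands over the embedding key, the PRF key, the token `y` and the client's
input. -/
def topKey (m : Memory P Loc) : Fin P.keyLen → Bool := m.bits (fun i => .top i) P.keyLen

def topPrfKey (m : Memory P Loc) : Fin P.prfKeyLen → Bool :=
  m.bits (fun i => .top (P.keyLen + i)) P.prfKeyLen

def topToken (m : Memory P Loc) : Fin P.θ → P.F := m.flds (fun i => .top i) P.θ

def topInput (m : Memory P Loc) : Fin P.inputLen → Bool :=
  m.bits (fun i => .top (P.keyLen + P.prfKeyLen + i)) P.inputLen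

/-- The honest server sends the embedding key and prepares its OLE inputs `r k` and
`s k - r k * y k`, which it keeps in `work (2 * k)` and `work (2 * k + 1)`. -/
def serverStart : Step P := fun _ m =>
  (serverRandomness (topPrfKey m) (topToken m)).map fun sr =>
    ((m.setBits (fun i => .chan i) (topKey m)).setFlds (fun k => .work (2 * k)) sr.2).setFlds
      (fun k => .work (2 * k + 1)) (fun k => sr.1 k - sr.2 k * topToken m k)

/-- The honest client stores its input. -/
def clientStart : Step P := fun _ m =>
  PMF.pure (m.setBits (fun i => .work i) (topInput m))

/-- The honest client takes the embedding key from the channel and computes its token. -/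
def clientToken : Step P := fun H m =>
  PMF.pure (m.setFlds (fun k => .work k)
    (P.token H (m.bits (fun i => .chan i) P.keyLen) (m.bits (fun i => .work i) P.inputLen)))

/-- The honest server hands its input to the functionality `F_IC` (the PRF key to the bits
`fn 1, fn 2, …`, the token to `fn 0, fn 1, …`) and sends the embedding key in the plain. -/
def idealStart (m : Memory P Loc) : Memory P Loc :=
  ((m.setBits (fun i => .chan i) (topKey m)).setBits (fun i => .fn (1 + i)) (topPrfKey m)).setFlds
    (fun k => .fn k) (topToken m)

/-- The functionality `F_IC`: the first time that bit `port 0` is set, it takes `y'` from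
`port 0, port 1, …`; if `F_IC` yields `γ`, it sets bit `port 1` and returns `γ` in the bits
`port 2, port 3, …`; if `F_IC` yields `⊥`, it clears bit `port 1`. -/
def icAnswer (m : Memory P Loc) : Memory P Loc :=
  if m.bit (.port 0) && !m.bit (.fn 0) then
    match P.fIC (m.flds (fun i => .port i) P.θ) (m.bits (fun i => .fn (1 + i)) P.prfKeyLen)
        (m.flds (fun i => .fn i) P.θ) with
    | some g =>
        ((m.setBit (.fn 0) true).setBit (.port 1) true).setBits (fun i => .port (2 + i)) g
    | none => (m.setBit (.fn 0) true).setBit (.port 1) false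
  else m

/-- The worlds for the implicit-check protocol, with its OLE calls carried out by `ρ`, and the
functionality `F_IC`. With both parties honest the environment hands over all inputs and sees the
client's output only. With the client corrupt it hands over the server's input and plays the
client. With the server corrupt it hands over the client's input and plays the server; as `F_IC`
returns nothing to the server, the simulator obtains nothing. -/
def worlds : Worlds P where
  honestReal := [fun H m =>
    (honest ρ H (topInput m) (topKey m) (topPrfKey m) (topToken m)).map (m.setFld (.top 0))]
  honestIdeal := [fun H m =>
    (honestOutput H (topInput m) (topKey m) (topPrfKey m) (topToken m)).map (m.setFld (.top 0))]
  clientReal :=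
    serverStart ::
      (List.range P.θ).flatMap fun k =>
        ρ.serverSession fun m => (m.fld (.work (2 * k)), m.fld (.work (2 * k + 1)))
  clientIdeal S :=
    (fun H m => S.act icAnswer 0 H (idealStart m)) ::
      (List.range (P.θ * (ρ.rounds + 1))).map fun t => S.act icAnswer (t + 1)
  serverReal :=
    clientStart :: clientToken ::
      (List.range P.θ).flatMap fun k => ρ.clientSession fun m => m.fld (.work k)
  serverIdeal S := (List.range (2 + P.θ * (ρ.rounds + 2))).map (S.act id)

end ImplicitCheck

/-- All lengths are polynomially bounded in the security parameter. -/
def Feasible (P : ∀ n, Params n) : Prop :=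
  PolyBounded (fun n => (P n).codeLen) ∧ PolyBounded (fun n => (P n).θ) ∧
  PolyBounded (fun n => (P n).keyLen) ∧ PolyBounded (fun n => (P n).inputLen) ∧
  PolyBounded (fun n => (P n).prfKeyLen)

end

noncomputable section

/-! ### Views of memories -/

namespace Memory

variable {n : ℕ} {P : Params n} {A B C : Type}

/-! There are two ingredients: a hybrid argument that replaces the OLE sessions one by one by ideal
or simulated ones, and linear algebra over the field for what remains. After the replacement
everything is an exact equality of distributions, valid for each fixed oracle `H`; only the
hypothesis on the OLE protocol costs a negligible error.

Both parties honest. With ideal OLE the client obtains `∑ a_k s_k + ∑ a_k r_k (y'_k - y_k)`. If `y'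
= y` this is the secret. If `y'_j ≠ y_j` for some `j`, the mask `r_j` is uniform and enters with a
nonzero coefficient, so the sum is uniform (`honestWith_idealOLE`).

Malicious client. Once each session is run by the OLE simulator, the client's queries `x_k` are
explicit and the answers are `t_k = s_k + r_k (x_k - y_k)`. Given the answers so far, the pair `(s,
r)` is uniform on an affine space (`Params.consistent`). On that space the next answer is either
constant or shifted by a translation of the space, hence uniform. It is constant exactly when all
other sessions have been answered and the complete query equals `y` (`Params.exists_shift`,
`Params.bind_answer`). The simulator can therefore answer with fresh uniform elements, query `F_IC`
only when the last missing query arrives, and, if `γ` comes back, give the one answer that completes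
a sharing of `γ`. The proof that this is perfect couples the simulator's memory with the hybrid
experiment: given the simulator's memory, the honest server's randomness has the posterior law
`masksOf`. The relation `Simulates` says that each activation respects this conditional law; the
decisive case is `simulates_answerBlock`.

Malicious server. The OLE simulators never see the client's input, so the client's computations can
be dropped, and running the OLE simulators one after the other is a simulator (`accept_dropWork`,
`serverIdeal_accept`).

The hybrid argument (`negligible_hybrid`, `hybrid_step`). Neighbouring hybrids differ in one
session. An environment of a single OLE experiment plays all other sessions itself, in private
registers, and leaves this session to its own experiment (`exists_reduction`). As environments are
non-uniform, the session with the largest gap can be hard-wired for each security parameter, and the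
total gap is at most `θ` times a negligible function.

Since parties, simulators and environments are straight-line programs with a length, the reduction
and the new simulators have to be exhibited as programs. Two general facts make this possible: a
program is natural with respect to injective renaming of addresses (`Prog.run_view`), and it changes
nothing outside the addresses it mentions (`Prog.run_frame`). On top of them, `FComp`, `BComp`,
`Impl`, `SessImpl`, `FreshImpl` and `SImpl` form a calculus of functions that are computable within
a given number of instructions. -/

@[simp] theorem blank_bit (a : A) : (blank P A).bit a = false := rfl

@[simp] theorem blank_fld (a : A) : (blank P A).fld a = 0 := rfl

open Classical in
theorem setBit_bit (m : Memory P A) (a b : A) (x : Bool) :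
    (m.setBit a x).bit b = if b = a then x else m.bit b := by
  simp [setBit, Function.update_apply]

@[simp] theorem setBit_fld (m : Memory P A) (a : A) (x : Bool) : (m.setBit a x).fld = m.fld := rfl

open Classical in
theorem setFld_fld (m : Memory P A) (a b : A) (x : P.F) :
    (m.setFld a x).fld b = if b = a then x else m.fld b := by
  simp [setFld, Function.update_apply]

@[simp] theorem setFld_bit (m : Memory P A) (a : A) (x : P.F) : (m.setFld a x).bit = m.bit := rfl

@[simp] theorem setBit_bit_self (m : Memory P A) (a : A) (x : Bool) :
    (m.setBit a x).bit a = x := by simp [setBit_bit]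

@[simp] theorem setFld_fld_self (m : Memory P A) (a : A) (x : P.F) :
    (m.setFld a x).fld a = x := by simp [setFld_fld]

theorem setBit_bit_of_ne (m : Memory P A) {a b : A} (x : Bool) (h : b ≠ a) :
    (m.setBit a x).bit b = m.bit b := by simp [setBit_bit, h]

theorem setFld_fld_of_ne (m : Memory P A) {a b : A} (x : P.F) (h : b ≠ a) :
    (m.setFld a x).fld b = m.fld b := by simp [setFld_fld, h]

@[simp] theorem setBit_same (m : Memory P A) (a : A) : m.setBit a (m.bit a) = m := by
  simp [setBit]

@[simp] theorem setFld_same (m : Memory P A) (a : A) : m.setFld a (m.fld a) = m := by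
  simp [setFld]

theorem setBits_zero (m : Memory P A) (a : ℕ → A) (v : Fin 0 → Bool) : m.setBits a v = m := rfl

theorem setFlds_zero (m : Memory P A) (a : ℕ → A) (v : Fin 0 → P.F) : m.setFlds a v = m := rfl

theorem setBits_succ (m : Memory P A) (a : ℕ → A) {k : ℕ} (v : Fin (k + 1) → Bool) :
    m.setBits a v = (m.setBit (a 0) (v 0)).setBits (fun i => a (i + 1)) (fun i => v i.succ) := by
  simp [setBits, List.finRange_succ, List.foldl_map]

theorem setFlds_succ (m : Memory P A) (a : ℕ → A) {k : ℕ} (v : Fin (k + 1) → P.F) :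
    m.setFlds a v = (m.setFld (a 0) (v 0)).setFlds (fun i => a (i + 1)) (fun i => v i.succ) := by
  simp [setFlds, List.finRange_succ, List.foldl_map]

@[simp] theorem setBits_fld (m : Memory P A) (a : ℕ → A) {k : ℕ} (v : Fin k → Bool) :
    (m.setBits a v).fld = m.fld := by
  induction k generalizing m a with
  | zero => rfl
  | succ k ih => rw [setBits_succ, ih]; rfl

@[simp] theorem setFlds_bit (m : Memory P A) (a : ℕ → A) {k : ℕ} (v : Fin k → P.F) :
    (m.setFlds a v).bit = m.bit := by
  induction k generalizing m a with
  | zero => rfl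
  | succ k ih => rw [setFlds_succ, ih]; rfl

theorem setBits_bit_of_ne (m : Memory P A) (a : ℕ → A) {k : ℕ} (v : Fin k → Bool) {b : A}
    (h : ∀ i < k, b ≠ a i) : (m.setBits a v).bit b = m.bit b := by
  induction k generalizing m a with
  | zero => rfl
  | succ k ih =>
    rw [setBits_succ, ih _ _ _ fun i hi => h (i + 1) (by omega),
      setBit_bit_of_ne _ _ (h 0 (by omega))]

theorem setFlds_fld_of_ne (m : Memory P A) (a : ℕ → A) {k : ℕ} (v : Fin k → P.F) {b : A}
    (h : ∀ i < k, b ≠ a i) : (m.setFlds a v).fld b = m.fld b := by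
  induction k generalizing m a with
  | zero => rfl
  | succ k ih =>
    rw [setFlds_succ, ih _ _ _ fun i hi => h (i + 1) (by omega),
      setFld_fld_of_ne _ _ (h 0 (by omega))]

theorem setBits_bit_apply (m : Memory P A) (a : ℕ → A) (ha : Function.Injective a) {k : ℕ}
    (v : Fin k → Bool) (i : Fin k) : (m.setBits a v).bit (a i) = v i := by
  induction k generalizing m a with
  | zero => exact i.elim0
  | succ k ih =>
    rw [setBits_succ]
    refine Fin.cases ?_ (fun j => ?_) i
    · rw [setBits_bit_of_ne _ _ _ fun i _ h => by simpa using ha h]; simp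
    · exact ih _ (fun i => a (i + 1)) (fun x y h => by simpa using ha h) _ j

theorem setFlds_fld_apply (m : Memory P A) (a : ℕ → A) (ha : Function.Injective a) {k : ℕ}
    (v : Fin k → P.F) (i : Fin k) : (m.setFlds a v).fld (a i) = v i := by
  induction k generalizing m a with
  | zero => exact i.elim0
  | succ k ih =>
    rw [setFlds_succ]
    refine Fin.cases ?_ (fun j => ?_) i
    · rw [setFlds_fld_of_ne _ _ _ fun i _ h => by simpa using ha h]; simp
    · exact ih _ (fun i => a (i + 1)) (fun x y h => by simpa using ha h) _ j

/-- The memory whose content at `a` is that of `m` at `f a` if `f a` is defined, and that of `w`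
otherwise. -/
def view (w : Memory P A) (f : A → Option B) (m : Memory P B) : Memory P A :=
  ⟨fun a => (f a).elim (w.bit a) m.bit, fun a => (f a).elim (w.fld a) m.fld⟩

/-- The memory whose content at `a` is that of `m` at `f a`. -/
def pull (f : A → B) (m : Memory P B) : Memory P A := ⟨fun a => m.bit (f a), fun a => m.fld (f a)⟩

@[simp] theorem pull_bit (f : A → B) (m : Memory P B) (a : A) : (pull f m).bit a = m.bit (f a) := rfl

@[simp] theorem pull_fld (f : A → B) (m : Memory P B) (a : A) : (pull f m).fld a = m.fld (f a) := rfl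

theorem view_bit (w : Memory P A) (f : A → Option B) (m : Memory P B) (a : A) :
    (view w f m).bit a = (f a).elim (w.bit a) m.bit := rfl

theorem view_fld (w : Memory P A) (f : A → Option B) (m : Memory P B) (a : A) :
    (view w f m).fld a = (f a).elim (w.fld a) m.fld := rfl

theorem pull_eq_view (w : Memory P A) (f : A → B) (m : Memory P B) :
    pull f m = view w (fun a => some (f a)) m := rfl

theorem pull_pull (f : A → B) (g : B → C) (m : Memory P C) :
    pull f (pull g m) = pull (fun a => g (f a)) m := rfl

theorem pull_blank (f : A → B) : pull f (blank P B) = blank P A := rfl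

/-- Partial injections. -/
def PInj (f : A → Option B) : Prop := ∀ ⦃a a' b⦄, f a = some b → f a' = some b → a = a'

theorem pInj_some {f : A → B} (hf : Function.Injective f) : PInj fun a => some (f a) := by
  intro a a' b h h'
  simp only [Option.some.injEq] at h h'
  exact hf (h.trans h'.symm)

/-- As `f` is injective where it is defined, `a` is the only address through which `b` is seen. -/
theorem view_setBit {w : Memory P A} {f : A → Option B} (hf : PInj f) {a : A} {b : B}
    (h : f a = some b) (m : Memory P B) (x : Bool) :
    view w f (m.setBit b x) = (view w f m).setBit a x := by
  ext a'
  · rw [setBit_bit, view_bit, view_bit]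
    by_cases e : a' = a
    · subst e; simp [h]
    · rw [if_neg e]
      cases h' : f a' with
      | none => rfl
      | some b' =>
        have : b' ≠ b := fun hb => e (hf (hb ▸ h') h)
        simp [setBit_bit_of_ne _ _ this]
  · rfl

theorem view_setFld {w : Memory P A} {f : A → Option B} (hf : PInj f) {a : A} {b : B}
    (h : f a = some b) (m : Memory P B) (x : P.F) :
    view w f (m.setFld b x) = (view w f m).setFld a x := by
  ext a'
  · rfl
  · rw [setFld_fld, view_fld, view_fld]
    by_cases e : a' = a
    · subst e; simp [h]
    · rw [if_neg e]
      cases h' : f a' with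
      | none => rfl
      | some b' =>
        have : b' ≠ b := fun hb => e (hf (hb ▸ h') h)
        simp [setFld_fld_of_ne _ _ this]

theorem view_setBits {w : Memory P A} {f : A → Option B} (hf : PInj f) {a : ℕ → A} {b : ℕ → B}
    (h : ∀ i, f (a i) = some (b i)) (m : Memory P B) {k : ℕ} (v : Fin k → Bool) :
    view w f (m.setBits b v) = (view w f m).setBits a v := by
  induction k generalizing m a b with
  | zero => rfl
  | succ k ih =>
    rw [setBits_succ, setBits_succ, ih (a := fun i => a (i + 1)) fun i => h (i + 1),
      view_setBit hf (h 0)]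

theorem view_setFlds {w : Memory P A} {f : A → Option B} (hf : PInj f) {a : ℕ → A} {b : ℕ → B}
    (h : ∀ i, f (a i) = some (b i)) (m : Memory P B) {k : ℕ} (v : Fin k → P.F) :
    view w f (m.setFlds b v) = (view w f m).setFlds a v := by
  induction k generalizing m a b with
  | zero => rfl
  | succ k ih =>
    rw [setFlds_succ, setFlds_succ, ih (a := fun i => a (i + 1)) fun i => h (i + 1),
      view_setFld hf (h 0)]

theorem view_setBit_of_notMem {w : Memory P A} {f : A → Option B} {b : B}
    (h : ∀ a, f a ≠ some b) (m : Memory P B) (x : Bool) :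
    view w f (m.setBit b x) = view w f m := by
  ext a
  · rw [view_bit, view_bit]
    cases h' : f a with
    | none => rfl
    | some b' =>
      have : b' ≠ b := fun hb => h a (hb ▸ h')
      simp [setBit_bit_of_ne _ _ this]
  · rfl

theorem view_setFld_of_notMem {w : Memory P A} {f : A → Option B} {b : B}
    (h : ∀ a, f a ≠ some b) (m : Memory P B) (x : P.F) :
    view w f (m.setFld b x) = view w f m := by
  ext a
  · rfl
  · rw [view_fld, view_fld]
    cases h' : f a with
    | none => rfl
    | some b' =>
      have : b' ≠ b := fun hb => h a (hb ▸ h')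
      simp [setFld_fld_of_ne _ _ this]

theorem view_setBits_of_notMem {w : Memory P A} {f : A → Option B} {b : ℕ → B}
    (h : ∀ i a, f a ≠ some (b i)) (m : Memory P B) {k : ℕ} (v : Fin k → Bool) :
    view w f (m.setBits b v) = view w f m := by
  induction k generalizing m b with
  | zero => rfl
  | succ k ih =>
    rw [setBits_succ, ih fun i => h (i + 1), view_setBit_of_notMem (h 0)]

theorem view_setFlds_of_notMem {w : Memory P A} {f : A → Option B} {b : ℕ → B}
    (h : ∀ i a, f a ≠ some (b i)) (m : Memory P B) {k : ℕ} (v : Fin k → P.F) :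
    view w f (m.setFlds b v) = view w f m := by
  induction k generalizing m b with
  | zero => rfl
  | succ k ih =>
    rw [setFlds_succ, ih fun i => h (i + 1), view_setFld_of_notMem (h 0)]

/-- Two memories agree on a set of addresses. -/
def EqOn (s : Set A) (m m' : Memory P A) : Prop := ∀ a ∈ s, m.bit a = m'.bit a ∧ m.fld a = m'.fld a

theorem EqOn.refl (s : Set A) (m : Memory P A) : EqOn s m m := fun _ _ => ⟨rfl, rfl⟩

theorem EqOn.trans {s : Set A} {m m' m'' : Memory P A} (h : EqOn s m m') (h' : EqOn s m' m'') :
    EqOn s m m'' := fun a ha => ⟨(h a ha).1.trans (h' a ha).1, (h a ha).2.trans (h' a ha).2⟩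

theorem EqOn.mono {s t : Set A} (hst : s ⊆ t) {m m' : Memory P A} (h : EqOn t m m') :
    EqOn s m m' := fun a ha => h a (hst ha)

theorem EqOn.setBit {s : Set A} (m : Memory P A) {a : A} (ha : a ∉ s) (x : Bool) :
    EqOn s m (m.setBit a x) := fun b hb =>
  ⟨(setBit_bit_of_ne m x fun (h : b = a) => ha (h ▸ hb)).symm, rfl⟩

theorem EqOn.setFld {s : Set A} (m : Memory P A) {a : A} (ha : a ∉ s) (x : P.F) :
    EqOn s m (m.setFld a x) := fun b hb =>
  ⟨rfl, (setFld_fld_of_ne m x fun (h : b = a) => ha (h ▸ hb)).symm⟩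

end Memory

/-! ### Execution of programs -/

section

variable {n : ℕ} {P : Params n} {A B C : Type}

open Memory

theorem Instr.map_map (f : A → B) (g : B → C) (i : Instr P A) :
    (i.map f).map g = i.map fun a => g (f a) := by
  cases i <;> rfl

theorem Instr.map_comp_map (f : A → B) (g : B → C) :
    (Instr.map g : Instr P B → _) ∘ Instr.map f = Instr.map fun a => g (f a) :=
  funext fun i => Instr.map_map f g i

/-- An instruction reads and writes only the addresses it mentions, so any partial injection under
which these correspond transports its effect. All later embeddings of one memory layout into another
rest on this. -/
theorem Instr.step_view {w : Memory P A} {f : A → Option B} (hf : PInj f) {j : C → B} {j' : C → A}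
    (h : ∀ c, f (j' c) = some (j c)) (H : P.Oracle) (m : Memory P B) (i : Instr P C) :
    ((i.map j).step H m).map (view w f) = (i.map j').step H (view w f m) := by
  have hb : ∀ c, (view w f m).bit (j' c) = m.bit (j c) := fun c => by simp [view_bit, h]
  have hc : ∀ c, (view w f m).fld (j' c) = m.fld (j c) := fun c => by simp [view_fld, h]
  cases i <;>
    simp only [Instr.map, Instr.step, PMF.pure_map, PMF.map_comp, view_setBit hf (h _),
      view_setFld hf (h _), hb, hc, Function.comp_def]

theorem Prog.run_nil (H : P.Oracle) (m : Memory P A) : Prog.run H [] m = PMF.pure m := rfl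

theorem Prog.run_cons (H : P.Oracle) (i : Instr P A) (p : Prog P A) (m : Memory P A) :
    Prog.run H (i :: p) m = (i.step H m).bind (Prog.run H p) := rfl

theorem Prog.run_append (H : P.Oracle) (p q : Prog P A) (m : Memory P A) :
    Prog.run H (p ++ q) m = (Prog.run H p m).bind (Prog.run H q) := by
  induction p generalizing m with
  | nil => simp [Prog.run_nil]
  | cons i p ih =>
    rw [List.cons_append, Prog.run_cons, Prog.run_cons, PMF.bind_bind]
    exact congrArg _ (funext fun m => ih m)

theorem Prog.run_view {w : Memory P A} {f : A → Option B} (hf : PInj f) {j : C → B} {j' : C → A}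
    (h : ∀ c, f (j' c) = some (j c)) (H : P.Oracle) (p : Prog P C) (m : Memory P B) :
    (Prog.run H (p.map (Instr.map j)) m).map (view w f) =
      Prog.run H (p.map (Instr.map j')) (view w f m) := by
  induction p generalizing m with
  | nil => simp [Prog.run_nil, PMF.pure_map]
  | cons i p ih =>
    rw [List.map_cons, List.map_cons, Prog.run_cons, Prog.run_cons, PMF.map_bind,
      ← Instr.step_view hf h, PMF.bind_map]
    exact congrArg _ (funext fun m => ih m)

theorem Prog.run_pull {f : A → B} (hf : Function.Injective f) {j : C → B} {j' : C → A}
    (h : ∀ c, f (j' c) = j c) (H : P.Oracle) (p : Prog P C) (m : Memory P B) :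
    (Prog.run H (p.map (Instr.map j)) m).map (pull f) =
      Prog.run H (p.map (Instr.map j')) (pull f m) :=
  Prog.run_view (w := blank P A) (pInj_some hf) (fun c => congrArg some (h c)) H p m

theorem Prog.run_map_pull {f : A → B} (hf : Function.Injective f) (H : P.Oracle) (p : Prog P A)
    (m : Memory P B) :
    (Prog.run H (p.map (Instr.map f)) m).map (pull f) = Prog.run H p (pull f m) := by
  have h := Prog.run_pull hf (j := f) (j' := id) (fun _ => rfl) H p m
  rwa [show (Instr.map id : Instr P A → _) = id from funext fun i => by cases i <;> rfl,
    List.map_id] at h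

theorem Instr.step_frame {j : C → B} (H : P.Oracle) (i : Instr P C) {m m' : Memory P B}
    (h : m' ∈ ((i.map j).step H m).support) : EqOn (Set.range j)ᶜ m m' := by
  have hb : ∀ c x, EqOn (Set.range j)ᶜ m (m.setBit (j c) x) := fun c x =>
    EqOn.setBit m (by simp) x
  have hc : ∀ c x, EqOn (Set.range j)ᶜ m (m.setFld (j c) x) := fun c x =>
    EqOn.setFld m (by simp) x
  cases i <;>
    simp only [Instr.map, Instr.step, PMF.support_pure, PMF.support_map, Set.mem_singleton_iff,
      Set.mem_image] at h <;>
    first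
    | (subst h; first | exact hb _ _ | exact hc _ _)
    | (obtain ⟨x, -, rfl⟩ := h; first | exact hb _ _ | exact hc _ _)

/-- The types of addresses act as access control: this is how the privacy of registers of parties,
simulators and emulated sessions enters the proof. -/
theorem Prog.run_frame {j : C → B} (H : P.Oracle) (p : Prog P C) {m m' : Memory P B}
    (h : m' ∈ (Prog.run H (p.map (Instr.map j)) m).support) : EqOn (Set.range j)ᶜ m m' := by
  induction p generalizing m with
  | nil =>
    simp only [List.map_nil, Prog.run_nil, PMF.support_pure, Set.mem_singleton_iff] at h
    exact h ▸ EqOn.refl _ _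
  | cons i p ih =>
    rw [List.map_cons, Prog.run_cons, PMF.mem_support_bind_iff] at h
    obtain ⟨m₁, h₁, h₂⟩ := h
    exact (Instr.step_frame H i h₁).trans (ih h₂)

end

/-! ### Tracking one random variable by another -/

section

variable {α β γ δ : Type*}

theorem PMF.bind_congr_support {p : PMF α} {f g : α → PMF β} (h : ∀ a ∈ p.support, f a = g a) :
    p.bind f = p.bind g := by
  ext b
  rw [PMF.bind_apply, PMF.bind_apply]
  refine tsum_congr fun a => ?_
  by_cases ha : a ∈ p.support
  · rw [h a ha]
  · rw [(PMF.apply_eq_zero_iff p a).2 ha, zero_mul, zero_mul]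

theorem PMF.map_congr_support {p : PMF α} {f g : α → β} (h : ∀ a ∈ p.support, f a = g a) :
    p.map f = p.map g :=
  PMF.bind_congr_support fun a ha => congrArg PMF.pure (h a ha)

/-- The image of `p` under `φ` is `q`, and the values of `p` satisfy `I`. -/
def Tracks (φ : α → β) (I : α → Prop) (p : PMF α) (q : PMF β) : Prop :=
  p.map φ = q ∧ ∀ a ∈ p.support, I a

/-- The second step has to be tracked only from values that can occur, and these satisfy the
invariant. -/
theorem Tracks.bind {φ : α → β} {I : α → Prop} {p : PMF α} {q : PMF β} {φ' : γ → δ}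
    {I' : γ → Prop} {f : α → PMF γ} {g : β → PMF δ} (h : Tracks φ I p q)
    (h' : ∀ a, I a → Tracks φ' I' (f a) (g (φ a))) : Tracks φ' I' (p.bind f) (q.bind g) := by
  refine ⟨?_, fun c hc => ?_⟩
  · rw [PMF.map_bind, ← h.1, PMF.bind_map]
    exact PMF.bind_congr_support fun a ha => (h' a (h.2 a ha)).1
  · rw [PMF.mem_support_bind_iff] at hc
    obtain ⟨a, ha, hc⟩ := hc
    exact (h' a (h.2 a ha)).2 c hc

theorem Tracks.pure {φ : α → β} {I : α → Prop} {a : α} (h : I a) :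
    Tracks φ I (PMF.pure a) (PMF.pure (φ a)) :=
  ⟨PMF.pure_map φ a, fun b hb => by
    rw [PMF.support_pure, Set.mem_singleton_iff] at hb; exact hb ▸ h⟩

end

end

noncomputable section

/-! ### Uniform distributions -/

section

variable {α β : Type*}

theorem PMF.uniformOfFintype_map_equiv [Fintype α] [Nonempty α] [Fintype β] [Nonempty β]
    (e : α ≃ β) : (PMF.uniformOfFintype α).map e = PMF.uniformOfFintype β := by
  classical
  ext b
  rw [PMF.map_apply, tsum_fintype, PMF.uniformOfFintype_apply, ← Fintype.card_congr e,
    Finset.sum_eq_single (e.symm b)]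
  · simp
  · intro a _ ha
    rw [if_neg]
    rintro rfl
    simp at ha
  · simp

theorem PMF.uniformOfFintype_prod [Fintype α] [Nonempty α] [Fintype β] [Nonempty β] :
    PMF.uniformOfFintype (α × β) =
      (PMF.uniformOfFintype α).bind fun a => (PMF.uniformOfFintype β).map fun b => (a, b) := by
  classical
  ext ⟨a, b⟩
  rw [PMF.bind_apply, tsum_fintype, Finset.sum_eq_single a]
  · rw [PMF.map_apply, tsum_fintype, Finset.sum_eq_single b]
    · simp only [PMF.uniformOfFintype_apply, Fintype.card_prod, if_true, Nat.cast_mul]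
      rw [ENNReal.mul_inv] <;> simp
    · intro b' _ hb
      rw [if_neg]
      simp [hb.symm]
    · simp
  · intro a' _ ha
    rw [PMF.map_apply, tsum_fintype, Finset.sum_eq_zero, mul_zero]
    intro b' _
    rw [if_neg]
    simp [ha.symm]
  · simp

end

section

variable {n : ℕ}

/-- A uniformly random vector of field elements. -/
def Params.unifVec (P : Params n) (k : ℕ) : PMF (Fin k → P.F) :=
  haveI : Fintype (Fin k → P.F) := Fintype.ofFinite _
  PMF.uniformOfFintype (Fin k → P.F)

theorem Params.unifVec_eq (P : Params n) (k : ℕ) [Fintype (Fin k → P.F)] :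
    P.unifVec k = PMF.uniformOfFintype (Fin k → P.F) := by
  unfold Params.unifVec
  congr!

theorem Params.unifVec_zero (P : Params n) : P.unifVec 0 = PMF.pure fun i => i.elim0 := by
  classical
  rw [P.unifVec_eq]
  ext v
  rw [Subsingleton.elim v fun i => i.elim0]
  simp

/-- A program draws one field element per instruction, so a uniform vector has to be built
coordinate by coordinate. -/
theorem Params.unifVec_succ (P : Params n) (k : ℕ) :
    P.unifVec (k + 1) = P.unif.bind fun c => (P.unifVec k).map (Fin.cons c) := by
  classical
  rw [P.unifVec_eq, P.unifVec_eq,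
    ← PMF.uniformOfFintype_map_equiv (Fin.consEquiv fun _ : Fin (k + 1) => P.F),
    PMF.uniformOfFintype_prod, PMF.map_bind]
  refine congrArg _ (funext fun c => ?_)
  rw [PMF.map_comp]
  rfl

end

/-! ### Implementing random functions of the memory by programs -/

section

variable {n : ℕ} {P : Params n} {A B C : Type}

open Memory

theorem Prog.run_append_pure {H : P.Oracle} {p q : Prog P A} {m m₁ m₂ : Memory P A}
    (h : Prog.run H p m = PMF.pure m₁) (h' : Prog.run H q m₁ = PMF.pure m₂) :
    Prog.run H (p ++ q) m = PMF.pure m₂ := by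
  rw [Prog.run_append, h, PMF.pure_bind, h']

theorem Prog.run_singleton (H : P.Oracle) (i : Instr P A) (m : Memory P A) :
    Prog.run H [i] m = i.step H m := by
  rw [Prog.run_cons]
  exact PMF.bind_pure _

/-- `m'` differs from `m` at most in the temporary registers with index at least `j`. -/
def Keeps (j : ℕ) (m m' : Memory P (A ⊕ ℕ)) : Prop :=
  pull Sum.inl m' = pull Sum.inl m ∧
    ∀ i < j, m'.bit (.inr i) = m.bit (.inr i) ∧ m'.fld (.inr i) = m.fld (.inr i)

theorem Keeps.refl (j : ℕ) (m : Memory P (A ⊕ ℕ)) : Keeps j m m := ⟨rfl, fun _ _ => ⟨rfl, rfl⟩⟩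

theorem Keeps.trans {i j : ℕ} {m m' m'' : Memory P (A ⊕ ℕ)} (h : Keeps i m m')
    (h' : Keeps j m' m'') (hij : i ≤ j) : Keeps i m m'' :=
  ⟨h'.1.trans h.1, fun a ha => ⟨((h'.2 a (by omega)).1).trans (h.2 a ha).1,
    ((h'.2 a (by omega)).2).trans (h.2 a ha).2⟩⟩

theorem Keeps.setFld {i j : ℕ} (m : Memory P (A ⊕ ℕ)) (x : P.F) (h : i ≤ j) :
    Keeps i m (m.setFld (.inr j) x) := by
  refine ⟨?_, fun a ha => ⟨rfl, setFld_fld_of_ne _ _ ?_⟩⟩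
  · rw [pull_eq_view (blank P A), view_setFld_of_notMem (by simp)]; rfl
  · simp only [ne_eq, Sum.inr.injEq]; omega

theorem Keeps.setBit {i j : ℕ} (m : Memory P (A ⊕ ℕ)) (x : Bool) (h : i ≤ j) :
    Keeps i m (m.setBit (.inr j) x) := by
  refine ⟨?_, fun a ha => ⟨setBit_bit_of_ne _ _ ?_, rfl⟩⟩
  · rw [pull_eq_view (blank P A), view_setBit_of_notMem (by simp)]; rfl
  · simp only [ne_eq, Sum.inr.injEq]; omega

theorem Keeps.bit_inl {j : ℕ} {m m' : Memory P (A ⊕ ℕ)} (h : Keeps j m m') (a : A) :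
    m'.bit (.inl a) = m.bit (.inl a) := congrFun (congrArg Memory.bit h.1) a

/-- The field element `v` can be computed, with at most `c` instructions, into a temporary
register. -/
def FComp (v : P.Oracle → Memory P A → P.F) (c : ℕ) : Prop :=
  ∀ j, ∃ p : Prog P (A ⊕ ℕ), p.length ≤ c ∧ ∀ H m, ∃ m', Prog.run H p m = PMF.pure m' ∧
    m'.fld (.inr j) = v H (pull Sum.inl m) ∧ Keeps j m m'

/-- The bit `v` can be computed, with at most `c` instructions, into a temporary register. -/
def BComp (v : P.Oracle → Memory P A → Bool) (c : ℕ) : Prop :=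
  ∀ j, ∃ p : Prog P (A ⊕ ℕ), p.length ≤ c ∧ ∀ H m, ∃ m', Prog.run H p m = PMF.pure m' ∧
    m'.bit (.inr j) = v H (pull Sum.inl m) ∧ Keeps j m m'

theorem FComp.mono {v : P.Oracle → Memory P A → P.F} {c d : ℕ} (h : FComp v c) (hcd : c ≤ d) :
    FComp v d := fun j => by
  obtain ⟨p, hp, h⟩ := h j
  exact ⟨p, hp.trans hcd, h⟩

theorem BComp.mono {v : P.Oracle → Memory P A → Bool} {c d : ℕ} (h : BComp v c) (hcd : c ≤ d) :
    BComp v d := fun j => by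
  obtain ⟨p, hp, h⟩ := h j
  exact ⟨p, hp.trans hcd, h⟩

theorem FComp.ofInstr {v : P.Oracle → Memory P A → P.F} (i : ℕ → Instr P (A ⊕ ℕ))
    (h : ∀ j H m, (i j).step H m = PMF.pure (m.setFld (.inr j) (v H (pull Sum.inl m)))) :
    FComp v 1 := fun j =>
  ⟨[i j], le_rfl, fun H m => ⟨_, by rw [Prog.run_singleton, h], by simp, Keeps.setFld m _ le_rfl⟩⟩

theorem BComp.ofInstr {v : P.Oracle → Memory P A → Bool} (i : ℕ → Instr P (A ⊕ ℕ))
    (h : ∀ j H m, (i j).step H m = PMF.pure (m.setBit (.inr j) (v H (pull Sum.inl m)))) :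
    BComp v 1 := fun j =>
  ⟨[i j], le_rfl, fun H m => ⟨_, by rw [Prog.run_singleton, h], by simp, Keeps.setBit m _ le_rfl⟩⟩

theorem FComp.const (x : P.F) : FComp (A := A) (fun _ _ => x) 1 :=
  FComp.ofInstr (fun j => .fconst (.inr j) x) fun _ _ _ => rfl

theorem BComp.const (x : Bool) : BComp (P := P) (A := A) (fun _ _ => x) 1 :=
  BComp.ofInstr (fun j => .const (.inr j) x) fun _ _ _ => rfl

/-- There is no copy instruction; a multiplexer with equal branches serves as one, whatever its
condition is. -/
theorem FComp.reg (a : A) : FComp (P := P) (fun _ m => m.fld a) 1 :=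
  FComp.ofInstr (fun j => .fmux (.inr j) (.inl a) (.inl a) (.inl a)) fun _ _ _ => by
    simp [Instr.step]

theorem FComp.emb (i : Fin P.θ) (k : Fin P.keyLen → A) (x : Fin P.inputLen → A) :
    FComp (fun _ m => P.emb (m.bit ∘ k) (m.bit ∘ x) i) 1 :=
  FComp.ofInstr (fun j => .emb (.inr j) i (Sum.inl ∘ k) (Sum.inl ∘ x)) fun _ _ _ => rfl

theorem BComp.prf (i : Fin n) (k : Fin P.prfKeyLen → A) (y : Fin P.θ → A) :
    BComp (fun _ m => P.prf (m.bit ∘ k) (m.fld ∘ y) i) 1 :=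
  BComp.ofInstr (fun j => .prf (.inr j) i (Sum.inl ∘ k) (Sum.inl ∘ y)) fun _ _ _ => rfl

/-- The temporary registers form a stack: the second operand is computed at `j + 1`, which by
`Keeps` leaves the first operand at `j` intact. The other operations follow the same pattern. -/
theorem FComp.add {v w : P.Oracle → Memory P A → P.F} {c d : ℕ} (hv : FComp v c)
    (hw : FComp w d) : FComp (fun H m => v H m + w H m) (c + d + 1) := fun j => by
  obtain ⟨p, hp, hv⟩ := hv j
  obtain ⟨q, hq, hw⟩ := hw (j + 1)
  refine ⟨p ++ (q ++ [.fadd (.inr j) (.inr j) (.inr (j + 1))]), by simp; omega, fun H m => ?_⟩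
  obtain ⟨m₁, r₁, e₁, k₁⟩ := hv H m
  obtain ⟨m₂, r₂, e₂, k₂⟩ := hw H m₁
  refine ⟨_, Prog.run_append_pure r₁ (Prog.run_append_pure r₂ (Prog.run_singleton _ _ _)), ?_,
    (k₁.trans k₂ (by omega)).trans (Keeps.setFld m₂ _ le_rfl) le_rfl⟩
  rw [setFld_fld_self, e₂, (k₂.2 j (by omega)).2, e₁, k₁.1]

theorem FComp.mul {v w : P.Oracle → Memory P A → P.F} {c d : ℕ} (hv : FComp v c)
    (hw : FComp w d) : FComp (fun H m => v H m * w H m) (c + d + 1) := fun j => by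
  obtain ⟨p, hp, hv⟩ := hv j
  obtain ⟨q, hq, hw⟩ := hw (j + 1)
  refine ⟨p ++ (q ++ [.fmul (.inr j) (.inr j) (.inr (j + 1))]), by simp; omega, fun H m => ?_⟩
  obtain ⟨m₁, r₁, e₁, k₁⟩ := hv H m
  obtain ⟨m₂, r₂, e₂, k₂⟩ := hw H m₁
  refine ⟨_, Prog.run_append_pure r₁ (Prog.run_append_pure r₂ (Prog.run_singleton _ _ _)), ?_,
    (k₁.trans k₂ (by omega)).trans (Keeps.setFld m₂ _ le_rfl) le_rfl⟩
  rw [setFld_fld_self, e₂, (k₂.2 j (by omega)).2, e₁, k₁.1]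

theorem BComp.nand {v w : P.Oracle → Memory P A → Bool} {c d : ℕ} (hv : BComp v c)
    (hw : BComp w d) : BComp (fun H m => !(v H m && w H m)) (c + d + 1) := fun j => by
  obtain ⟨p, hp, hv⟩ := hv j
  obtain ⟨q, hq, hw⟩ := hw (j + 1)
  refine ⟨p ++ (q ++ [.nand (.inr j) (.inr j) (.inr (j + 1))]), by simp; omega, fun H m => ?_⟩
  obtain ⟨m₁, r₁, e₁, k₁⟩ := hv H m
  obtain ⟨m₂, r₂, e₂, k₂⟩ := hw H m₁
  refine ⟨_, Prog.run_append_pure r₁ (Prog.run_append_pure r₂ (Prog.run_singleton _ _ _)), ?_,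
    (k₁.trans k₂ (by omega)).trans (Keeps.setBit m₂ _ le_rfl) le_rfl⟩
  rw [setBit_bit_self, e₂, (k₂.2 j (by omega)).1, e₁, k₁.1]

theorem FComp.mux {b : P.Oracle → Memory P A → Bool} {v w : P.Oracle → Memory P A → P.F}
    {c d e : ℕ} (hb : BComp b c) (hv : FComp v d) (hw : FComp w e) :
    FComp (fun H m => if b H m then v H m else w H m) (c + d + e + 1) := fun j => by
  obtain ⟨o, ho, hb⟩ := hb j
  obtain ⟨p, hp, hv⟩ := hv (j + 1)
  obtain ⟨q, hq, hw⟩ := hw (j + 2)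
  refine ⟨o ++ (p ++ (q ++ [.fmux (.inr j) (.inr j) (.inr (j + 1)) (.inr (j + 2))])),
    by simp; omega, fun H m => ?_⟩
  obtain ⟨m₁, r₁, e₁, k₁⟩ := hb H m
  obtain ⟨m₂, r₂, e₂, k₂⟩ := hv H m₁
  obtain ⟨m₃, r₃, e₃, k₃⟩ := hw H m₂
  refine ⟨_, Prog.run_append_pure r₁ (Prog.run_append_pure r₂ (Prog.run_append_pure r₃
    (Prog.run_singleton _ _ _))), ?_,
    ((k₁.trans k₂ (by omega)).trans k₃ (by omega)).trans (Keeps.setFld m₃ _ le_rfl) le_rfl⟩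
  rw [setFld_fld_self, e₃, (k₃.2 j (by omega)).1, (k₂.2 j (by omega)).1, e₁,
    (k₃.2 (j + 1) (by omega)).2, e₂, k₂.1, k₁.1]

/-- Bits are copied by negating twice; the negation `nand a a` is computed for each operand of an
outer `nand`, hence three instructions. -/
theorem BComp.reg (a : A) : BComp (P := P) (fun _ m => m.bit a) 3 := by
  have h : BComp (P := P) (A := A) (fun _ m => !(m.bit a && m.bit a)) 1 :=
    BComp.ofInstr (fun j => .nand (.inr j) (.inl a) (.inl a)) fun _ _ _ => rfl
  simpa using h.nand h

theorem BComp.not {v : P.Oracle → Memory P A → Bool} {c : ℕ} (hv : BComp v c) :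
    BComp (fun H m => !v H m) (c + 1) := fun j => by
  obtain ⟨p, hp, hv⟩ := hv j
  refine ⟨p ++ [.nand (.inr j) (.inr j) (.inr j)], by simp; omega, fun H m => ?_⟩
  obtain ⟨m₁, r₁, e₁, k₁⟩ := hv H m
  refine ⟨_, Prog.run_append_pure r₁ (Prog.run_singleton _ _ _), ?_,
    k₁.trans (Keeps.setBit m₁ _ le_rfl) le_rfl⟩
  rw [setBit_bit_self, e₁, Bool.and_self]

theorem BComp.and {v w : P.Oracle → Memory P A → Bool} {c d : ℕ} (hv : BComp v c)
    (hw : BComp w d) : BComp (fun H m => v H m && w H m) (c + d + 2) := by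
  simpa only [Bool.not_not] using (hv.nand hw).not

theorem BComp.or {v w : P.Oracle → Memory P A → Bool} {c d : ℕ} (hv : BComp v c)
    (hw : BComp w d) : BComp (fun H m => v H m || w H m) (c + d + 3) := by
  have h := hv.not.nand hw.not
  simp only [Bool.not_and, Bool.not_not] at h
  exact h.mono (by omega)

theorem FComp.neg {v : P.Oracle → Memory P A → P.F} {c : ℕ} (hv : FComp v c) :
    FComp (fun H m => -v H m) (c + 2) := by
  have h := (FComp.const (A := A) (-1 : P.F)).mul hv
  simp only [neg_mul, one_mul] at h
  exact h.mono (by omega)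

theorem FComp.sub {v w : P.Oracle → Memory P A → P.F} {c d : ℕ} (hv : FComp v c)
    (hw : FComp w d) : FComp (fun H m => v H m - w H m) (c + d + 3) := by
  simp only [sub_eq_add_neg]
  exact (hv.add hw.neg).mono (by omega)

theorem FComp.sum {c k : ℕ} {v : Fin k → P.Oracle → Memory P A → P.F} (hv : ∀ i, FComp (v i) c) :
    FComp (fun H m => ∑ i, v i H m) (k * (c + 1) + 1) := by
  induction k with
  | zero => simpa using FComp.const (A := A) (0 : P.F)
  | succ k ih =>
    simp only [Fin.sum_univ_succ]
    refine ((hv 0).add (ih fun i => hv i.succ)).mono ?_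
    rw [Nat.add_mul k 1]
    omega

theorem BComp.forall {c k : ℕ} {v : Fin k → P.Oracle → Memory P A → Bool}
    (hv : ∀ i, BComp (v i) c) :
    BComp (fun H m => decide (∀ i, v i H m = true)) (k * (c + 2) + 1) := by
  induction k with
  | zero => simpa using BComp.const (P := P) (A := A) true
  | succ k ih =>
    simp only [Fin.forall_fin_succ, Bool.decide_and, Bool.decide_eq_true]
    refine ((hv 0).and (ih fun i => hv i.succ)).mono ?_
    rw [Nat.add_mul k 1]
    omega

/-- Each new component goes on top of the stack, at `j + k`, so it cannot destroy the components
below it. -/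
theorem FComp.vec {c : ℕ} {k : ℕ} {v : Fin k → P.Oracle → Memory P A → P.F}
    (hv : ∀ i, FComp (v i) c) (j : ℕ) :
    ∃ p : Prog P (A ⊕ ℕ), p.length ≤ k * c ∧ ∀ H m, ∃ m', Prog.run H p m = PMF.pure m' ∧
      (∀ i : Fin k, m'.fld (.inr (j + i)) = v i H (pull Sum.inl m)) ∧ Keeps j m m' := by
  induction k with
  | zero => exact ⟨[], by simp, fun H m => ⟨m, rfl, fun i => i.elim0, Keeps.refl _ _⟩⟩
  | succ k ih =>
    obtain ⟨p, hp, ih⟩ := ih fun i => hv i.castSucc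
    obtain ⟨q, hq, hv⟩ := hv (Fin.last k) (j + k)
    refine ⟨p ++ q, by rw [List.length_append, Nat.add_mul]; omega, fun H m => ?_⟩
    obtain ⟨m₁, r₁, e₁, k₁⟩ := ih H m
    obtain ⟨m₂, r₂, e₂, k₂⟩ := hv H m₁
    refine ⟨m₂, Prog.run_append_pure r₁ r₂, fun i => ?_, k₁.trans k₂ (by omega)⟩
    refine Fin.lastCases ?_ (fun i => ?_) i
    · rw [Fin.val_last, e₂, k₁.1]
    · rw [Fin.val_castSucc, (k₂.2 _ (by omega)).2, e₁]

theorem BComp.vec {c : ℕ} {k : ℕ} {v : Fin k → P.Oracle → Memory P A → Bool}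
    (hv : ∀ i, BComp (v i) c) (j : ℕ) :
    ∃ p : Prog P (A ⊕ ℕ), p.length ≤ k * c ∧ ∀ H m, ∃ m', Prog.run H p m = PMF.pure m' ∧
      (∀ i : Fin k, m'.bit (.inr (j + i)) = v i H (pull Sum.inl m)) ∧ Keeps j m m' := by
  induction k with
  | zero => exact ⟨[], by simp, fun H m => ⟨m, rfl, fun i => i.elim0, Keeps.refl _ _⟩⟩
  | succ k ih =>
    obtain ⟨p, hp, ih⟩ := ih fun i => hv i.castSucc
    obtain ⟨q, hq, hv⟩ := hv (Fin.last k) (j + k)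
    refine ⟨p ++ q, by rw [List.length_append, Nat.add_mul]; omega, fun H m => ?_⟩
    obtain ⟨m₁, r₁, e₁, k₁⟩ := ih H m
    obtain ⟨m₂, r₂, e₂, k₂⟩ := hv H m₁
    refine ⟨m₂, Prog.run_append_pure r₁ r₂, fun i => ?_, k₁.trans k₂ (by omega)⟩
    refine Fin.lastCases ?_ (fun i => ?_) i
    · rw [Fin.val_last, e₂, k₁.1]
    · rw [Fin.val_castSucc, (k₂.2 _ (by omega)).1, e₁]

theorem FComp.hash {c : ℕ} (i : Fin P.θ) (x : Fin P.inputLen → A)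
    {e : Fin P.θ → P.Oracle → Memory P A → P.F} (he : ∀ i, FComp (e i) c)
    (k : Fin P.keyLen → A) :
    FComp (fun H m => H (m.bit ∘ x) (fun i => e i H m) (m.bit ∘ k) i) (P.θ * c + 1) := fun j => by
  obtain ⟨p, hp, h⟩ := FComp.vec he j
  refine ⟨p ++ [.hash (.inr j) i (Sum.inl ∘ x) (fun i => .inr (j + i)) (Sum.inl ∘ k)],
    by simp; omega, fun H m => ?_⟩
  obtain ⟨m₁, r₁, e₁, k₁⟩ := h H m
  refine ⟨_, Prog.run_append_pure r₁ (Prog.run_singleton _ _ _), ?_,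
    k₁.trans (Keeps.setFld m₁ _ le_rfl) le_rfl⟩
  rw [setFld_fld_self]
  have hb : ∀ {l : ℕ} (z : Fin l → A), m₁.bit ∘ Sum.inl ∘ z = (pull Sum.inl m).bit ∘ z :=
    fun z => funext fun i => k₁.bit_inl (z i)
  rw [hb, hb, show (m₁.fld ∘ fun i : Fin P.θ => Sum.inr (j + i)) = _ from funext e₁]

theorem FComp.tok {c : ℕ} {g : Fin n → P.Oracle → Memory P A → Bool} (hg : ∀ i, BComp (g i) c) :
    FComp (fun H m => P.tok fun i => g i H m) (n * c + 1) := fun j => by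
  obtain ⟨p, hp, h⟩ := BComp.vec hg j
  refine ⟨p ++ [.tok (.inr j) (fun i => .inr (j + i))], by simp; omega, fun H m => ?_⟩
  obtain ⟨m₁, r₁, e₁, k₁⟩ := h H m
  refine ⟨_, Prog.run_append_pure r₁ (Prog.run_singleton _ _ _), ?_,
    k₁.trans (Keeps.setFld m₁ _ le_rfl) le_rfl⟩
  rw [setFld_fld_self, show (m₁.bit ∘ fun i : Fin n => Sum.inr (j + i)) = _ from funext e₁]

/-- The random function `K` of a memory is implemented by a program, with temporary registers, of
length at most `c`. -/
def Impl (K : P.Oracle → Memory P A → PMF (Memory P A)) (c : ℕ) : Prop :=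
  ∃ p : Prog P (A ⊕ ℕ), p.length ≤ c ∧
    ∀ H m, (Prog.run H p m).map (pull Sum.inl) = K H (pull Sum.inl m)

theorem Impl.mono {K : P.Oracle → Memory P A → PMF (Memory P A)} {c d : ℕ} (h : Impl K c)
    (hcd : c ≤ d) : Impl K d := by
  obtain ⟨p, hp, h⟩ := h
  exact ⟨p, hp.trans hcd, h⟩

theorem Impl.prog (p : Prog P A) : Impl (fun H m => Prog.run H p m) p.length :=
  ⟨p.map (Instr.map Sum.inl), by simp, fun H m => Prog.run_map_pull Sum.inl_injective H p m⟩

theorem Impl.id : Impl (fun (_ : P.Oracle) (m : Memory P A) => PMF.pure m) 0 := Impl.prog []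

theorem Impl.seq {K L : P.Oracle → Memory P A → PMF (Memory P A)} {c d : ℕ} (hK : Impl K c)
    (hL : Impl L d) : Impl (fun H m => (K H m).bind (L H)) (c + d) := by
  obtain ⟨p, hp, hK⟩ := hK
  obtain ⟨q, hq, hL⟩ := hL
  refine ⟨p ++ q, by simp; omega, fun H m => ?_⟩
  change _ = (K H (pull Sum.inl m)).bind (L H)
  rw [Prog.run_append, PMF.map_bind, ← hK, PMF.bind_map]
  exact congrArg _ (funext fun m => hL H m)

theorem Impl.seq_pure {K : P.Oracle → Memory P A → PMF (Memory P A)}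
    {f : P.Oracle → Memory P A → Memory P A} {c d : ℕ} (hK : Impl K c)
    (hf : Impl (fun H m => PMF.pure (f H m)) d) : Impl (fun H m => (K H m).map (f H)) (c + d) :=
  hK.seq hf

theorem Impl.pure_seq {L : P.Oracle → Memory P A → PMF (Memory P A)}
    {f : P.Oracle → Memory P A → Memory P A} {c d : ℕ}
    (hf : Impl (fun H m => PMF.pure (f H m)) c) (hL : Impl L d) :
    Impl (fun H m => L H (f H m)) (c + d) := by
  simpa only [PMF.pure_bind] using hf.seq hL

/-- Copy the fields in the temporary registers `o, o + 1, …`. -/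
def copyFlds (P : Params n) : ℕ → (ℕ → A) → ℕ → Prog P (A ⊕ ℕ)
  | _, _, 0 => []
  | o, a, k + 1 => .fmux (.inl (a 0)) (.inr o) (.inr o) (.inr o) ::
      copyFlds P (o + 1) (fun i => a (i + 1)) k

theorem length_copyFlds (o : ℕ) (a : ℕ → A) (k : ℕ) : (copyFlds P o a k).length = k := by
  induction k generalizing o a with
  | zero => rfl
  | succ k ih => simp [copyFlds, ih]

theorem run_copyFlds (H : P.Oracle) (m : Memory P (A ⊕ ℕ)) (o : ℕ) (a : ℕ → A) (k : ℕ) :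
    (Prog.run H (copyFlds P o a k) m).map (pull Sum.inl) =
      PMF.pure ((pull Sum.inl m).setFlds a fun i : Fin k => m.fld (.inr (o + i))) := by
  induction k generalizing o a m with
  | zero => simp [copyFlds, Prog.run_nil, PMF.pure_map, setFlds_zero]
  | succ k ih =>
    rw [copyFlds, Prog.run_cons, Instr.step, PMF.pure_bind, ih, setFlds_succ,
      pull_eq_view (blank P A), view_setFld (pInj_some Sum.inl_injective) rfl]
    simp [setFld_fld, pull_eq_view (blank P A), add_assoc, add_comm 1]

/-- Copy the complements of the bits in the temporary registers `o, o + 1, …`. -/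
def copyNots (P : Params n) : ℕ → (ℕ → A) → ℕ → Prog P (A ⊕ ℕ)
  | _, _, 0 => []
  | o, a, k + 1 => .nand (.inl (a 0)) (.inr o) (.inr o) ::
      copyNots P (o + 1) (fun i => a (i + 1)) k

theorem length_copyNots (o : ℕ) (a : ℕ → A) (k : ℕ) : (copyNots P o a k).length = k := by
  induction k generalizing o a with
  | zero => rfl
  | succ k ih => simp [copyNots, ih]

theorem run_copyNots (H : P.Oracle) (m : Memory P (A ⊕ ℕ)) (o : ℕ) (a : ℕ → A) (k : ℕ) :
    (Prog.run H (copyNots P o a k) m).map (pull Sum.inl) =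
      PMF.pure ((pull Sum.inl m).setBits a fun i : Fin k => !m.bit (.inr (o + i))) := by
  induction k generalizing o a m with
  | zero => simp [copyNots, Prog.run_nil, PMF.pure_map, setBits_zero]
  | succ k ih =>
    rw [copyNots, Prog.run_cons, Instr.step, PMF.pure_bind, ih, setBits_succ,
      pull_eq_view (blank P A), view_setBit (pInj_some Sum.inl_injective) rfl]
    simp [setBit_bit, pull_eq_view (blank P A), add_assoc, add_comm 1]

/-- All values are computed into temporary registers before the first of them is written, so the
assignment is simultaneous even if the `v i` read the addresses `a i`. -/
theorem Impl.setFlds {c k : ℕ} (a : ℕ → A) {v : Fin k → P.Oracle → Memory P A → P.F}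
    (hv : ∀ i, FComp (v i) c) :
    Impl (fun H m => PMF.pure (m.setFlds a fun i => v i H m)) (k * (c + 1)) := by
  obtain ⟨p, hp, h⟩ := FComp.vec hv 0
  refine ⟨p ++ copyFlds P 0 a k, by
    rw [List.length_append, length_copyFlds, Nat.mul_add]; omega, fun H m => ?_⟩
  obtain ⟨m₁, r₁, e₁, k₁⟩ := h H m
  rw [Prog.run_append, r₁, PMF.pure_bind, run_copyFlds, k₁.1]
  simp only [e₁]

theorem Impl.setBits {c k : ℕ} (a : ℕ → A) {v : Fin k → P.Oracle → Memory P A → Bool}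
    (hv : ∀ i, BComp (v i) c) :
    Impl (fun H m => PMF.pure (m.setBits a fun i => v i H m)) (k * (c + 2)) := by
  -- Copying a bit by a single `nand` complements it, so the complements are what has to be
  -- computed.
  obtain ⟨p, hp, h⟩ := BComp.vec (fun i => (hv i).not) 0
  refine ⟨p ++ copyNots P 0 a k, by
    rw [List.length_append, length_copyNots]
    have : k * (c + 2) = k * (c + 1) + k := by ring
    omega, fun H m => ?_⟩
  obtain ⟨m₁, r₁, e₁, k₁⟩ := h H m
  rw [Prog.run_append, r₁, PMF.pure_bind, run_copyNots, k₁.1]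
  simp only [e₁, Bool.not_not]

theorem Impl.setFld {c : ℕ} (a : A) {v : P.Oracle → Memory P A → P.F} (hv : FComp v c) :
    Impl (fun H m => PMF.pure (m.setFld a (v H m))) (c + 1) := by
  have h := Impl.setFlds (k := 1) (fun _ => a) fun _ => hv
  rw [one_mul] at h
  exact h

theorem Impl.setBit {c : ℕ} (a : A) {v : P.Oracle → Memory P A → Bool} (hv : BComp v c) :
    Impl (fun H m => PMF.pure (m.setBit a (v H m))) (c + 2) := by
  have h := Impl.setBits (k := 1) (fun _ => a) fun _ => hv
  rw [one_mul] at h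
  exact h

theorem Impl.sampleFlds (a : ℕ → A) (k : ℕ) :
    Impl (fun _ (m : Memory P A) => (P.unifVec k).map (m.setFlds a)) k := by
  induction k generalizing a with
  | zero =>
    refine Impl.id.mono (le_refl 0) |> cast (congrArg (Impl · 0) (funext fun H => funext fun m => ?_))
    rw [P.unifVec_zero, PMF.pure_map, setFlds_zero]
  | succ k ih =>
    have h := (Impl.prog [.funif (a 0)]).seq (ih fun i => a (i + 1))
    refine (h.mono (d := k + 1) (by simp; omega)) |>
      cast (congrArg (Impl · (k + 1)) (funext fun H => funext fun m => ?_))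
    rw [Prog.run_singleton, Instr.step, PMF.bind_map, P.unifVec_succ, PMF.map_bind]
    refine congrArg _ (funext fun c => ?_)
    rw [PMF.map_comp]
    refine congrArg (PMF.map · _) (funext fun v => ?_)
    simp [setFlds_succ]

end

end

noncomputable section

/-! ### Secret sharing -/

section

variable {α β : Type*}

open Classical in
/-- The image of a uniform distribution under a map all of whose fibres have the same size. -/
theorem PMF.uniformOfFinset_map [Fintype α] {X : Finset α} (hX : X.Nonempty) {Y : Finset β}
    (hY : Y.Nonempty) (f : α → β) (N : ℕ) (hf : ∀ a ∈ X, f a ∈ Y)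
    (hN : ∀ b ∈ Y, (X.filter fun a => f a = b).card = N) :
    (PMF.uniformOfFinset X hX).map f = PMF.uniformOfFinset Y hY := by
  have hcard : X.card = N * Y.card := by
    rw [Finset.card_eq_sum_card_fiberwise hf, Finset.sum_congr rfl hN, Finset.sum_const,
      smul_eq_mul, mul_comm]
  have hN0 : N ≠ 0 := by
    rintro rfl
    rw [zero_mul] at hcard
    exact hX.card_pos.ne' hcard
  ext b
  rw [PMF.map_apply, tsum_fintype, PMF.uniformOfFinset_apply]
  have h1 : (∑ a, if b = f a then (PMF.uniformOfFinset X hX) a else 0) =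
      ∑ a ∈ X.filter fun a => f a = b, (X.card : ENNReal)⁻¹ := by
    rw [Finset.sum_filter, ← Finset.sum_subset (Finset.subset_univ X)]
    · refine Finset.sum_congr rfl fun a ha => ?_
      simp [PMF.uniformOfFinset_apply, ha, eq_comm]
    · intro a _ ha
      simp [PMF.uniformOfFinset_apply, ha]
  rw [h1, Finset.sum_const, nsmul_eq_mul]
  split_ifs with hb
  · rw [hN b hb, hcard, Nat.cast_mul, ENNReal.mul_inv (by simp) (by simp), ← mul_assoc,
      ENNReal.mul_inv_cancel (by simpa using hN0) (by simp), one_mul]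
  · rw [Finset.card_eq_zero.2, Nat.cast_zero, zero_mul]
    rw [Finset.filter_eq_empty_iff]
    intro a ha h
    exact hb (h ▸ hf a ha)

open Classical in
/-- A uniformly random element of `X` is a uniformly random element of a uniformly random fibre, if
all fibres have the same size. -/
theorem PMF.uniformOfFinset_eq_bind_fiber [Fintype α] [Fintype β] [Nonempty β] {X : Finset α}
    (hX : X.Nonempty) (f : α → β) (N : ℕ)
    (hN : ∀ b, (X.filter fun a => f a = b).card = N)
    (hne : ∀ b, (X.filter fun a => f a = b).Nonempty) :
    PMF.uniformOfFinset X hX =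
      (PMF.uniformOfFintype β).bind fun b => PMF.uniformOfFinset _ (hne b) := by
  have hcard : X.card = N * Fintype.card β := by
    rw [Finset.card_eq_sum_card_fiberwise (f := f) (t := Finset.univ) (by simp),
      Finset.sum_congr rfl fun b _ => hN b, Finset.sum_const, smul_eq_mul, mul_comm,
      Finset.card_univ]
  ext a
  rw [PMF.bind_apply, tsum_fintype, Finset.sum_eq_single (f a)]
  · simp only [PMF.uniformOfFinset_apply, PMF.uniformOfFintype_apply, Finset.mem_filter, and_true,
      hN, mul_ite, mul_zero]
    split_ifs with h
    · rw [hcard, Nat.cast_mul, ENNReal.mul_inv (by simp) (by simp), mul_comm]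
    · rfl
  · intro b _ hb
    rw [PMF.uniformOfFinset_apply_of_notMem, mul_zero]
    simp [hb.symm]
  · simp

open Classical in
/-- All fibres of `f` on `X` have the same size if translations move them into each other. -/
theorem card_fiber_eq_of_translation [AddCommGroup α] [Fintype α] {F : Type*} [Field F]
    [Module F α] {X : Finset α} (f : α → F) (v : α)
    (hX : ∀ a ∈ X, ∀ c : F, a + c • v ∈ X) (hf : ∀ a ∈ X, ∀ c : F, f (a + c • v) = f a + c)
    (b b' : F) : (X.filter fun a => f a = b).card = (X.filter fun a => f a = b').card := by
  refine Finset.card_bij' (fun a _ => a + (b' - b) • v) (fun a _ => a + (b - b') • v) ?_ ?_ ?_ ?_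
  · intro a ha
    rw [Finset.mem_filter] at ha ⊢
    exact ⟨hX a ha.1 _, by rw [hf a ha.1, ha.2]; ring⟩
  · intro a ha
    rw [Finset.mem_filter] at ha ⊢
    exact ⟨hX a ha.1 _, by rw [hf a ha.1, ha.2]; ring⟩
  · intro a _
    rw [add_assoc, ← add_smul]
    simp
  · intro a _
    rw [add_assoc, ← add_smul]
    simp

open Classical in
/-- The value of `f` at a uniformly random element of `X` is uniformly random if translations shift
it. -/
theorem PMF.uniformOfFinset_map_of_translation [AddCommGroup α] [Fintype α] {F : Type*} [Field F]
    [Fintype F] [Module F α] {X : Finset α} (hne : X.Nonempty) (f : α → F) (v : α)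
    (hX : ∀ a ∈ X, ∀ c : F, a + c • v ∈ X) (hf : ∀ a ∈ X, ∀ c : F, f (a + c • v) = f a + c) :
    (PMF.uniformOfFinset X hne).map f = PMF.uniformOfFintype F :=
  PMF.uniformOfFinset_map hne Finset.univ_nonempty f (X.filter fun a => f a = 0).card
    (fun _ _ => Finset.mem_univ _) fun b _ => card_fiber_eq_of_translation f v hX hf b 0

end

/-! ### Sharing by correcting a uniform vector, and programs for the honest steps -/

section

variable {n : ℕ} {P : Params n} {A : Type}

open Memory

/-- The index of the first share. -/
def Params.zeroIdx (P : Params n) : Fin P.θ := ⟨0, P.θ_pos⟩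

/-- Change the first share so that the secret becomes `g`. -/
def Params.fixShare (P : Params n) (g : P.F) (w : Fin P.θ → P.F) : Fin P.θ → P.F := fun k =>
  if k = P.zeroIdx then w k + (P.coef P.zeroIdx)⁻¹ * (g - P.reconstruct w) else w k

theorem Params.fixShare_eq (P : Params n) (g : P.F) (w : Fin P.θ → P.F) :
    P.fixShare g w = w + Pi.single P.zeroIdx ((P.coef P.zeroIdx)⁻¹ * (g - P.reconstruct w)) := by
  ext k
  by_cases h : k = P.zeroIdx
  · subst h; simp [fixShare]
  · simp [fixShare, h]

theorem Params.reconstruct_add (P : Params n) (s t : Fin P.θ → P.F) :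
    P.reconstruct (s + t) = P.reconstruct s + P.reconstruct t := by
  simp [reconstruct, mul_add, Finset.sum_add_distrib]

theorem Params.reconstruct_smul (P : Params n) (c : P.F) (s : Fin P.θ → P.F) :
    P.reconstruct (c • s) = c * P.reconstruct s := by
  simp only [reconstruct, Pi.smul_apply, smul_eq_mul, Finset.mul_sum]
  exact Finset.sum_congr rfl fun k _ => by ring

theorem Params.reconstruct_single (P : Params n) (k : Fin P.θ) (c : P.F) :
    P.reconstruct (Pi.single k c) = P.coef k * c := by
  classical
  simp [reconstruct, Pi.single_apply]

theorem Params.reconstruct_fixShare (P : Params n) (g : P.F) (w : Fin P.θ → P.F) :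
    P.reconstruct (P.fixShare g w) = g := by
  rw [fixShare_eq, reconstruct_add, reconstruct_single, mul_inv_cancel_left₀ (P.coef_ne _)]
  ring

/-- Programs can draw only independent uniform elements. Correcting the first coordinate forgets
exactly that coordinate, so each sharing of `g` arises from equally many vectors, one for each field
element. -/
theorem Params.share_eq (P : Params n) (g : P.F) :
    P.share g = (P.unifVec P.θ).map (P.fixShare g) := by
  classical
  rw [P.unifVec_eq]
  refine (PMF.uniformOfFinset_map (Finset.univ_nonempty) _ (P.fixShare g) (Fintype.card P.F) ?_
    ?_).symm
  · intro w _
    simp [P.reconstruct_fixShare]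
  · intro s hs
    simp only [Finset.mem_filter, Finset.mem_univ, true_and] at hs ⊢
    rw [← Finset.card_univ]
    -- The fibre over `s` is the line through `s` in the direction of the first coordinate.
    refine (Finset.card_bij (fun c _ => s + Pi.single P.zeroIdx c) ?_ ?_ ?_).symm
    · intro c _
      simp only [Finset.mem_filter, Finset.mem_univ, true_and]
      rw [P.fixShare_eq, P.reconstruct_add, P.reconstruct_single, hs, add_assoc, ← Pi.single_add,
        sub_add_cancel_left, mul_neg, inv_mul_cancel_left₀ (P.coef_ne _)]
      simp
    · intro c _ c' _ h
      simpa using congrFun h P.zeroIdx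
    · intro w hw
      simp only [Finset.mem_filter, Finset.mem_univ, true_and] at hw
      refine ⟨w P.zeroIdx - s P.zeroIdx, Finset.mem_univ _, ?_⟩
      ext k
      by_cases h : k = P.zeroIdx
      · subst h; simp
      · rw [← hw]; simp [h, Params.fixShare]

/-- Shares and masks are independent, so the masks may be drawn first; this is the order of the
program below. -/
theorem ImplicitCheck.serverRandomness_eq (k : Fin P.prfKeyLen → Bool) (y : Fin P.θ → P.F) :
    ImplicitCheck.serverRandomness k y = (P.unifVec P.θ).bind fun r =>
      (P.unifVec P.θ).map fun w => (P.fixShare (P.tok (P.prf k y)) w, r) := by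
  unfold ImplicitCheck.serverRandomness
  rw [P.share_eq, PMF.bind_map]
  exact PMF.bind_comm _ _ _

/-! ### Programs for the steps of the experiments -/

theorem Impl.congr {K K' : P.Oracle → Memory P A → PMF (Memory P A)} {c : ℕ} (h : Impl K c)
    (e : ∀ H m, K H m = K' H m) : Impl K' c := by
  rwa [show K = K' from funext fun H => funext fun m => e H m] at h

namespace Memory

theorem bits_setBits (m : Memory P A) {a : ℕ → A} (ha : Function.Injective a) {k : ℕ}
    (v : Fin k → Bool) : (m.setBits a v).bits a k = v :=
  funext fun i => setBits_bit_apply m a ha v i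

theorem flds_setFlds (m : Memory P A) {a : ℕ → A} (ha : Function.Injective a) {k : ℕ}
    (v : Fin k → P.F) : (m.setFlds a v).flds a k = v :=
  funext fun i => setFlds_fld_apply m a ha v i

theorem setFlds_setFlds (m : Memory P A) {a : ℕ → A} (ha : Function.Injective a) {k : ℕ}
    (v w : Fin k → P.F) : (m.setFlds a v).setFlds a w = m.setFlds a w := by
  ext b
  · simp
  · by_cases h : ∃ i : Fin k, b = a i
    · obtain ⟨i, rfl⟩ := h
      rw [setFlds_fld_apply _ _ ha, setFlds_fld_apply _ _ ha]
    · have h' : ∀ i < k, b ≠ a i := fun i hi e => h ⟨⟨i, hi⟩, e⟩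
      rw [setFlds_fld_of_ne _ _ _ h', setFlds_fld_of_ne _ _ _ h', setFlds_fld_of_ne _ _ _ h']

end Memory

/-- Values computed by the implicit-check server, with the masks `r k` in `work (2 * k)` and random
elements in `work (2 * k + 1)`. -/
def serverValue (k : Fin P.θ) (m : Memory P Loc) : P.F :=
  P.fixShare (P.tok (P.prf (ImplicitCheck.topPrfKey m) (ImplicitCheck.topToken m)))
    (m.flds (fun i => .work (2 * i + 1)) P.θ) k -
    m.fld (.work (2 * k)) * ImplicitCheck.topToken m k

theorem FComp.serverValue (k : Fin P.θ) :
    FComp (fun _ m => serverValue (P := P) k m) (n + 4 * P.θ + 20) := by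
  have hg : FComp (fun _ (m : Memory P Loc) =>
      P.tok (P.prf (ImplicitCheck.topPrfKey m) (ImplicitCheck.topToken m))) (n * 1 + 1) :=
    FComp.tok fun i => BComp.prf i (fun i => Loc.top (P.keyLen + i)) (fun i => Loc.top i)
  have hw : ∀ k : Fin P.θ, FComp (P := P) (fun _ (m : Memory P Loc) =>
      m.flds (fun i => .work (2 * i + 1)) P.θ k) 1 := fun k => FComp.reg _
  have hrec : FComp (P := P) (fun _ (m : Memory P Loc) =>
      P.reconstruct (m.flds (fun i => .work (2 * i + 1)) P.θ)) (P.θ * (3 + 1) + 1) :=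
    FComp.sum fun k => (FComp.const _).mul (hw k)
  have hmask : FComp (P := P) (fun _ (m : Memory P Loc) =>
      m.fld (.work (2 * k)) * ImplicitCheck.topToken m k) 3 := (FComp.reg _).mul (FComp.reg _)
  unfold _root_.serverValue Params.fixShare
  -- The index is known when the program is written, so this is a choice between two programs, not a
  -- branch at run time; only the first share involves the secret.
  by_cases h : k = P.zeroIdx
  · simp only [h, if_true] at *
    exact (((hw P.zeroIdx).add ((FComp.const _).mul (hg.sub hrec))).sub hmask).mono (by omega)
  · simp only [h, if_false]
    exact ((hw k).sub hmask).mono (by omega)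

theorem work_even_injective : Function.Injective fun k => Loc.work (2 * k) := fun i j h => by
  simpa using h

theorem work_odd_injective : Function.Injective fun k => Loc.work (2 * k + 1) := fun i j h => by
  simpa using h

/-- The honest server prepares its OLE inputs. -/
def serverShares : Step P := fun _ m =>
  (ImplicitCheck.serverRandomness (ImplicitCheck.topPrfKey m) (ImplicitCheck.topToken m)).map
    fun sr => (m.setFlds (fun k => .work (2 * k)) sr.2).setFlds
      (fun k => .work (2 * k + 1)) (fun k => sr.1 k - sr.2 k * ImplicitCheck.topToken m k)

/-- The masks go to the even `work` registers and uniform elements to the odd ones; the latter are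
then replaced in place by the corrected shares minus the mask terms. -/
theorem Impl.serverShares : Impl (serverShares (P := P))
    (P.θ + P.θ + P.θ * (n + 4 * P.θ + 21)) := by
  have h4 : Impl (fun _ (m : Memory P Loc) => PMF.pure (m.setFlds (fun k => .work (2 * k + 1))
      fun k => _root_.serverValue k m)) (P.θ * (n + 4 * P.θ + 21)) :=
    Impl.setFlds _ fun i => FComp.serverValue i
  refine (((Impl.sampleFlds (fun k => .work (2 * k)) P.θ).seq
    (Impl.sampleFlds (fun k => .work (2 * k + 1)) P.θ)).seq h4).congr fun H m => ?_
  unfold _root_.serverShares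
  rw [ImplicitCheck.serverRandomness_eq]
  simp only [PMF.bind_bind, PMF.bind_map, PMF.map_bind, PMF.map_comp]
  refine congrArg _ (funext fun r => ?_)
  simp only [Function.comp_def]
  rw [PMF.bind_map]
  refine congrArg (PMF.bind _) (funext fun w => ?_)
  simp only [Function.comp_def]
  rw [Memory.setFlds_setFlds _ work_odd_injective]
  refine congrArg PMF.pure (congrArg _ (funext fun k => ?_))
  have hk : ImplicitCheck.topPrfKey ((m.setFlds (fun k => .work (2 * k)) r).setFlds
      (fun k => .work (2 * k + 1)) w) = ImplicitCheck.topPrfKey m := by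
    funext i
    simp only [ImplicitCheck.topPrfKey, Memory.bits, setFlds_bit]
  have ht : ImplicitCheck.topToken ((m.setFlds (fun k => .work (2 * k)) r).setFlds
      (fun k => .work (2 * k + 1)) w) = ImplicitCheck.topToken m := by
    funext i
    simp only [ImplicitCheck.topToken, Memory.flds]
    rw [setFlds_fld_of_ne _ _ _ (by simp), setFlds_fld_of_ne _ _ _ (by simp)]
  unfold _root_.serverValue
  rw [hk, ht, Memory.flds_setFlds _ work_odd_injective, setFlds_fld_of_ne _ _ _ (by simp; omega),
    setFlds_fld_apply _ _ work_even_injective]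

theorem Impl.serverStart : Impl (ImplicitCheck.serverStart (P := P))
    (P.keyLen * 5 + P.θ + P.θ + P.θ * (n + 4 * P.θ + 21)) := by
  have h1 : Impl (fun _ (m : Memory P Loc) =>
      PMF.pure (m.setBits (fun i => .chan i) (ImplicitCheck.topKey m))) (P.keyLen * 5) :=
    Impl.setBits _ fun i => BComp.reg (Loc.top i)
  refine ((h1.pure_seq Impl.serverShares).mono (le_of_eq (by ring))).congr fun H m => ?_
  have hk : ImplicitCheck.topPrfKey (m.setBits (fun i => Loc.chan i) (ImplicitCheck.topKey m)) =
      ImplicitCheck.topPrfKey m := funext fun i => setBits_bit_of_ne _ _ _ (by simp)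
  have ht : ImplicitCheck.topToken (m.setBits (fun i => Loc.chan i) (ImplicitCheck.topKey m)) =
      ImplicitCheck.topToken m := by
    funext i
    simp only [ImplicitCheck.topToken, Memory.flds, setBits_fld]
  unfold _root_.serverShares
  rw [hk, ht]
  rfl

theorem Impl.clientStart :
    Impl (ImplicitCheck.clientStart (P := P)) (P.inputLen * 5) :=
  Impl.setBits _ fun i => BComp.reg (Loc.top (P.keyLen + P.prfKeyLen + i))

theorem Impl.clientToken :
    Impl (ImplicitCheck.clientToken (P := P)) (P.θ * (P.θ * 1 + 3 + 1)) :=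
  Impl.setFlds _ fun i => ((FComp.emb i (fun i => Loc.chan i) (fun i => Loc.work i)).add
    (FComp.hash (c := 1) i (fun i => Loc.work i)
      (fun i => FComp.emb i (fun i => Loc.chan i) (fun i => Loc.work i)) (fun i => Loc.chan i))).mono
        (by omega)

/-- Straight-line programs cannot branch, so the functionality is rewritten as two unconditional
assignments with selected values. -/
theorem OLEProtocol.oleAnswer_eq (m : Memory P Loc) : OLEProtocol.oleAnswer m =
    (m.setBit (.fn 0) (m.bit (.fn 0) || m.bit (.port 0))).setFld (.port 1)
      (if m.bit (.port 0) && !m.bit (.fn 0) then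
        m.fld (.fn 0) * m.fld (.port 0) + m.fld (.fn 1) else m.fld (.port 1)) := by
  unfold OLEProtocol.oleAnswer Params.fOLE
  cases h : m.bit (.port 0) <;> cases h' : m.bit (.fn 0) <;> simp
  · rw [← h', setBit_same, setFld_same]
  · rw [← h', setBit_same, setFld_same]
  · rw [← h', setBit_same, setFld_same]

theorem Impl.oleAnswer :
    Impl (fun _ (m : Memory P Loc) => PMF.pure (OLEProtocol.oleAnswer m)) 32 := by
  have hp : BComp (P := P) (fun _ (m : Memory P Loc) => m.bit (.port 0)) 3 := BComp.reg _
  have hf : BComp (P := P) (fun _ (m : Memory P Loc) => m.bit (.fn 0)) 3 := BComp.reg _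
  have h1 := Impl.setFld (.port 1) (FComp.mux (hp.and hf.not)
    (((FComp.reg (P := P) (Loc.fn 0)).mul (FComp.reg (.port 0))).add (FComp.reg (.fn 1)))
    (FComp.reg (.port 1)))
  have h2 := Impl.setBit (.fn 0) (hf.or hp)
  -- The field is written before the bit `fn 0`, because its value depends on the old bit; the two
  -- writes themselves commute.
  refine ((h1.pure_seq h2).mono (by omega)).congr fun H m => ?_
  rw [OLEProtocol.oleAnswer_eq]
  rfl

theorem Impl.act (S : Simulator P) {f : Memory P Loc → Memory P Loc} {c : ℕ}
    (hf : Impl (fun _ m => PMF.pure (f m)) c) (t : ℕ) :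
    Impl (S.act f t) ((S t).1.length + c + (S t).2.length) := by
  have h := ((Impl.prog ((S t).1.map (Instr.map SReg.loc))).seq_pure hf).seq
    (Impl.prog ((S t).2.map (Instr.map SReg.loc)))
  rw [List.length_map, List.length_map] at h
  exact h

theorem Impl.party (ρ : OLEProtocol P) (c : Bool) (t : ℕ) :
    Impl (ρ.party c t) ((if c then ρ.client else ρ.server) t).length := by
  have h := Impl.prog (((if c then ρ.client else ρ.server) t).map (Instr.map (PReg.loc c)))
  rw [List.length_map] at h
  exact h

end

end

noncomputable section

/-! ### Addresses of the reduction -/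

/-- The registers of an experiment that outlive an OLE session. -/
def Loc.isGlob : Loc → Bool
  | .adv _ => true
  | .chan _ => true
  | .top _ => true
  | .work _ => true
  | _ => false

/-- An injective numbering of the addresses of an experiment. -/
def Loc.num : Loc → ℕ
  | .adv i => Nat.pair 0 i
  | .chan i => Nat.pair 1 i
  | .top i => Nat.pair 2 i
  | .inp c i => Nat.pair 3 (Nat.pair c.toNat i)
  | .prv c i => Nat.pair 4 (Nat.pair c.toNat i)
  | .work i => Nat.pair 5 i
  | .sim i => Nat.pair 6 i
  | .port i => Nat.pair 7 i
  | .fn i => Nat.pair 8 i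

theorem Bool.toNat_injective : Function.Injective Bool.toNat := by
  intro a b; cases a <;> cases b <;> simp

theorem Loc.num_injective : Function.Injective Loc.num := by
  intro a b h
  cases a <;> cases b <;> simp [Loc.num, Nat.pair_eq_pair, Bool.toNat_injective.eq_iff] at h ⊢ <;>
    exact h

/-- An injective numbering of the addresses of a set-up. -/
def DReg.num : DReg → ℕ
  | .part c i => Nat.pair c.toNat i
  | .own i => Nat.pair 2 i

theorem DReg.num_injective : Function.Injective DReg.num := by
  intro a b h
  cases a with
  | part c i =>
    cases b with
    | part c' j => simpa [DReg.num, Nat.pair_eq_pair, Bool.toNat_injective.eq_iff] using h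
    | own j => cases c <;> simp [DReg.num, Nat.pair_eq_pair] at h
  | own i =>
    cases b with
    | part c' j => cases c' <;> simp [DReg.num, Nat.pair_eq_pair] at h
    | own j => simpa [DReg.num, Nat.pair_eq_pair] using h

/-- The addresses of one session that is played by the reduction: those of the experiment, those of
the set-up, and those of a run with two honest parties. -/
abbrev SessReg : Type := Loc ⊕ (DReg ⊕ Loc)

/-- An injective numbering of the addresses of a session. -/
def SessReg.num : SessReg → ℕ
  | .inl a => Nat.pair 0 a.num
  | .inr (.inl d) => Nat.pair 1 d.num
  | .inr (.inr a) => Nat.pair 2 a.num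

theorem SessReg.num_injective : Function.Injective SessReg.num := by
  rintro (a | a | a) (b | b | b) h <;>
    simp [SessReg.num, Nat.pair_eq_pair, Loc.num_injective.eq_iff, DReg.num_injective.eq_iff]
      at h ⊢ <;> exact h

/-- Where the reduction keeps the register `y` of session `k`. -/
def sessIdx (k : ℕ) (y : SessReg) : ℕ := Nat.pair (k + 2) y.num

/-- Where the reduction keeps the global registers of the experiment that it plays. -/
def globReg : Loc → EReg
  | .chan i => .chan i
  | a => .adv (Nat.pair 0 a.num)

/-- Where the reduction keeps the registers of session `k`, and temporary registers. -/
def sessReg (k : ℕ) : SessReg ⊕ ℕ → EReg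
  | .inl (.inl a) => if a.isGlob then globReg a else .adv (sessIdx k (.inl a))
  | .inl (.inr y) => .adv (sessIdx k (.inr y))
  | .inr j => .adv (Nat.pair 1 j)

theorem EReg.loc_injective : Function.Injective EReg.loc := by
  intro a b h
  cases a <;> cases b <;> simp_all [EReg.loc]

theorem globReg_cases (a : Loc) :
    (∃ i, a = .chan i) ∨ globReg a = .adv (Nat.pair 0 a.num) := by
  cases a <;> simp [globReg]

theorem globReg_injective : Function.Injective globReg := by
  intro a b h
  rcases globReg_cases a with ⟨i, rfl⟩ | ha <;> rcases globReg_cases b with ⟨j, rfl⟩ | hb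
  · simpa [globReg] using h
  · rw [hb] at h; simp [globReg] at h
  · rw [ha] at h; simp [globReg] at h
  · rw [ha, hb] at h
    simpa [Nat.pair_eq_pair, Loc.num_injective.eq_iff] using h

theorem globReg_ne_adv (a : Loc) {i j : ℕ} (hi : i ≠ 0) : globReg a ≠ .adv (Nat.pair i j) := by
  rcases globReg_cases a with ⟨i, rfl⟩ | ha
  · simp [globReg]
  · rw [ha]; simp [Nat.pair_eq_pair, hi.symm]

theorem sessIdx_inj {k k' : ℕ} {y y' : SessReg} : sessIdx k y = sessIdx k' y' ↔ k = k' ∧ y = y' := by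
  simp [sessIdx, Nat.pair_eq_pair, SessReg.num_injective.eq_iff]

/-- The first component of the pairing separates the uses of the `adv` registers: `0` for global
registers, `1` for temporary ones, `k + 2` for session `k`. The channel is kept in place, since it
is the one on which the outer experiment communicates. -/
theorem sessReg_injective (k : ℕ) : Function.Injective (sessReg k) := by
  rintro ((a | y) | i) ((b | z) | j) h <;> simp only [sessReg] at h
  · split_ifs at h
    · simpa using globReg_injective h
    · exact absurd h (globReg_ne_adv _ (by omega))
    · exact absurd h.symm (globReg_ne_adv _ (by omega))
    · simpa [sessIdx_inj] using h
  · split_ifs at h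
    · exact absurd h (globReg_ne_adv _ (by omega))
    · simp [sessIdx_inj] at h
  · split_ifs at h
    · exact absurd h (globReg_ne_adv _ (by omega))
    · simp [sessIdx, Nat.pair_eq_pair] at h
  · split_ifs at h
    · exact absurd h.symm (globReg_ne_adv _ (by omega))
    · simp [sessIdx_inj] at h
  · simpa [sessIdx_inj] using h
  · simp [sessIdx, Nat.pair_eq_pair] at h
  · split_ifs at h
    · exact absurd h.symm (globReg_ne_adv _ (by omega))
    · simp [sessIdx, Nat.pair_eq_pair] at h
  · simp [sessIdx, Nat.pair_eq_pair] at h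
  · simpa [Nat.pair_eq_pair] using h

theorem sessReg_ne {k k' : ℕ} (h : k ≠ k') (x : SessReg ⊕ ℕ) (y : SessReg) :
    sessReg k x ≠ .adv (sessIdx k' y) := by
  rcases x with (a | z) | j <;> simp only [sessReg]
  · split_ifs
    · exact globReg_ne_adv _ (by omega)
    · simp [sessIdx_inj, h]
  · simp [sessIdx_inj, h]
  · simp [sessIdx, Nat.pair_eq_pair]

section

variable {n : ℕ} {P : Params n} {A B : Type}

open Memory

/-! ### Worlds as compositions of random functions -/

/-- Execution of a program of the environment. -/
def envRun (H : P.Oracle) (q : Prog P EReg) (m : Memory P Loc) : PMF (Memory P Loc) :=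
  Prog.run H (q.map (Instr.map EReg.loc)) m

theorem envRun_nil (H : P.Oracle) (m : Memory P Loc) : envRun H [] m = PMF.pure m := rfl

theorem envRun_append (H : P.Oracle) (p q : Prog P EReg) (m : Memory P Loc) :
    envRun H (p ++ q) m = (envRun H p m).bind (envRun H q) := by
  unfold envRun
  rw [List.map_append, Prog.run_append]

/-- The interaction of an environment with a world, up to the last activation. -/
def World.play (H : P.Oracle) : World P → Env P → Memory P Loc → PMF (Memory P Loc)
  | [], _, m => PMF.pure m
  | h :: W, e, m => ((envRun H (e.headD []) m).bind (h H)).bind (World.play H W e.tail)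

theorem World.run_eq (H : P.Oracle) (W : World P) (e : Env P) (m : Memory P Loc) :
    W.run H e m = (W.play H e m).bind (envRun H ((e.drop W.length).headD [])) := by
  induction W generalizing e m with
  | nil => simp [World.run, World.play, envRun]
  | cons h W ih =>
    rw [World.run, World.play, funext (ih e.tail), List.length_cons, ← List.drop_tail]
    simp only [PMF.bind_bind]
    rfl

theorem World.play_append (H : P.Oracle) (V W : World P) (e : Env P) (m : Memory P Loc) :
    World.play H (V ++ W) e m = (V.play H e m).bind (W.play H (e.drop V.length)) := by
  induction V generalizing e m with
  | nil => simp [World.play]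
  | cons h V ih =>
    rw [List.cons_append, World.play, World.play, funext (ih e.tail), List.length_cons,
      ← List.drop_tail]
    simp only [PMF.bind_bind]

theorem World.play_append_env (H : P.Oracle) (W : World P) (e e' : Env P) (m : Memory P Loc)
    (h : W.length ≤ e.length) : World.play H W (e ++ e') m = World.play H W e m := by
  induction W generalizing e m with
  | nil => rfl
  | cons g W ih =>
    cases e with
    | nil => simp at h
    | cons q e =>
      simp only [World.play, List.cons_append, List.headD_cons, List.tail_cons]
      refine congrArg _ (funext fun m => ih _ _ ?_)
      simpa using h

/-- Composition of random functions of the memory. -/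
def chain : List (Step P) → Step P
  | [] => fun _ m => PMF.pure m
  | K :: Ks => fun H m => (K H m).bind (chain Ks H)

theorem chain_append (H : P.Oracle) (Ks Ls : List (Step P)) (m : Memory P Loc) :
    chain (Ks ++ Ls) H m = (chain Ks H m).bind (chain Ls H) := by
  induction Ks generalizing m with
  | nil => simp [chain]
  | cons K Ks ih =>
    simp only [List.cons_append, chain, PMF.bind_bind]
    exact congrArg _ (funext fun m => ih _)

/-- The probability that a random function of the memory, applied to the blank memory, yields bit 1
in register 0 of the environment. -/
def acceptOf (K : Step P) : ℝ :=
  ((P.randomOracle.bind fun H => K H (blank P Loc)).map (fun m => m.bit (.adv 0)) true).toReal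

theorem World.accept_eq (W : World P) (e : Env P) :
    W.accept e = acceptOf fun H m => W.run H e m := rfl

theorem acceptOf_congr {K L : Step P}
    (h : ∀ H, (K H (blank P Loc)).map (fun m => m.bit (.adv 0)) =
      (L H (blank P Loc)).map (fun m => m.bit (.adv 0))) : acceptOf K = acceptOf L := by
  unfold acceptOf
  simp only [PMF.map_bind, h]

/-- Forget all registers that do not outlive a session. -/
def wipe (m : Memory P Loc) : Memory P Loc :=
  view (blank P Loc) (fun a => if a.isGlob then some a else none) m

theorem pInj_glob {f : Loc → A} (hf : Function.Injective f) :
    PInj fun a : Loc => if a.isGlob then some (f a) else none := by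
  intro a a' b h h'
  simp only [Option.ite_none_right_eq_some, Option.some.injEq] at h h'
  exact hf (h.2.trans h'.2.symm)

theorem wipe_bit (m : Memory P Loc) (a : Loc) :
    (wipe m).bit a = if a.isGlob then m.bit a else false := by
  rw [wipe, view_bit]; split_ifs <;> rfl

theorem wipe_fld (m : Memory P Loc) (a : Loc) :
    (wipe m).fld a = if a.isGlob then m.fld a else 0 := by
  rw [wipe, view_fld]; split_ifs <;> rfl

theorem wipe_wipe (m : Memory P Loc) : wipe (wipe m) = wipe m := by
  ext a
  · simp only [wipe_bit]; split_ifs <;> rfl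
  · simp only [wipe_fld]; split_ifs <;> rfl

theorem EReg.isGlob_loc (a : EReg) : a.loc.isGlob = true := by cases a <;> rfl

theorem envRun_wipe (H : P.Oracle) (q : Prog P EReg) (m : Memory P Loc) :
    (envRun H q m).map wipe = envRun H q (wipe m) :=
  Prog.run_view (pInj_glob (f := fun a => a) fun _ _ h => h)
    (fun c => by simp [EReg.isGlob_loc]) H q m

/-- The interaction with a world, after which only global registers are kept. -/
def playWipe (W : World P) (e : Env P) : Step P := fun H g => (W.play H e g).map wipe

/-- The random functions that correspond to the worlds of a list, and to the last move of the
environment. -/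
def kernels : List (World P) → Env P → List (Step P)
  | [], e => [fun H g => (envRun H (e.headD []) g).map wipe]
  | W :: Ws, e => playWipe W e :: kernels Ws (e.drop W.length)

/-- The registers of earlier sessions do not matter. -/
def Wipeable (W : World P) : Prop := ∀ H e g, playWipe W e H g = playWipe W e H (wipe g)

/-- The environment cannot reach non-global registers, and no session depends on what earlier ones
left there. Hence wiping at each boundary is harmless, and the run becomes a composition of random
functions of the global registers alone. -/
theorem run_flatten_wipe {Ws : List (World P)} (h : ∀ W ∈ Ws, Wipeable W) (H : P.Oracle)
    (e : Env P) (m : Memory P Loc) :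
    (World.run H Ws.flatten e m).map wipe = chain (kernels Ws e) H (wipe m) := by
  induction Ws generalizing e m with
  | nil =>
    simp only [List.flatten_nil, World.run_eq, World.play, PMF.pure_bind, List.length_nil,
      List.drop_zero, kernels, chain, PMF.bind_pure]
    rw [← envRun_wipe, PMF.map_comp]
    exact congrArg (PMF.map · _) (funext fun m => (wipe_wipe m).symm)
  | cons W Ws ih =>
    change _ = (playWipe W e H (wipe m)).bind _
    rw [← h W (by simp), playWipe, PMF.bind_map, World.run_eq, List.flatten_cons,
      World.play_append, PMF.bind_bind, PMF.map_bind]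
    refine congrArg _ (funext fun m' => ?_)
    rw [Function.comp_apply, ← ih (fun W hW => h W (by simp [hW])), World.run_eq, List.length_append,
      List.drop_drop]

/-- The first world starts from the blank memory, so nothing has to be wiped before it; the output
bit lies in a global register and survives the wiping. -/
theorem accept_flatten {W : World P} {Ws : List (World P)} (h : ∀ W ∈ Ws, Wipeable W)
    (e : Env P) : World.accept (W ++ Ws.flatten) e = acceptOf (chain (kernels (W :: Ws) e)) := by
  rw [World.accept_eq]
  refine acceptOf_congr fun H => ?_
  change _ = PMF.map _ ((playWipe W e H (blank P Loc)).bind (chain (kernels Ws _) H))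
  rw [playWipe, PMF.bind_map, World.run_eq, World.play_append, PMF.bind_bind,
    PMF.map_bind, PMF.map_bind]
  refine congrArg _ (funext fun m => ?_)
  rw [Function.comp_apply, ← run_flatten_wipe h, PMF.map_comp, World.run_eq, List.length_append,
    List.drop_drop]
  refine congrArg (PMF.map · _) (funext fun m => ?_)
  simp [wipe_bit, Loc.isGlob]

/-! ### What the reduction plays itself -/

/-- The memory of a session at its start. -/
def freshSess (g : Memory P Loc) : Memory P SessReg :=
  ⟨Sum.elim g.bit fun _ => false, Sum.elim g.fld fun _ => 0⟩

/-- A random function of the global registers that is implemented by a program, with session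
registers and temporary registers, of length at most `c`. -/
def SessImpl (K : Step P) (c : ℕ) : Prop :=
  ∃ p : Prog P (SessReg ⊕ ℕ), p.length ≤ c ∧ ∀ H m g, pull Sum.inl m = freshSess g → wipe g = g →
    (Prog.run H p m).map (fun m => wipe (pull (fun a => .inl (.inl a)) m)) = K H g

/-- The global registers of the experiment that the reduction plays. -/
def globView (m : Memory P Loc) : Memory P Loc :=
  view (blank P Loc) (fun a => if a.isGlob then some (globReg a).loc else none) m

theorem globView_bit (m : Memory P Loc) (a : Loc) :
    (globView m).bit a = if a.isGlob then m.bit (globReg a).loc else false := by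
  rw [globView, view_bit]; split_ifs <;> rfl

theorem globView_fld (m : Memory P Loc) (a : Loc) :
    (globView m).fld a = if a.isGlob then m.fld (globReg a).loc else 0 := by
  rw [globView, view_fld]; split_ifs <;> rfl

theorem wipe_globView (m : Memory P Loc) : wipe (globView m) = globView m := by
  ext a
  · rw [wipe_bit, globView_bit]; split_ifs <;> rfl
  · rw [wipe_fld, globView_fld]; split_ifs <;> rfl

/-- The registers of the sessions `k, k + 1, …` have not been used, and neither have, if `b` holds,
those of the session that is not played by the reduction. -/
def Unused (b : Prop) (k : ℕ) (m : Memory P Loc) : Prop :=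
  (∀ k' ≥ k, ∀ y, m.bit (.adv (sessIdx k' y)) = false ∧ m.fld (.adv (sessIdx k' y)) = 0) ∧
    (b → ∀ a : Loc, a.isGlob = false → m.bit a = false ∧ m.fld a = 0)

theorem Unused.blank (b : Prop) (k : ℕ) : Unused b k (blank P Loc) :=
  ⟨fun _ _ _ => ⟨rfl, rfl⟩, fun _ _ _ => ⟨rfl, rfl⟩⟩

/-- Session `k` is played at the private addresses `sessReg k`, which are still zero, as a fresh
session requires. By the frame property the registers of later sessions stay zero, and an
environment's program cannot touch the non-global registers that the outer experiment will need. -/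
theorem SessImpl.emulate {K : Step P} {c : ℕ} (h : SessImpl K c) (k : ℕ) :
    ∃ p : Prog P EReg, p.length ≤ c ∧ ∀ b H m, Unused b k m →
      Tracks globView (Unused b (k + 1)) (envRun H p m) (K H (globView m)) := by
  obtain ⟨p, hp, h⟩ := h
  refine ⟨p.map (Instr.map (sessReg k)), by simpa using hp, fun b H m hm => ⟨?_, fun m' hm' => ?_⟩⟩
  · rw [envRun, List.map_map, Instr.map_comp_map]
    have hf : Function.Injective fun a => (sessReg k a).loc :=
      EReg.loc_injective.comp (sessReg_injective k)
    rw [← h H (pull (fun a => (sessReg k a).loc) m) (globView m), ← Prog.run_map_pull hf,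
      PMF.map_comp]
    · refine congrArg (PMF.map · _) (funext fun m' => ?_)
      ext a
      · simp only [globView_bit, Function.comp_apply, wipe_bit, pull_bit, sessReg]
        split_ifs <;> rfl
      · simp only [globView_fld, Function.comp_apply, wipe_fld, pull_fld, sessReg]
        split_ifs <;> rfl
    · ext a
      · rcases a with a | y
        · simp only [freshSess, pull_bit, sessReg, Sum.elim_inl, globView_bit]
          split_ifs with ha
          · rfl
          · exact (hm.1 k le_rfl _).1
        · exact (hm.1 k le_rfl _).1
      · rcases a with a | y
        · simp only [freshSess, pull_fld, sessReg, Sum.elim_inl, globView_fld]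
          split_ifs with ha
          · rfl
          · exact (hm.1 k le_rfl _).2
        · exact (hm.1 k le_rfl _).2
    · exact wipe_globView m
  · rw [envRun, List.map_map, Instr.map_comp_map] at hm'
    have hf := Prog.run_frame H p hm'
    refine ⟨fun k' hk' y => ?_, fun hb a ha => ?_⟩
    · obtain ⟨h1, h2⟩ := hf (.adv (sessIdx k' y)) (by
        rintro ⟨x, hx⟩
        exact sessReg_ne (k := k) (k' := k') (by omega) x y
          (EReg.loc_injective (a₂ := .adv (sessIdx k' y)) hx))
      rw [← h1, ← h2]
      exact hm.1 k' (by omega) y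
    · obtain ⟨h1, h2⟩ := hf a (by
        rintro ⟨x, rfl⟩
        simp [EReg.isGlob_loc] at ha)
      rw [← h1, ← h2]
      exact hm.2 hb a ha

theorem SessImpl.emulate_chain {Ks : List (Step P)} {c : ℕ} (h : ∀ K ∈ Ks, SessImpl K c) (k : ℕ) :
    ∃ p : Prog P EReg, p.length ≤ Ks.length * c ∧ ∀ b H m, Unused b k m →
      Tracks globView (Unused b (k + Ks.length)) (envRun H p m) (chain Ks H (globView m)) := by
  induction Ks generalizing k with
  | nil => exact ⟨[], by simp, fun b H m hm => Tracks.pure hm⟩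
  | cons K Ks ih =>
    obtain ⟨p, hp, h1⟩ := (h K (by simp)).emulate k
    obtain ⟨q, hq, h2⟩ := ih (fun K hK => h K (by simp [hK])) (k + 1)
    refine ⟨p ++ q, ?_, fun b H m hm => ?_⟩
    · rw [List.length_append, List.length_cons, Nat.add_mul]; omega
    · rw [envRun_append, chain, List.length_cons, add_comm Ks.length, ← add_assoc]
      exact (h1 b H m hm).bind fun m' hm' => h2 b H m' hm'

/-! ### Embedding one session into a larger experiment -/

/-- The worlds `V` and `W`, together with programs of the reduction of length at most `c`, play
session `k` as specified by `K` and `L`. -/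
def Embeds (V W : World P) (K L : Step P) (k c : ℕ) : Prop :=
  ∃ (q : Prog P EReg) (f : Env P) (p : Prog P EReg),
    V.length = f.length + 1 ∧ W.length = f.length + 1 ∧
    q.length + f.flatten.length + p.length ≤ c ∧
    ∀ H m, Unused True k m →
      Tracks globView (Unused False (k + 1)) ((V.play H (q :: f) m).bind (envRun H p))
        (K H (globView m)) ∧
      Tracks globView (Unused False (k + 1)) ((W.play H (q :: f) m).bind (envRun H p))
        (L H (globView m))

theorem World.run_surround (H : P.Oracle) (V : World P) (q₀ q p p₀ : Prog P EReg) (f : Env P)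
    (hV : V.length = f.length + 1) (m : Memory P Loc) :
    V.run H ((q₀ ++ q) :: f ++ [p ++ p₀]) m = (envRun H q₀ m).bind fun m =>
      ((V.play H (q :: f) m).bind (envRun H p)).bind (envRun H p₀) := by
  rw [World.run_eq, World.play_append_env _ _ _ _ _ (by simp [hV]), List.drop_append_of_le_length
    (by simp [hV]), hV, List.drop_of_length_le (by simp)]
  cases V with
  | nil => simp at hV
  | cons h V =>
    have h1 : envRun H (p ++ p₀) = fun m => (envRun H p m).bind (envRun H p₀) :=
      funext fun m => envRun_append H p p₀ m
    simp only [World.play, List.headD_cons, List.tail_cons, List.nil_append, PMF.bind_bind,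
      envRun_append, h1]

/-- The reduction emulates the sessions before, leaves one session to its own experiment, and
emulates those after it. One environment serves both worlds, since the embedding uses the same
programs for both. -/
theorem exists_reduction {V W : World P} {K L : Step P} {before after : List (Step P)} {c c' : ℕ}
    (hb : ∀ K ∈ before, SessImpl K c) (ha : ∀ K ∈ after, SessImpl K c)
    (h : Embeds V W K L before.length c') :
    ∃ e : Env P, e.flatten.length ≤ before.length * c + after.length * c + c' ∧
      V.accept e = acceptOf (chain (before ++ K :: after)) ∧
      W.accept e = acceptOf (chain (before ++ L :: after)) := by
  obtain ⟨q₀, hq₀, h₀⟩ := SessImpl.emulate_chain hb 0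
  obtain ⟨p₀, hp₀, h₁⟩ := SessImpl.emulate_chain ha (before.length + 1)
  obtain ⟨q, f, p, hV, hW, hc, h⟩ := h
  refine ⟨(q₀ ++ q) :: f ++ [p ++ p₀], by simp at hc ⊢; omega, ?_⟩
  have key : ∀ (V : World P) (K : Step P), V.length = f.length + 1 →
      (∀ H m, Unused True before.length m → Tracks globView (Unused False (before.length + 1))
        ((V.play H (q :: f) m).bind (envRun H p)) (K H (globView m))) →
      V.accept ((q₀ ++ q) :: f ++ [p ++ p₀]) = acceptOf (chain (before ++ K :: after)) := by
    intro V K hV h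
    rw [World.accept_eq]
    refine acceptOf_congr fun H => ?_
    rw [World.run_surround _ _ _ _ _ _ _ hV, chain_append]
    have hg : globView (blank P Loc) = blank P Loc := by
      ext a
      · simp [globView_bit]
      · simp [globView_fld]
    have ht := (h₀ True H (blank P Loc) (Unused.blank _ _)).bind
      (g := fun m => (K H m).bind (chain after H)) fun m hm =>
        (h H m (by simpa using hm)).bind fun m hm => h₁ False H m hm
    rw [hg] at ht
    change _ = PMF.map _ ((chain before H (blank P Loc)).bind fun m =>
      (K H m).bind (chain after H))
    rw [← ht.1, PMF.map_comp]
    -- The emulated register `adv 0` is kept in `adv (Nat.pair 0 (Nat.pair 0 0))`, which is `adv 0`;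
    -- so the reduction outputs the bit of the environment that it plays.
    rfl
  exact ⟨key V K hV fun H m hm => (h H m hm).1, key W L hW fun H m hm => (h H m hm).2⟩

end

end

noncomputable section

/-! ### Polynomial bounds -/

theorem PolyBounded.mono {f g : ℕ → ℕ} (hg : PolyBounded g) (h : ∀ n, f n ≤ g n) :
    PolyBounded f := by
  obtain ⟨p, hp⟩ := hg
  exact ⟨p, fun n => (h n).trans (hp n)⟩

theorem PolyBounded.add {f g : ℕ → ℕ} (hf : PolyBounded f) (hg : PolyBounded g) :
    PolyBounded fun n => f n + g n := by
  obtain ⟨p, hp⟩ := hf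
  obtain ⟨q, hq⟩ := hg
  exact ⟨p + q, fun n => by rw [Polynomial.eval_add]; exact add_le_add (hp n) (hq n)⟩

theorem PolyBounded.mul {f g : ℕ → ℕ} (hf : PolyBounded f) (hg : PolyBounded g) :
    PolyBounded fun n => f n * g n := by
  obtain ⟨p, hp⟩ := hf
  obtain ⟨q, hq⟩ := hg
  exact ⟨p * q, fun n => by rw [Polynomial.eval_mul]; exact Nat.mul_le_mul (hp n) (hq n)⟩

theorem PolyBounded.const (c : ℕ) : PolyBounded fun _ => c :=
  ⟨Polynomial.C c, fun n => by simp⟩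

theorem PolyBounded.id : PolyBounded fun n => n := ⟨Polynomial.X, fun n => by simp⟩

/-! ### The hybrid argument -/

theorem Negligible.mono {f g : ℕ → ℝ} (hf : Negligible f) (h : ∀ n, |g n| ≤ |f n|) :
    Negligible g :=
  Asymptotics.SuperpolynomialDecay.trans_abs_le hf h

theorem Negligible.polyBounded_mul {f : ℕ → ℝ} (hf : Negligible f) {θ : ℕ → ℕ}
    (hθ : PolyBounded θ) : Negligible fun n => θ n * |f n| := by
  obtain ⟨p, hp⟩ := hθ
  have h := Asymptotics.SuperpolynomialDecay.polynomial_mul hf (p.map (Nat.castRingHom ℝ))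
  refine Negligible.mono h fun n => ?_
  have h1 : Polynomial.eval (n : ℝ) (p.map (Nat.castRingHom ℝ)) = ((p.eval n : ℕ) : ℝ) := by
    simp
  rw [h1, abs_mul, abs_mul, abs_abs, Nat.abs_cast, Nat.abs_cast]
  exact mul_le_mul_of_nonneg_right (by exact_mod_cast hp n) (abs_nonneg _)

/-- The gap between the extreme hybrids telescopes and is at most `θ` times the largest single gap.
Non-uniform environments may know, for each `n`, where that gap occurs, so one family of
environments bounds everything. -/
theorem negligible_hybrid {P : ∀ n, Params n} {V W : ∀ n, World (P n)} (hVW : Indist P V W)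
    {θ L : ℕ → ℕ} (hθ : PolyBounded θ) (hL : PolyBounded L) (a : ℕ → ℕ → ℝ)
    (h : ∀ n, ∀ i < θ n, ∃ e : Env (P n), e.flatten.length ≤ L n ∧
      (V n).accept e = a n i ∧ (W n).accept e = a n (i + 1)) :
    Negligible fun n => |a n 0 - a n (θ n)| := by
  have key : ∀ n, ∃ e : Env (P n), e.flatten.length ≤ L n ∧
      |a n 0 - a n (θ n)| ≤ θ n * |(V n).accept e - (W n).accept e| := by
    intro n
    rcases Nat.eq_zero_or_pos (θ n) with h0 | hpos
    · exact ⟨[], by simp, by simp [h0]⟩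
    -- The index of the largest gap depends on `n`; it is hard-wired into the environment.
    · obtain ⟨i, hi, hmax⟩ := Finset.exists_max_image (Finset.range (θ n))
        (fun i => |a n i - a n (i + 1)|) ⟨0, Finset.mem_range.2 hpos⟩
      obtain ⟨e, he, hV, hW⟩ := h n i (Finset.mem_range.1 hi)
      refine ⟨e, he, ?_⟩
      rw [hV, hW, ← Finset.sum_range_sub' (fun i => a n i) (θ n)]
      refine (Finset.abs_sum_le_sum_abs _ _).trans ?_
      refine (Finset.sum_le_card_nsmul _ _ _ hmax).trans ?_
      simp
  choose e he hle using key
  refine ((hVW e (hL.mono he)).polyBounded_mul hθ).mono fun n => ?_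
  rw [abs_abs, abs_of_nonneg (a := (θ n : ℝ) * _) (by positivity), abs_abs]
  exact hle n

/-! ### Hybrids in which sessions are replaced one at a time -/

section

variable {n : ℕ} {P : Params n}

open Memory

/-- The random functions that correspond to the worlds of a list. -/
def initKernels : List (World P) → Env P → List (Step P)
  | [], _ => []
  | W :: Ws, e => playWipe W e :: initKernels Ws (e.drop W.length)

theorem kernels_append (Ws Vs : List (World P)) (e : Env P) :
    kernels (Ws ++ Vs) e = initKernels Ws e ++ kernels Vs (e.drop Ws.flatten.length) := by
  induction Ws generalizing e with
  | nil => simp [initKernels]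
  | cons W Ws ih => simp [kernels, initKernels, ih, List.drop_drop]

theorem length_initKernels (Ws : List (World P)) (e : Env P) :
    (initKernels Ws e).length = Ws.length := by
  induction Ws generalizing e with
  | nil => rfl
  | cons W Ws ih => simp [initKernels, ih]

theorem length_kernels (Ws : List (World P)) (e : Env P) :
    (kernels Ws e).length = Ws.length + 1 := by
  induction Ws generalizing e with
  | nil => rfl
  | cons W Ws ih => simp [kernels, ih]

theorem length_flatten_drop_le (e : Env P) (k : ℕ) :
    (e.drop k).flatten.length ≤ e.flatten.length :=
  ((List.drop_sublist k e).flatten).length_le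

theorem length_headD_le (e : Env P) : (e.headD []).length ≤ e.flatten.length := by
  cases e <;> simp

theorem SessImpl.mono {K : Step P} {c d : ℕ} (h : SessImpl K c) (hcd : c ≤ d) : SessImpl K d := by
  obtain ⟨p, hp, h⟩ := h
  exact ⟨p, hp.trans hcd, h⟩

theorem SessImpl.envRun (q : Prog P EReg) :
    SessImpl (fun H g => (envRun H q g).map wipe) q.length := by
  refine ⟨q.map (Instr.map fun a => .inl (.inl a.loc)), by simp, fun H m g hm _ => ?_⟩
  have hf : Function.Injective fun a : Loc => (.inl (.inl a) : SessReg ⊕ ℕ) := fun a b h => by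
    simpa using h
  have h := Prog.run_pull hf (j := fun a : EReg => .inl (.inl a.loc)) (j' := EReg.loc)
    (fun _ => rfl) H q m
  have hg : pull (fun a : Loc => (.inl (.inl a) : SessReg ⊕ ℕ)) m = g := by
    rw [← pull_pull (fun a => .inl a) Sum.inl m, hm]; rfl
  rw [hg] at h
  change _ = (Prog.run H (q.map (Instr.map EReg.loc)) g).map wipe
  rw [← h, PMF.map_comp]
  rfl

theorem sessImpl_of_mem_initKernels {Ws : List (World P)} {c : ℕ}
    (h : ∀ W ∈ Ws, ∀ e, SessImpl (playWipe W e) (e.flatten.length + c)) {e : Env P} {K : Step P}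
    (hK : K ∈ initKernels Ws e) : SessImpl K (e.flatten.length + c) := by
  induction Ws generalizing e with
  | nil => simp [initKernels] at hK
  | cons W Ws ih =>
    rw [initKernels, List.mem_cons] at hK
    rcases hK with rfl | hK
    · exact h W (by simp) e
    · exact (ih (fun W hW => h W (by simp [hW])) hK).mono
        (Nat.add_le_add_right (length_flatten_drop_le e _) _)

theorem sessImpl_of_mem_kernels {Ws : List (World P)} {c : ℕ}
    (h : ∀ W ∈ Ws, ∀ e, SessImpl (playWipe W e) (e.flatten.length + c)) {e : Env P} {K : Step P}
    (hK : K ∈ kernels Ws e) : SessImpl K (e.flatten.length + c) := by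
  rw [← List.append_nil Ws, kernels_append, List.mem_append] at hK
  rcases hK with hK | hK
  · exact sessImpl_of_mem_initKernels h hK
  · rw [kernels, List.mem_singleton] at hK
    subst hK
    refine (SessImpl.envRun _).mono ?_
    have h1 := length_headD_le (e.drop Ws.flatten.length)
    have h2 := length_flatten_drop_le e Ws.flatten.length
    omega

/-- The `i`-th hybrid: the sessions before `i` are those of `J`, the other ones those of `R`. -/
def hybridWorlds (pre post : World P) (R J : ℕ → World P) (θ i : ℕ) : List (World P) :=
  pre :: ((List.range θ).map fun k => if k < i then J k else R k) ++ [post]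

theorem hybridWorlds_split (pre post : World P) (R J : ℕ → World P) {θ i j : ℕ} (hi : i < θ)
    (hj : j = i ∨ j = i + 1) : hybridWorlds pre post R J θ j =
      (pre :: (List.range i).map J) ++ ((if i < j then J i else R i) ::
        ((List.range' (i + 1) (θ - i - 1)).map R ++ [post])) := by
  have h1 : List.range θ = List.range i ++ i :: List.range' (i + 1) (θ - i - 1) := by
    have h := List.range'_append (s := 0) (m := i) (n := θ - i - 1 + 1) (step := 1)
    rw [List.range'_succ, one_mul, Nat.zero_add] at h
    rw [List.range_eq_range', List.range_eq_range', h]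
    congr 1
    omega
  have h2 : (List.range i).map (fun k => if k < j then J k else R k) = (List.range i).map J :=
    List.map_congr_left fun k hk => by
      rw [List.mem_range] at hk; rw [if_pos (by omega)]
  have h3 : (List.range' (i + 1) (θ - i - 1)).map (fun k => if k < j then J k else R k) =
      (List.range' (i + 1) (θ - i - 1)).map R :=
    List.map_congr_left fun k hk => by
      rw [List.mem_range'_1] at hk; rw [if_neg (by omega)]
  unfold hybridWorlds
  rw [h1, List.map_append, List.map_cons, h2, h3]
  simp

/-- Hybrids `i` and `i + 1` differ in session `i` only. Both kinds of sessions have the same number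
of activations, so the later sessions meet the same programs of the environment in both hybrids, and
the reduction for `V` and `W` applies. -/
theorem hybrid_step {pre post V W : World P} {R J : ℕ → World P} {θ c : ℕ}
    (hpre : ∀ e, SessImpl (playWipe pre e) (e.flatten.length + c))
    (hpost : ∀ e, SessImpl (playWipe post e) (e.flatten.length + c))
    (hR : ∀ k < θ, ∀ e, SessImpl (playWipe (R k) e) (e.flatten.length + c))
    (hJ : ∀ k < θ, ∀ e, SessImpl (playWipe (J k) e) (e.flatten.length + c))
    (hlen : ∀ k < θ, (J k).length = (R k).length)
    (hemb : ∀ k < θ, ∀ e, Embeds V W (playWipe (R k) e) (playWipe (J k) e) (k + 1)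
      (e.flatten.length + c)) (e : Env P) {i : ℕ} (hi : i < θ) :
    ∃ e' : Env P, e'.flatten.length ≤ (θ + 3) * (e.flatten.length + c) ∧
      V.accept e' = acceptOf (chain (kernels (hybridWorlds pre post R J θ i) e)) ∧
      W.accept e' = acceptOf (chain (kernels (hybridWorlds pre post R J θ (i + 1)) e)) := by
  rw [hybridWorlds_split pre post R J hi (Or.inl rfl),
    hybridWorlds_split pre post R J hi (Or.inr rfl), if_neg (lt_irrefl i), if_pos (Nat.lt_succ_self i),
    kernels_append, kernels_append, kernels, kernels, hlen i hi]
  set Ws : List (World P) := pre :: (List.range i).map J with hWs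
  set e₁ := e.drop Ws.flatten.length
  have hb : ∀ K ∈ initKernels Ws e, SessImpl K (e.flatten.length + c) := fun K hK => by
    refine sessImpl_of_mem_initKernels (fun W hW e => ?_) hK
    rw [hWs, List.mem_cons, List.mem_map] at hW
    rcases hW with rfl | ⟨k, hk, rfl⟩
    · exact hpre e
    · exact hJ k (by rw [List.mem_range] at hk; omega) e
  have ha : ∀ K ∈ kernels ((List.range' (i + 1) (θ - i - 1)).map R ++ [post])
      (e₁.drop (R i).length), SessImpl K (e.flatten.length + c) := fun K hK => by
    have h1 := length_flatten_drop_le e₁ (R i).length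
    have h2 : e₁.flatten.length ≤ _ := length_flatten_drop_le e Ws.flatten.length
    refine (sessImpl_of_mem_kernels (c := c) (fun W hW e => ?_) hK).mono (by omega)
    rw [List.mem_append, List.mem_map, List.mem_singleton] at hW
    rcases hW with ⟨k, hk, rfl⟩ | rfl
    · exact hR k (by rw [List.mem_range'_1] at hk; omega) e
    · exact hpost e
  have hl : (initKernels Ws e).length = i + 1 := by
    rw [length_initKernels, hWs]; simp
  obtain ⟨e', he', h⟩ := exists_reduction hb ha (by rw [hl]; exact hemb i hi e₁)
  refine ⟨e', he'.trans ?_, h⟩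
  rw [hl, length_kernels, List.length_append, List.length_map, List.length_range',
    List.length_singleton, ← Nat.add_mul]
  have h2 : e₁.flatten.length ≤ _ := length_flatten_drop_le e Ws.flatten.length
  -- The emulated pieces are `pre` and the `i` earlier sessions, then the `θ - i - 1` later
  -- sessions, `post` and the last move of the environment; the final `1` pays for the embedded
  -- session.
  calc _ ≤ (i + 1 + (θ - i - 1 + 1 + 1)) * (e.flatten.length + c) +
        1 * (e.flatten.length + c) := by omega
    _ = (θ + 3) * (e.flatten.length + c) := by
        rw [← Nat.add_mul]; congr 1; omega

end

/-- Indistinguishability of the first and the last hybrid. -/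
theorem negligible_hybridWorlds {P : ∀ n, Params n} {V W : ∀ n, World (P n)} (hVW : Indist P V W)
    {θ c : ℕ → ℕ} (hθ : PolyBounded θ) (hc : PolyBounded c) {pre post : ∀ n, World (P n)}
    {R J : ∀ n, ℕ → World (P n)}
    (hpre : ∀ n e, SessImpl (playWipe (pre n) e) (e.flatten.length + c n))
    (hpost : ∀ n e, SessImpl (playWipe (post n) e) (e.flatten.length + c n))
    (hR : ∀ n, ∀ k < θ n, ∀ e, SessImpl (playWipe (R n k) e) (e.flatten.length + c n))
    (hJ : ∀ n, ∀ k < θ n, ∀ e, SessImpl (playWipe (J n k) e) (e.flatten.length + c n))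
    (hlen : ∀ n, ∀ k < θ n, (J n k).length = (R n k).length)
    (hemb : ∀ n, ∀ k < θ n, ∀ e, Embeds (V n) (W n) (playWipe (R n k) e) (playWipe (J n k) e)
      (k + 1) (e.flatten.length + c n))
    (e : ∀ n, Env (P n)) (he : PolyBounded fun n => (e n).flatten.length) :
    Negligible fun n =>
      |acceptOf (chain (kernels (hybridWorlds (pre n) (post n) (R n) (J n) (θ n) 0) (e n))) -
        acceptOf (chain (kernels (hybridWorlds (pre n) (post n) (R n) (J n) (θ n) (θ n)) (e n)))| :=
  negligible_hybrid hVW hθ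
    ((hθ.add (PolyBounded.const 3)).mul (he.add hc))
    (fun n i => acceptOf (chain (kernels (hybridWorlds (pre n) (post n) (R n) (J n) (θ n) i) (e n))))
    fun n _ hi => hybrid_step (hpre n) (hpost n) (hR n) (hJ n) (hlen n) (hemb n) (e n) hi

end

noncomputable section

section

variable {n : ℕ} {P : Params n} {A B : Type}

open Memory

/-! ### Playing sessions -/

theorem Impl.play {ι : Type*} (l : List ι) (h : ι → Step P) (c : ι → ℕ)
    (hh : ∀ i, Impl (h i) (c i)) (e : Env P) :
    Impl (fun H m => World.play H (l.map h) e m) (e.flatten.length + (l.map c).sum) := by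
  induction l generalizing e with
  | nil => exact Impl.id.mono (by simp)
  | cons i l ih =>
    have h1 := Impl.prog (P := P) ((e.headD []).map (Instr.map EReg.loc))
    refine (((h1.seq (hh i)).seq (ih e.tail)).mono ?_).congr fun H m => rfl
    cases e
    · simp
    · simp; omega

theorem SessImpl.of_impl {K : Step P} {c : ℕ} (h : Impl K c) :
    SessImpl (fun H g => (K H g).map wipe) c := by
  obtain ⟨p, hp, h⟩ := h
  refine ⟨p.map (Instr.map (Sum.map Sum.inl id)), by simpa using hp, fun H m g hm _ => ?_⟩
  have hf : Function.Injective (Sum.map Sum.inl id : Loc ⊕ ℕ → SessReg ⊕ ℕ) :=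
    Sum.inl_injective.sumMap Function.injective_id
  have hg : pull Sum.inl (pull (Sum.map Sum.inl id : Loc ⊕ ℕ → SessReg ⊕ ℕ) m) = g := by
    have : pull Sum.inl (pull Sum.inl m) = g := by rw [hm]; rfl
    exact this
  change _ = (K H g).map wipe
  rw [← hg, ← h, ← Prog.run_map_pull hf, PMF.map_comp, PMF.map_comp]
  rfl

/-- A random function of the global registers, with values in the memories of an experiment, that is
implemented by a program, with session registers and temporary registers, of length at most `c`. -/
def FreshImpl (K : Step P) (c : ℕ) : Prop :=
  ∃ p : Prog P (SessReg ⊕ ℕ), p.length ≤ c ∧ ∀ H m g, pull Sum.inl m = freshSess g → wipe g = g →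
    (Prog.run H p m).map (pull fun a => .inl (.inl a)) = K H g

theorem FreshImpl.seq {K L : Step P} {c d : ℕ} (hK : FreshImpl K c) (hL : Impl L d) :
    FreshImpl (fun H g => (K H g).bind (L H)) (c + d) := by
  obtain ⟨p, hp, hK⟩ := hK
  obtain ⟨q, hq, hL⟩ := hL
  refine ⟨p ++ q.map (Instr.map (Sum.map Sum.inl id)), by simp; omega, fun H m g hm hg => ?_⟩
  have hf : Function.Injective (Sum.map Sum.inl id : Loc ⊕ ℕ → SessReg ⊕ ℕ) :=
    Sum.inl_injective.sumMap Function.injective_id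
  change _ = (K H g).bind (L H)
  rw [Prog.run_append, PMF.map_bind, ← hK H m g hm hg, PMF.bind_map]
  refine congrArg _ (funext fun m' => ?_)
  have h1 := hL H (pull (Sum.map Sum.inl id : Loc ⊕ ℕ → SessReg ⊕ ℕ) m')
  rw [← Prog.run_map_pull hf, PMF.map_comp] at h1
  exact h1

/-- The environment moves before a session starts. Its program reaches neither the session registers
nor non-global ones, so the memory is still that of a fresh session afterwards. -/
theorem FreshImpl.envRun_seq {K : Step P} {c : ℕ} (hK : FreshImpl K c) (q : Prog P EReg) :
    FreshImpl (fun H g => (envRun H q g).bind (K H)) (q.length + c) := by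
  obtain ⟨p, hp, hK⟩ := hK
  refine ⟨q.map (Instr.map fun a => .inl (.inl a.loc)) ++ p, by simp; omega,
    fun H m g hm hg => ?_⟩
  have hf : Function.Injective fun a : Loc => (.inl (.inl a) : SessReg ⊕ ℕ) := fun a b h => by
    simpa using h
  have h := Prog.run_pull hf (j := fun a : EReg => .inl (.inl a.loc)) (j' := EReg.loc)
    (fun _ => rfl) H q m
  have hg' : pull (fun a : Loc => (.inl (.inl a) : SessReg ⊕ ℕ)) m = g := by
    rw [← pull_pull (fun a => .inl a) Sum.inl m, hm]; rfl
  rw [hg'] at h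
  change _ = (Prog.run H (q.map (Instr.map EReg.loc)) g).bind _
  rw [Prog.run_append, PMF.map_bind, ← h, PMF.bind_map]
  refine PMF.bind_congr_support fun m' hm' => ?_
  have hfr := Prog.run_frame H q hm'
  refine hK H m' _ ?_ ?_
  · ext (a | y)
    · rfl
    · obtain ⟨h1, h2⟩ := hfr (.inl (.inr y)) (by simp)
      exact h1.symm.trans (congrFun (congrArg Memory.bit hm) (.inr y))
    · rfl
    · obtain ⟨h1, h2⟩ := hfr (.inl (.inr y)) (by simp)
      exact h2.symm.trans (congrFun (congrArg Memory.fld hm) (.inr y))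
  · have key : ∀ a : Loc, a.isGlob = false →
        m'.bit (.inl (.inl a)) = false ∧ m'.fld (.inl (.inl a)) = 0 := by
      intro a ha
      obtain ⟨h1, h2⟩ := hfr (.inl (.inl a)) (by
        rintro ⟨x, hx⟩
        simp only [Sum.inl.injEq] at hx
        rw [← hx, EReg.isGlob_loc] at ha
        simp at ha)
      rw [← h1, ← h2]
      constructor
      · rw [show m.bit (.inl (.inl a)) = g.bit a from congrFun (congrArg Memory.bit hg') a, ← hg,
          wipe_bit, ha]
        rfl
      · rw [show m.fld (.inl (.inl a)) = g.fld a from congrFun (congrArg Memory.fld hg') a, ← hg,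
          wipe_fld, ha]
        rfl
    ext a
    · rw [wipe_bit]
      split_ifs with ha
      · rfl
      · exact ((key a (by simpa using ha)).1).symm
    · rw [wipe_fld]
      split_ifs with ha
      · rfl
      · exact ((key a (by simpa using ha)).2).symm

theorem FreshImpl.wipe {K : Step P} {c : ℕ} (hK : FreshImpl K c) :
    SessImpl (fun H g => (K H g).map wipe) c := by
  obtain ⟨p, hp, hK⟩ := hK
  refine ⟨p, hp, fun H m g hm hg => ?_⟩
  change _ = (K H g).map _root_.wipe
  rw [← hK H m g hm hg, PMF.map_comp]
  rfl

theorem FreshImpl.mono {K : Step P} {c d : ℕ} (h : FreshImpl K c) (hcd : c ≤ d) :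
    FreshImpl K d := by
  obtain ⟨p, hp, h⟩ := h
  exact ⟨p, hp.trans hcd, h⟩

theorem FreshImpl.of_impl {K : Step P} {c : ℕ} (h : Impl K c) : FreshImpl K c := by
  obtain ⟨p, hp, h⟩ := h
  refine ⟨p.map (Instr.map (Sum.map Sum.inl id)), by simpa using hp, fun H m g hm _ => ?_⟩
  have hf : Function.Injective (Sum.map Sum.inl id : Loc ⊕ ℕ → SessReg ⊕ ℕ) :=
    Sum.inl_injective.sumMap Function.injective_id
  have hg : pull Sum.inl (pull (Sum.map Sum.inl id : Loc ⊕ ℕ → SessReg ⊕ ℕ) m) = g := by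
    have : pull Sum.inl (pull Sum.inl m) = g := by rw [hm]; rfl
    exact this
  rw [← hg, ← h, ← Prog.run_map_pull hf, PMF.map_comp]
  rfl

/-- A session can be played by the reduction. -/
theorem SessImpl.session {K : Step P} {c : ℕ} (hK : FreshImpl K c) {ι : Type*} (l : List ι)
    (h : ι → Step P) (d : ι → ℕ) (hh : ∀ i, Impl (h i) (d i)) (e : Env P) :
    SessImpl (playWipe (K :: l.map h) e) (e.flatten.length + (c + (l.map d).sum)) := by
  refine (((hK.envRun_seq (e.headD [])).seq (Impl.play l h d hh e.tail)).mono ?_).wipe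
  cases e
  · simp
  · simp; omega

theorem SessImpl.world {ι : Type*} (l : List ι)
    (h : ι → Step P) (d : ι → ℕ) (hh : ∀ i, Impl (h i) (d i)) (e : Env P) :
    SessImpl (playWipe (l.map h) e) (e.flatten.length + (l.map d).sum) :=
  SessImpl.of_impl (Impl.play l h d hh e)

/-! ### Naturality of activations -/

/-- The step `h` commutes with the view `φ`. -/
def Commutes (φ : Memory P Loc → Memory P Loc) (h : Step P) : Prop :=
  ∀ H m, (h H m).map φ = h H (φ m)

/-- The step `h` does not change the registers in `s`. -/
def Preserves (s : Set Loc) (h : Step P) : Prop := ∀ H m, ∀ m' ∈ (h H m).support, EqOn s m m'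

/-- The translation `μ` of programs compensates for the view `φ`: it is the identity for views that
forget registers, and `liftEnv` for the relocation made by the reduction. -/
theorem Commutes.play {φ : Memory P Loc → Memory P Loc} {μ : Prog P EReg → Prog P EReg}
    (hμ0 : μ [] = []) (hμ : ∀ H q m, (envRun H (μ q) m).map φ = envRun H q (φ m)) {W : World P}
    (hW : ∀ h ∈ W, Commutes φ h) (H : P.Oracle) (e : Env P) (m : Memory P Loc) :
    (World.play H W (e.map μ) m).map φ = World.play H W e (φ m) := by
  induction W generalizing e m with
  | nil => exact PMF.pure_map _ _
  | cons h W ih =>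
    have hh : (e.map μ).headD [] = μ (e.headD []) := by cases e <;> simp [hμ0]
    rw [World.play, World.play, ← hμ, PMF.bind_map, PMF.bind_bind, PMF.bind_bind, PMF.map_bind, hh]
    refine congrArg _ (funext fun m₁ => ?_)
    rw [PMF.map_bind, Function.comp_apply, ← hW h (by simp) H m₁, PMF.bind_map, ← List.map_tail]
    exact congrArg _ (funext fun m₂ => ih (fun h hh => hW h (by simp [hh])) _ _)

theorem Preserves.play {s : Set Loc} {W : World P} (hW : ∀ h ∈ W, Preserves s h) {e : Env P}
    (he : ∀ q ∈ e, Preserves s fun H => envRun H q) :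
    Preserves s fun H m => World.play H W e m := by
  induction W generalizing e with
  | nil =>
    intro H m m' hm'
    simp only [World.play, PMF.support_pure, Set.mem_singleton_iff] at hm'
    exact hm' ▸ EqOn.refl _ _
  | cons h W ih =>
    intro H m m' hm'
    simp only [World.play, PMF.mem_support_bind_iff] at hm'
    obtain ⟨m₂, ⟨m₁, h1, h2⟩, h3⟩ := hm'
    have e1 : EqOn s m m₁ := by
      cases e with
      | nil =>
        simp only [List.headD_nil, envRun_nil, PMF.support_pure, Set.mem_singleton_iff] at h1
        exact h1 ▸ EqOn.refl _ _
      | cons q e => exact he q (by simp) H m m₁ h1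
    exact (e1.trans (hW h (by simp) H m₁ m₂ h2)).trans
      (ih (fun h hh => hW h (by simp [hh])) (fun q hq => he q (List.mem_of_mem_tail hq)) H m₂ m' h3)

theorem Commutes.party (ρ : OLEProtocol P) {f : Loc → Option Loc} (hf : PInj f) {c : Bool}
    (h : ∀ a : PReg, f (a.loc c) = some (a.loc c)) (t : ℕ) :
    Commutes (view (blank P Loc) f) (ρ.party c t) := fun H m => Prog.run_view hf h H _ m

theorem Preserves.party (ρ : OLEProtocol P) {s : Set Loc} {c : Bool}
    (h : ∀ a : PReg, a.loc c ∉ s) (t : ℕ) : Preserves s (ρ.party c t) := fun H _ _ hm' =>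
  (Prog.run_frame H _ hm').mono fun _ ha ⟨b, hb⟩ => h b (hb ▸ ha)

theorem Commutes.act {S : Simulator P} {f : Loc → Option Loc} (hf : PInj f)
    (h : ∀ a : SReg, f a.loc = some a.loc) {F : Memory P Loc → Memory P Loc}
    (hF : ∀ m, view (blank P Loc) f (F m) = F (view (blank P Loc) f m)) (t : ℕ) :
    Commutes (view (blank P Loc) f) (S.act F t) := fun H m => by
  unfold Simulator.act
  rw [← Prog.run_view hf h, PMF.map_bind, PMF.bind_map, PMF.map_comp, PMF.bind_map]
  refine congrArg _ (funext fun m' => ?_)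
  simp only [Function.comp_apply]
  rw [Prog.run_view hf h, hF]

theorem Preserves.act {S : Simulator P} {s : Set Loc} (h : ∀ a : SReg, a.loc ∉ s)
    {F : Memory P Loc → Memory P Loc} (hF : ∀ m, EqOn s m (F m)) (t : ℕ) :
    Preserves s (S.act F t) := fun H m m' hm' => by
  unfold Simulator.act at hm'
  rw [PMF.bind_map, PMF.mem_support_bind_iff] at hm'
  obtain ⟨m₁, h1, h2⟩ := hm'
  have hs : s ⊆ (Set.range SReg.loc)ᶜ := fun a ha ⟨b, hb⟩ => h b (hb ▸ ha)
  exact (((Prog.run_frame H _ h1).mono hs).trans (hF m₁)).trans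
    ((Prog.run_frame H _ h2).mono hs)

/-! ### The start of a session -/

/-- The inputs of a session, which are in the registers `a 0, a 1, …`. -/
def inputs (k : ℕ) (a : ℕ → Loc) (m : Memory P Loc) : ℕ → P.F := fun i =>
  if i < k then m.fld (a i) else 0

/-- The memory at the start of a session, for a set-up that has dealt `d`. -/
def OLEProtocol.dealt (ρ : OLEProtocol P) (c : Bool) (z : ℕ → P.F) (m : Memory P Loc)
    (d : Memory P DReg) : Memory P Loc :=
  { bit := fun
      | .prv c' i => if c' = c ∧ i < ρ.setupLen then d.bit (.part c i) else false
      | .inp _ _ => false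
      | .chan i => if i < ρ.setupLen then d.bit (.part (!c) i) else m.bit (.chan i)
      | a => m.bit a
    fld := fun
      | .prv c' i => if c' = c ∧ i < ρ.setupLen then d.fld (.part c i) else 0
      | .inp c' i => if c' = c then z i else 0
      | .chan i => if i < ρ.setupLen then d.fld (.part (!c) i) else m.fld (.chan i)
      | a => m.fld a }

theorem OLEProtocol.start_eq (ρ : OLEProtocol P) (c : Bool) (z : ℕ → P.F) (H : P.Oracle)
    (m : Memory P Loc) : ρ.start c z H m =
      (Prog.run H ρ.dealer (blank P DReg)).map (ρ.dealt c z m) := by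
  unfold OLEProtocol.start
  refine congrArg (PMF.map · _) (funext fun d => ?_)
  ext a <;> cases a <;> rfl

namespace Memory

theorem setBits_bit_ite (m : Memory P A) {a : ℕ → A} (ha : Function.Injective a) (k : ℕ)
    (v : ℕ → Bool) (j : ℕ) : (m.setBits a fun i : Fin k => v i).bit (a j) =
      if j < k then v j else m.bit (a j) := by
  split_ifs with h
  · exact setBits_bit_apply m a ha (fun i : Fin k => v i) ⟨j, h⟩
  · exact setBits_bit_of_ne _ _ _ fun i hi e => by have := ha e; omega

theorem setFlds_fld_ite (m : Memory P A) {a : ℕ → A} (ha : Function.Injective a) (k : ℕ)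
    (v : ℕ → P.F) (j : ℕ) : (m.setFlds a fun i : Fin k => v i).fld (a j) =
      if j < k then v j else m.fld (a j) := by
  split_ifs with h
  · exact setFlds_fld_apply m a ha (fun i : Fin k => v i) ⟨j, h⟩
  · exact setFlds_fld_of_ne _ _ _ fun i hi e => by have := ha e; omega

end Memory

theorem Loc.prv_injective (c : Bool) : Function.Injective (Loc.prv c) := fun i j h => by
  simpa using h

theorem Loc.inp_injective (c : Bool) : Function.Injective (Loc.inp c) := fun i j h => by
  simpa using h

theorem Loc.chan_injective : Function.Injective Loc.chan := fun i j h => by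
  simpa using h

/-- On a wiped memory the registers that the start of a session has to clear are zero already, so
the start reduces to a sequence of writes, which a program can perform. -/
theorem OLEProtocol.dealt_eq (ρ : OLEProtocol P) (c : Bool) (k : ℕ) (a : ℕ → Loc)
    {m : Memory P Loc} (hm : wipe m = m) (d : Memory P DReg) :
    ρ.dealt c (inputs k a m) m d =
      ((((m.setFlds (.inp c) fun i : Fin k => m.fld (a i)).setBits (.prv c)
        fun i : Fin ρ.setupLen => d.bit (.part c i)).setFlds (.prv c)
        fun i : Fin ρ.setupLen => d.fld (.part c i)).setBits .chan
        fun i : Fin ρ.setupLen => d.bit (.part (!c) i)).setFlds .chan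
        fun i : Fin ρ.setupLen => d.fld (.part (!c) i) := by
  have hb : ∀ b : Loc, b.isGlob = false → m.bit b = false := fun b hb => by
    rw [← hm, wipe_bit, hb]; rfl
  have hf : ∀ b : Loc, b.isGlob = false → m.fld b = 0 := fun b hb => by
    rw [← hm, wipe_fld, hb]; rfl
  ext b
  · rw [setFlds_bit]
    by_cases h : ∃ j, b = .chan j
    · obtain ⟨j, rfl⟩ := h
      rw [setBits_bit_ite _ Loc.chan_injective _ fun i => d.bit (.part (!c) i), setFlds_bit,
        setBits_bit_of_ne _ _ _ (by simp), setFlds_bit]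
      rfl
    · rw [setBits_bit_of_ne _ _ _ (fun i _ e => h ⟨i, e⟩), setFlds_bit]
      by_cases h' : ∃ j, b = .prv c j
      · obtain ⟨j, rfl⟩ := h'
        rw [setBits_bit_ite _ (Loc.prv_injective c) _ fun i => d.bit (.part c i), setFlds_bit]
        simp [dealt, hb (.prv c j) rfl]
      · rw [setBits_bit_of_ne _ _ _ (fun i _ e => h' ⟨i, e⟩), setFlds_bit]
        cases b <;> simp only [dealt]
        · simp at h
        · exact (hb _ rfl).symm
        · rw [if_neg (by rintro ⟨rfl, _⟩; simp at h')]
          exact (hb _ rfl).symm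
  · by_cases h : ∃ j, b = .chan j
    · obtain ⟨j, rfl⟩ := h
      rw [setFlds_fld_ite _ Loc.chan_injective _ fun i => d.fld (.part (!c) i), setBits_fld,
        setFlds_fld_of_ne _ _ _ (by simp), setBits_fld, setFlds_fld_of_ne _ _ _ (by simp)]
      rfl
    · rw [setFlds_fld_of_ne _ _ _ (fun i _ e => h ⟨i, e⟩), setBits_fld]
      by_cases h' : ∃ j, b = .prv c j
      · obtain ⟨j, rfl⟩ := h'
        rw [setFlds_fld_ite _ (Loc.prv_injective c) _ fun i => d.fld (.part c i), setBits_fld,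
          setFlds_fld_of_ne _ _ _ (by simp)]
        simp [dealt, hf (.prv c j) rfl]
      · rw [setFlds_fld_of_ne _ _ _ (fun i _ e => h' ⟨i, e⟩), setBits_fld]
        by_cases h₀ : ∃ j, b = .inp c j
        · obtain ⟨j, rfl⟩ := h₀
          rw [setFlds_fld_ite _ (Loc.inp_injective c) _ fun i => m.fld (a i),
            hf (.inp c j) rfl]
          simp [dealt, inputs]
        · rw [setFlds_fld_of_ne _ _ _ (fun i _ e => h₀ ⟨i, e⟩)]
          cases b <;> simp only [dealt]
          · simp at h
          · rw [if_neg (by rintro rfl; simp at h₀)]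
            exact (hf _ rfl).symm
          · rw [if_neg (by rintro ⟨rfl, _⟩; simp at h')]
            exact (hf _ rfl).symm

theorem FreshImpl.start (ρ : OLEProtocol P) (c : Bool) (k : ℕ) (a : ℕ → Loc) :
    FreshImpl (fun H m => ρ.start c (inputs k a m) H m)
      (ρ.dealer.length + 14 * ρ.setupLen + 2 * k) := by
  have h0 := Impl.prog (ρ.dealer.map (Instr.map fun d => (.inr (.inl d) : SessReg)))
  have h1 : Impl (P := P) (A := SessReg) (fun _ m => PMF.pure (m.setBits (fun i => .inl (.prv c i))
      fun i : Fin ρ.setupLen => m.bit (.inr (.inl (.part c i))))) (ρ.setupLen * 5) :=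
    Impl.setBits _ fun i => BComp.reg _
  have h2 : Impl (P := P) (A := SessReg) (fun _ m => PMF.pure (m.setFlds (fun i => .inl (.prv c i))
      fun i : Fin ρ.setupLen => m.fld (.inr (.inl (.part c i))))) (ρ.setupLen * 2) :=
    Impl.setFlds _ fun i => FComp.reg _
  have h3 : Impl (P := P) (A := SessReg) (fun _ m => PMF.pure (m.setBits (fun i => .inl (.chan i))
      fun i : Fin ρ.setupLen => m.bit (.inr (.inl (.part (!c) i))))) (ρ.setupLen * 5) :=
    Impl.setBits _ fun i => BComp.reg _
  have h4 : Impl (P := P) (A := SessReg) (fun _ m => PMF.pure (m.setFlds (fun i => .inl (.chan i))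
      fun i : Fin ρ.setupLen => m.fld (.inr (.inl (.part (!c) i))))) (ρ.setupLen * 2) :=
    Impl.setFlds _ fun i => FComp.reg _
  have h5 : Impl (P := P) (A := SessReg) (fun _ m => PMF.pure (m.setFlds (fun i => .inl (.inp c i))
      fun i : Fin k => m.fld (.inl (a i)))) (k * 2) :=
    Impl.setFlds _ fun i => FComp.reg _
  -- The inputs are copied before the set-up is distributed, as the source addresses may be among
  -- those that are overwritten, for instance on the channel.
  obtain ⟨p, hp, h⟩ := ((((h0.seq h5).seq h1).seq h2).seq h3).seq h4
  refine ⟨p, hp.trans (by rw [List.length_map]; omega), fun H m g hm hg => ?_⟩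
  rw [show (pull fun a : Loc => (.inl (.inl a) : SessReg ⊕ ℕ)) =
    pull (P := P) (fun a => .inl a) ∘ pull Sum.inl from rfl, ← PMF.map_comp, h, hm]
  dsimp only
  rw [OLEProtocol.start_eq]
  have hd : (Prog.run H (ρ.dealer.map (Instr.map fun d => (.inr (.inl d) : SessReg)))
      (freshSess g)).map (pull fun d => .inr (.inl d)) = Prog.run H ρ.dealer (blank P DReg) :=
    Prog.run_map_pull (f := fun d => (.inr (.inl d) : SessReg)) (fun _ _ h => by simpa using h) H
      ρ.dealer (freshSess g)
  rw [← hd, PMF.map_comp]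
  simp only [PMF.bind_bind, PMF.pure_bind, PMF.map_bind, PMF.pure_map]
  refine PMF.map_congr_support fun y hy => ?_
  have hy' : pull (fun a => .inl a) y = g := by
    have hfr := Prog.run_frame H _ hy
    ext b
    · exact ((hfr (.inl b) (by simp)).1).symm
    · exact ((hfr (.inl b) (by simp)).2).symm
  rw [Function.comp_apply, OLEProtocol.dealt_eq ρ c k a hg]
  have hi : PInj fun a : Loc => some (.inl a : SessReg) := pInj_some Sum.inl_injective
  have hfl : ∀ b, y.fld (.inl b) = g.fld b := fun b => congrFun (congrArg Memory.fld hy') b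
  simp only [pull_eq_view (blank P Loc)] at hy' ⊢
  rw [view_setFlds hi (a := fun i => .chan i) fun _ => rfl,
    view_setBits hi (a := fun i => .chan i) fun _ => rfl,
    view_setFlds hi (a := fun i => .prv c i) fun _ => rfl,
    view_setBits hi (a := fun i => .prv c i) fun _ => rfl,
    view_setFlds hi (a := fun i => .inp c i) fun _ => rfl, hy']
  have e1 : ∀ (y : Memory P SessReg) (b : ℕ → Loc) {l : ℕ} (v : Fin l → Bool) (d : DReg),
      (y.setBits (fun i => .inl (b i)) v).bit (.inr (.inl d)) = y.bit (.inr (.inl d)) :=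
    fun y b l v d => setBits_bit_of_ne _ _ _ (by simp)
  have e2 : ∀ (y : Memory P SessReg) (b : ℕ → Loc) {l : ℕ} (v : Fin l → P.F) (d : DReg),
      (y.setFlds (fun i => .inl (b i)) v).fld (.inr (.inl d)) = y.fld (.inr (.inl d)) :=
    fun y b l v d => setFlds_fld_of_ne _ _ _ (by simp)
  simp only [setBits_fld, setFlds_bit, e1 _ (Loc.prv c),
    e2 _ (Loc.prv c), e2 _ (Loc.inp c), hfl]
  rfl

end

end

noncomputable section

section

variable {n : ℕ} {P : Params n} {A B : Type}

open Memory

/-! ### Naturality of the activations of a session -/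

/-- The registers that the start of an OLE session leaves alone. -/
def Loc.isOuter : Loc → Bool
  | .chan _ => false
  | .inp _ _ => false
  | .prv _ _ => false
  | _ => true

theorem OLEProtocol.dealt_bit_outer (ρ : OLEProtocol P) (c : Bool) (z : ℕ → P.F) (m : Memory P Loc)
    (d : Memory P DReg) {a : Loc} (ha : a.isOuter = true) : (ρ.dealt c z m d).bit a = m.bit a := by
  cases a <;> simp_all [Loc.isOuter, dealt]

theorem OLEProtocol.dealt_fld_outer (ρ : OLEProtocol P) (c : Bool) (z : ℕ → P.F) (m : Memory P Loc)
    (d : Memory P DReg) {a : Loc} (ha : a.isOuter = true) : (ρ.dealt c z m d).fld a = m.fld a := by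
  cases a <;> simp_all [Loc.isOuter, dealt]

/-- The start writes only to the channel and to the parties' registers. A view that fixes these and
keeps all other addresses apart from them cannot notice whether it is taken before or after. -/
theorem OLEProtocol.view_dealt (ρ : OLEProtocol P) (c : Bool) (z : ℕ → P.F) {f : Loc → Option Loc}
    (h : ∀ a : Loc, a.isOuter = false → f a = some a)
    (h' : ∀ a b : Loc, a.isOuter = true → f a = some b → b.isOuter = true) (m : Memory P Loc)
    (d : Memory P DReg) :
    view (blank P Loc) f (ρ.dealt c z m d) = ρ.dealt c z (view (blank P Loc) f m) d := by
  ext a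
  · cases ha : a.isOuter with
    | false =>
      cases a with
      | chan i => simp [dealt, view_bit, h (.chan i) rfl]
      | inp c' i => simp [dealt, view_bit, h (.inp c' i) rfl]
      | prv c' i => simp [dealt, view_bit, h (.prv c' i) rfl]
      | _ => simp [Loc.isOuter] at ha
    | true =>
      rw [ρ.dealt_bit_outer c z _ d ha, view_bit, view_bit]
      cases hb : f a with
      | none => rfl
      | some b => exact ρ.dealt_bit_outer c z m d (h' a b ha hb)
  · cases ha : a.isOuter with
    | false =>
      cases a with
      | chan i => simp [dealt, view_fld, h (.chan i) rfl]
      | inp c' i => simp [dealt, view_fld, h (.inp c' i) rfl]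
      | prv c' i => simp [dealt, view_fld, h (.prv c' i) rfl]
      | _ => simp [Loc.isOuter] at ha
    | true =>
      rw [ρ.dealt_fld_outer c z _ d ha, view_fld, view_fld]
      cases hb : f a with
      | none => rfl
      | some b => exact ρ.dealt_fld_outer c z m d (h' a b ha hb)

theorem Commutes.start (ρ : OLEProtocol P) (c : Bool) (z : ℕ → P.F) {f : Loc → Option Loc}
    (h : ∀ a : Loc, a.isOuter = false → f a = some a)
    (h' : ∀ a b : Loc, a.isOuter = true → f a = some b → b.isOuter = true) :
    Commutes (view (blank P Loc) f) (ρ.start c z) := fun H m => by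
  rw [OLEProtocol.start_eq, OLEProtocol.start_eq, PMF.map_comp]
  exact congrArg (PMF.map · _) (funext fun d => ρ.view_dealt c z h h' m d)

theorem Preserves.start (ρ : OLEProtocol P) (c : Bool) (z : ℕ → P.F) {s : Set Loc}
    (h : ∀ a ∈ s, a.isOuter = true) : Preserves s (ρ.start c z) := fun H m m' hm' => by
  rw [OLEProtocol.start_eq, PMF.support_map] at hm'
  obtain ⟨d, _, rfl⟩ := hm'
  exact fun a ha => ⟨(ρ.dealt_bit_outer c z m d (h a ha)).symm,
    (ρ.dealt_fld_outer c z m d (h a ha)).symm⟩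

theorem view_oleAnswer {w : Memory P Loc} {f : Loc → Option Loc} (hf : PInj f)
    (hp : ∀ i, f (.port i) = some (.port i)) (hn : ∀ i, f (.fn i) = some (.fn i))
    (m : Memory P Loc) :
    view w f (OLEProtocol.oleAnswer m) = OLEProtocol.oleAnswer (view w f m) := by
  rw [OLEProtocol.oleAnswer_eq, OLEProtocol.oleAnswer_eq, view_setFld hf (hp 1),
    view_setBit hf (hn 0)]
  simp [view_bit, view_fld, hp, hn]

theorem eqOn_oleAnswer {s : Set Loc} (h : ∀ a ∈ s, a.isGlob = true) (m : Memory P Loc) :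
    EqOn s m (OLEProtocol.oleAnswer m) := by
  rw [OLEProtocol.oleAnswer_eq]
  refine (EqOn.setBit m (fun ha => ?_) _).trans (EqOn.setFld _ (fun ha => ?_) _)
  · simpa [Loc.isGlob] using h _ ha
  · simpa [Loc.isGlob] using h _ ha

/-- The first activation of a session of the simulator `S`, with the server's input `z`. -/
def Simulator.begin (S : Simulator P) (F : Memory P Loc → Memory P Loc) (z : ℕ → P.F) : Step P :=
  fun H m => S.act F 0 H ((m.setFld (.fn 0) (z 0)).setFld (.fn 1) (z 1))

theorem Commutes.begin {S : Simulator P} {f : Loc → Option Loc} (hf : PInj f)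
    (h : ∀ a : SReg, f a.loc = some a.loc) (hn : ∀ i, f (.fn i) = some (.fn i))
    {F : Memory P Loc → Memory P Loc}
    (hF : ∀ m, view (blank P Loc) f (F m) = F (view (blank P Loc) f m)) (z : ℕ → P.F) :
    Commutes (view (blank P Loc) f) (S.begin F z) := fun H m => by
  unfold Simulator.begin
  rw [Commutes.act hf h hF, view_setFld hf (hn 1), view_setFld hf (hn 0)]

theorem Preserves.begin {S : Simulator P} {s : Set Loc} (h : ∀ a : SReg, a.loc ∉ s)
    (hn : ∀ i, Loc.fn i ∉ s) {F : Memory P Loc → Memory P Loc} (hF : ∀ m, EqOn s m (F m))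
    (z : ℕ → P.F) : Preserves s (S.begin F z) := fun H m m' hm' =>
  ((EqOn.setFld m (hn 0) _).trans (EqOn.setFld _ (hn 1) _)).trans
    (Preserves.act h hF 0 H _ m' hm')

theorem Impl.begin (S : Simulator P) {F : Memory P Loc → Memory P Loc} {c : ℕ}
    (hF : Impl (fun _ m => PMF.pure (F m)) c) (k : ℕ) (a : ℕ → Loc) :
    Impl (fun H m => S.begin F (inputs k a m) H m) (4 + ((S 0).1.length + c + (S 0).2.length)) := by
  have hi : ∀ i, FComp (fun _ (m : Memory P Loc) => inputs k a m i) 1 := fun i => by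
    unfold inputs
    by_cases h : i < k
    · simp only [h, if_true]; exact FComp.reg _
    · simp only [h, if_false]; exact FComp.const _
  have h1 : Impl (P := P) (fun _ m => PMF.pure (m.setFlds Loc.fn fun i : Fin 2 =>
      inputs k a m i)) (2 * (1 + 1)) := Impl.setFlds _ fun i => hi i
  refine (h1.pure_seq (Impl.act S hF 0)).congr fun H m => ?_
  rw [setFlds_succ, setFlds_succ, setFlds_zero]
  rfl

/-! ### Playing a session in an OLE experiment -/

/-- Where the reduction keeps the registers of the session that it does not play itself. -/
def outerReg (a : Loc) : Loc := if a.isGlob then (globReg a).loc else a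

/-- Global addresses are moved to registers of the environment, which are again global, and the
other addresses stay where they are; so the two kinds cannot collide. -/
theorem outerReg_injective : Function.Injective outerReg := by
  intro a b h
  unfold outerReg at h
  split_ifs at h with ha hb hb
  · exact globReg_injective (EReg.loc_injective h)
  · exact absurd (h ▸ EReg.isGlob_loc (globReg a)) hb
  · exact absurd (h.symm ▸ EReg.isGlob_loc (globReg b)) ha
  · exact h

theorem globView_eq_wipe (m : Memory P Loc) : globView m = wipe (pull outerReg m) := by
  ext a
  · rw [globView_bit, wipe_bit, pull_bit, outerReg]; split_ifs <;> rfl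
  · rw [globView_fld, wipe_fld, pull_fld, outerReg]; split_ifs <;> rfl

theorem Unused.pull_outerReg {k : ℕ} {m : Memory P Loc} (h : Unused True k m) :
    pull outerReg m = globView m := by
  ext a
  · rw [globView_bit, pull_bit, outerReg]
    split_ifs with ha
    · rfl
    · exact (h.2 trivial a (by simpa using ha)).1
  · rw [globView_fld, pull_fld, outerReg]
    split_ifs with ha
    · rfl
    · exact (h.2 trivial a (by simpa using ha)).2

/-- The registers of the sessions that the reduction plays. -/
def sessLocs : Set Loc := Set.range fun x : ℕ × SessReg => Loc.adv (sessIdx x.1 x.2)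

theorem Unused.of_eqOn {b : Prop} {k : ℕ} {m m' : Memory P Loc} (h : Unused b k m)
    (h' : EqOn sessLocs m m') : Unused False (k + 1) m' :=
  ⟨fun k' hk' y => by
    rw [← (h' _ ⟨(k', y), rfl⟩).1, ← (h' _ ⟨(k', y), rfl⟩).2]
    exact h.1 k' (by omega) y, fun hb => hb.elim⟩

/-- The first `k` programs of an environment. -/
def fitEnv : ℕ → Env P → Env P
  | 0, _ => []
  | k + 1, e => e.headD [] :: fitEnv k e.tail

theorem length_fitEnv (k : ℕ) (e : Env P) : (fitEnv k e).length = k := by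
  induction k generalizing e with
  | zero => rfl
  | succ k ih => simp [fitEnv, ih]

theorem length_flatten_fitEnv (k : ℕ) (e : Env P) :
    (fitEnv k e).flatten.length ≤ e.flatten.length := by
  induction k generalizing e with
  | zero => simp [fitEnv]
  | succ k ih =>
    have := ih e.tail
    cases e with
    | nil => simpa [fitEnv] using ih []
    | cons q e => simp [fitEnv] at this ⊢; omega

theorem World.play_fitEnv (H : P.Oracle) (W : World P) (e : Env P) (m : Memory P Loc) :
    World.play H W (fitEnv W.length e) m = World.play H W e m := by
  induction W generalizing e m with
  | nil => rfl
  | cons h W ih =>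
    simp only [World.play, List.length_cons, fitEnv, List.headD_cons, List.tail_cons]
    exact congrArg _ (funext fun m => ih _ _)

/-- Embed a program of the environment into the reduction. -/
def liftEnv (q : Prog P EReg) : Prog P EReg := q.map (Instr.map fun a => globReg a.loc)

theorem length_flatten_map_liftEnv (e : Env P) :
    (e.map liftEnv).flatten.length = e.flatten.length := by
  induction e with
  | nil => rfl
  | cons q e ih => simp_all [liftEnv]

theorem envRun_liftEnv (H : P.Oracle) (q : Prog P EReg) (m : Memory P Loc) :
    (envRun H (liftEnv q) m).map (pull outerReg) = envRun H q (pull outerReg m) := by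
  unfold envRun liftEnv
  rw [List.map_map, Instr.map_comp_map]
  exact Prog.run_pull outerReg_injective (fun a => by rw [outerReg, if_pos a.isGlob_loc]) H q m

theorem Preserves.liftEnv (q : Prog P EReg) :
    Preserves sessLocs fun H => envRun H (liftEnv q) := fun H m m' hm' => by
  unfold envRun _root_.liftEnv at hm'
  rw [List.map_map, Instr.map_comp_map] at hm'
  refine (Prog.run_frame H q hm').mono ?_
  rintro _ ⟨⟨k, y⟩, rfl⟩ ⟨a, ha⟩
  exact globReg_ne_adv a.loc (by omega) (EReg.loc_injective (a₂ := .adv (sessIdx k y)) ha)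

/-- Copy the inputs of a session to the registers where an OLE experiment expects them. -/
def copyInputs (P : Params n) (k : ℕ) (a : ℕ → Loc) : Prog P EReg :=
  (List.range k).map fun i => .fmux (.top i) (.top i) (globReg (a i)) (globReg (a i))

theorem run_copyInputs (H : P.Oracle) (k : ℕ) (a : ℕ → Loc) (m : Memory P Loc) :
    ∃ m', envRun H (copyInputs P k a) m = PMF.pure m' ∧
      (∀ i < k, m'.fld (.top i) = m.fld (globReg (a i)).loc) ∧
      EqOn (Set.range Loc.top)ᶜ m m' := by
  induction k with
  | zero => exact ⟨m, rfl, by simp, EqOn.refl _ _⟩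
  | succ k ih =>
    obtain ⟨m₁, h1, h2, h3⟩ := ih
    have hne : (globReg (a k)).loc ∈ (Set.range Loc.top)ᶜ := by
      rintro ⟨i, hi⟩
      rcases globReg_cases (a k) with ⟨j, hj⟩ | hj
      · rw [hj] at hi; simp [globReg, EReg.loc] at hi
      · rw [hj] at hi; simp [EReg.loc] at hi
    refine ⟨m₁.setFld (.top k) (m.fld (globReg (a k)).loc), ?_, fun i hi => ?_,
      h3.trans (EqOn.setFld _ (by simp) _)⟩
    · rw [copyInputs, List.range_succ, List.map_append, envRun_append,
        show envRun H (List.map _ (List.range k)) m = _ from h1, PMF.pure_bind, List.map_singleton,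
        envRun, List.map_singleton, Prog.run_singleton]
      rw [(h3 _ hne).2]
      simp only [Instr.map, Instr.step, ite_self]
      rfl
    · by_cases h : i = k
      · subst h; simp
      · rw [setFld_fld_of_ne _ _ (by simpa using h)]
        exact h2 i (by omega)

/-- Nothing of the emulated experiment is kept in the `top` registers, not even its own `top`
registers. The reduction is therefore free to use them for its dealings with the OLE experiment. -/
theorem pull_outerReg_congr {m m' : Memory P Loc} (h : EqOn (Set.range Loc.top)ᶜ m m') :
    pull outerReg m' = pull outerReg m := by
  have key : ∀ a, outerReg a ∈ (Set.range Loc.top)ᶜ := by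
    rintro a ⟨i, hi⟩
    unfold outerReg at hi
    split_ifs at hi with ha
    · rcases globReg_cases a with ⟨j, hj⟩ | hj
      · rw [hj] at hi; simp [globReg, EReg.loc] at hi
      · rw [hj] at hi; simp [EReg.loc] at hi
    · rw [← hi] at ha; simp [Loc.isGlob] at ha
  ext a
  · exact (h _ (key a)).1.symm
  · exact (h _ (key a)).2.symm

/-- A session whose inputs are in the registers `a 0, a 1, …`. -/
def sessionWorld (T : (ℕ → P.F) → Step P) (r : ℕ → Step P) (L k : ℕ) (a : ℕ → Loc) : World P :=
  (fun H m => T (inputs k a m) H m) :: (List.range L).map r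

/-- All activations commute with the relocation `outerReg`; the only mismatch is where the session
reads its inputs. The reduction repairs this by copying them from the emulated `a i` to `top i` just
before the session starts. -/
theorem tracks_session {T : (ℕ → P.F) → Step P} {r : ℕ → Step P} {a : ℕ → Loc}
    (ha : ∀ i, (a i).isGlob = true) (hT : ∀ z, Commutes (pull outerReg) (T z))
    (hr : ∀ t, Commutes (pull outerReg) (r t)) (hT' : ∀ z, Preserves sessLocs (T z))
    (hr' : ∀ t, Preserves sessLocs (r t)) (L k i : ℕ) (e : Env P) (H : P.Oracle) {m : Memory P Loc}
    (hm : Unused True i m) : Tracks globView (Unused False (i + 1))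
      ((World.play H (sessionWorld T r L k Loc.top) ((liftEnv (e.headD []) ++ copyInputs P k a) ::
        (fitEnv L e.tail).map liftEnv) m).bind (envRun H []))
      (playWipe (sessionWorld T r L k a) e H (globView m)) := by
  rw [show envRun H [] = PMF.pure from rfl, PMF.bind_pure]
  refine ⟨?_, fun m' hm' => hm.of_eqOn ?_⟩
  · rw [show (globView (P := P)) = wipe ∘ pull outerReg from funext globView_eq_wipe,
      ← PMF.map_comp, playWipe, Function.comp_apply, ← globView_eq_wipe, ← hm.pull_outerReg]
    refine congrArg _ ?_
    rw [sessionWorld, sessionWorld, World.play, World.play, List.headD_cons, List.tail_cons,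
      ← envRun_liftEnv, PMF.bind_map, envRun_append]
    simp only [PMF.bind_bind, PMF.map_bind]
    refine congrArg _ (funext fun m₁ => ?_)
    obtain ⟨m₂, h1, h2, h3⟩ := run_copyInputs (P := P) H k a m₁
    have hz : inputs k a (pull outerReg m₁) = inputs k Loc.top m₂ := by
      funext i
      unfold inputs
      split_ifs with hi
      · rw [h2 i hi, pull_fld, outerReg, if_pos (ha i)]
      · rfl
    -- The copied inputs determine the same `T z` on both sides, and copying is invisible under
    -- `outerReg`.
    rw [h1, PMF.pure_bind, Function.comp_apply, hz, ← pull_outerReg_congr h3, ← hT, PMF.bind_map]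
    refine congrArg _ (funext fun m₃ => ?_)
    rw [Function.comp_apply, ← World.play_fitEnv H _ e.tail, List.length_map, List.length_range]
    refine Commutes.play rfl envRun_liftEnv (fun h hh => ?_) H _ m₃
    obtain ⟨t, _, rfl⟩ := List.mem_map.1 hh
    exact hr t
  · refine Preserves.play (s := sessLocs) (fun h hh => ?_) (fun q hq => ?_) H m m' hm'
    · rw [sessionWorld, List.mem_cons] at hh
      rcases hh with rfl | hh
      · exact fun H m => hT' _ H m
      · obtain ⟨t, _, rfl⟩ := List.mem_map.1 hh
        exact hr' t
    · rw [List.mem_cons] at hq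
      rcases hq with rfl | hq
      · intro H m m' hm'
        dsimp only at hm'
        rw [envRun_append, PMF.mem_support_bind_iff] at hm'
        obtain ⟨m₁, h1, h2⟩ := hm'
        obtain ⟨m₂, h3, _, h4⟩ := run_copyInputs (P := P) H k a m₁
        rw [h3, PMF.support_pure, Set.mem_singleton_iff] at h2
        subst h2
        refine (Preserves.liftEnv _ H m m₁ h1).trans (h4.mono ?_)
        rintro _ ⟨x, rfl⟩ ⟨j, hj⟩
        simp at hj
      · obtain ⟨q, _, rfl⟩ := List.mem_map.1 hq
        exact Preserves.liftEnv q

theorem Embeds.session {T S : (ℕ → P.F) → Step P} {r s : ℕ → Step P} {a : ℕ → Loc}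
    (ha : ∀ i, (a i).isGlob = true) (hT : ∀ z, Commutes (pull outerReg) (T z))
    (hr : ∀ t, Commutes (pull outerReg) (r t)) (hT' : ∀ z, Preserves sessLocs (T z))
    (hr' : ∀ t, Preserves sessLocs (r t)) (hS : ∀ z, Commutes (pull outerReg) (S z))
    (hs : ∀ t, Commutes (pull outerReg) (s t)) (hS' : ∀ z, Preserves sessLocs (S z))
    (hs' : ∀ t, Preserves sessLocs (s t)) (L k i : ℕ) (e : Env P) :
    Embeds (sessionWorld T r L k Loc.top) (sessionWorld S s L k Loc.top)
      (playWipe (sessionWorld T r L k a) e) (playWipe (sessionWorld S s L k a) e) i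
      (e.flatten.length + k) := by
  refine ⟨liftEnv (e.headD []) ++ copyInputs P k a, (fitEnv L e.tail).map liftEnv, [],
    by simp [sessionWorld, length_fitEnv], by simp [sessionWorld, length_fitEnv], ?_,
    fun H m hm => ⟨tracks_session ha hT hr hT' hr' L k i e H hm,
      tracks_session ha hS hs hS' hs' L k i e H hm⟩⟩
  rw [length_flatten_map_liftEnv, List.length_append, liftEnv, copyInputs, List.length_map,
    List.length_map, List.length_range, List.length_nil]
  have h := length_flatten_fitEnv L e.tail
  cases e with
  | nil => simp at h ⊢; omega
  | cons q e => simp at h ⊢; omega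

end

end

noncomputable section

section

variable {n : ℕ} {P : Params n} {A B : Type}

open Memory

/-! ### The sessions of the experiments -/

theorem OLEProtocol.dealt_congr (ρ : OLEProtocol P) (c : Bool) (z : ℕ → P.F) {m m' : Memory P Loc}
    (h : EqOn {a | (∀ c i, a ≠ .inp c i) ∧ ∀ c i, a ≠ .prv c i} m m') (d : Memory P DReg) :
    ρ.dealt c z m d = ρ.dealt c z m' d := by
  ext a <;> cases a with
  | inp c i => rfl
  | prv c i => rfl
  | chan i =>
    simp only [dealt]
    split_ifs
    · rfl
    · first | exact (h _ (by simp)).1 | exact (h _ (by simp)).2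
  | _ =>
    simp only [dealt]
    first | exact (h _ (by simp)).1 | exact (h _ (by simp)).2

/-- The global registers and those of the parties. -/
def Loc.isReal : Loc → Bool
  | .sim _ => false
  | .port _ => false
  | .fn _ => false
  | _ => true

/-- Forget the registers of the simulator and the functionality. -/
def realView (m : Memory P Loc) : Memory P Loc :=
  view (blank P Loc) (fun a => if a.isReal then some a else none) m

theorem pInj_real : PInj fun a : Loc => if a.isReal then some a else none := by
  intro a a' b h h'
  simp only [Option.ite_none_right_eq_some, Option.some.injEq] at h h'
  exact h.2.trans h'.2.symm

theorem EReg.isReal_loc (a : EReg) : a.loc.isReal = true := by cases a <;> rfl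

theorem PReg.isReal_loc (c : Bool) (a : PReg) : (a.loc c).isReal = true := by cases a <;> rfl

theorem Loc.isReal_of_isGlob {a : Loc} (h : a.isGlob = true) : a.isReal = true := by
  cases a <;> simp_all [Loc.isReal, Loc.isGlob]

theorem wipe_realView (m : Memory P Loc) : wipe (realView m) = wipe m := by
  ext a
  · rw [wipe_bit, wipe_bit, realView, view_bit]
    split_ifs with h h'
    · rfl
    · exact absurd (Loc.isReal_of_isGlob h) h'
    · rfl
  · rw [wipe_fld, wipe_fld, realView, view_fld]
    split_ifs with h h'
    · rfl
    · exact absurd (Loc.isReal_of_isGlob h) h'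
    · rfl

theorem inputs_wipe {a : ℕ → Loc} (ha : ∀ i, (a i).isGlob = true) (k : ℕ) (m : Memory P Loc) :
    inputs k a (wipe m) = inputs k a m := by
  funext i
  simp [inputs, wipe_fld, ha]

/-- The start resets all `inp` and `prv` registers and leaves `work` and the environment's private
registers alone. So the only non-global registers with a past are those of the simulator and the
functionality, which `realView` forgets. -/
theorem realView_start (ρ : OLEProtocol P) (c : Bool) (z : ℕ → P.F) (H : P.Oracle)
    (m : Memory P Loc) : (ρ.start c z H m).map realView = ρ.start c z H (wipe m) := by
  have h := Commutes.start ρ c z (f := fun a => if a.isReal then some a else none)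
    (fun a ha => by cases a <;> simp_all [Loc.isReal, Loc.isOuter])
    (fun a b ha hb => by
      simp only [Option.ite_none_right_eq_some, Option.some.injEq] at hb
      rw [← hb.2, ha]) H m
  refine h.trans ?_
  rw [OLEProtocol.start_eq, OLEProtocol.start_eq]
  refine congrArg (PMF.map · _) (funext fun d => ρ.dealt_congr c z (fun a ha => ?_) d)
  cases a <;>
    simp_all [view_bit, view_fld, wipe_bit, wipe_fld, Loc.isReal, Loc.isGlob]

/-- After the start has reset the parties' registers, old contents survive only in registers that
neither the honest party nor the environment can address. -/
theorem Wipeable.session (ρ : OLEProtocol P) (c : Bool) {a : ℕ → Loc}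
    (ha : ∀ i, (a i).isGlob = true) (L k : ℕ) :
    Wipeable (sessionWorld (ρ.start c) (ρ.party c) L k a) := by
  intro H e g
  have key : (World.play H (sessionWorld (ρ.start c) (ρ.party c) L k a) e g).map realView =
      World.play H (sessionWorld (ρ.start c) (ρ.party c) L k a) e (wipe g) := by
    rw [sessionWorld, World.play, World.play, ← envRun_wipe, PMF.bind_map, PMF.map_bind,
      PMF.bind_bind, PMF.bind_bind]
    refine congrArg _ (funext fun m₁ => ?_)
    rw [Function.comp_apply, inputs_wipe ha, ← realView_start, PMF.bind_map]
    refine congrArg _ (funext fun m₂ => ?_)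
    have h := Commutes.play (φ := realView) (μ := fun q => q)
      (W := (List.range L).map (ρ.party c)) rfl
      (fun H q m => Prog.run_view pInj_real (fun a => by simp [a.isReal_loc]) H q m)
      (fun h hh => by
        obtain ⟨t, _, rfl⟩ := List.mem_map.1 hh
        exact Commutes.party ρ pInj_real (fun a => by simp [PReg.isReal_loc]) t) H e.tail m₂
    rw [List.map_id'] at h
    exact h
  rw [playWipe, playWipe, ← key, PMF.map_comp]
  exact congrArg (PMF.map · _) (funext fun m => (wipe_realView m).symm)

theorem Wipeable.nil : Wipeable ([] : World P) := fun H e g => by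
  simp only [playWipe, World.play, PMF.pure_map, wipe_wipe]

/-! ### Naturality with respect to the addresses of the reduction -/

theorem outerReg_of_not_isOuter {a : Loc} (h : a.isOuter = false) : outerReg a = a := by
  cases a <;> simp_all [Loc.isOuter, outerReg, Loc.isGlob, globReg, EReg.loc]

theorem isOuter_outerReg {a : Loc} (h : a.isOuter = true) : (outerReg a).isOuter = true := by
  cases a <;> simp_all [Loc.isOuter, outerReg, Loc.isGlob, globReg, EReg.loc]

theorem outerReg_preg (c : Bool) (a : PReg) : outerReg (a.loc c) = a.loc c :=
  outerReg_of_not_isOuter (by cases a <;> rfl)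

theorem outerReg_sreg (a : SReg) : outerReg a.loc = a.loc := by
  cases a
  · rfl
  · exact outerReg_of_not_isOuter rfl
  · rfl

theorem isAdv_of_mem_sessLocs {a : Loc} (h : a ∈ sessLocs) : ∃ i, a = .adv i := by
  obtain ⟨x, rfl⟩ := h
  exact ⟨_, rfl⟩

theorem Commutes.start_outerReg (ρ : OLEProtocol P) (c : Bool) (z : ℕ → P.F) :
    Commutes (pull outerReg) (ρ.start c z) :=
  Commutes.start ρ c z (f := fun a => some (outerReg a))
    (fun a ha => by rw [outerReg_of_not_isOuter ha])
    (fun a b ha hb => by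
      simp only [Option.some.injEq] at hb
      exact hb ▸ isOuter_outerReg ha)

theorem Commutes.party_outerReg (ρ : OLEProtocol P) (c : Bool) (t : ℕ) :
    Commutes (pull outerReg) (ρ.party c t) :=
  Commutes.party ρ (pInj_some outerReg_injective) (fun a => by rw [outerReg_preg]) t

theorem Preserves.start_sessLocs (ρ : OLEProtocol P) (c : Bool) (z : ℕ → P.F) :
    Preserves sessLocs (ρ.start c z) :=
  Preserves.start ρ c z fun a ha => by obtain ⟨i, rfl⟩ := isAdv_of_mem_sessLocs ha; rfl

theorem Preserves.party_sessLocs (ρ : OLEProtocol P) (c : Bool) (t : ℕ) :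
    Preserves sessLocs (ρ.party c t) :=
  Preserves.party ρ (fun a ha => by
    obtain ⟨i, hi⟩ := isAdv_of_mem_sessLocs ha
    cases a <;> simp [PReg.loc] at hi) t

theorem Commutes.act_outerReg (S : Simulator P) {F : Memory P Loc → Memory P Loc}
    (hF : ∀ m, pull outerReg (F m) = F (pull outerReg m)) (t : ℕ) :
    Commutes (pull outerReg) (S.act F t) :=
  Commutes.act (pInj_some outerReg_injective) (fun a => by rw [outerReg_sreg]) hF t

theorem Commutes.begin_outerReg (S : Simulator P) {F : Memory P Loc → Memory P Loc}
    (hF : ∀ m, pull outerReg (F m) = F (pull outerReg m)) (z : ℕ → P.F) :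
    Commutes (pull outerReg) (S.begin F z) :=
  Commutes.begin (pInj_some outerReg_injective) (fun a => by rw [outerReg_sreg])
    (fun i => rfl) hF z

theorem not_mem_sessLocs_sreg (a : SReg) : a.loc ∉ sessLocs := fun ha => by
  obtain ⟨i, hi⟩ := isAdv_of_mem_sessLocs ha
  cases a <;> simp [SReg.loc] at hi

theorem pull_outerReg_oleAnswer (m : Memory P Loc) :
    pull outerReg (OLEProtocol.oleAnswer m) = OLEProtocol.oleAnswer (pull outerReg m) :=
  view_oleAnswer (w := blank P Loc) (pInj_some outerReg_injective) (fun _ => rfl) (fun _ => rfl) m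

theorem eqOn_sessLocs_oleAnswer (m : Memory P Loc) :
    EqOn sessLocs m (OLEProtocol.oleAnswer m) :=
  eqOn_oleAnswer (fun a ha => by obtain ⟨i, rfl⟩ := isAdv_of_mem_sessLocs ha; rfl) m

/-! ### The worlds as lists of sessions -/

theorem serverSession_eq (ρ : OLEProtocol P) (a : ℕ → Loc) :
    ρ.serverSession (fun m => (m.fld (a 0), m.fld (a 1))) =
      sessionWorld (ρ.start false) (ρ.party false) ρ.rounds 2 a := by
  refine congrArg (· :: _) (funext fun H => funext fun m =>
    congrArg (fun z => ρ.start false z H m) (funext fun i => ?_))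
  match i with
  | 0 => rfl
  | 1 => rfl
  | i + 2 => simp [inputs]

theorem clientSession_eq (ρ : OLEProtocol P) (a : ℕ → Loc) :
    ρ.clientSession (fun m => m.fld (a 0)) =
      sessionWorld (ρ.start true) (ρ.party true) (ρ.rounds + 1) 1 a := by
  refine congrArg (· :: _) (funext fun H => funext fun m =>
    congrArg (fun z => ρ.start true z H m) (funext fun i => ?_))
  match i with
  | 0 => rfl
  | i + 1 => simp [inputs]

theorem OLEProtocol.clientReal_eq (ρ : OLEProtocol P) : ρ.worlds.clientReal =
    sessionWorld (ρ.start false) (ρ.party false) ρ.rounds 2 .top := serverSession_eq ρ .top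

theorem OLEProtocol.serverReal_eq (ρ : OLEProtocol P) : ρ.worlds.serverReal =
    sessionWorld (ρ.start true) (ρ.party true) (ρ.rounds + 1) 1 .top := clientSession_eq ρ .top

/-- A session of the simulator for a corrupt client. -/
def idealClient (S : Simulator P) (L : ℕ) (a : ℕ → Loc) : World P :=
  sessionWorld (S.begin OLEProtocol.oleAnswer) (fun t => S.act OLEProtocol.oleAnswer (t + 1)) L 2 a

/-- A session of the simulator for a corrupt server. -/
def idealServer (S : Simulator P) (L : ℕ) (a : ℕ → Loc) : World P :=
  sessionWorld (fun _ => S.act id 0) (fun t => S.act id (t + 1)) L 1 a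

theorem OLEProtocol.clientIdeal_eq (ρ : OLEProtocol P) (S : Simulator P) :
    ρ.worlds.clientIdeal S = idealClient S ρ.rounds .top := rfl

theorem OLEProtocol.serverIdeal_eq (ρ : OLEProtocol P) (S : Simulator P) :
    ρ.worlds.serverIdeal S = idealServer S (ρ.rounds + 1) .top := by
  change (List.range (ρ.rounds + 2)).map (S.act id) = _
  rw [List.range_succ_eq_map, List.map_cons, List.map_map]
  rfl

theorem length_sessionWorld (T : (ℕ → P.F) → Step P) (r : ℕ → Step P) (L k : ℕ) (a : ℕ → Loc) :
    (sessionWorld T r L k a).length = L + 1 := by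
  simp [sessionWorld]

/-- The real experiment is hybrid `0`. It contains no replaced session, so `J` is arbitrary. -/
theorem clientReal_accept (ρ : OLEProtocol P) (J : ℕ → World P) (e : Env P) :
    (ImplicitCheck.worlds ρ).clientReal.accept e = acceptOf (chain (kernels (hybridWorlds
      [ImplicitCheck.serverStart] [] (fun k => sessionWorld (ρ.start false) (ρ.party false)
        ρ.rounds 2 fun i => .work (2 * k + i)) J P.θ 0) e)) := by
  unfold hybridWorlds
  simp only [Nat.not_lt_zero, if_false, List.cons_append]
  rw [← accept_flatten]
  · congr 1
    simp only [ImplicitCheck.worlds, List.flatten_append, List.singleton_append, List.flatten_cons,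
      List.append_nil, List.flatten_nil, List.flatMap_def]
    congr 2
    refine List.map_congr_left fun k _ => ?_
    exact serverSession_eq ρ fun i => .work (2 * k + i)
  · intro W hW
    rw [List.mem_append, List.mem_map, List.mem_singleton] at hW
    rcases hW with ⟨k, _, rfl⟩ | rfl
    · exact Wipeable.session ρ false (fun _ => rfl) _ _
    · exact Wipeable.nil

theorem serverReal_accept (ρ : OLEProtocol P) (J : ℕ → World P) (e : Env P) :
    (ImplicitCheck.worlds ρ).serverReal.accept e = acceptOf (chain (kernels (hybridWorlds
      [ImplicitCheck.clientStart, ImplicitCheck.clientToken] [] (fun k =>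
        sessionWorld (ρ.start true) (ρ.party true) (ρ.rounds + 1) 1 fun i => .work (k + i))
        J P.θ 0) e)) := by
  unfold hybridWorlds
  simp only [Nat.not_lt_zero, if_false, List.cons_append]
  rw [← accept_flatten]
  · congr 1
    simp only [ImplicitCheck.worlds, List.flatten_append, List.cons_append, List.flatten_cons,
      List.append_nil, List.flatten_nil, List.flatMap_def, List.nil_append]
    congr 3
    refine List.map_congr_left fun k _ => ?_
    exact clientSession_eq ρ fun i => .work (k + i)
  · intro W hW
    rw [List.mem_append, List.mem_map, List.mem_singleton] at hW
    rcases hW with ⟨k, _, rfl⟩ | rfl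
    · exact Wipeable.session ρ true (fun _ => rfl) _ _
    · exact Wipeable.nil

/-! ### Costs -/

theorem sum_map_range (L : ℕ) (f : ℕ → ℕ) : ((List.range L).map f).sum = ∑ t ∈ range L, f t := by
  induction L with
  | zero => rfl
  | succ L ih => rw [List.range_succ, List.map_append, List.sum_append, ih, Finset.sum_range_succ]; simp

theorem SessImpl.realSession (ρ : OLEProtocol P) (c : Bool) (L k : ℕ) (a : ℕ → Loc)
    (hL : L ≤ ρ.rounds + 1) (hc : c = false → L ≤ ρ.rounds) (e : Env P) :
    SessImpl (playWipe (sessionWorld (ρ.start c) (ρ.party c) L k a) e)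
      (e.flatten.length + (15 * ρ.time + 2 * k)) := by
  refine (SessImpl.session (FreshImpl.start ρ c k a) (List.range L) (ρ.party c) _
    (Impl.party ρ c) e).mono ?_
  have h : ((List.range L).map fun t => ((if c then ρ.client else ρ.server) t).length).sum ≤
      ∑ t ∈ range (ρ.rounds + 1), (ρ.client t).length +
        ∑ t ∈ range ρ.rounds, (ρ.server t).length := by
    rw [sum_map_range]
    cases c with
    | true =>
      refine le_add_right (Finset.sum_le_sum_of_subset ?_)
      exact Finset.range_subset_range.2 hL
    | false =>
      refine le_add_left (Finset.sum_le_sum_of_subset ?_)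
      exact Finset.range_subset_range.2 (hc rfl)
  -- The factor 15 is generous: handing out one dealt register to both sides takes 14 instructions,
  -- and the programs of the protocol are run once.
  unfold OLEProtocol.time
  omega

theorem sum_time (S : Simulator P) (L c : ℕ) :
    ((S 0).1.length + c + (S 0).2.length) +
      ((List.range L).map fun t => (S (t + 1)).1.length + c + (S (t + 1)).2.length).sum =
      S.time (L + 1) + c * (L + 1) := by
  rw [sum_map_range, Simulator.time, Finset.sum_range_succ']
  have h : ∀ t, (S (t + 1)).1.length + c + (S (t + 1)).2.length =
      ((S (t + 1)).1.length + (S (t + 1)).2.length) + c := fun t => by omega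
  simp only [h, Finset.sum_add_distrib, Finset.sum_const, Finset.card_range, smul_eq_mul]
  ring

theorem SessImpl.idealClient (S : Simulator P) (L : ℕ) (a : ℕ → Loc) (e : Env P) :
    SessImpl (playWipe (idealClient S L a) e)
      (e.flatten.length + (4 + S.time (L + 1) + 32 * (L + 1))) := by
  refine (SessImpl.session (FreshImpl.of_impl (Impl.begin S Impl.oleAnswer 2 a)) (List.range L)
    (fun t => S.act OLEProtocol.oleAnswer (t + 1)) _ (fun t => Impl.act S Impl.oleAnswer (t + 1))
    e).mono ?_
  have := sum_time S L 32
  omega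

theorem SessImpl.idealServer (S : Simulator P) (L : ℕ) (a : ℕ → Loc) (e : Env P) :
    SessImpl (playWipe (idealServer S L a) e) (e.flatten.length + S.time (L + 1)) := by
  have hid : Impl (fun _ (m : Memory P Loc) => PMF.pure (id m)) 0 := Impl.id
  refine (SessImpl.session (FreshImpl.of_impl (Impl.act S hid 0)) (List.range L)
    (fun t => S.act id (t + 1)) _ (fun t => Impl.act S hid (t + 1)) e).mono ?_
  have := sum_time S L 0
  omega

theorem Embeds.client (ρ : OLEProtocol P) (S : Simulator P) {a : ℕ → Loc}
    (ha : ∀ i, (a i).isGlob = true) (i : ℕ) (e : Env P) :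
    Embeds ρ.worlds.clientReal (ρ.worlds.clientIdeal S)
      (playWipe (sessionWorld (ρ.start false) (ρ.party false) ρ.rounds 2 a) e)
      (playWipe (idealClient S ρ.rounds a) e) i (e.flatten.length + 2) := by
  rw [ρ.clientReal_eq, ρ.clientIdeal_eq]
  exact Embeds.session ha (Commutes.start_outerReg ρ false) (Commutes.party_outerReg ρ false)
    (Preserves.start_sessLocs ρ false) (Preserves.party_sessLocs ρ false)
    (Commutes.begin_outerReg S pull_outerReg_oleAnswer)
    (fun t => Commutes.act_outerReg S pull_outerReg_oleAnswer (t + 1))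
    (Preserves.begin not_mem_sessLocs_sreg (fun i ⟨_, hi⟩ => by simp at hi)
      eqOn_sessLocs_oleAnswer)
    (fun t => Preserves.act not_mem_sessLocs_sreg eqOn_sessLocs_oleAnswer (t + 1)) _ _ _ _

theorem Embeds.server (ρ : OLEProtocol P) (S : Simulator P) {a : ℕ → Loc}
    (ha : ∀ i, (a i).isGlob = true) (i : ℕ) (e : Env P) :
    Embeds ρ.worlds.serverReal (ρ.worlds.serverIdeal S)
      (playWipe (sessionWorld (ρ.start true) (ρ.party true) (ρ.rounds + 1) 1 a) e)
      (playWipe (idealServer S (ρ.rounds + 1) a) e) i (e.flatten.length + 1) := by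
  rw [ρ.serverReal_eq, ρ.serverIdeal_eq]
  exact Embeds.session (S := fun _ => S.act id 0) (s := fun t => S.act id (t + 1)) ha
    (Commutes.start_outerReg ρ true) (Commutes.party_outerReg ρ true)
    (Preserves.start_sessLocs ρ true) (Preserves.party_sessLocs ρ true)
    (fun _ => Commutes.act_outerReg S (F := id) (fun _ => rfl) 0)
    (fun t => Commutes.act_outerReg S (F := id) (fun _ => rfl) (t + 1))
    (fun _ => Preserves.act (F := id) not_mem_sessLocs_sreg (fun _ => EqOn.refl _ _) 0)
    (fun t => Preserves.act (F := id) not_mem_sessLocs_sreg (fun _ => EqOn.refl _ _) (t + 1))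
    _ _ _ _

theorem Embeds.mono {V W : World P} {K L : Step P} {k c d : ℕ} (h : Embeds V W K L k c)
    (hcd : c ≤ d) : Embeds V W K L k d := by
  obtain ⟨q, f, p, h1, h2, h3, h4⟩ := h
  exact ⟨q, f, p, h1, h2, h3.trans hcd, h4⟩

theorem SessImpl.serverStart (e : Env P) :
    SessImpl (playWipe [ImplicitCheck.serverStart (P := P)] e)
      (e.flatten.length + (P.keyLen * 5 + P.θ + P.θ + P.θ * (n + 4 * P.θ + 21))) := by
  have h := SessImpl.world [()] (fun _ => ImplicitCheck.serverStart (P := P)) _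
    (fun _ => Impl.serverStart) e
  simpa using h

theorem SessImpl.clientStart (e : Env P) :
    SessImpl (playWipe [ImplicitCheck.clientStart (P := P), ImplicitCheck.clientToken] e)
      (e.flatten.length + (P.inputLen * 5 + P.θ * (P.θ * 1 + 3 + 1))) := by
  have h := SessImpl.world [true, false]
    (fun b => if b then ImplicitCheck.clientStart (P := P) else ImplicitCheck.clientToken)
    (fun b => if b then P.inputLen * 5 else P.θ * (P.θ * 1 + 3 + 1))
    (fun b => by cases b; exacts [Impl.clientToken, Impl.clientStart]) e
  simpa using h

theorem SessImpl.nil (e : Env P) (c : ℕ) :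
    SessImpl (playWipe ([] : World P) e) (e.flatten.length + c) :=
  (SessImpl.world ([] : List Unit) (fun _ _ => PMF.pure) (fun _ => 0) (fun _ => Impl.id) e).mono
    (by simp)

end

/-! ### Replacing the sessions by simulated ones -/

/-- This is where security of the OLE protocol against a corrupt client is spent. In the last hybrid
the honest server still has its shares and masks, but they are used only as inputs of `F_ole`. -/
theorem negligible_client {P : ∀ n, Params n} (hP : Feasible P) {ρ : ∀ n, OLEProtocol (P n)}
    (hρ : PolyBounded fun n => (ρ n).time) {S : ∀ n, Simulator (P n)}
    (hS : PolyBounded fun n => (S n).time (ρ n).worlds.clientReal.length)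
    (hind : Indist P (fun n => (ρ n).worlds.clientReal)
      (fun n => (ρ n).worlds.clientIdeal (S n)))
    (e : ∀ n, Env (P n)) (he : PolyBounded fun n => (e n).flatten.length) :
    Negligible fun n => |(ImplicitCheck.worlds (ρ n)).clientReal.accept (e n) -
      acceptOf (chain (kernels (hybridWorlds [ImplicitCheck.serverStart] [] (fun k =>
        sessionWorld ((ρ n).start false) ((ρ n).party false) (ρ n).rounds 2
          fun i => .work (2 * k + i)) (fun k => idealClient (S n) (ρ n).rounds
            fun i => .work (2 * k + i)) (P n).θ (P n).θ) (e n)))| := by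
  replace hS : PolyBounded fun n => (S n).time ((ρ n).rounds + 1) := hS.mono fun n => by
    rw [OLEProtocol.clientReal_eq, length_sessionWorld]
  obtain ⟨-, hθ, hk, -, -⟩ := hP
  have hround : PolyBounded fun n => (ρ n).rounds := hρ.mono fun n => by
    unfold OLEProtocol.time; omega
  let c : ℕ → ℕ := fun n =>
    ((P n).keyLen * 5 + (P n).θ + (P n).θ + (P n).θ * (n + 4 * (P n).θ + 21)) +
      (15 * (ρ n).time + 2 * 2) + (4 + (S n).time ((ρ n).rounds + 1) + 32 * ((ρ n).rounds + 1))
  have hc : PolyBounded c := by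
    refine (((((hk.mul (.const 5)).add hθ).add hθ).add (hθ.mul ((PolyBounded.id.add
      ((PolyBounded.const 4).mul hθ)).add (.const 21)))).add (((PolyBounded.const 15).mul hρ).add
      (.const _))).add (((PolyBounded.const 4).add hS).add ((PolyBounded.const 32).mul
      (hround.add (.const 1))))
  have hn := fun n => clientReal_accept (ρ n) (fun k => idealClient (S n) (ρ n).rounds
    fun i => .work (2 * k + i)) (e n)
  simp only [hn]
  refine negligible_hybridWorlds hind hθ hc (fun n e => ?_) (fun n e => ?_) (fun n k _ e => ?_)
    (fun n k _ e => ?_) (fun n k _ => ?_) (fun n k _ e => ?_) e he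
  · exact (SessImpl.serverStart e).mono (by simp only [c]; omega)
  · exact SessImpl.nil e _
  · exact (SessImpl.realSession (ρ n) false (ρ n).rounds 2 _ (by omega) (by simp) e).mono
      (by simp only [c]; omega)
  · exact (SessImpl.idealClient (S n) (ρ n).rounds _ e).mono (by simp only [c]; omega)
  · rw [idealClient, length_sessionWorld, length_sessionWorld]
  · exact (Embeds.client (ρ n) (S n) (fun _ => rfl) (k + 1) e).mono (by simp only [c]; omega)

theorem negligible_server {P : ∀ n, Params n} (hP : Feasible P) {ρ : ∀ n, OLEProtocol (P n)}
    (hρ : PolyBounded fun n => (ρ n).time) {S : ∀ n, Simulator (P n)}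
    (hS : PolyBounded fun n => (S n).time (ρ n).worlds.serverReal.length)
    (hind : Indist P (fun n => (ρ n).worlds.serverReal)
      (fun n => (ρ n).worlds.serverIdeal (S n)))
    (e : ∀ n, Env (P n)) (he : PolyBounded fun n => (e n).flatten.length) :
    Negligible fun n => |(ImplicitCheck.worlds (ρ n)).serverReal.accept (e n) -
      acceptOf (chain (kernels (hybridWorlds
        [ImplicitCheck.clientStart, ImplicitCheck.clientToken] [] (fun k =>
          sessionWorld ((ρ n).start true) ((ρ n).party true) ((ρ n).rounds + 1) 1
            fun i => .work (k + i)) (fun k => idealServer (S n) ((ρ n).rounds + 1)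
              fun i => .work (k + i)) (P n).θ (P n).θ) (e n)))| := by
  replace hS : PolyBounded fun n => (S n).time ((ρ n).rounds + 1 + 1) := hS.mono fun n => by
    rw [OLEProtocol.serverReal_eq, length_sessionWorld]
  obtain ⟨-, hθ, -, hx, -⟩ := hP
  let c : ℕ → ℕ := fun n =>
    ((P n).inputLen * 5 + (P n).θ * ((P n).θ * 1 + 3 + 1)) +
      (15 * (ρ n).time + 2 * 1) + (S n).time ((ρ n).rounds + 1 + 1)
  have hc : PolyBounded c :=
    (((hx.mul (.const 5)).add (hθ.mul (((hθ.mul (.const 1)).add (.const 3)).add (.const 1)))).add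
      (((PolyBounded.const 15).mul hρ).add (.const _))).add hS
  have hn := fun n => serverReal_accept (ρ n) (fun k => idealServer (S n) ((ρ n).rounds + 1)
    fun i => .work (k + i)) (e n)
  simp only [hn]
  refine negligible_hybridWorlds hind hθ hc (fun n e => ?_) (fun n e => ?_) (fun n k _ e => ?_)
    (fun n k _ e => ?_) (fun n k _ => ?_) (fun n k _ e => ?_) e he
  · exact (SessImpl.clientStart e).mono (by simp only [c]; omega)
  · exact SessImpl.nil e _
  · exact (SessImpl.realSession (ρ n) true ((ρ n).rounds + 1) 1 _ le_rfl (by simp) e).mono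
      (by simp only [c]; omega)
  · exact (SessImpl.idealServer (S n) ((ρ n).rounds + 1) _ e).mono (by simp only [c]; omega)
  · rw [idealServer, length_sessionWorld, length_sessionWorld]
  · exact (Embeds.server (ρ n) (S n) (fun _ => rfl) (k + 1) e).mono (by simp only [c]; omega)

end

noncomputable section

section

variable {n : ℕ} {P : Params n} {A B : Type}

open Memory

/-! ### Simulation of one experiment by another -/

/-- If the random memory of the step `h'` is `D m` when the memory of the step `h` is `m`, then it is
`E m` after both steps; the invariant `I` becomes `J`. -/
def Simulates (I J : Memory P Loc → Prop) (D E : Memory P Loc → PMF (Memory P Loc))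
    (h h' : Step P) : Prop :=
  ∀ H m, I m → (h H m).bind E = (D m).bind (h' H) ∧ ∀ m' ∈ (h H m).support, J m'

section

variable {I J K : Memory P Loc → Prop} {D E F : Memory P Loc → PMF (Memory P Loc)}
  {g g' h h' : Step P}

/-- The kernel `D` is the conditional law of the hybrid's memory given the simulator's memory. Such
conditional laws compose, and the second step is needed only on memories that the first one can
reach. -/
theorem Simulates.seq (hh : Simulates I J D E h h') (hg : Simulates J K E F g g') :
    Simulates I K D F (fun H m => (h H m).bind (g H)) (fun H m => (h' H m).bind (g' H)) := by
  intro H m hm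
  obtain ⟨h1, h2⟩ := hh H m hm
  refine ⟨?_, fun m' hm' => ?_⟩
  · change _ = (D m).bind fun m => (h' H m).bind (g' H)
    rw [PMF.bind_bind]
    refine Eq.trans ?_ (PMF.bind_bind _ _ _)
    rw [← h1, PMF.bind_bind]
    exact PMF.bind_congr_support fun m' hm' => (hg H m' (h2 m' hm')).1
  · rw [PMF.mem_support_bind_iff] at hm'
    obtain ⟨m₁, h3, h4⟩ := hm'
    exact (hg H m₁ (h2 m₁ h3)).2 m' h4

theorem Simulates.pure (hIJ : ∀ m, I m → J m ∧ E m = D m) :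
    Simulates I J D E (fun _ => PMF.pure) (fun _ => PMF.pure) := by
  intro H m hm
  refine ⟨by rw [PMF.pure_bind, PMF.bind_pure, (hIJ m hm).2], fun m' hm' => ?_⟩
  rw [PMF.support_pure, Set.mem_singleton_iff] at hm'
  exact hm' ▸ (hIJ m hm).1

theorem Simulates.play {V W : World P} (hVW : List.Forall₂ (Simulates I I D D) V W)
    (he : ∀ q, Simulates I I D D (fun H => envRun H q) fun H => envRun H q) (e : Env P) :
    Simulates I I D D (fun H => World.play H V e) fun H => World.play H W e := by
  induction hVW generalizing e with
  | nil => exact Simulates.pure fun m hm => ⟨hm, rfl⟩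
  | cons h _ ih => exact ((he _).seq h).seq (ih e.tail)

theorem Simulates.wipe (hIJ : ∀ m, I m → J m ∧ E m = (D m).map wipe) :
    Simulates I J D E (fun _ => PMF.pure) (fun _ m => PMF.pure (wipe m)) := by
  intro H m hm
  refine ⟨by rw [PMF.pure_bind, (hIJ m hm).2]; rfl, fun m' hm' => ?_⟩
  rw [PMF.support_pure, Set.mem_singleton_iff] at hm'
  exact hm' ▸ (hIJ m hm).1

/-- Simulation of a session whose first activation differs from the other ones. -/
theorem Simulates.session {V W : World P} (hh : Simulates I J D E h h')
    (hVW : List.Forall₂ (Simulates J J E E) V W)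
    (heI : ∀ q, Simulates I I D D (fun H => envRun H q) fun H => envRun H q)
    (heJ : ∀ q, Simulates J J E E (fun H => envRun H q) fun H => envRun H q)
    (hJK : ∀ m, J m → K m ∧ F m = (E m).map _root_.wipe) (e : Env P) :
    Simulates I K D F (fun H => World.play H (h :: V) e) (playWipe (h' :: W) e) := by
  have := (((heI (e.headD [])).seq hh).seq (Simulates.play hVW heJ e.tail)).seq
    (Simulates.wipe hJK)
  intro H m hm
  have h := this H m hm
  simp only [PMF.bind_pure] at h
  exact h

end

/-- The bit that the environment outputs. -/
def outBit (m : Memory P Loc) : Bool := m.bit (.adv 0)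

/-- The coupling is carried through the sessions one by one. It is dissolved only after the last
move, where `hfin` says that the hidden part does not influence the output bit. -/
theorem Simulates.run {I : ℕ → Memory P Loc → Prop} {D : ℕ → Memory P Loc → PMF (Memory P Loc)}
    {V W : ℕ → World P} {N : ℕ}
    (h : ∀ k < N, ∀ e, Simulates (I k) (I (k + 1)) (D k) (D (k + 1))
      (fun H => World.play H (V k) e) (playWipe (W k) e))
    (hlen : ∀ k < N, (V k).length = (W k).length)
    (hfin : ∀ q H m, I N m → (envRun H q m).map outBit =
      (D N m).bind fun g => (envRun H q g).map outBit) (H : P.Oracle) {j k : ℕ} (hk : k + j = N)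
    (e : Env P) (m : Memory P Loc) (hm : I k m) :
    (World.run H ((List.range' k j).flatMap V) e m).map outBit =
      ((D k m).bind (chain (kernels ((List.range' k j).map W ++ [[]]) e) H)).map outBit := by
  induction j generalizing k e m with
  | zero =>
    obtain rfl : k = N := hk
    simp only [List.range'_zero, List.flatMap_nil, List.map_nil, List.nil_append, kernels, chain,
      World.run_eq, World.play, PMF.pure_bind, List.length_nil, List.drop_zero]
    rw [hfin _ H m hm, PMF.map_bind]
    refine congrArg _ (funext fun g => ?_)
    have h1 : playWipe [] e H g = PMF.pure (_root_.wipe g) := PMF.pure_map _ _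
    have h2 : outBit ∘ (_root_.wipe : Memory P Loc → _) = outBit := funext fun m => by
      simp [outBit, wipe_bit, Loc.isGlob]
    rw [h1, PMF.pure_bind]
    simp only [PMF.bind_pure]
    rw [← envRun_wipe, PMF.map_comp, PMF.map_comp, h2, h2]
  | succ j ih =>
    obtain ⟨h1, h2⟩ := h k (by omega) e H m hm
    have hl := hlen k (by omega)
    rw [List.range'_succ, List.flatMap_cons, List.map_cons, List.cons_append, kernels, chain,
      ← PMF.bind_bind, ← h1, World.run_eq, World.play_append, PMF.bind_bind, PMF.bind_bind,
      PMF.map_bind, PMF.map_bind]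
    refine PMF.bind_congr_support fun m' hm' => ?_
    rw [← hl, ← ih (by omega) (e.drop (V k).length) m' (h2 m' hm'), World.run_eq,
      List.length_append, List.drop_drop]

/-- Simulation of a hybrid in which all sessions are ideal ones. -/
theorem Simulates.accept {I : ℕ → Memory P Loc → Prop}
    {D : ℕ → Memory P Loc → PMF (Memory P Loc)} {J₀ : Memory P Loc → Prop}
    {D₀ : Memory P Loc → PMF (Memory P Loc)} {V₀ W₀ : World P} {V W R : ℕ → World P} {N : ℕ}
    (h₀ : ∀ e, Simulates J₀ (I 0) D₀ (D 0) (fun H => World.play H V₀ e) (playWipe W₀ e))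
    (hJ₀ : J₀ (blank P Loc)) (hD₀ : D₀ (blank P Loc) = PMF.pure (blank P Loc)) (hlen₀ : V₀.length = W₀.length)
    (h : ∀ k < N, ∀ e, Simulates (I k) (I (k + 1)) (D k) (D (k + 1))
      (fun H => World.play H (V k) e) (playWipe (W k) e))
    (hlen : ∀ k < N, (V k).length = (W k).length)
    (hfin : ∀ q H m, I N m → (envRun H q m).map outBit =
      (D N m).bind fun g => (envRun H q g).map outBit) (e : Env P) :
    World.accept (V₀ ++ (List.range N).flatMap V) e =
      acceptOf (chain (kernels (hybridWorlds W₀ [] R W N N) e)) := by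
  rw [World.accept_eq]
  refine acceptOf_congr fun H => ?_
  have hW : (List.range N).map (fun k => if k < N then W k else R k) = (List.range N).map W :=
    List.map_congr_left fun k hk => by rw [if_pos (List.mem_range.1 hk)]
  obtain ⟨h1, h2⟩ := h₀ e H _ hJ₀
  change PMF.map outBit _ = PMF.map outBit _
  rw [hybridWorlds, hW, List.cons_append, kernels, chain]
  rw [hD₀, PMF.pure_bind] at h1
  change _ = PMF.map outBit ((playWipe W₀ e H (blank P Loc)).bind _)
  rw [← h1, World.run_eq, World.play_append, PMF.bind_bind, PMF.bind_bind, PMF.map_bind,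
    PMF.map_bind]
  refine PMF.bind_congr_support fun m hm => ?_
  have := Simulates.run (k := 0) h hlen hfin H (Nat.zero_add N) (e.drop V₀.length) m (h2 m hm)
  rw [← List.range_eq_range'] at this
  rw [← hlen₀, ← this, World.run_eq, List.length_append, List.drop_drop]

/-! ### Simulators that run one simulator for each session -/

/-- The simulator that does nothing in its first `o` activations and then runs the simulators
`S 0, S 1, …`, for `L` activations each. -/
def seqSim (o L : ℕ) (S : ℕ → Simulator P) : Simulator P := fun i =>
  if i < o then ([], []) else S ((i - o) / L) ((i - o) % L)

theorem seqSim_lt {o L i : ℕ} (S : ℕ → Simulator P) (h : i < o) : seqSim o L S i = ([], []) := by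
  rw [seqSim, if_pos h]

theorem seqSim_add {L k t : ℕ} (o : ℕ) (S : ℕ → Simulator P) (h : t < L) :
    seqSim o L S (o + (k * L + t)) = S k t := by
  rw [seqSim, if_neg (by omega), Nat.add_sub_cancel_left, mul_comm,
    Nat.mul_add_div (by omega), Nat.mul_add_mod, Nat.div_eq_of_lt h, Nat.mod_eq_of_lt h, add_zero]

theorem range_mul_eq_flatMap {α : Type*} (N L : ℕ) (f : ℕ → α) :
    (List.range (N * L)).map f =
      (List.range N).flatMap fun k => (List.range L).map fun t => f (k * L + t) := by
  induction N with
  | zero => simp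
  | succ N ih =>
    rw [Nat.succ_mul, List.range_add, List.map_append, ih, List.range_succ, List.flatMap_append,
      List.map_map]
    simp [Function.comp_def]

theorem act_of_eq {S S' : Simulator P} {f : Memory P Loc → Memory P Loc} {i j : ℕ}
    (h : S i = S' j) : S.act f i = S'.act f j := by
  unfold Simulator.act; rw [h]

theorem map_act_seqSim (o N L : ℕ) (S : ℕ → Simulator P) (f : Memory P Loc → Memory P Loc) :
    (List.range (N * L)).map (fun t => (seqSim o L S).act f (o + t)) =
      (List.range N).flatMap fun k => (List.range L).map ((S k).act f) := by
  rw [range_mul_eq_flatMap]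
  refine congrArg (fun g => List.flatMap g (List.range N)) (funext fun k => ?_)
  exact List.map_congr_left fun t ht => act_of_eq (seqSim_add o S (List.mem_range.1 ht))

theorem time_seqSim (o N L : ℕ) (S : ℕ → Simulator P) :
    (seqSim o L S).time (o + N * L) = ∑ k ∈ range N, (S k).time L := by
  have h0 : ∀ N, (seqSim o L S).time (o + N * L) = ∑ k ∈ range N, (S k).time L := by
    intro N
    induction N with
    | zero =>
      rw [Nat.zero_mul, Nat.add_zero, Finset.range_zero, Finset.sum_empty, Simulator.time]
      exact Finset.sum_eq_zero fun t ht => by rw [seqSim_lt S (Finset.mem_range.1 ht)]; rfl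
    | succ N ih =>
      rw [Nat.succ_mul, ← Nat.add_assoc, Finset.sum_range_succ, ← ih, Simulator.time,
        Finset.sum_range_add]
      refine congrArg _ (Finset.sum_congr rfl fun t ht => ?_)
      rw [Nat.add_assoc, seqSim_add o S (Finset.mem_range.1 ht)]
  exact h0 N

/-- Where the registers of session `k` of a simulator are kept. -/
def simReg (k : ℕ) : SReg → SReg
  | .sim i => .sim (Nat.pair 0 (Nat.pair k i))
  | .port i => .sim (Nat.pair 1 (Nat.pair k i))
  | .chan i => .chan i

theorem SReg.loc_injective : Function.Injective SReg.loc := by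
  intro a b h
  cases a <;> cases b <;> simp_all [SReg.loc]

/-- The registers of session `k` as seen by its simulator. -/
def simView (k : ℕ) : Loc → Option Loc
  | .adv i => some (.adv i)
  | .top i => some (.top i)
  | .chan i => some (.chan i)
  | .sim i => some (.sim (Nat.pair 0 (Nat.pair k i)))
  | .port i => some (.sim (Nat.pair 1 (Nat.pair k i)))
  | _ => none

theorem pInj_simView (k : ℕ) : PInj (simView k) := by
  intro a a' b h h'
  cases a <;> cases a' <;> simp only [simView, Option.some.injEq, reduceCtorEq] at h h' <;>
    (subst h'; simp_all [Nat.pair_eq_pair])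

theorem simView_sreg (k : ℕ) (a : SReg) : simView k a.loc = some (simReg k a).loc := by
  cases a <;> rfl

theorem simView_ereg (k : ℕ) (a : EReg) : simView k a.loc = some a.loc := by
  cases a <;> rfl

/-- The simulator `S` on the registers of session `k`. -/
def Simulator.rename (S : Simulator P) (k : ℕ) : Simulator P := fun t =>
  ((S t).1.map (Instr.map (simReg k)), (S t).2.map (Instr.map (simReg k)))

theorem run_simView (H : P.Oracle) {w : Memory P Loc} (k : ℕ) (p : Prog P SReg)
    (m : Memory P Loc) :
    (Prog.run H ((p.map (Instr.map (simReg k))).map (Instr.map SReg.loc)) m).map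
      (view w (simView k)) = Prog.run H (p.map (Instr.map SReg.loc)) (view w (simView k) m) := by
  rw [List.map_map, Instr.map_comp_map]
  exact Prog.run_view (pInj_simView k) (simView_sreg k) H p m

theorem run_simReg_frame {H : P.Oracle} {k : ℕ} {p : Prog P SReg} {m m' : Memory P Loc}
    (h : m' ∈ (Prog.run H ((p.map (Instr.map (simReg k))).map (Instr.map SReg.loc)) m).support) :
    EqOn (Set.range fun a => (simReg k a).loc)ᶜ m m' := by
  rw [List.map_map, Instr.map_comp_map] at h
  exact Prog.run_frame H p h

theorem envRun_simView (H : P.Oracle) {w : Memory P Loc} (k : ℕ) (q : Prog P EReg)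
    (m : Memory P Loc) :
    (envRun H q m).map (view w (simView k)) = envRun H q (view w (simView k) m) :=
  Prog.run_view (pInj_simView k) (simView_ereg k) H q m

/-- The registers of the sessions `k, k + 1, …` are zero. -/
def SimFresh (k : ℕ) (m : Memory P Loc) : Prop :=
  ∀ c < 2, ∀ k' ≥ k, ∀ i, m.bit (.sim (Nat.pair c (Nat.pair k' i))) = false ∧
    m.fld (.sim (Nat.pair c (Nat.pair k' i))) = 0

theorem SimFresh.mono {k k' : ℕ} {m : Memory P Loc} (h : SimFresh k m) (hk : k ≤ k') :
    SimFresh k' m := fun c hc j hj => h c hc j (le_trans hk hj)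

theorem SimFresh.of_eqOn {k : ℕ} {m m' : Memory P Loc} (h : SimFresh k m)
    (e : EqOn {a | ∃ c < 2, ∃ k' ≥ k, ∃ i, a = .sim (Nat.pair c (Nat.pair k' i))} m m') :
    SimFresh k m' := fun c hc k' hk' i => by
  obtain ⟨h1, h2⟩ := e _ ⟨c, hc, k', hk', i, rfl⟩
  rw [← h1, ← h2]
  exact h c hc k' hk' i

theorem SimFresh.envRun {k : ℕ} {m m' : Memory P Loc} (h : SimFresh k m) {H : P.Oracle}
    {q : Prog P EReg} (hm' : m' ∈ (envRun H q m).support) : SimFresh k m' :=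
  h.of_eqOn ((Prog.run_frame H q hm').mono (by
    rintro _ ⟨c, _, k', _, i, rfl⟩ ⟨a, ha⟩
    cases a <;> simp [EReg.loc] at ha))

theorem SimFresh.run {k : ℕ} {m m' : Memory P Loc} (h : SimFresh (k + 1) m) {H : P.Oracle}
    {p : Prog P SReg}
    (hm' : m' ∈ (Prog.run H ((p.map (Instr.map (simReg k))).map (Instr.map SReg.loc)) m).support) :
    SimFresh (k + 1) m' :=
  h.of_eqOn ((run_simReg_frame hm').mono (by
    rintro _ ⟨c, _, k', hk', i, rfl⟩ ⟨a, ha⟩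
    cases a <;> simp [simReg, SReg.loc, Nat.pair_eq_pair] at ha <;> omega))

/-! ### A corrupt server -/

/-- The environment's registers. -/
def envView (a : Loc) : Option Loc :=
  match a with
  | .adv i => some (.adv i)
  | .top i => some (.top i)
  | .chan i => some (.chan i)
  | _ => none

theorem envView_eq_some {a b : Loc} (h : envView a = some b) : a = b := by
  cases a <;> simp_all [envView]

theorem pInj_envView : PInj envView := fun _ _ _ h h' =>
  (envView_eq_some h).trans (envView_eq_some h').symm

theorem envView_ereg (a : EReg) : envView a.loc = some a.loc := by cases a <;> rfl

theorem Simulates.of_view {I J : Memory P Loc → Prop} {f g : Loc → Option Loc}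
    {w : Memory P Loc} {h h' : Step P}
    (hh : ∀ H m, I m → (h H m).map (view w g) = h' H (view w f m))
    (hJ : ∀ H m, I m → ∀ m' ∈ (h H m).support, J m') :
    Simulates I J (fun m => PMF.pure (view w f m)) (fun m => PMF.pure (view w g m)) h h' :=
  fun H m hm => ⟨by rw [PMF.pure_bind, ← hh H m hm]; rfl, hJ H m hm⟩

/-- Before session `k` its copy of the simulator has only zeros, which is the state in which the
hybrid starts a session after wiping. This lets the coupling switch from `envView` to `simView k`.
-/
theorem view_simView {k : ℕ} {m : Memory P Loc} (h : SimFresh k m) :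
    view (blank P Loc) (simView k) m = view (blank P Loc) envView m := by
  ext a
  · cases a with
    | sim i => exact (h 0 (by omega) k le_rfl i).1
    | port i => exact (h 1 (by omega) k le_rfl i).1
    | _ => rfl
  · cases a with
    | sim i => exact (h 0 (by omega) k le_rfl i).2
    | port i => exact (h 1 (by omega) k le_rfl i).2
    | _ => rfl

theorem wipe_simView (k : ℕ) (m : Memory P Loc) :
    wipe (view (blank P Loc) (simView k) m) = view (blank P Loc) envView m := by
  ext a
  · rw [wipe_bit]; cases a <;> rfl
  · rw [wipe_fld]; cases a <;> rfl

theorem simulates_act_rename (S : Simulator P) (k t : ℕ) :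
    Simulates (SimFresh (k + 1)) (SimFresh (k + 1))
      (fun m => PMF.pure (view (blank P Loc) (simView k) m))
      (fun m => PMF.pure (view (blank P Loc) (simView k) m)) ((S.rename k).act id t)
      (S.act id t) := by
  refine Simulates.of_view (fun H m _ => ?_) fun H m hm m' hm' => ?_
  · unfold Simulator.act
    rw [← run_simView, PMF.map_id, PMF.map_id, PMF.map_bind, PMF.bind_map]
    exact congrArg _ (funext fun m' => run_simView H k _ m')
  · unfold Simulator.act at hm'
    rw [PMF.map_id, PMF.mem_support_bind_iff] at hm'
    obtain ⟨m₁, h1, h2⟩ := hm'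
    exact (hm.run h1).run h2

/-- The hybrid reuses one set of simulator registers and wipes it after each session, whereas the
new simulator gives each session registers of its own. During session `k` the latter are viewed
through `simView k`; wiping afterwards returns to the environment's registers. -/
theorem simulates_idealServer (S : Simulator P) (L k : ℕ) (a : ℕ → Loc) (e : Env P) :
    Simulates (SimFresh k) (SimFresh (k + 1))
      (fun m => PMF.pure (view (blank P Loc) envView m))
      (fun m => PMF.pure (view (blank P Loc) envView m))
      (fun H => World.play H ((List.range (L + 1)).map ((S.rename k).act id)) e)
      (playWipe (idealServer S L a) e) := by
  rw [List.range_succ_eq_map, List.map_cons, List.map_map]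
  refine Simulates.session (J := SimFresh (k + 1))
    (E := fun m => PMF.pure (view (blank P Loc) (simView k) m)) ?_ ?_ (fun q => ?_) (fun q => ?_)
    (fun m hm => ⟨hm, ?_⟩) e
  · intro H m hm
    have := simulates_act_rename S k 0 H m (hm.mono (by omega))
    simp only [view_simView hm] at this
    exact this
  · rw [List.forall₂_map_left_iff, List.forall₂_map_right_iff, List.forall₂_same]
    exact fun t _ => simulates_act_rename S k (t + 1)
  · exact Simulates.of_view (fun H m _ => Prog.run_view pInj_envView envView_ereg H q m)
      fun H m hm m' hm' => hm.envRun hm'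
  · exact Simulates.of_view (fun H m _ => envRun_simView H k q m)
      fun H m hm m' hm' => hm.envRun hm'
  · rw [PMF.pure_map, wipe_simView]

/-- Forget the private registers of the honest party. -/
def dropWork (m : Memory P Loc) : Memory P Loc :=
  view (blank P Loc) (fun a => match a with | .work _ => none | a => some a) m

theorem pInj_dropWork : PInj fun a : Loc => match a with | .work _ => none | a => some a := by
  intro a a' b h h'
  cases a <;> cases a' <;> simp_all

theorem envRun_dropWork (H : P.Oracle) (q : Prog P EReg) (m : Memory P Loc) :
    (envRun H q m).map dropWork = envRun H q (dropWork m) :=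
  Prog.run_view pInj_dropWork (fun a => by cases a <;> rfl) H q m

theorem dropWork_wipe (m : Memory P Loc) : dropWork (wipe m) = wipe (dropWork m) := by
  ext a
  · rw [wipe_bit, dropWork, dropWork, view_bit, view_bit]
    cases a <;> simp [wipe_bit, Loc.isGlob]
  · rw [wipe_fld, dropWork, dropWork, view_fld, view_fld]
    cases a <;> simp [wipe_fld, Loc.isGlob]

theorem Commutes.chain {φ : Memory P Loc → Memory P Loc} {Ks : List (Step P)}
    (h : ∀ K ∈ Ks, Commutes φ K) : Commutes φ (chain Ks) := by
  induction Ks with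
  | nil => exact fun H m => PMF.pure_map _ _
  | cons K Ks ih =>
    intro H m
    change ((K H m).bind _).map φ = (K H (φ m)).bind _
    rw [PMF.map_bind, ← h K (by simp) H m, PMF.bind_map]
    exact congrArg _ (funext fun m' => ih (fun K hK => h K (by simp [hK])) H m')

theorem Commutes.playWipe_dropWork {W : World P} (h : ∀ g ∈ W, Commutes dropWork g) (e : Env P) :
    Commutes dropWork (playWipe W e) := fun H m => by
  have := Commutes.play (φ := dropWork) (μ := fun q => q) rfl envRun_dropWork h H e m
  rw [List.map_id'] at this
  rw [playWipe, playWipe, ← this, PMF.map_comp, PMF.map_comp]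
  exact congrArg (PMF.map · _) (funext fun m => dropWork_wipe m)

theorem Commutes.kernels_dropWork {Ws : List (World P)}
    (h : ∀ W ∈ Ws, ∀ g ∈ W, Commutes dropWork g) (e : Env P) :
    ∀ K ∈ kernels Ws e, Commutes dropWork K := by
  induction Ws generalizing e with
  | nil =>
    intro K hK H m
    rw [kernels, List.mem_singleton] at hK
    subst hK
    dsimp only
    rw [← envRun_dropWork, PMF.map_comp, PMF.map_comp]
    exact congrArg (PMF.map · _) (funext fun m => dropWork_wipe m)
  | cons W Ws ih =>
    intro K hK
    rw [kernels, List.mem_cons] at hK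
    rcases hK with rfl | hK
    · exact Commutes.playWipe_dropWork (h W (by simp)) e
    · exact ih (fun W hW => h W (by simp [hW])) _ K hK

theorem Commutes.idealServer (S : Simulator P) (L : ℕ) (a : ℕ → Loc) :
    ∀ g ∈ idealServer S L a, Commutes dropWork g := by
  have h : ∀ t, Commutes dropWork (S.act id t) := fun t =>
    Commutes.act (F := id) pInj_dropWork (fun a => by cases a <;> rfl) (fun _ => rfl) t
  intro g hg
  rw [_root_.idealServer, sessionWorld, List.mem_cons, List.mem_map] at hg
  rcases hg with rfl | ⟨t, _, rfl⟩
  exacts [h 0, h (t + 1)]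

theorem dropWork_setBits (m : Memory P Loc) {k : ℕ} (v : Fin k → Bool) :
    dropWork (m.setBits (fun i => .work i) v) = dropWork m :=
  view_setBits_of_notMem (fun i a => by cases a <;> simp) m v

theorem dropWork_setFlds (m : Memory P Loc) {k : ℕ} (v : Fin k → P.F) :
    dropWork (m.setFlds (fun i => .work i) v) = dropWork m :=
  view_setFlds_of_notMem (fun i a => by cases a <;> simp) m v

/-- Without the real sessions the computations of the honest client do not matter. -/
theorem accept_dropWork (S : Simulator P) (L N : ℕ) (a : ℕ → ℕ → Loc) (R : ℕ → World P)
    (e : Env P) :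
    acceptOf (chain (kernels (hybridWorlds [ImplicitCheck.clientStart, ImplicitCheck.clientToken]
      [] R (fun k => idealServer S L (a k)) N N) e)) =
    acceptOf (chain (kernels (hybridWorlds [fun _ => PMF.pure, fun _ => PMF.pure]
      [] R (fun k => idealServer S L (a k)) N N) e)) := by
  refine acceptOf_congr fun H => ?_
  change PMF.map outBit ((playWipe _ e H _).bind _) = PMF.map outBit ((playWipe _ e H _).bind _)
  set Ks := chain (kernels (((List.range N).map fun k =>
    if k < N then idealServer S L (a k) else R k) ++ [[]]) (e.drop 2)) with hKs
  -- Simulated sessions address no `work` register: the simulator has no access to them, and `F_ole`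
  -- gives it nothing that depends on the client's input.
  have hc : Commutes dropWork Ks := by
    refine Commutes.chain (Commutes.kernels_dropWork (fun W hW => ?_) _)
    rw [List.mem_append, List.mem_map, List.mem_singleton] at hW
    rcases hW with ⟨k, hk, rfl⟩ | rfl
    · rw [if_pos (List.mem_range.1 hk)]
      exact Commutes.idealServer S L (a k)
    · simp
  have key : ∀ p : PMF (Memory P Loc), (p.bind (Ks H)).map outBit =
      ((p.map dropWork).bind (Ks H)).map outBit := fun p => by
    rw [PMF.bind_map, PMF.map_bind, PMF.map_bind]
    refine congrArg _ (funext fun m => ?_)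
    rw [Function.comp_apply, ← hc, PMF.map_comp]
    rfl
  have hsim : Simulates (P := P) (fun _ => True) (fun _ => True) (fun m => PMF.pure (dropWork m))
      (fun m => PMF.pure (dropWork m)) (fun H => World.play H
        [ImplicitCheck.clientStart, ImplicitCheck.clientToken] e)
      (fun H => World.play H [fun _ => PMF.pure, fun _ => PMF.pure] e) := by
    refine Simulates.play (.cons ?_ (.cons ?_ .nil)) (fun q => ?_) e
    · exact Simulates.of_view (fun H m _ => (PMF.pure_map _ _).trans
        (congrArg PMF.pure (dropWork_setBits m _))) fun _ _ _ _ _ => trivial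
    · exact Simulates.of_view (fun H m _ => (PMF.pure_map _ _).trans
        (congrArg PMF.pure (dropWork_setFlds m _))) fun _ _ _ _ _ => trivial
    · exact Simulates.of_view (fun H m _ => envRun_dropWork H q m) fun _ _ _ _ _ => trivial
  have h := (hsim H (blank P Loc) trivial).1
  dsimp only at h
  rw [PMF.pure_bind, show dropWork (blank P Loc) = blank P Loc from by
    ext a <;> cases a <;> rfl] at h
  have h' : (playWipe [ImplicitCheck.clientStart, ImplicitCheck.clientToken] e H
      (blank P Loc)).map dropWork =
      playWipe [fun _ => PMF.pure, fun _ => PMF.pure] e H (blank P Loc) := by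
    rw [playWipe, playWipe, ← h, PMF.map_comp, PMF.map_bind]
    refine congrArg _ (funext fun m => ?_)
    rw [PMF.pure_map, ← dropWork_wipe]
    rfl
  exact (key _).trans (congrArg (fun p => (p.bind (Ks H)).map outBit) h')

/-- Only the registers of the environment have been used. -/
def EnvOnly (m : Memory P Loc) : Prop := EqOn (Set.range EReg.loc)ᶜ (blank P Loc) m

theorem EnvOnly.envRun {H : P.Oracle} {q : Prog P EReg} {m m' : Memory P Loc} (h : EnvOnly m)
    (hm' : m' ∈ (envRun H q m).support) : EnvOnly m' := h.trans (Prog.run_frame H q hm')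

theorem EnvOnly.zero {m : Memory P Loc} (h : EnvOnly m) {a : Loc} (ha : envView a = none) :
    m.bit a = false ∧ m.fld a = 0 := by
  obtain ⟨h1, h2⟩ := h a (by rintro ⟨b, rfl⟩; cases b <;> simp [EReg.loc, envView] at ha)
  exact ⟨h1.symm, h2.symm⟩

theorem EnvOnly.simFresh {m : Memory P Loc} (h : EnvOnly m) : SimFresh 0 m :=
  fun _ _ _ _ _ => h.zero rfl

theorem EnvOnly.view_envView {m : Memory P Loc} (h : EnvOnly m) :
    view (blank P Loc) envView m = m := by
  ext a
  · cases ha : envView a with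
    | none => rw [view_bit, ha, (h.zero ha).1]; rfl
    | some b => rw [view_bit, ha, envView_eq_some ha]; rfl
  · cases ha : envView a with
    | none => rw [view_fld, ha, (h.zero ha).2]; rfl
    | some b => rw [view_fld, ha, envView_eq_some ha]; rfl

theorem wipe_envView (m : Memory P Loc) :
    wipe (view (blank P Loc) envView m) = view (blank P Loc) envView m := by
  ext a
  · rw [wipe_bit]; cases a <;> rfl
  · rw [wipe_fld]; cases a <;> rfl

theorem simulates_play_envOnly {V : World P}
    (hV : ∀ h ∈ V, h = fun _ => PMF.pure) (e : Env P) :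
    Simulates EnvOnly EnvOnly PMF.pure PMF.pure (fun H => World.play H V e)
      (fun H => World.play H V e) := by
  refine Simulates.play ?_ (fun q H m hm => ⟨?_, fun m' hm' => hm.envRun hm'⟩) e
  · rw [List.forall₂_same]
    intro h hh
    rw [hV h hh]
    exact Simulates.pure fun m hm => ⟨hm, rfl⟩
  · rw [PMF.pure_bind, PMF.bind_pure]

/-- The simulator for a corrupt server of the implicit check. -/
def serverSim (S : Simulator P) (L : ℕ) : Simulator P := seqSim 2 L fun k => S.rename k

/-- Once the client's `work` registers are dropped, its first two activations do nothing, like the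
first two activations of `serverSim`. From then on the sessions match one by one. -/
theorem serverIdeal_accept (ρ : OLEProtocol P) (S : Simulator P) (R : ℕ → World P) (e : Env P) :
    acceptOf (chain (kernels (hybridWorlds [ImplicitCheck.clientStart, ImplicitCheck.clientToken]
      [] R (fun k => idealServer S (ρ.rounds + 1) fun i => .work (k + i)) P.θ P.θ) e)) =
    ((ImplicitCheck.worlds ρ).serverIdeal (serverSim S (ρ.rounds + 2))).accept e := by
  have hsplit : (ImplicitCheck.worlds ρ).serverIdeal (serverSim S (ρ.rounds + 2)) =
      [fun _ => PMF.pure, fun _ => PMF.pure] ++ (List.range P.θ).flatMap fun k =>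
        (List.range (ρ.rounds + 1 + 1)).map ((S.rename k).act id) := by
    change (List.range (2 + P.θ * (ρ.rounds + 2))).map ((serverSim S (ρ.rounds + 2)).act id) = _
    rw [List.range_add, List.map_append, List.map_map]
    refine congrArg₂ _ ?_ (map_act_seqSim 2 P.θ (ρ.rounds + 2) _ id)
    have h : ∀ i < 2, (serverSim S (ρ.rounds + 2)).act id i = fun _ => PMF.pure := fun i hi => by
      funext H m
      unfold Simulator.act serverSim
      rw [seqSim_lt _ hi, PMF.map_id]
      exact PMF.pure_bind _ _
    simp [List.range_succ, h]
  rw [accept_dropWork, hsplit]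
  refine (Simulates.accept (I := SimFresh) (J₀ := EnvOnly)
    (D₀ := PMF.pure) (D := fun _ m => PMF.pure (view (blank P Loc) envView m))
    (fun e H m hm => ?_)
    (EqOn.refl _ _) rfl rfl
    (fun k _ e => simulates_idealServer S (ρ.rounds + 1) k _ e)
    (fun k _ => by simp [idealServer, length_sessionWorld]) (fun q H m _ => ?_) e).symm
  · have h := ((simulates_play_envOnly (P := P) (V := [fun _ => PMF.pure, fun _ => PMF.pure])
      (by simp) e).seq (Simulates.wipe (J := SimFresh 0) (E := fun m => PMF.pure
        (view (blank P Loc) envView m)) fun m hm => ⟨hm.simFresh, by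
          rw [PMF.pure_map, hm.view_envView, ← hm.view_envView, wipe_envView]⟩)) H m hm
    simp only [PMF.bind_pure] at h
    exact h
  · rw [PMF.pure_bind, show envRun H q (view (blank P Loc) envView m) = _ from
      (Prog.run_view pInj_envView envView_ereg H q m).symm, PMF.map_comp]
    rfl

end

end

/-! ### Conclusion for a malicious server -/

noncomputable section

theorem Simulator.time_rename {n : ℕ} {P : Params n} (S : Simulator P) (k T : ℕ) :
    (S.rename k).time T = S.time T := by
  simp [Simulator.time, Simulator.rename]

theorem length_serverReal {n : ℕ} {P : Params n} (ρ : OLEProtocol P) :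
    (ImplicitCheck.worlds ρ).serverReal.length = 2 + P.θ * (ρ.rounds + 2) := by
  simp [ImplicitCheck.worlds, OLEProtocol.clientSession]
  ring

/-- Security against a malicious server. -/
theorem ImplicitCheck.server_secure {P : ∀ n, Params n} (hP : Feasible P)
    {ρ : ∀ n, OLEProtocol (P n)} (hρ : PolyBounded fun n => (ρ n).time)
    {S : ∀ n, Simulator (P n)}
    (hS : PolyBounded fun n => (S n).time (ρ n).worlds.serverReal.length)
    (hind : Indist P (fun n => (ρ n).worlds.serverReal)
      (fun n => (ρ n).worlds.serverIdeal (S n))) :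
    ∃ S : ∀ n, Simulator (P n),
      PolyBounded (fun n => (S n).time (ImplicitCheck.worlds (ρ n)).serverReal.length) ∧
      Indist P (fun n => (ImplicitCheck.worlds (ρ n)).serverReal)
        (fun n => (ImplicitCheck.worlds (ρ n)).serverIdeal (S n)) := by
  refine ⟨fun n => serverSim (S n) ((ρ n).rounds + 2), ?_, fun e he => ?_⟩
  · refine (hP.2.1.mul hS).mono fun n => ?_
    unfold serverSim
    rw [length_serverReal, time_seqSim, OLEProtocol.serverReal_eq, length_sessionWorld]
    simp [Simulator.time_rename]
  · have h := negligible_server hP hρ hS hind e he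
    refine h.mono fun n => le_of_eq ?_
    rw [serverIdeal_accept]

end

noncomputable section

/-! ### Shares and masks that are consistent with given answers -/

namespace Params

variable {n : ℕ} (P : Params n)

/-- The pairs of a vector `s` of shares of `g` and a vector `r` of masks for which the answers
`s k + r k * (x k - y k)` to the queries `x k` that have been made are `t k`. -/
def consistent (g : P.F) (y : Fin P.θ → P.F) (d : Fin P.θ → Bool) (x t : Fin P.θ → P.F) :
    Finset ((Fin P.θ → P.F) × (Fin P.θ → P.F)) :=
  haveI : DecidableEq P.F := Classical.decEq _
  Finset.univ.filter fun sr => P.reconstruct sr.1 = g ∧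
    ∀ k, d k = true → sr.1 k + sr.2 k * (x k - y k) = t k

variable {P}

theorem mem_consistent {g : P.F} {y : Fin P.θ → P.F} {d : Fin P.θ → Bool} {x t : Fin P.θ → P.F}
    {sr : (Fin P.θ → P.F) × (Fin P.θ → P.F)} : sr ∈ P.consistent g y d x t ↔
      P.reconstruct sr.1 = g ∧ ∀ k, d k = true → sr.1 k + sr.2 k * (x k - y k) = t k := by
  simp [consistent]

variable (P) in
open Classical in
/-- A uniformly random pair of shares and masks that is consistent with the answers. -/
def randomConsistent (g : P.F) (y : Fin P.θ → P.F) (d : Fin P.θ → Bool) (x t : Fin P.θ → P.F) :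
    PMF ((Fin P.θ → P.F) × (Fin P.θ → P.F)) :=
  if h : (P.consistent g y d x t).Nonempty then PMF.uniformOfFinset _ h else PMF.pure 0

theorem randomConsistent_of_nonempty {g : P.F} {y : Fin P.θ → P.F} {d : Fin P.θ → Bool}
    {x t : Fin P.θ → P.F} (h : (P.consistent g y d x t).Nonempty) :
    P.randomConsistent g y d x t = PMF.uniformOfFinset _ h := by
  rw [randomConsistent, dif_pos h]

/-- The pairs that are consistent with one more answer. -/
theorem consistent_update (g : P.F) (y : Fin P.θ → P.F) {d : Fin P.θ → Bool}
    (x t : Fin P.θ → P.F) {k : Fin P.θ} (hk : d k = false) (x₀ t₀ : P.F) [DecidableEq P.F] :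
    P.consistent g y (Function.update d k true) (Function.update x k x₀) (Function.update t k t₀) =
      (P.consistent g y d x t).filter fun sr => sr.1 k + sr.2 k * (x₀ - y k) = t₀ := by
  ext sr
  rw [Finset.mem_filter, mem_consistent, mem_consistent, and_assoc]
  refine and_congr_right fun _ => ⟨fun h => ⟨fun j hj => ?_, ?_⟩, fun h j hj => ?_⟩
  · have hjk : j ≠ k := by rintro rfl; rw [hk] at hj; simp at hj
    simpa [hjk] using h j (by simpa [hjk] using hj)
  · simpa using h k (by simp)
  · by_cases hjk : j = k
    · subst hjk; simpa using h.2
    · simpa [hjk] using h.1 j (by simpa [hjk] using hj)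

/-- What is sought is a direction of the affine space of consistent pairs along which the answer in
session `k` grows by one. It exists unless the secret and the other answers already determine that
answer, which happens only if all other sessions are answered and the complete query is `y`. -/
theorem exists_shift (y : Fin P.θ → P.F) (d : Fin P.θ → Bool)
    (x : Fin P.θ → P.F) {k : Fin P.θ} (hk : d k = false) (x₀ : P.F)
    (h : ¬ ((∀ j, j ≠ k → d j = true) ∧ y = Function.update x k x₀)) :
    ∃ s r : Fin P.θ → P.F, P.reconstruct s = 0 ∧
      (∀ j, d j = true → s j + r j * (x j - y j) = 0) ∧ s k + r k * (x₀ - y k) = 1 := by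
  -- Raising share `k` by one is compensated in share `j`; this needs a nonzero coefficient at `j`.
  have hrec : ∀ j, P.reconstruct (Pi.single k 1 + Pi.single j (-(P.coef k / P.coef j))) = 0 := by
    intro j
    rw [reconstruct_add, reconstruct_single, reconstruct_single]
    have := P.coef_ne j
    field_simp
    ring
  -- If another session is unanswered, its share can absorb the change unseen.
  by_cases h1 : ∃ j, j ≠ k ∧ d j = false
  · obtain ⟨j, hj, hd⟩ := h1
    refine ⟨Pi.single k 1 + Pi.single j (-(P.coef k / P.coef j)), 0, hrec j, fun i hi => ?_, ?_⟩
    · have h1 : i ≠ k := by rintro rfl; rw [hk] at hi; simp at hi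
      have h2 : i ≠ j := by rintro rfl; rw [hd] at hi; simp at hi
      simp [h1, h2]
    · simp [hj.symm]
  · have hall : ∀ j, j ≠ k → d j = true := fun j hj => by
      by_contra hd
      exact h1 ⟨j, hj, by simpa using hd⟩
    have hne : y ≠ Function.update x k x₀ := fun e => h ⟨hall, e⟩
    -- Here mask `k` is cancelled, so share `k` has to move. Some other query `x i` is wrong: share
    -- `i` absorbs the change, and mask `i` restores the answer of session `i`, which is possible as
    -- `x i - y i ≠ 0`.
    by_cases h2 : x₀ = y k
    · obtain ⟨i, hi⟩ := Function.ne_iff.1 hne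
      have hik : i ≠ k := by rintro rfl; simp [h2] at hi
      rw [Function.update_of_ne hik] at hi
      have hsub : x i - y i ≠ 0 := sub_ne_zero.2 hi.symm
      refine ⟨Pi.single k 1 + Pi.single i (-(P.coef k / P.coef i)),
        Pi.single i (P.coef k / P.coef i / (x i - y i)), hrec i, fun j hj => ?_, ?_⟩
      · have h1 : j ≠ k := by rintro rfl; rw [hk] at hj; simp at hj
        by_cases hji : j = i
        · subst hji
          simp only [Pi.add_apply, Pi.single_eq_same, Pi.single_eq_of_ne h1, zero_add]
          field_simp
          ring
        · simp [h1, hji]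
      · simp [h2, hik.symm]
    -- If the query itself is wrong at `k`, the mask of session `k` suffices; it occurs in no
    -- earlier answer.
    · refine ⟨0, Pi.single k (x₀ - y k)⁻¹, by simp [reconstruct], fun j hj => ?_, ?_⟩
      · have h1 : j ≠ k := by rintro rfl; rw [hk] at hj; simp at hj
        simp [h1]
      · simp [inv_mul_cancel₀ (sub_ne_zero.2 h2)]

variable (P) in
open Classical in
/-- The distribution of the answer to the query `x₀` in session `k`. -/
def answer (g : P.F) (y : Fin P.θ → P.F) (d : Fin P.θ → Bool) (x t : Fin P.θ → P.F)
    (k : Fin P.θ) (x₀ : P.F) : PMF P.F :=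
  if (∀ j, j ≠ k → d j = true) ∧ y = Function.update x k x₀ then
    PMF.pure ((P.coef k)⁻¹ * (g - ∑ j, if j = k then 0 else P.coef j * t j))
  else P.unif

/-- Deferred decisions: drawing shares and masks first and computing the answer from them is the
same as drawing the answer first and then shares and masks that are consistent with it as well.
Either the answer is constant on the consistent pairs, or a translation makes all its fibres equally
large. The second claim keeps the fallback value of `randomConsistent` out of play. -/
theorem bind_answer {α : Type*} {g : P.F} {y : Fin P.θ → P.F} {d : Fin P.θ → Bool}
    {x t : Fin P.θ → P.F} (hne : (P.consistent g y d x t).Nonempty) {k : Fin P.θ}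
    (hk : d k = false) (x₀ : P.F) (G : (Fin P.θ → P.F) × (Fin P.θ → P.F) → P.F → PMF α) :
    (P.randomConsistent g y d x t).bind (fun sr => G sr (sr.1 k + sr.2 k * (x₀ - y k))) =
      ((P.answer g y d x t k x₀).bind fun t₀ =>
        (P.randomConsistent g y (Function.update d k true) (Function.update x k x₀)
          (Function.update t k t₀)).bind fun sr => G sr t₀) ∧
    ∀ t₀ ∈ (P.answer g y d x t k x₀).support,
      (P.consistent g y (Function.update d k true) (Function.update x k x₀)
        (Function.update t k t₀)).Nonempty := by
  classical
  unfold answer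
  split_ifs with h
  -- All queries are right, so each answer is a share; the last share follows from the secret and
  -- the others.
  · have hval : ∀ sr ∈ P.consistent g y d x t, sr.1 k + sr.2 k * (x₀ - y k) =
        (P.coef k)⁻¹ * (g - ∑ j, if j = k then 0 else P.coef j * t j) := by
      intro sr hsr
      rw [mem_consistent] at hsr
      have hy : ∀ j, y j = Function.update x k x₀ j := fun j => congrFun h.2 j
      have hyk : y k = x₀ := by simpa using hy k
      have hs : ∀ j, j ≠ k → sr.1 j = t j := fun j hj => by
        have h1 := hsr.2 j (h.1 j hj)
        have h2 : y j = x j := by simpa [hj] using hy j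
        rw [h2] at h1
        simpa using h1
      have hsum : P.reconstruct sr.1 =
          P.coef k * sr.1 k + ∑ j, if j = k then 0 else P.coef j * t j := by
        unfold reconstruct
        rw [← Finset.add_sum_erase _ _ (Finset.mem_univ k),
          ← Finset.add_sum_erase Finset.univ (fun j => if j = k then 0 else P.coef j * t j)
            (Finset.mem_univ k), if_pos rfl, zero_add]
        refine congrArg _ (Finset.sum_congr rfl fun j hj => ?_)
        have hj := Finset.ne_of_mem_erase hj
        rw [if_neg hj, hs j hj]
      rw [hyk, sub_self, mul_zero, add_zero, ← hsr.1, hsum, add_sub_cancel_right,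
        inv_mul_cancel_left₀ (P.coef_ne k)]
    have hC := consistent_update g y x t hk x₀
      ((P.coef k)⁻¹ * (g - ∑ j, if j = k then 0 else P.coef j * t j))
    rw [Finset.filter_true_of_mem hval] at hC
    refine ⟨?_, fun t₀ ht₀ => ?_⟩
    · rw [PMF.pure_bind, randomConsistent, randomConsistent, hC, dif_pos hne]
      refine PMF.bind_congr_support fun sr hsr => ?_
      rw [hval sr ((PMF.mem_support_uniformOfFinset_iff hne sr).1 hsr)]
    · rw [PMF.support_pure, Set.mem_singleton_iff] at ht₀
      rw [ht₀, hC]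
      exact hne
  -- Translations along this direction preserve consistency and move the fibres of the new answer
  -- into each other.
  · obtain ⟨s, r, h1, h2, h3⟩ := exists_shift y d x hk x₀ h
    have hX : ∀ a ∈ P.consistent g y d x t, ∀ c : P.F, a + c • (s, r) ∈ P.consistent g y d x t := by
      intro a ha c
      rw [mem_consistent] at ha ⊢
      refine ⟨?_, fun j hj => ?_⟩
      · rw [Prod.fst_add, Prod.smul_fst, reconstruct_add, reconstruct_smul, h1, ha.1]
        ring
      · have e1 := ha.2 j hj
        have e2 := h2 j hj
        simp only [Prod.fst_add, Prod.snd_add, Prod.smul_fst, Prod.smul_snd, Pi.add_apply,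
          Pi.smul_apply, smul_eq_mul]
        linear_combination e1 + c * e2
    have hf : ∀ a ∈ P.consistent g y d x t, ∀ c : P.F,
        (a + c • (s, r)).1 k + (a + c • (s, r)).2 k * (x₀ - y k) =
          a.1 k + a.2 k * (x₀ - y k) + c := by
      intro a _ c
      simp only [Prod.fst_add, Prod.snd_add, Prod.smul_fst, Prod.smul_snd, Pi.add_apply,
        Pi.smul_apply, smul_eq_mul]
      linear_combination c * h3
    have hcard := card_fiber_eq_of_translation (fun sr : (Fin P.θ → P.F) × (Fin P.θ → P.F) =>
      sr.1 k + sr.2 k * (x₀ - y k)) (s, r) hX hf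
    have hfib : ∀ b, ((P.consistent g y d x t).filter fun sr =>
        sr.1 k + sr.2 k * (x₀ - y k) = b).Nonempty := by
      intro b
      obtain ⟨a, ha⟩ := hne
      rw [← Finset.card_pos, hcard b (a.1 k + a.2 k * (x₀ - y k)), Finset.card_pos]
      exact ⟨a, by simp [ha]⟩
    refine ⟨?_, fun t₀ _ => ?_⟩
    -- A uniform consistent pair is a uniform member of a uniformly chosen fibre, and the fibre over
    -- `t₀` is the set of pairs consistent with the additional answer `t₀`.
    · rw [randomConsistent_of_nonempty hne, PMF.uniformOfFinset_eq_bind_fiber hne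
        (fun sr : (Fin P.θ → P.F) × (Fin P.θ → P.F) => sr.1 k + sr.2 k * (x₀ - y k)) _
        (fun b => hcard b 0) hfib, PMF.bind_bind]
      refine congrArg _ (funext fun t₀ => ?_)
      have hC := consistent_update g y x t hk x₀ t₀
      have hne' : (P.consistent g y (Function.update d k true) (Function.update x k x₀)
          (Function.update t k t₀)).Nonempty := by
        rw [hC]
        convert hfib t₀
      rw [randomConsistent_of_nonempty hne']
      have he : PMF.uniformOfFinset _ (hfib t₀) = PMF.uniformOfFinset _ hne' := by
        congr 1
        rw [hC]
      rw [he]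
      refine PMF.bind_congr_support fun sr hsr => ?_
      have := (PMF.mem_support_uniformOfFinset_iff hne' sr).1 hsr
      rw [hC, Finset.mem_filter] at this
      rw [this.2]
    · rw [consistent_update g y x t hk]
      convert hfib t₀

theorem consistent_nonempty (g : P.F) (y : Fin P.θ → P.F) (x t : Fin P.θ → P.F) :
    (P.consistent g y (fun _ => false) x t).Nonempty := by
  obtain ⟨s, hs⟩ := P.exists_shares g
  exact ⟨(s, 0), mem_consistent.2 ⟨hs, by simp⟩⟩

end Params

/-- Before any query the posterior is the prior: only the shares are constrained, and the product of
the two uniform laws is uniform on the product set. As no session is answered, `x` and `t` may be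
anything, such as the initial contents of the simulator's registers. -/
theorem ImplicitCheck.serverRandomness_eq_randomConsistent {n : ℕ} {P : Params n}
    (k : Fin P.prfKeyLen → Bool) (y x t : Fin P.θ → P.F) :
    ImplicitCheck.serverRandomness k y =
      P.randomConsistent (P.tok (P.prf k y)) y (fun _ => false) x t := by
  classical
  have hne := Params.consistent_nonempty (P.tok (P.prf k y)) y x t
  rw [Params.randomConsistent_of_nonempty hne]
  unfold ImplicitCheck.serverRandomness Params.share
  rw [← @Params.unifVec_eq n P P.θ (Fintype.ofFinite _), P.unifVec_eq]
  set X := Finset.univ.filter fun s => P.reconstruct s = P.tok (P.prf k y)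
  have hX : P.consistent (P.tok (P.prf k y)) y (fun _ => false) x t = X ×ˢ Finset.univ := by
    ext sr
    simp [X, Params.mem_consistent]
  ext ⟨s, r⟩
  rw [PMF.bind_apply, tsum_fintype, Finset.sum_eq_single s, PMF.map_apply, tsum_fintype,
    Finset.sum_eq_single r]
  · rw [if_pos rfl, PMF.uniformOfFinset_apply, PMF.uniformOfFinset_apply]
    simp only [hX, Finset.mem_product, Finset.mem_univ, and_true, Finset.card_product]
    split_ifs
    · rw [PMF.uniformOfFintype_apply, Nat.cast_mul, ENNReal.mul_inv (by simp) (by simp),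
        Finset.card_univ]
    · rw [zero_mul]
  · intro r' _ hr
    rw [if_neg]
    simp [hr.symm]
  · simp
  · intro s' _ hs
    rw [PMF.map_apply, tsum_fintype, Finset.sum_eq_zero, mul_zero]
    intro r' _
    rw [if_neg]
    simp [hs.symm]
  · simp

end

noncomputable section

section

variable {n : ℕ} {P : Params n}

open Memory

/-! ### Programs of simulators -/

/-- Where a simulator with temporary registers keeps its registers. -/
def tempReg : SReg ⊕ ℕ → SReg
  | .inl (.sim i) => .sim (2 * i)
  | .inl a => a
  | .inr j => .sim (2 * j + 1)

theorem tempReg_injective : Function.Injective tempReg := by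
  rintro ((i | i | i) | i) ((j | j | j) | j) h <;> simp [tempReg] at h ⊢ <;> omega

/-- The registers of a simulator with temporary registers. -/
def visReg : Loc → Loc
  | .sim i => .sim (2 * i)
  | a => a

theorem visReg_injective : Function.Injective visReg := by
  intro a b h
  cases a <;> cases b <;> simp_all [visReg]

theorem visReg_loc (a : SReg) : visReg a.loc = (tempReg (.inl a)).loc := by cases a <;> rfl

theorem visReg_ereg (a : EReg) : visReg a.loc = a.loc := by cases a <;> rfl

/-- Replace the registers of the simulator. -/
def Memory.merge (m : Memory P Loc) (v : Memory P SReg) : Memory P Loc where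
  bit := fun
    | .sim i => v.bit (.sim i)
    | .chan i => v.bit (.chan i)
    | .port i => v.bit (.port i)
    | a => m.bit a
  fld := fun
    | .sim i => v.fld (.sim i)
    | .chan i => v.fld (.chan i)
    | .port i => v.fld (.port i)
    | a => m.fld a

theorem Memory.merge_pull (m : Memory P Loc) : m.merge (pull SReg.loc m) = m := by
  ext a <;> cases a <;> rfl

theorem Memory.merge_setFld (m : Memory P Loc) (v : Memory P SReg) (a : SReg) (x : P.F) :
    m.merge (v.setFld a x) = (m.merge v).setFld a.loc x := by
  ext b
  · cases b <;> rfl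
  · rw [setFld_fld]
    cases a <;> cases b <;> simp [merge, SReg.loc, setFld_fld]

theorem Memory.merge_setBit (m : Memory P Loc) (v : Memory P SReg) (a : SReg) (x : Bool) :
    m.merge (v.setBit a x) = (m.merge v).setBit a.loc x := by
  ext b
  · rw [setBit_bit]
    cases a <;> cases b <;> simp [merge, SReg.loc, setBit_bit]
  · cases b <;> rfl

theorem Memory.merge_setFlds (m : Memory P Loc) (v : Memory P SReg) (a : ℕ → SReg) {k : ℕ}
    (x : Fin k → P.F) : m.merge (v.setFlds a x) = (m.merge v).setFlds (fun i => (a i).loc) x := by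
  induction k generalizing a v with
  | zero => rfl
  | succ k ih => rw [setFlds_succ, setFlds_succ, ih, merge_setFld]

/-- A step that is implemented, up to temporary registers, by a simulator's program of length at
most `c`. -/
def SImpl (K : Step P) (c : ℕ) : Prop :=
  ∃ p : Prog P SReg, p.length ≤ c ∧ ∀ H m,
    (Prog.run H (p.map (Instr.map SReg.loc)) m).map (pull visReg) = K H (pull visReg m)

theorem SImpl.congr {K K' : Step P} {c : ℕ} (h : SImpl K c) (e : ∀ H m, K H m = K' H m) :
    SImpl K' c := by
  rwa [show K = K' from funext fun H => funext fun m => e H m] at h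

theorem SImpl.seq {K L : Step P} {c d : ℕ} (hK : SImpl K c) (hL : SImpl L d) :
    SImpl (fun H m => (K H m).bind (L H)) (c + d) := by
  obtain ⟨p, hp, hK⟩ := hK
  obtain ⟨q, hq, hL⟩ := hL
  refine ⟨p ++ q, by simp; omega, fun H m => ?_⟩
  change _ = (K H (pull visReg m)).bind (L H)
  rw [List.map_append, Prog.run_append, PMF.map_bind, ← hK, PMF.bind_map]
  exact congrArg _ (funext fun m => hL H m)

theorem SImpl.pure_seq {f : Memory P Loc → Memory P Loc} {L : Step P} {c d : ℕ}
    (hf : SImpl (fun _ m => PMF.pure (f m)) c) (hL : SImpl L d) :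
    SImpl (fun H m => L H (f m)) (c + d) :=
  (hf.seq hL).congr fun _ _ => PMF.pure_bind _ _

theorem SImpl.prog (p : Prog P SReg) :
    SImpl (fun H m => Prog.run H (p.map (Instr.map SReg.loc)) m) p.length := by
  refine ⟨p.map (Instr.map fun a => tempReg (.inl a)), by simp, fun H m => ?_⟩
  rw [List.map_map, Instr.map_comp_map]
  exact Prog.run_pull visReg_injective visReg_loc H p m

/-- A simulator has no spare address space, so temporary registers are interleaved with its own: odd
and even `sim` addresses. What it cannot address is unchanged and is merged back from the old
memory. -/
theorem SImpl.of_impl {K : P.Oracle → Memory P SReg → PMF (Memory P SReg)} {c : ℕ}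
    (h : Impl K c) : SImpl (fun H m => (K H (pull SReg.loc m)).map m.merge) c := by
  obtain ⟨p, hp, h⟩ := h
  refine ⟨p.map (Instr.map tempReg), by simpa using hp, fun H m => ?_⟩
  have hinj : Function.Injective fun a => (tempReg a).loc :=
    SReg.loc_injective.comp tempReg_injective
  rw [List.map_map, Instr.map_comp_map]
  have h1 : pull SReg.loc (pull visReg m) =
      pull Sum.inl (pull (fun a => (tempReg a).loc) m) := by
    ext a <;> cases a <;> rfl
  change _ = (K H (pull SReg.loc (pull visReg m))).map _
  rw [h1, ← h, ← Prog.run_map_pull hinj, PMF.map_comp, PMF.map_comp]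
  refine PMF.map_congr_support fun m' hm' => ?_
  have hf := Prog.run_frame H p hm'
  have key : ∀ a : Loc, (∀ b : SReg, a ≠ b.loc) →
      m'.bit a = m.bit a ∧ m'.fld a = m.fld a := fun a ha => by
    obtain ⟨h1, h2⟩ := hf a (by rintro ⟨b, hb⟩; exact ha _ hb.symm)
    exact ⟨h1.symm, h2.symm⟩
  ext a
  · cases a <;> first | rfl | exact (key _ (by intro b; cases b <;> simp [SReg.loc, visReg])).1
  · cases a <;> first | rfl | exact (key _ (by intro b; cases b <;> simp [SReg.loc, visReg])).2

theorem SImpl.setFld {c : ℕ} (a : SReg) {v : P.Oracle → Memory P SReg → P.F} (hv : FComp v c) :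
    SImpl (fun H m => PMF.pure (m.setFld a.loc (v H (pull SReg.loc m)))) (c + 1) :=
  (SImpl.of_impl (Impl.setFld a hv)).congr fun H m => by
    rw [PMF.pure_map, merge_setFld, merge_pull]

theorem SImpl.setBit {c : ℕ} (a : SReg) {v : P.Oracle → Memory P SReg → Bool} (hv : BComp v c) :
    SImpl (fun H m => PMF.pure (m.setBit a.loc (v H (pull SReg.loc m)))) (c + 2) :=
  (SImpl.of_impl (Impl.setBit a hv)).congr fun H m => by
    rw [PMF.pure_map, merge_setBit, merge_pull]

theorem SImpl.setFlds {c k : ℕ} (a : ℕ → SReg) {v : Fin k → P.Oracle → Memory P SReg → P.F}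
    (hv : ∀ i, FComp (v i) c) :
    SImpl (fun H m => PMF.pure (m.setFlds (fun i => (a i).loc) fun i =>
      v i H (pull SReg.loc m))) (k * (c + 1)) :=
  (SImpl.of_impl (Impl.setFlds a hv)).congr fun H m => by
    rw [PMF.pure_map, merge_setFlds, merge_pull]

/-! ### The simulator for a corrupt client -/

/-- Bit: whether the query of session `j` has been made; field: the answer. -/
def ansReg (j : ℕ) : SReg := .sim (Nat.pair 2 j)

/-- The query of session `j`. -/
def argReg (j : ℕ) : SReg := .sim (Nat.pair 3 j)

/-- Bit: whether a query is being answered; field: a random element. -/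
def flagReg : SReg := .sim (Nat.pair 4 0)

/-- Record the query of session `k`, if there is a new one, and query the functionality if all
queries have been made. -/
def recordQuery (k : ℕ) (m : Memory P Loc) : Memory P Loc :=
  -- The outcome of the test is kept in a flag, because the next write changes the bit of `ansReg k`
  -- on which it depends.
  let m := m.setBit flagReg.loc (m.bit (simReg k (.port 0)).loc && !m.bit (ansReg k).loc)
  let m := m.setBit (ansReg k).loc (m.bit flagReg.loc || m.bit (ansReg k).loc)
  let m := m.setFld (argReg k).loc
    (if m.bit flagReg.loc then m.fld (simReg k (.port 0)).loc else m.fld (argReg k).loc)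
  -- The request to `F_IC` is raised only in the activation in which the last missing query arrives,
  -- hence at most once.
  let m := m.setBit (.port 0)
    (m.bit flagReg.loc && decide (∀ j : Fin P.θ, m.bit (ansReg j).loc = true))
  -- The collected queries are laid out at every activation; without a request `F_IC` does not read
  -- them.
  m.setFlds Loc.port fun j : Fin P.θ => m.fld (argReg j).loc

/-- The last answer, if it is determined by the value of the functionality. -/
def lastAnswer (k : Fin P.θ) (m : Memory P Loc) : P.F :=
  (P.coef k)⁻¹ * (P.tok (m.bits (fun i => .port (2 + i)) n) -
    ∑ j, if j = k then 0 else P.coef j * m.fld (ansReg j).loc)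

/-- Answer the query of session `k`, if there is a new one. -/
def answerQuery (k : Fin P.θ) (u : P.F) (m : Memory P Loc) : Memory P Loc :=
  let m := m.setFld flagReg.loc u
  let m := m.setFld (ansReg k).loc (if m.bit flagReg.loc then
    -- Bit `port 1` is trusted only together with the request bit; in all other cases the answer is
    -- the fresh random element.
    (if m.bit (.port 0) && m.bit (.port 1) then lastAnswer k m else m.fld flagReg.loc)
    else m.fld (ansReg k).loc)
  m.setFld (simReg k (.port 1)).loc
    (if m.bit flagReg.loc then m.fld (ansReg k).loc else m.fld (simReg k (.port 1)).loc)

theorem SImpl.recordQuery (k : ℕ) :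
    SImpl (fun _ (m : Memory P Loc) => PMF.pure (recordQuery k m)) (7 * P.θ + 40) := by
  have hb : ∀ a : SReg, BComp (P := P) (fun _ v => v.bit a) 3 := BComp.reg
  have hf : ∀ a : SReg, FComp (P := P) (fun _ v => v.fld a) 1 := FComp.reg
  have h1 := SImpl.setBit flagReg ((hb (simReg k (.port 0))).and (hb (ansReg k)).not)
  have h2 := SImpl.setBit (ansReg k) ((hb flagReg).or (hb (ansReg k)))
  have h3 := SImpl.setFld (argReg k)
    (FComp.mux (hb flagReg) (hf (simReg k (.port 0))) (hf (argReg k)))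
  have h4 := SImpl.setBit (.port 0)
    ((hb flagReg).and (BComp.forall fun j : Fin P.θ => hb (ansReg j)))
  have h5 := SImpl.setFlds SReg.port fun j : Fin P.θ => hf (argReg j)
  have h := h1.pure_seq (h2.pure_seq (h3.pure_seq (h4.pure_seq h5)))
  obtain ⟨p, hp, h⟩ := h
  exact ⟨p, hp.trans (by omega), h⟩

theorem FComp.lastAnswer (k : Fin P.θ) :
    FComp (fun _ (v : Memory P SReg) => (P.coef k)⁻¹ * (P.tok (v.bits (fun i => .port (2 + i)) n) -
      ∑ j : Fin P.θ, if j = k then 0 else P.coef j * v.fld (ansReg j))) (3 * n + 4 * P.θ + 7) := by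
  have h1 : FComp (P := P) (fun _ (v : Memory P SReg) =>
      P.tok fun i => v.bit (.port (2 + (i : ℕ)))) (n * 3 + 1) :=
    FComp.tok fun i => BComp.reg (SReg.port (2 + (i : ℕ)))
  have h2 : FComp (P := P) (fun _ (v : Memory P SReg) =>
      ∑ j : Fin P.θ, if j = k then 0 else P.coef j * v.fld (ansReg j)) (P.θ * (3 + 1) + 1) := by
    refine FComp.sum (v := fun j _ v => if j = k then 0 else P.coef j * v.fld (ansReg j))
      fun j => ?_
    by_cases hj : j = k
    · simp only [hj, if_true]
      exact (FComp.const _).mono (by omega)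
    · simp only [hj, if_false]
      exact (FComp.const _).mul (FComp.reg _)
  exact ((FComp.const _).mul (h1.sub h2)).mono (by omega)

theorem SImpl.answerQuery (k : Fin P.θ) :
    SImpl (fun _ (m : Memory P Loc) => P.unif.map fun u => answerQuery k u m)
      (3 * n + 4 * P.θ + 40) := by
  have hb : ∀ a : SReg, BComp (P := P) (fun _ v => v.bit a) 3 := BComp.reg
  have hf : ∀ a : SReg, FComp (P := P) (fun _ v => v.fld a) 1 := FComp.reg
  have h1 := SImpl.prog (P := P) [.funif flagReg]
  have h2 := SImpl.setFld (ansReg k) (FComp.mux (hb flagReg)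
    (FComp.mux ((hb (.port 0)).and (hb (.port 1))) (FComp.lastAnswer k) (hf flagReg))
    (hf (ansReg k)))
  have h3 := SImpl.setFld (simReg k (.port 1))
    (FComp.mux (hb flagReg) (hf (ansReg k)) (hf (simReg k (.port 1))))
  obtain ⟨p, hp, h⟩ := (h1.seq (h2.pure_seq h3)).congr (K' := fun _ m =>
    P.unif.map fun u => _root_.answerQuery k u m) fun H m => by
      rw [List.map_singleton, Prog.run_singleton]
      simp only [Instr.map, Instr.step]
      rw [PMF.bind_map]
      rfl
  exact ⟨p, hp.trans (by simp; omega), h⟩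

end

end

noncomputable section

section

variable {n : ℕ} {P : Params n}

open Memory

/-! ### The state of the simulator for a corrupt client -/

theorem ansReg_loc_inj {i j : ℕ} : (ansReg i).loc = (ansReg j).loc ↔ i = j := by
  simp [ansReg, SReg.loc, Nat.pair_eq_pair]

theorem argReg_loc_inj {i j : ℕ} : (argReg i).loc = (argReg j).loc ↔ i = j := by
  simp [argReg, SReg.loc, Nat.pair_eq_pair]

/-- The sessions whose queries have been made. -/
def doneOf (m : Memory P Loc) : Fin P.θ → Bool := fun j => m.bit (ansReg j).loc

/-- The queries. -/
def argOf (m : Memory P Loc) : Fin P.θ → P.F := fun j => m.fld (argReg j).loc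

/-- The answers. -/
def ansOf (m : Memory P Loc) : Fin P.θ → P.F := fun j => m.fld (ansReg j).loc

/-- The server's token. -/
def tokenOf (m : Memory P Loc) : Fin P.θ → P.F := m.flds (fun i => .fn i) P.θ

/-- The server's secret. -/
def secretOf (m : Memory P Loc) : P.F :=
  P.tok (P.prf (m.bits (fun i => .fn (1 + i)) P.prfKeyLen) (tokenOf m))

/-- The shares and masks that are consistent with the answers. -/
def consistentOf (m : Memory P Loc) : Finset ((Fin P.θ → P.F) × (Fin P.θ → P.F)) :=
  P.consistent (secretOf m) (tokenOf m) (doneOf m) (argOf m) (ansOf m)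

/-- Random shares and masks that are consistent with the answers. -/
def masksOf (m : Memory P Loc) : PMF ((Fin P.θ → P.F) × (Fin P.θ → P.F)) :=
  P.randomConsistent (secretOf m) (tokenOf m) (doneOf m) (argOf m) (ansOf m)

/-- Equality up to the registers that are used only while a query is answered. -/
def CoreEq (m m' : Memory P Loc) : Prop :=
  EqOn {a | a ≠ .fn 0 ∧ a ≠ flagReg.loc ∧ ∀ i, a ≠ .port i} m m' ∧ m.fld (.fn 0) = m'.fld (.fn 0)

namespace CoreEq

variable {m m' m'' : Memory P Loc}

theorem refl (m : Memory P Loc) : CoreEq m m := ⟨EqOn.refl _ _, rfl⟩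

theorem trans (h : CoreEq m m') (h' : CoreEq m' m'') : CoreEq m m'' :=
  ⟨h.1.trans h'.1, h.2.trans h'.2⟩

theorem setBit (h : CoreEq m m') (a : Loc) (x : Bool) : CoreEq (m.setBit a x) (m'.setBit a x) :=
  ⟨fun b hb => ⟨by simp only [setBit_bit, (h.1 b hb).1], (h.1 b hb).2⟩, h.2⟩

theorem setFld (h : CoreEq m m') (a : Loc) (x : P.F) : CoreEq (m.setFld a x) (m'.setFld a x) :=
  ⟨fun b hb => ⟨(h.1 b hb).1, by simp only [setFld_fld, (h.1 b hb).2]⟩, by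
    simp only [setFld_fld, h.2]⟩

theorem dropBit (m : Memory P Loc) {a : Loc}
    (ha : a ∉ {a : Loc | a ≠ .fn 0 ∧ a ≠ flagReg.loc ∧ ∀ i, a ≠ .port i}) (x : Bool) :
    CoreEq (m.setBit a x) m :=
  ⟨fun b hb => ⟨setBit_bit_of_ne _ _ fun (e : b = a) => ha (e ▸ hb), rfl⟩, rfl⟩

/-- The address `fn 0` plays two roles: its bit says whether `F_IC` has been used and is ignored by
`CoreEq`, whereas its field is a coordinate of the server's token and must be kept. -/
theorem dropFld (m : Memory P Loc) {a : Loc}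
    (ha : a ∉ {a : Loc | a ≠ .fn 0 ∧ a ≠ flagReg.loc ∧ ∀ i, a ≠ .port i}) (h0 : a ≠ .fn 0)
    (x : P.F) : CoreEq (m.setFld a x) m :=
  ⟨fun b hb => ⟨rfl, setFld_fld_of_ne _ _ fun (e : b = a) => ha (e ▸ hb)⟩,
    setFld_fld_of_ne _ _ h0.symm⟩

theorem dropPortBits (m : Memory P Loc) (a : ℕ → ℕ) {k : ℕ} (v : Fin k → Bool) :
    CoreEq (m.setBits (fun i => .port (a i)) v) m :=
  ⟨fun b hb => ⟨setBits_bit_of_ne _ _ _ fun i _ => hb.2.2 _, by rw [setBits_fld]⟩,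
    by rw [setBits_fld]⟩

theorem dropPortFlds (m : Memory P Loc) {k : ℕ} (v : Fin k → P.F) :
    CoreEq (m.setFlds Loc.port v) m :=
  ⟨fun b hb => ⟨by rw [setFlds_bit], setFlds_fld_of_ne _ _ _ fun i _ => hb.2.2 _⟩,
    setFlds_fld_of_ne _ _ _ (by simp)⟩

theorem bit (h : CoreEq m m') {a : Loc} (h0 : a ≠ .fn 0) (h1 : a ≠ flagReg.loc)
    (h2 : ∀ i, a ≠ .port i) : m.bit a = m'.bit a := (h.1 a ⟨h0, h1, h2⟩).1

theorem fld (h : CoreEq m m') {a : Loc} (h1 : a ≠ flagReg.loc)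
    (h2 : ∀ i, a ≠ .port i) : m.fld a = m'.fld a := by
  by_cases h0 : a = .fn 0
  · rw [h0]; exact h.2
  · exact (h.1 a ⟨h0, h1, h2⟩).2

theorem doneOf (h : CoreEq m m') : doneOf m = doneOf m' := funext fun j =>
  h.bit (by simp [ansReg, SReg.loc]) (by simp [ansReg, flagReg, SReg.loc, Nat.pair_eq_pair])
    (by simp [ansReg, SReg.loc])

theorem argOf (h : CoreEq m m') : argOf m = argOf m' := funext fun j =>
  h.fld (by simp [argReg, flagReg, SReg.loc, Nat.pair_eq_pair]) (by simp [argReg, SReg.loc])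

theorem ansOf (h : CoreEq m m') : ansOf m = ansOf m' := funext fun j =>
  h.fld (by simp [ansReg, flagReg, SReg.loc, Nat.pair_eq_pair]) (by simp [ansReg, SReg.loc])

theorem tokenOf (h : CoreEq m m') : tokenOf m = tokenOf m' := funext fun j =>
  h.fld (by simp [flagReg, SReg.loc]) (by simp)

theorem secretOf (h : CoreEq m m') : secretOf m = secretOf m' := by
  unfold _root_.secretOf
  rw [h.tokenOf, show m.bits (fun i => .fn (1 + i)) P.prfKeyLen =
    m'.bits (fun i => .fn (1 + i)) P.prfKeyLen from funext fun i =>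
      h.bit (by simp) (by simp [flagReg, SReg.loc]) (by simp)]

theorem masksOf (h : CoreEq m m') : masksOf m = masksOf m' := by
  unfold _root_.masksOf
  rw [h.secretOf, h.tokenOf, h.doneOf, h.argOf, h.ansOf]

theorem consistentOf (h : CoreEq m m') : consistentOf m = consistentOf m' := by
  unfold _root_.consistentOf
  rw [h.secretOf, h.tokenOf, h.doneOf, h.argOf, h.ansOf]

theorem simFresh (h : CoreEq m m') {k : ℕ} (hk : SimFresh k m) : SimFresh k m' :=
  hk.of_eqOn fun a ⟨c, hc, k', _, i, ha⟩ => h.1 a (by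
    subst ha
    refine ⟨by simp, ?_, by simp⟩
    simp only [flagReg, SReg.loc, ne_eq, Loc.sim.injEq, Nat.pair_eq_pair]
    omega)

end CoreEq

/-- Record the query `x` of session `k` and its answer `t`. -/
def record (k : ℕ) (x t : P.F) (m : Memory P Loc) : Memory P Loc :=
  (((m.setBit (ansReg k).loc true).setFld (argReg k).loc x).setFld (ansReg k).loc t).setFld
    (simReg k (.port 1)).loc t

theorem doneOf_record (k : Fin P.θ) (x t : P.F) (m : Memory P Loc) :
    doneOf (record k x t m) = Function.update (doneOf m) k true := by
  funext j
  simp only [doneOf, record, setFld_bit, setBit_bit, ansReg_loc_inj, Function.update_apply,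
    Fin.val_inj]

theorem argOf_record (k : Fin P.θ) (x t : P.F) (m : Memory P Loc) :
    argOf (record k x t m) = Function.update (argOf m) k x := by
  funext j
  simp only [argOf, record]
  rw [setFld_fld_of_ne _ _ (by simp [argReg, simReg, SReg.loc, Nat.pair_eq_pair]),
    setFld_fld_of_ne _ _ (by simp [argReg, ansReg, SReg.loc, Nat.pair_eq_pair]), setFld_fld]
  simp only [argReg_loc_inj, Function.update_apply, Fin.val_inj]
  rfl

theorem ansOf_record (k : Fin P.θ) (x t : P.F) (m : Memory P Loc) :
    ansOf (record k x t m) = Function.update (ansOf m) k t := by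
  funext j
  simp only [ansOf, record]
  rw [setFld_fld_of_ne _ _ (by simp [ansReg, simReg, SReg.loc, Nat.pair_eq_pair]), setFld_fld]
  simp only [ansReg_loc_inj, Function.update_apply, Fin.val_inj]
  split_ifs
  · rfl
  · rw [setFld_fld_of_ne _ _ (by simp [argReg, ansReg, SReg.loc, Nat.pair_eq_pair])]
    rfl

theorem tokenOf_record (k : ℕ) (x t : P.F) (m : Memory P Loc) :
    tokenOf (record k x t m) = tokenOf m := by
  funext j
  simp only [tokenOf, flds, record]
  rw [setFld_fld_of_ne _ _ (by simp [simReg, SReg.loc]),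
    setFld_fld_of_ne _ _ (by simp [ansReg, SReg.loc]),
    setFld_fld_of_ne _ _ (by simp [argReg, SReg.loc])]
  rfl

theorem secretOf_record (k : ℕ) (x t : P.F) (m : Memory P Loc) :
    secretOf (record k x t m) = secretOf m := by
  unfold secretOf
  rw [tokenOf_record]
  congr 2
  funext i
  simp only [bits, record, setFld_bit]
  exact setBit_bit_of_ne _ _ (by simp [ansReg, SReg.loc])

/-! ### Answering a query -/

/-- Whether there is a new query in session `k`. -/
def isNew (k : ℕ) (m : Memory P Loc) : Bool :=
  m.bit (simReg k (.port 0)).loc && !m.bit (ansReg k).loc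

theorem recordQuery_of_not_isNew {k : ℕ} {m : Memory P Loc} (h : isNew k m = false) :
    recordQuery k m = ((m.setBit flagReg.loc false).setBit (.port 0) false).setFlds Loc.port
      (argOf m) := by
  unfold isNew at h
  unfold recordQuery
  have h1 : ((m.setBit flagReg.loc false).setBit (ansReg k).loc
      ((m.setBit flagReg.loc false).bit (ansReg k).loc)) = m.setBit flagReg.loc false :=
    setBit_same _ _
  have h2 : ((m.setBit flagReg.loc false).setFld (argReg k).loc (m.fld (argReg k).loc)) =
    m.setBit flagReg.loc false := setFld_same (m.setBit flagReg.loc false) _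
  simp only [h, setBit_bit_self, Bool.false_or, h1, Bool.false_eq_true, if_false, setBit_fld, h2,
    Bool.false_and]
  rfl

theorem recordQuery_of_isNew {k : ℕ} {m : Memory P Loc} (h : isNew k m = true) :
    recordQuery k m = (((((m.setBit flagReg.loc true).setBit (ansReg k).loc true).setFld
      (argReg k).loc (m.fld (simReg k (.port 0)).loc))).setBit (.port 0)
        (decide (∀ j : Fin P.θ, (m.setBit (ansReg k).loc true).bit (ansReg j).loc = true))).setFlds
      Loc.port (argOf (m.setFld (argReg k).loc (m.fld (simReg k (.port 0)).loc))) := by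
  unfold isNew at h
  have h0 : (ansReg k).loc ≠ flagReg.loc := by
    simp [ansReg, flagReg, SReg.loc, Nat.pair_eq_pair]
  have h1 : ∀ j, ((m.setBit flagReg.loc true).setBit (ansReg k).loc true).bit (ansReg j).loc =
      (m.setBit (ansReg k).loc true).bit (ansReg j).loc := fun j => by
    simp only [setBit_bit]
    rw [if_neg (show (ansReg j).loc ≠ flagReg.loc by
      simp [ansReg, flagReg, SReg.loc, Nat.pair_eq_pair])]
  unfold recordQuery
  simp only [h, setBit_bit_self, Bool.true_or, setBit_bit_of_ne _ _ h0.symm, if_true, setFld_bit,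
    Bool.true_and, setBit_fld, h1]
  rfl

theorem coreEq_icAnswer (m : Memory P Loc) : CoreEq (ImplicitCheck.icAnswer m) m := by
  unfold ImplicitCheck.icAnswer
  split_ifs
  · split
    · exact ((CoreEq.dropPortBits _ _ _).trans (CoreEq.dropBit _ (by simp) _)).trans
        (CoreEq.dropBit _ (by simp) _)
    · exact (CoreEq.dropBit _ (by simp) _).trans (CoreEq.dropBit _ (by simp) _)
  · exact CoreEq.refl m

theorem icAnswer_bit_fn (m : Memory P Loc) (h : (ImplicitCheck.icAnswer m).bit (.fn 0) = true) :
    m.bit (.fn 0) = true ∨ m.bit (.port 0) = true := by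
  unfold ImplicitCheck.icAnswer at h
  split_ifs at h with hc
  · simp only [Bool.and_eq_true] at hc
    exact Or.inr hc.1
  · exact Or.inl h

theorem icAnswer_bit_flag (m : Memory P Loc) :
    (ImplicitCheck.icAnswer m).bit flagReg.loc = m.bit flagReg.loc := by
  unfold ImplicitCheck.icAnswer
  split_ifs
  · split
    · rw [setBits_bit_of_ne _ _ _ (by simp [flagReg, SReg.loc]),
        setBit_bit_of_ne _ _ (by simp [flagReg, SReg.loc]),
        setBit_bit_of_ne _ _ (by simp [flagReg, SReg.loc])]
    · rw [setBit_bit_of_ne _ _ (by simp [flagReg, SReg.loc]),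
        setBit_bit_of_ne _ _ (by simp [flagReg, SReg.loc])]
  · rfl

theorem answerQuery_of_flag_false (k : Fin P.θ) (u : P.F) {m : Memory P Loc}
    (h : m.bit flagReg.loc = false) : answerQuery k u m = m.setFld flagReg.loc u := by
  unfold answerQuery
  simp only [setFld_bit, h, Bool.false_eq_true, if_false]
  rw [setFld_same, setFld_same]

theorem answerQuery_of_flag (k : Fin P.θ) (u : P.F) {m : Memory P Loc}
    (h : m.bit flagReg.loc = true) : answerQuery k u m =
      ((m.setFld flagReg.loc u).setFld (ansReg k).loc
        (if m.bit (.port 0) && m.bit (.port 1) then lastAnswer k m else u)).setFld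
      (simReg k (.port 1)).loc
        (if m.bit (.port 0) && m.bit (.port 1) then lastAnswer k m else u) := by
  unfold answerQuery
  have hl : lastAnswer k (m.setFld flagReg.loc u) = lastAnswer k m := by
    unfold lastAnswer
    refine congrArg (fun z => (P.coef k)⁻¹ * (P.tok (m.bits (fun i => .port (2 + i)) n) - z)) ?_
    refine Finset.sum_congr rfl fun j _ => ?_
    rw [setFld_fld_of_ne _ _ (by simp [ansReg, flagReg, SReg.loc, Nat.pair_eq_pair])]
  simp only [setFld_bit, h, if_true, setFld_fld_self, hl]

/-- The part of an activation in which a query is answered. -/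
def answerBlock (k : Fin P.θ) : Step P := fun _ m =>
  P.unif.map fun u => answerQuery k u (ImplicitCheck.icAnswer (recordQuery k m))

/-- What holds while the sessions from `k` on have not been started. -/
structure ClientInv (k : ℕ) (m : Memory P Loc) : Prop where
  fresh : SimFresh k m
  not_done : ∀ j : Fin P.θ, k ≤ j → doneOf m j = false
  all_done : m.bit (.fn 0) = true → ∀ j, doneOf m j = true
  nonempty : (consistentOf m).Nonempty

/-- With the flag cleared no request is raised, `F_IC` stays silent, and only scratch registers
change, whatever random element is drawn. -/
theorem answerBlock_of_not_isNew {k : Fin P.θ} {m : Memory P Loc} (h : isNew k m = false)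
    (u : P.F) : CoreEq (answerQuery k u (ImplicitCheck.icAnswer (recordQuery k m))) m ∧
      (answerQuery k u (ImplicitCheck.icAnswer (recordQuery k m))).bit (.fn 0) =
        m.bit (.fn 0) := by
  have hp : (recordQuery k m).bit (.port 0) = false := by
    rw [recordQuery_of_not_isNew h, setFlds_bit, setBit_bit_self]
  have hf : (recordQuery k m).bit flagReg.loc = false := by
    rw [recordQuery_of_not_isNew h, setFlds_bit,
      setBit_bit_of_ne _ _ (by simp [flagReg, SReg.loc]), setBit_bit_self]
  have hi : ImplicitCheck.icAnswer (recordQuery k m) = recordQuery k m := by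
    unfold ImplicitCheck.icAnswer
    rw [hp]
    rfl
  rw [hi, answerQuery_of_flag_false k u hf, recordQuery_of_not_isNew h]
  refine ⟨(CoreEq.dropFld _ (by simp) (by simp [flagReg, SReg.loc]) _).trans
    ((CoreEq.dropPortFlds _ _).trans ((CoreEq.dropBit _ (by simp) _).trans
      (CoreEq.dropBit _ (by simp) _))), ?_⟩
  rw [setFld_bit, setFlds_bit, setBit_bit_of_ne _ _ (by simp),
    setBit_bit_of_ne _ _ (by simp [flagReg, SReg.loc])]

/-- The code of the simulator realizes the abstract law `Params.answer`: a single uniform `u` is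
drawn and then used or discarded, which is the map `v`. Afterwards, up to scratch registers, the
query and its answer have been recorded. -/
theorem answerBlock_of_isNew {k : Fin P.θ} {m : Memory P Loc} (h : isNew k m = true)
    (hm : m.bit (.fn 0) = true → ∀ j, doneOf m j = true) :
    ∃ v : P.F → P.F, P.unif.map v = P.answer (secretOf m) (tokenOf m) (doneOf m) (argOf m)
        (ansOf m) k (m.fld (simReg k (.port 0)).loc) ∧
      ∀ u, CoreEq (answerQuery k u (ImplicitCheck.icAnswer (recordQuery k m)))
        (record k (m.fld (simReg k (.port 0)).loc) (v u) m) ∧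
      ((answerQuery k u (ImplicitCheck.icAnswer (recordQuery k m))).bit (.fn 0) = true →
        ∀ j, doneOf (record k (m.fld (simReg k (.port 0)).loc) (v u) m) j = true) := by
  classical
  have hnew : m.bit (ansReg k).loc = false := by
    simp only [isNew, Bool.and_eq_true, Bool.not_eq_true'] at h
    exact h.2
  -- `F_IC` cannot have been used yet, since session `k` is unanswered and `F_IC` is queried only
  -- when all queries are known.
  have hfn : m.bit (.fn 0) = false := by
    by_contra hc
    have := hm (by simpa using hc) k
    rw [doneOf, hnew] at this
    simp at this
  set x := m.fld (simReg k (.port 0)).loc with hx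
  set m₁ := recordQuery k m with hm₁
  set m₂ := ImplicitCheck.icAnswer m₁ with hm₂
  have e₁ := recordQuery_of_isNew h
  rw [← hm₁, ← hx] at e₁
  have hflag : m₂.bit flagReg.loc = true := by
    rw [hm₂, icAnswer_bit_flag, e₁, setFlds_bit, setBit_bit_of_ne _ _ (by simp [flagReg, SReg.loc]),
      setFld_bit, setBit_bit_of_ne _ _ (by simp [ansReg, flagReg, SReg.loc, Nat.pair_eq_pair]),
      setBit_bit_self]
  have hdone : ∀ t j, doneOf (record k x t m) j = (m.setBit (ansReg k).loc true).bit (ansReg j).loc :=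
    fun t j => rfl
  have hport : m₁.bit (.port 0) =
      decide (∀ j : Fin P.θ, (m.setBit (ansReg k).loc true).bit (ansReg j).loc = true) := by
    rw [e₁, setFlds_bit, setBit_bit_self]
  have hcore : CoreEq m₂ ((m.setBit (ansReg k).loc true).setFld (argReg k).loc x) := by
    refine (coreEq_icAnswer m₁).trans ?_
    rw [e₁]
    exact (CoreEq.dropPortFlds _ _).trans ((CoreEq.dropBit _ (by simp) _).trans
      (((CoreEq.dropBit _ (by simp) _).setBit _ _).setFld _ _))
  have hfn₁ : m₁.bit (.fn 0) = false := by
    rw [e₁, setFlds_bit, setBit_bit_of_ne _ _ (by simp), setFld_bit,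
      setBit_bit_of_ne _ _ (by simp [ansReg, SReg.loc]),
      setBit_bit_of_ne _ _ (by simp [flagReg, SReg.loc]), hfn]
  -- The value of `m₂` is independent of `u`, so the choice between the forced answer and `u` has
  -- been made before `u` is drawn.
  refine ⟨fun u => if m₂.bit (.port 0) && m₂.bit (.port 1) then lastAnswer k m₂ else u, ?_,
    fun u => ⟨?_, fun hc j => ?_⟩⟩
  · have hans : ∀ j, m₂.fld (ansReg j).loc = m.fld (ansReg j).loc := fun j => by
      rw [hcore.fld (by simp [ansReg, flagReg, SReg.loc, Nat.pair_eq_pair])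
        (by simp [ansReg, SReg.loc]),
        setFld_fld_of_ne _ _ (by simp [ansReg, argReg, SReg.loc, Nat.pair_eq_pair])]
      rfl
    have hfull : (∀ j : Fin P.θ, (m.setBit (ansReg k).loc true).bit (ansReg j).loc = true) ↔
        ∀ j, j ≠ k → doneOf m j = true := by
      refine forall_congr' fun j => ?_
      rw [setBit_bit]
      simp only [ansReg_loc_inj, Fin.val_inj, doneOf]
      by_cases hj : j = k <;> simp [hj]
    have hargs : m₁.flds (fun i => .port i) P.θ = Function.update (argOf m) k x := by
      rw [e₁]
      refine (flds_setFlds _ (fun i j hij => by simpa using hij) _).trans ?_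
      funext j
      simp only [argOf, setFld_fld, argReg_loc_inj, Fin.val_inj, Function.update_apply]
    have hcm₁ : CoreEq m₁ ((m.setBit (ansReg k).loc true).setFld (argReg k).loc x) := by
      rw [e₁]
      exact (CoreEq.dropPortFlds _ _).trans ((CoreEq.dropBit _ (by simp) _).trans
        (((CoreEq.dropBit _ (by simp) _).setBit _ _).setFld _ _))
    have htok₁ : m₁.flds (fun i => .fn i) P.θ = tokenOf m := by
      funext j
      simp only [flds, tokenOf]
      rw [hcm₁.fld (by simp [flagReg, SReg.loc]) (by simp),
        setFld_fld_of_ne _ _ (by simp [argReg, SReg.loc])]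
      rfl
    have hkey₁ : m₁.bits (fun i => .fn (1 + i)) P.prfKeyLen =
        m.bits (fun i => .fn (1 + i)) P.prfKeyLen := by
      funext j
      simp only [bits]
      rw [hcm₁.bit (by simp) (by simp [flagReg, SReg.loc]) (by simp), setFld_bit,
        setBit_bit_of_ne _ _ (by simp [ansReg, SReg.loc])]
    unfold Params.answer
    -- Three cases match those of `Params.answer`: complete and correct (the answer is forced by
    -- `γ`), complete but wrong (`F_IC` yields `⊥`, so `u` is used), and incomplete (no request, so
    -- `u` is used).
    by_cases hall : ∀ j, j ≠ k → doneOf m j = true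
    · have hp1 : m₁.bit (.port 0) = true := by rw [hport, decide_eq_true (hfull.2 hall)]
      by_cases hy : tokenOf m = Function.update (argOf m) k x
      · have hF : P.fIC (m₁.flds (fun i => .port i) P.θ)
            (m₁.bits (fun i => .fn (1 + i)) P.prfKeyLen) (m₁.flds (fun i => .fn i) P.θ) =
            some (P.prf (m.bits (fun i => .fn (1 + i)) P.prfKeyLen) (tokenOf m)) := by
          rw [hargs, hkey₁, htok₁, Params.fIC, if_pos hy, ← hy]
        have e₂ : m₂ = ((m₁.setBit (.fn 0) true).setBit (.port 1) true).setBits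
            (fun i => .port (2 + i))
            (P.prf (m.bits (fun i => .fn (1 + i)) P.prfKeyLen) (tokenOf m)) := by
          rw [hm₂, ImplicitCheck.icAnswer, hp1, hfn₁, hF]
          rfl
        have h0 : m₂.bit (.port 0) = true := by
          rw [e₂, setBits_bit_of_ne _ _ _ (by simp; omega), setBit_bit_of_ne _ _ (by simp),
            setBit_bit_of_ne _ _ (by simp), hp1]
        have h1 : m₂.bit (.port 1) = true := by
          rw [e₂, setBits_bit_of_ne _ _ _ (by simp; omega), setBit_bit_self]
        have hv : lastAnswer k m₂ = (P.coef k)⁻¹ * (secretOf m -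
            ∑ j, if j = k then 0 else P.coef j * ansOf m j) := by
          unfold lastAnswer
          have hb : m₂.bits (fun i => .port (2 + i)) n =
              P.prf (m.bits (fun i => .fn (1 + i)) P.prfKeyLen) (tokenOf m) := by
            rw [e₂]
            exact bits_setBits _ (fun i j hij => by simpa using hij) _
          rw [hb]
          simp only [hans]
          rfl
        rw [if_pos ⟨hall, hy⟩]
        simp only [h0, h1, Bool.and_self, if_true, hv]
        exact PMF.map_const _ _
      · have hF : P.fIC (m₁.flds (fun i => .port i) P.θ)
            (m₁.bits (fun i => .fn (1 + i)) P.prfKeyLen) (m₁.flds (fun i => .fn i) P.θ) =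
            none := by
          rw [hargs, hkey₁, htok₁, Params.fIC, if_neg hy]
        -- On `⊥` the functionality actively clears `port 1`, so no leftover bit can be mistaken for
        -- success.
        have h1 : m₂.bit (.port 1) = false := by
          rw [hm₂, ImplicitCheck.icAnswer, hp1, hfn₁, hF]
          simp
        rw [if_neg fun hc => hy hc.2]
        simp only [h1, Bool.and_false, Bool.false_eq_true, if_false]
        exact PMF.map_id _
    · have hp1 : m₁.bit (.port 0) = false := by
        rw [hport, decide_eq_false fun hc => hall (hfull.1 hc)]
      have h0 : m₂.bit (.port 0) = false := by
        rw [hm₂, ImplicitCheck.icAnswer, hp1]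
        exact hp1
      rw [if_neg fun hc => hall hc.1]
      simp only [h0, Bool.false_and, Bool.false_eq_true, if_false]
      exact PMF.map_id _
  · rw [answerQuery_of_flag k u hflag]
    exact ((CoreEq.dropFld _ (by simp) (by simp [flagReg, SReg.loc]) _).trans hcore).setFld _ _
      |>.setFld _ _
  · rw [answerQuery_of_flag k u hflag, setFld_bit, setFld_bit, setFld_bit] at hc
    rcases icAnswer_bit_fn m₁ hc with hc | hc
    · rw [hfn₁] at hc
      simp at hc
    · rw [hport, decide_eq_true_eq] at hc
      exact hc j

end

end

noncomputable section

section

variable {n : ℕ} {P : Params n}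

open Memory

theorem Memory.setFlds_fld_congr {A : Type} {m m' : Memory P A} {b : A} (h : m.fld b = m'.fld b)
    (a : ℕ → A) {k : ℕ} (v : Fin k → P.F) :
    (m.setFlds a v).fld b = (m'.setFlds a v).fld b := by
  induction k generalizing m m' a with
  | zero => exact h
  | succ k ih =>
    rw [setFlds_succ, setFlds_succ]
    exact ih (by simp only [setFld_fld, h]) _ _

/-! ### The honest server's state behind the state of the simulator -/

/-- The registers that determine the distribution of the server's randomness. -/
def stateLocs : Set Loc := {a | (∃ i, a = .fn i) ∨ ∃ c ≥ 2, ∃ i, a = .sim (Nat.pair c i)}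

variable {m m' : Memory P Loc}

theorem doneOf_congr (h : EqOn stateLocs m m') : doneOf m = doneOf m' :=
  funext fun j => (h _ (Or.inr ⟨2, le_rfl, j, rfl⟩)).1

theorem tokenOf_congr (h : EqOn stateLocs m m') : tokenOf m = tokenOf m' :=
  funext fun j => (h _ (Or.inl ⟨j, rfl⟩)).2

theorem consistentOf_masksOf_congr (h : EqOn stateLocs m m') :
    consistentOf m = consistentOf m' ∧ masksOf m = masksOf m' := by
  have h1 : argOf m = argOf m' := funext fun j => (h _ (Or.inr ⟨3, by omega, j, rfl⟩)).2
  have h2 : ansOf m = ansOf m' := funext fun j => (h _ (Or.inr ⟨2, le_rfl, j, rfl⟩)).2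
  have h3 : secretOf m = secretOf m' := by
    unfold secretOf
    rw [tokenOf_congr h, show m.bits (fun i => .fn (1 + i)) P.prfKeyLen =
      m'.bits (fun i => .fn (1 + i)) P.prfKeyLen from funext fun i => (h _ (Or.inl ⟨1 + i, rfl⟩)).1]
  unfold consistentOf masksOf
  rw [h1, h2, h3, doneOf_congr h, tokenOf_congr h]
  exact ⟨rfl, rfl⟩

theorem ClientInv.congr {k : ℕ} (hm : ClientInv k m) (h : EqOn stateLocs m m')
    (hf : SimFresh k m') : ClientInv k m' where
  fresh := hf
  not_done := by rw [← doneOf_congr h]; exact hm.not_done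
  all_done h0 := by
    rw [← doneOf_congr h]
    exact hm.all_done (by rw [(h _ (Or.inl ⟨0, rfl⟩)).1, h0])
  nonempty := by rw [← (consistentOf_masksOf_congr h).1]; exact hm.nonempty

theorem ClientInv.succ {k : ℕ} (hm : ClientInv k m) : ClientInv (k + 1) m where
  fresh := hm.fresh.mono (by omega)
  not_done j hj := hm.not_done j (by omega)
  all_done := hm.all_done
  nonempty := hm.nonempty

theorem eqOn_stateLocs_envRun {H : P.Oracle} {q : Prog P EReg}
    (h : m' ∈ (envRun H q m).support) : EqOn stateLocs m m' :=
  (Prog.run_frame H q h).mono (by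
    rintro a ha ⟨b, rfl⟩
    rcases ha with ⟨i, hi⟩ | ⟨c, _, i, hi⟩ <;> cases b <;> simp [EReg.loc] at hi)

/-- The embedded OLE simulators live at the tags `0` and `1` of the pairing, and the bookkeeping of
queries and answers at the tags from `2` on; so the former cannot influence the posterior of the
server's randomness. -/
theorem eqOn_stateLocs_run {H : P.Oracle} {k : ℕ} {p : Prog P SReg}
    (h : m' ∈ (Prog.run H ((p.map (Instr.map (simReg k))).map (Instr.map SReg.loc)) m).support) :
    EqOn stateLocs m m' :=
  (run_simReg_frame h).mono (by
    rintro a ha ⟨b, rfl⟩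
    rcases ha with ⟨i, hi⟩ | ⟨c, hc, i, hi⟩ <;> cases b <;>
      simp [simReg, SReg.loc, Nat.pair_eq_pair] at hi <;> omega)

/-- The memory that is `w sr m` outside the range of the view `f` of `m`, for random shares and masks
`sr` that are consistent with the answers. -/
def overlay (f : Loc → Option Loc)
    (w : (Fin P.θ → P.F) × (Fin P.θ → P.F) → Memory P Loc → Memory P Loc) (m : Memory P Loc) :
    PMF (Memory P Loc) :=
  (masksOf m).map fun sr => view (w sr m) f m

/-- A step that leaves the bookkeeping alone leaves the posterior alone, so it may be exchanged with
drawing the hidden shares and masks. -/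
theorem Simulates.overlay {I : Memory P Loc → Prop} {f : Loc → Option Loc}
    {w : (Fin P.θ → P.F) × (Fin P.θ → P.F) → Memory P Loc → Memory P Loc} {h h' : Step P}
    (hs : ∀ H m, I m → ∀ m' ∈ (h H m).support, I m' ∧ EqOn stateLocs m m')
    (hw : ∀ sr m m', EqOn stateLocs m m' → w sr m = w sr m')
    (hv : ∀ H m w, (h H m).map (view w f) = h' H (view w f m)) :
    Simulates I I (overlay f w) (overlay f w) h h' := by
  intro H m hm
  refine ⟨?_, fun m' hm' => (hs H m hm m' hm').1⟩
  unfold _root_.overlay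
  rw [PMF.bind_map]
  refine Eq.trans (PMF.bind_congr_support (g := fun m' =>
    (masksOf m).bind fun sr => PMF.pure (view (w sr m) f m')) fun m' hm' => ?_) ?_
  · have he := (hs H m hm m' hm').2
    rw [← (consistentOf_masksOf_congr he).2]
    simp only [← hw _ _ _ he]
    rfl
  · rw [PMF.bind_comm]
    exact congrArg _ (funext fun sr => hv H m (w sr m))

/-- The honest server's registers. -/
def workMem (sr : (Fin P.θ → P.F) × (Fin P.θ → P.F)) (m : Memory P Loc) : Memory P Loc :=
  ((blank P Loc).setFlds (fun k => .work (2 * k)) sr.2).setFlds (fun k => .work (2 * k + 1))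
    fun k => sr.1 k - sr.2 k * tokenOf m k

/-- The honest server's registers and those of the functionality in session `k`. -/
def sessMem (k : Fin P.θ) (sr : (Fin P.θ → P.F) × (Fin P.θ → P.F)) (m : Memory P Loc) :
    Memory P Loc :=
  (((workMem sr m).setFld (.fn 0) (sr.2 k)).setFld (.fn 1)
    (sr.1 k - sr.2 k * tokenOf m k)).setBit (.fn 0) (doneOf m k)

theorem workMem_congr (sr : (Fin P.θ → P.F) × (Fin P.θ → P.F)) (h : EqOn stateLocs m m') :
    workMem sr m = workMem sr m' := by
  unfold workMem; rw [tokenOf_congr h]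

theorem sessMem_congr (k : Fin P.θ) (sr : (Fin P.θ → P.F) × (Fin P.θ → P.F))
    (h : EqOn stateLocs m m') : sessMem k sr m = sessMem k sr m' := by
  unfold sessMem; rw [tokenOf_congr h, doneOf_congr h, workMem_congr sr h]

theorem workMem_bit (sr : (Fin P.θ → P.F) × (Fin P.θ → P.F)) (m : Memory P Loc) (a : Loc) :
    (workMem sr m).bit a = false := by
  rw [workMem, setFlds_bit, setFlds_bit]; rfl

theorem workMem_fld (sr : (Fin P.θ → P.F) × (Fin P.θ → P.F)) (m : Memory P Loc) {a : Loc}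
    (ha : ∀ i, a ≠ .work i) : (workMem sr m).fld a = 0 := by
  rw [workMem, setFlds_fld_of_ne _ _ _ fun i _ => ha _, setFlds_fld_of_ne _ _ _ fun i _ => ha _]
  rfl

theorem workMem_even (sr : (Fin P.θ → P.F) × (Fin P.θ → P.F)) (m : Memory P Loc) (k : Fin P.θ) :
    (workMem sr m).fld (.work (2 * k)) = sr.2 k := by
  rw [workMem, setFlds_fld_of_ne _ _ _ (by simp; omega)]
  exact setFlds_fld_apply _ (fun k => Loc.work (2 * k)) (fun i j h => by simpa using h) _ k

theorem workMem_odd (sr : (Fin P.θ → P.F) × (Fin P.θ → P.F)) (m : Memory P Loc) (k : Fin P.θ) :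
    (workMem sr m).fld (.work (2 * k + 1)) = sr.1 k - sr.2 k * tokenOf m k :=
  setFlds_fld_apply _ (fun k => Loc.work (2 * k + 1)) (fun i j h => by simpa using h) _ k

theorem view_simView_congr (w : Memory P Loc) {k : ℕ} (h : CoreEq m m') :
    view w (simView k) m = view w (simView k) m' := by
  have hk : ∀ a b, simView k a = some b → m.bit b = m'.bit b ∧ m.fld b = m'.fld b := by
    intro a b hab
    refine h.1 b ?_
    cases a <;> simp only [simView, Option.some.injEq, reduceCtorEq] at hab <;> subst hab <;>
      simp [flagReg, SReg.loc, Nat.pair_eq_pair]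
  ext a
  · rw [view_bit, view_bit]
    cases hb : simView k a with
    | none => rfl
    | some b => exact (hk a b hb).1
  · rw [view_fld, view_fld]
    cases hb : simView k a with
    | none => rfl
    | some b => exact (hk a b hb).2

theorem overlay_sessMem_congr (k : Fin P.θ) (h : CoreEq m m') :
    overlay (simView k) (sessMem k) m = overlay (simView k) (sessMem k) m' := by
  unfold overlay sessMem workMem
  rw [h.masksOf, h.tokenOf, h.doneOf]
  simp only [view_simView_congr _ h]

/-- The server's inputs give `r_k x + (s_k - r_k y_k) = s_k + r_k (x - y_k)`, and the used bit of
`F_ole` is the simulator's record that session `k` has been answered; thus both sides react to the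
same requests. -/
theorem oleAnswer_sessMem (k : Fin P.θ) (sr : (Fin P.θ → P.F) × (Fin P.θ → P.F))
    (m : Memory P Loc) : OLEProtocol.oleAnswer (view (sessMem k sr m) (simView k) m) =
      if isNew k m then ((view (sessMem k sr m) (simView k) m).setBit (.fn 0) true).setFld (.port 1)
        (sr.1 k + sr.2 k * (m.fld (simReg k (.port 0)).loc - tokenOf m k))
      else view (sessMem k sr m) (simView k) m := by
  have hc : ((view (sessMem k sr m) (simView k) m).bit (.port 0) &&
      !(view (sessMem k sr m) (simView k) m).bit (.fn 0)) = isNew k m := by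
    change (m.bit _ && !(sessMem k sr m).bit (.fn 0)) = _
    rw [sessMem, setBit_bit_self]
    rfl
  unfold OLEProtocol.oleAnswer
  rw [hc]
  refine if_congr Iff.rfl (congrArg _ ?_) rfl
  change P.fOLE (m.fld (simReg k (.port 0)).loc) ((sessMem k sr m).fld (.fn 0))
    ((sessMem k sr m).fld (.fn 1)) = _
  rw [sessMem, setBit_fld, setFld_fld_self, setFld_fld_of_ne _ _ (by simp), setFld_fld_self,
    Params.fOLE]
  ring

theorem view_sessMem_record (k : Fin P.θ) (sr : (Fin P.θ → P.F) × (Fin P.θ → P.F)) (x t : P.F)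
    (m : Memory P Loc) : view (sessMem k sr (record k x t m)) (simView k) (record k x t m) =
      ((view (sessMem k sr m) (simView k) m).setBit (.fn 0) true).setFld (.port 1) t := by
  have h1 : sessMem k sr (record k x t m) = (sessMem k sr m).setBit (.fn 0) true := by
    unfold sessMem workMem
    rw [tokenOf_record, doneOf_record, Function.update_self]
    ext a
    · rw [setBit_bit, setBit_bit, setBit_bit]
      split_ifs <;> rfl
    · rfl
  have hne : ∀ c ≥ 2, ∀ i a, simView k a ≠ some (.sim (Nat.pair c i)) := by
    intro c hc i a ha
    cases a <;> simp [simView, Nat.pair_eq_pair] at ha <;> omega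
  rw [h1, record, view_setFld (pInj_simView k) (simView_sreg k (.port 1)),
    view_setFld_of_notMem (b := (ansReg k).loc) (hne 2 le_rfl k),
    view_setFld_of_notMem (b := (argReg k).loc) (hne 3 (by omega) k),
    view_setBit_of_notMem (b := (ansReg k).loc) (hne 2 le_rfl k)]
  refine congrArg (fun v => setFld v _ _) ?_
  ext a
  · rw [setBit_bit, view_bit, view_bit]
    cases a <;> simp [simView, setBit_bit]
  · rfl

/-- The heart of the simulation. For a new query the hybrid computes the answer from hidden shares
and masks, while the simulator draws it from `Params.answer` and the hidden part is drawn
afterwards, given this answer. By `Params.bind_answer` the joint laws agree. -/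
theorem simulates_answerBlock (k : Fin P.θ) :
    Simulates (ClientInv (k + 1)) (ClientInv (k + 1)) (overlay (simView k) (sessMem k))
      (overlay (simView k) (sessMem k)) (answerBlock k)
      (fun _ m => PMF.pure (OLEProtocol.oleAnswer m)) := by
  intro H m hm
  have hr : (overlay (simView k) (sessMem k) m).bind
      (fun m => PMF.pure (OLEProtocol.oleAnswer m)) = (masksOf m).bind fun sr =>
        PMF.pure (OLEProtocol.oleAnswer (view (sessMem k sr m) (simView k) m)) := by
    unfold overlay
    rw [PMF.bind_map]
    rfl
  rw [hr]
  simp only [oleAnswer_sessMem]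
  unfold answerBlock
  rw [PMF.bind_map]
  cases hn : isNew k m with
  | false =>
    have hc := fun u => answerBlock_of_not_isNew hn u
    refine ⟨?_, fun m' hm' => ?_⟩
    -- Without a new query the drawn element is irrelevant and can be integrated out.
    · simp only [Function.comp_def, overlay_sessMem_congr k (hc _).1, PMF.bind_const]
      rfl
    · rw [PMF.support_map] at hm'
      obtain ⟨u, _, rfl⟩ := hm'
      obtain ⟨h1, h2⟩ := hc u
      have h3 := h1.doneOf
      exact ⟨(CoreEq.simFresh ⟨fun a ha => ⟨(h1.1 a ha).1.symm, (h1.1 a ha).2.symm⟩, h1.2.symm⟩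
        hm.fresh), by rw [h3]; exact hm.not_done, by rw [h3, h2]; exact hm.all_done,
        by rw [h1.consistentOf]; exact hm.nonempty⟩
  | true =>
    obtain ⟨v, hv, hc⟩ := answerBlock_of_isNew hn hm.all_done
    have hk : doneOf m k = false := by
      simp only [isNew, Bool.and_eq_true, Bool.not_eq_true'] at hn
      exact hn.2
    -- The continuation writes the answer into the hybrid's memory for the given shares and masks.
    obtain ⟨h1, h2⟩ := Params.bind_answer hm.nonempty hk (m.fld (simReg k (.port 0)).loc)
      (fun sr t => PMF.pure (((view (sessMem k sr m) (simView k) m).setBit (.fn 0) true).setFld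
        (.port 1) t))
    refine ⟨?_, fun m' hm' => ?_⟩
    · simp only [if_true]
      unfold masksOf
      rw [h1, ← hv, PMF.bind_map]
      refine congrArg _ (funext fun u => ?_)
      simp only [Function.comp_apply]
      rw [overlay_sessMem_congr k (hc u).1, overlay, masksOf, tokenOf_record, secretOf_record,
        doneOf_record, argOf_record, ansOf_record]
      simp only [view_sessMem_record]
      rfl
    · rw [PMF.support_map] at hm'
      obtain ⟨u, hu, rfl⟩ := hm'
      obtain ⟨h3, h4⟩ := hc u
      have h5 := h3.doneOf
      have hmem : v u ∈ (P.answer (secretOf m) (tokenOf m) (doneOf m) (argOf m) (ansOf m) k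
          (m.fld (simReg k (.port 0)).loc)).support := by
        rw [← hv, PMF.support_map]
        exact ⟨u, hu, rfl⟩
      refine ⟨CoreEq.simFresh ⟨fun a ha => ⟨(h3.1 a ha).1.symm, (h3.1 a ha).2.symm⟩, h3.2.symm⟩
        (hm.fresh.of_eqOn ?_), fun j hj => ?_, by rw [h5]; exact h4, ?_⟩
      -- The record touches the bookkeeping and the port of session `k` only, never a session from
      -- `k + 1` on.
      · refine (((EqOn.setBit _ ?_ _).trans (EqOn.setFld _ ?_ _)).trans (EqOn.setFld _ ?_ _)).trans
          (EqOn.setFld _ ?_ _)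
        all_goals
          rintro ⟨c, hc, k', hk', i, ha⟩
          simp [ansReg, argReg, simReg, SReg.loc, Nat.pair_eq_pair] at ha
          omega
      · rw [h5, doneOf_record, Function.update_of_ne (by rintro rfl; omega)]
        exact hm.not_done j hj
      · rw [h3.consistentOf, consistentOf, tokenOf_record, secretOf_record,
          doneOf_record, argOf_record, ansOf_record]
        exact h2 _ hmem

end

end

/-! ### Coupling of whole sessions with a corrupt client -/

noncomputable section

section

variable {n : ℕ} {P : Params n}

open Memory

/-- Activation `t` in session `k` of the simulator for a corrupt client, up to temporary
registers. -/
def clientAct (S : Simulator P) (k : Fin P.θ) (t : ℕ) : Step P := fun H m =>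
  ((Prog.run H (((S t).1.map (Instr.map (simReg k))).map (Instr.map SReg.loc)) m).bind
    (answerBlock k H)).bind
      (Prog.run H (((S t).2.map (Instr.map (simReg k))).map (Instr.map SReg.loc)))

theorem simulates_clientAct (S : Simulator P) (k : Fin P.θ) (t : ℕ) :
    Simulates (ClientInv (k + 1)) (ClientInv (k + 1)) (overlay (simView k) (sessMem k))
      (overlay (simView k) (sessMem k)) (clientAct S k t) (S.act OLEProtocol.oleAnswer t) := by
  have hrun : ∀ p : Prog P SReg, Simulates (ClientInv (k + 1)) (ClientInv (k + 1))
      (overlay (simView k) (sessMem k)) (overlay (simView k) (sessMem k))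
      (fun H => Prog.run H ((p.map (Instr.map (simReg k))).map (Instr.map SReg.loc)))
      (fun H => Prog.run H (p.map (Instr.map SReg.loc))) := fun p =>
    Simulates.overlay (fun H m hm m' hm' => ⟨hm.congr (eqOn_stateLocs_run hm') (hm.fresh.run hm'),
      eqOn_stateLocs_run hm'⟩) (fun sr _ _ => sessMem_congr k sr) fun H m w => run_simView H k p m
  exact ((hrun _).seq (simulates_answerBlock k)).seq (hrun _)

theorem simulates_envRun_envView (k : ℕ) (q : Prog P EReg) :
    Simulates (ClientInv k) (ClientInv k) (overlay envView workMem) (overlay envView workMem)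
      (fun H => envRun H q) (fun H => envRun H q) :=
  Simulates.overlay (fun _ _ hm _ hm' => ⟨hm.congr (eqOn_stateLocs_envRun hm')
    (hm.fresh.envRun hm'), eqOn_stateLocs_envRun hm'⟩) (fun sr _ _ => workMem_congr sr)
    fun H m _ => Prog.run_view pInj_envView envView_ereg H q m

theorem simulates_envRun_simView (k : Fin P.θ) (q : Prog P EReg) :
    Simulates (ClientInv (k + 1)) (ClientInv (k + 1)) (overlay (simView k) (sessMem k))
      (overlay (simView k) (sessMem k)) (fun H => envRun H q) (fun H => envRun H q) :=
  Simulates.overlay (fun _ _ hm _ hm' => ⟨hm.congr (eqOn_stateLocs_envRun hm')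
    (hm.fresh.envRun hm'), eqOn_stateLocs_envRun hm'⟩) (fun sr _ _ => sessMem_congr k sr)
    fun H m _ => envRun_simView H k q m

/-- At the start of session `k` its simulator's registers are zero and its query is unmade. So the
coupled memory is what the hybrid has after loading the server's inputs from `work` into `F_ole`. -/
theorem view_sessMem {k : Fin P.θ} {m : Memory P Loc} (h : ClientInv k m)
    (sr : (Fin P.θ → P.F) × (Fin P.θ → P.F)) : view (sessMem k sr m) (simView k) m =
      ((view (workMem sr m) envView m).setFld (.fn 0)
        ((view (workMem sr m) envView m).fld (.work (2 * k)))).setFld (.fn 1)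
        ((view (workMem sr m) envView m).fld (.work (2 * k + 1))) := by
  have hw0 : (view (workMem sr m) envView m).fld (.work (2 * k)) = sr.2 k := workMem_even sr m k
  have hw1 : (view (workMem sr m) envView m).fld (.work (2 * k + 1)) =
    sr.1 k - sr.2 k * tokenOf m k := workMem_odd sr m k
  have hb : (sessMem k sr m).bit = (workMem sr m).bit := by
    funext a
    rw [sessMem, setBit_bit, h.not_done k le_rfl, workMem_bit]
    split_ifs
    · rfl
    · exact workMem_bit sr m a
  rw [hw0, hw1]
  ext a
  · rw [setFld_bit, setFld_bit, view_bit, view_bit, hb]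
    cases a with
    | sim i => exact (h.fresh 0 (by omega) k le_rfl i).1.trans (workMem_bit _ _ _).symm
    | port i => exact (h.fresh 1 (by omega) k le_rfl i).1.trans (workMem_bit _ _ _).symm
    | _ => rfl
  · rw [setFld_fld, setFld_fld, view_fld, view_fld]
    cases a with
    | sim i =>
      simpa [envView, simView, workMem_fld] using (h.fresh 0 (by omega) k le_rfl i).2
    | port i =>
      simpa [envView, simView, workMem_fld] using (h.fresh 1 (by omega) k le_rfl i).2
    | _ => simp [envView, simView, sessMem, setFld_fld]

theorem wipe_sessMem (k : Fin P.θ) (sr : (Fin P.θ → P.F) × (Fin P.θ → P.F)) (m : Memory P Loc) :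
    wipe (view (sessMem k sr m) (simView k) m) = view (workMem sr m) envView m := by
  ext a
  · rw [wipe_bit, view_bit, view_bit]
    cases a <;> simp [Loc.isGlob, simView, envView, sessMem, setBit_bit, workMem_bit]
  · rw [wipe_fld, view_fld, view_fld]
    cases a <;> simp [Loc.isGlob, simView, envView, sessMem, setFld_fld, workMem_fld]

/-- Between sessions the hidden part is the server's `work` registers; during session `k` it also
contains the state of `F_ole`. The first activation creates that state and the final wiping removes
it, while the posterior persists. -/
theorem simulates_idealClient (S : Simulator P) (L : ℕ) (k : Fin P.θ) (e : Env P) :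
    Simulates (ClientInv k) (ClientInv (k + 1)) (overlay envView workMem)
      (overlay envView workMem)
      (fun H => World.play H ((List.range (L + 1)).map (clientAct S k)) e)
      (playWipe (idealClient S L fun i => .work (2 * k + i)) e) := by
  rw [List.range_succ_eq_map, List.map_cons, List.map_map]
  refine Simulates.session (J := ClientInv (k + 1))
    (E := overlay (simView k) (sessMem k)) ?_ ?_ (simulates_envRun_envView k)
    (simulates_envRun_simView k) (fun m hm => ⟨hm, ?_⟩) e
  · intro H m hm
    obtain ⟨h1, h2⟩ := simulates_clientAct S k 0 H m hm.succ
    refine ⟨h1.trans ?_, h2⟩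
    unfold overlay
    rw [PMF.bind_map, PMF.bind_map]
    refine congrArg _ (funext fun sr => ?_)
    rw [Function.comp_apply, view_sessMem hm]
    rfl
  · rw [List.forall₂_map_left_iff, List.forall₂_map_right_iff, List.forall₂_same]
    exact fun t _ => simulates_clientAct S k (t + 1)
  · unfold overlay
    rw [PMF.map_comp]
    exact congrArg (PMF.map · _) (funext fun sr => (wipe_sessMem k sr m).symm)

/-! ### The start of the protocol -/

theorem wipe_overlay (m : Memory P Loc) :
    (overlay envView workMem m).map wipe = overlay envView workMem m := by
  unfold overlay
  rw [PMF.map_comp]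
  refine congrArg (PMF.map · _) (funext fun sr => ?_)
  ext a
  · rw [Function.comp_apply, wipe_bit, view_bit]
    cases a <;> simp [Loc.isGlob, envView, workMem_bit]
  · rw [Function.comp_apply, wipe_fld, view_fld]
    cases a <;> simp [Loc.isGlob, envView, workMem_fld]

theorem idealStart_bit (m : Memory P Loc) {a : Loc} (h : ∀ i, a ≠ .fn i) :
    (ImplicitCheck.idealStart m).bit a =
      (m.setBits (fun i => .chan i) (ImplicitCheck.topKey m)).bit a := by
  rw [ImplicitCheck.idealStart, setFlds_bit, setBits_bit_of_ne _ _ _ fun i _ => h _]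

theorem idealStart_fld (m : Memory P Loc) {a : Loc} (h : ∀ i, a ≠ .fn i) :
    (ImplicitCheck.idealStart m).fld a = m.fld a := by
  rw [ImplicitCheck.idealStart, setFlds_fld_of_ne _ _ _ fun i _ => h _, setBits_fld, setBits_fld]

theorem tokenOf_idealStart (m : Memory P Loc) :
    tokenOf (ImplicitCheck.idealStart m) = ImplicitCheck.topToken m :=
  flds_setFlds _ (fun i j h => by simpa using h) _

theorem secretOf_idealStart (m : Memory P Loc) : secretOf (ImplicitCheck.idealStart m) =
    P.tok (P.prf (ImplicitCheck.topPrfKey m) (ImplicitCheck.topToken m)) := by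
  unfold secretOf
  rw [tokenOf_idealStart]
  refine congrArg (fun v => P.tok (P.prf v _)) (Eq.trans ?_ (bits_setBits
    (m.setBits (fun i => Loc.chan i) (ImplicitCheck.topKey m)) (a := fun i => Loc.fn (1 + i))
    (fun i j h => by simpa using h) (ImplicitCheck.topPrfKey m)))
  funext i
  simp only [bits, ImplicitCheck.idealStart, setFlds_bit]

theorem doneOf_idealStart {m : Memory P Loc} (h : EnvOnly m) :
    doneOf (ImplicitCheck.idealStart m) = fun _ => false := funext fun j => by
  rw [doneOf, idealStart_bit _ (by simp [ansReg, SReg.loc]),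
    setBits_bit_of_ne _ _ _ (by simp [ansReg, SReg.loc])]
  exact (h.zero rfl).1

theorem clientInv_idealStart {m : Memory P Loc} (h : EnvOnly m) :
    ClientInv 0 (ImplicitCheck.idealStart m) where
  fresh c hc k hk i := by
    rw [idealStart_bit _ (by simp), idealStart_fld _ (by simp),
      setBits_bit_of_ne _ _ _ (by simp)]
    exact h.zero rfl
  not_done j _ := by rw [doneOf_idealStart h]
  all_done h0 := by
    rw [ImplicitCheck.idealStart, setFlds_bit, setBits_bit_of_ne _ _ _ (by simp; omega),
      setBits_bit_of_ne _ _ _ (by simp), (h.zero rfl).1] at h0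
    simp at h0
  nonempty := by
    rw [consistentOf, doneOf_idealStart h]
    exact Params.consistent_nonempty _ _ _ _

/-- The request bit is still zero, so the first activation, in which the simulator is idle, uses up
no query. -/
theorem icAnswer_idealStart {m : Memory P Loc} (h : EnvOnly m) :
    ImplicitCheck.icAnswer (ImplicitCheck.idealStart m) = ImplicitCheck.idealStart m := by
  unfold ImplicitCheck.icAnswer
  rw [idealStart_bit _ (by simp), setBits_bit_of_ne _ _ _ (by simp), (h.zero rfl).1]
  rfl

/-- The coupling starts here: the randomness that the honest server draws is the posterior given no
answers, and the embedding key is on the channel in both experiments. -/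
theorem serverStart_eq_overlay {m : Memory P Loc} (h : EnvOnly m) (H : P.Oracle) :
    ImplicitCheck.serverStart H m = overlay envView workMem (ImplicitCheck.idealStart m) := by
  unfold ImplicitCheck.serverStart overlay masksOf
  rw [ImplicitCheck.serverRandomness_eq_randomConsistent _ _ (argOf (ImplicitCheck.idealStart m))
    (ansOf (ImplicitCheck.idealStart m)), secretOf_idealStart, tokenOf_idealStart,
    doneOf_idealStart h]
  refine congrArg (PMF.map · _) (funext fun sr => ?_)
  ext a
  · rw [setFlds_bit, setFlds_bit, view_bit]
    cases ha : envView a with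
    | none =>
      rw [setBits_bit_of_ne _ _ _ (by rintro i _ rfl; simp [envView] at ha), (h.zero ha).1]
      exact (workMem_bit _ _ _).symm
    | some b =>
      obtain rfl := envView_eq_some ha
      exact (idealStart_bit _ (by rintro i rfl; simp [envView] at ha)).symm
  · rw [view_fld]
    cases ha : envView a with
    | none =>
      have h0 : ((m.setBits (fun i => Loc.chan i) (ImplicitCheck.topKey m)).fld a) =
          (blank P Loc).fld a := by
        rw [setBits_fld, (h.zero ha).2]; rfl
      change _ = (workMem _ _).fld a
      rw [workMem, tokenOf_idealStart]
      exact setFlds_fld_congr (setFlds_fld_congr h0 _ _) _ _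
    | some b =>
      obtain rfl := envView_eq_some ha
      rw [setFlds_fld_of_ne _ _ _ (by rintro i _ rfl; simp [envView] at ha),
        setFlds_fld_of_ne _ _ _ (by rintro i _ rfl; simp [envView] at ha), setBits_fld]
      exact (idealStart_fld _ (by rintro i rfl; simp [envView] at ha)).symm

theorem simulates_serverStart (e : Env P) :
    Simulates EnvOnly (ClientInv 0) PMF.pure (overlay envView workMem)
      (fun H => World.play H [fun _ m => PMF.pure (ImplicitCheck.icAnswer
        (ImplicitCheck.idealStart m))] e)
      (playWipe [ImplicitCheck.serverStart] e) := by
  refine Simulates.session (J := ClientInv 0) (E := overlay envView workMem) ?_ .nil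
    (fun q H m hm => ⟨?_, fun m' hm' => hm.envRun hm'⟩) (simulates_envRun_envView 0)
    (fun m hm => ⟨hm, (wipe_overlay m).symm⟩) e
  · intro H m hm
    refine ⟨?_, fun m' hm' => ?_⟩
    · rw [PMF.pure_bind, PMF.pure_bind, icAnswer_idealStart hm, serverStart_eq_overlay hm]
    · rw [PMF.support_pure, Set.mem_singleton_iff] at hm'
      rw [hm', icAnswer_idealStart hm]
      exact clientInv_idealStart hm
  · rw [PMF.pure_bind, PMF.bind_pure]

/-! ### The simulator for a corrupt client -/

theorem pull_visReg_icAnswer (m : Memory P Loc) :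
    pull visReg (ImplicitCheck.icAnswer m) = ImplicitCheck.icAnswer (pull visReg m) := by
  have hs : ∀ (m : Memory P Loc) (a : Loc) (x : Bool), (∀ i, a ≠ .sim i) →
      pull visReg (m.setBit a x) = (pull visReg m).setBit a x := fun m a x ha =>
    view_setBit (w := blank P Loc) (pInj_some visReg_injective)
      (by cases a <;> first | rfl | exact absurd rfl (ha _)) m x
  have hp : ∀ (m : Memory P Loc) (g : Fin n → Bool),
      pull visReg (m.setBits (fun i => .port (2 + i)) g) =
        (pull visReg m).setBits (fun i => .port (2 + i)) g := fun m g =>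
    view_setBits (w := blank P Loc) (pInj_some visReg_injective) (a := fun i => Loc.port (2 + i))
      (b := fun i => Loc.port (2 + i)) (fun i => rfl) m g
  unfold ImplicitCheck.icAnswer
  change pull visReg (if m.bit (.port 0) && !m.bit (.fn 0) then _ else m) =
    if m.bit (.port 0) && !m.bit (.fn 0) then
      match P.fIC (m.flds (fun i => .port i) P.θ) (m.bits (fun i => .fn (1 + i)) P.prfKeyLen)
        (m.flds (fun i => .fn i) P.θ) with
      | some g => _
      | none => _
    else _
  split_ifs
  · cases P.fIC (m.flds (fun i => .port i) P.θ) (m.bits (fun i => .fn (1 + i)) P.prfKeyLen)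
      (m.flds (fun i => .fn i) P.θ) with
    | some g =>
      dsimp only
      rw [hp, hs _ _ _ (by simp), hs _ _ _ (by simp)]
    | none =>
      dsimp only
      rw [hs _ _ _ (by simp), hs _ _ _ (by simp)]
  · rfl

/-- The OLE simulator expects `F_ole` between its two programs. Here that place is taken by
recording the query, calling `F_IC`, and answering; so one activation of the new simulator splits at
the call of `F_IC`. -/
theorem SImpl.clientAct (S : Simulator P) (k : Fin P.θ) (t : ℕ) :
    ∃ p q : Prog P SReg, p.length + q.length ≤
        (S t).1.length + (S t).2.length + (3 * n + 11 * P.θ + 80) ∧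
      ∀ H m, (((Prog.run H (p.map (Instr.map SReg.loc)) m).map ImplicitCheck.icAnswer).bind
        (Prog.run H (q.map (Instr.map SReg.loc)))).map (pull visReg) =
          clientAct S k t H (pull visReg m) := by
  obtain ⟨p, hp, h1⟩ := (SImpl.prog ((S t).1.map (Instr.map (simReg k)))).seq
    (SImpl.recordQuery (P := P) k)
  obtain ⟨q, hq, h2⟩ := (SImpl.answerQuery k).seq
    (SImpl.prog ((S t).2.map (Instr.map (simReg k))))
  refine ⟨p, q, by simp at hp hq; omega, fun H m => ?_⟩
  unfold _root_.clientAct answerBlock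
  rw [PMF.map_bind, PMF.bind_map]
  simp only [Function.comp_def, h2, pull_visReg_icAnswer]
  have e1 := congrArg (fun μ : PMF (Memory P Loc) => μ.bind fun m =>
    (P.unif.map fun u => _root_.answerQuery k u (ImplicitCheck.icAnswer m)).bind
      (Prog.run H (((S t).2.map (Instr.map (simReg k))).map (Instr.map SReg.loc)))) (h1 H m)
  simp only [PMF.bind_map, PMF.bind_bind, PMF.pure_bind, Function.comp_def] at e1 ⊢
  exact e1

/-- The programs of the simulator for a corrupt client. -/
def clientSess (S : Simulator P) (k : ℕ) : Simulator P := fun t =>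
  if hk : k < P.θ then ((SImpl.clientAct S ⟨k, hk⟩ t).choose,
    (SImpl.clientAct S ⟨k, hk⟩ t).choose_spec.choose) else ([], [])

theorem clientSess_spec (S : Simulator P) (k : Fin P.θ) (t : ℕ) :
    ((clientSess S k t).1.length + (clientSess S k t).2.length ≤
      (S t).1.length + (S t).2.length + (3 * n + 11 * P.θ + 80)) ∧
    ∀ H m, ((clientSess S k).act ImplicitCheck.icAnswer t H m).map (pull visReg) =
      clientAct S k t H (pull visReg m) := by
  have h := (SImpl.clientAct S k t).choose_spec.choose_spec
  unfold Simulator.act clientSess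
  rw [dif_pos k.2]
  exact h

/-- The coupling was established for activations without temporary registers; it pulls back along
the view that hides these registers. -/
theorem Simulates.comap {I J : Memory P Loc → Prop} {D E : Memory P Loc → PMF (Memory P Loc)}
    {φ : Memory P Loc → Memory P Loc} {g h h' : Step P} (hh : Simulates I J D E h h')
    (hg : Simulates (fun _ => True) (fun _ => True) (fun m => PMF.pure (φ m))
      (fun m => PMF.pure (φ m)) g h) :
    Simulates (fun m => I (φ m)) (fun m => J (φ m)) (fun m => D (φ m)) (fun m => E (φ m)) g h' := by
  intro H m hm
  obtain ⟨h1, h2⟩ := hh H (φ m) hm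
  have h3 : (g H m).map φ = h H (φ m) := by
    have := (hg H m trivial).1
    rw [PMF.pure_bind] at this
    exact this
  refine ⟨?_, fun m' hm' => h2 _ ?_⟩
  · rw [← h1, ← h3, PMF.bind_map]
    rfl
  · rw [← h3, PMF.support_map]
    exact ⟨m', hm', rfl⟩

/-- Steps of which the second is the first, up to temporary registers. -/
abbrev Hides (g h : Step P) : Prop :=
  Simulates (fun _ => True) (fun _ => True) (fun m => PMF.pure (pull visReg m))
    (fun m => PMF.pure (pull visReg m)) g h

theorem Hides.of_map {g h : Step P} (hg : ∀ H m, (g H m).map (pull visReg) = h H (pull visReg m)) :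
    Hides g h := fun H m _ => ⟨by rw [PMF.pure_bind, ← hg H m]; rfl, fun _ _ => trivial⟩

theorem Hides.play {V W : World P} (h : List.Forall₂ Hides V W) (e : Env P) :
    Hides (fun H => World.play H V e) (fun H => World.play H W e) :=
  Simulates.play h (fun q => Hides.of_map fun H m =>
    Prog.run_pull visReg_injective visReg_ereg H q m) e

/-- The simulator for a corrupt client of the implicit check. -/
def clientSim (S : Simulator P) (L : ℕ) : Simulator P := seqSim 1 L (clientSess S)

theorem pull_visReg_idealStart (m : Memory P Loc) :
    pull visReg (ImplicitCheck.idealStart m) = ImplicitCheck.idealStart (pull visReg m) := by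
  unfold ImplicitCheck.idealStart
  have hv : PInj fun a : Loc => some (visReg a) := pInj_some visReg_injective
  rw [pull_eq_view (blank P Loc), pull_eq_view (blank P Loc),
    view_setFlds hv (a := fun i => Loc.fn i) (b := fun i => Loc.fn i) fun i => rfl,
    view_setBits hv (a := fun i => Loc.fn (1 + i)) (b := fun i => Loc.fn (1 + i)) fun i => rfl,
    view_setBits hv (a := fun i => Loc.chan i) (b := fun i => Loc.chan i) fun i => rfl]
  rfl

end

end

/-! ### Conclusion for a malicious client -/

noncomputable section

open Memory

/-- The last hybrid and the ideal experiment are coupled from the blank memory on, through the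
server's start and all sessions, so the environment accepts with exactly the same probability. -/
theorem clientIdeal_accept {n : ℕ} {P : Params n} (ρ : OLEProtocol P) (S : Simulator P)
    (R : ℕ → World P) (e : Env P) :
    acceptOf (chain (kernels (hybridWorlds [ImplicitCheck.serverStart] [] R
      (fun k => idealClient S ρ.rounds fun i => .work (2 * k + i)) P.θ P.θ) e)) =
    ((ImplicitCheck.worlds ρ).clientIdeal (clientSim S (ρ.rounds + 1))).accept e := by
  have hsplit : (ImplicitCheck.worlds ρ).clientIdeal (clientSim S (ρ.rounds + 1)) =
      [fun _ m => PMF.pure (ImplicitCheck.icAnswer (ImplicitCheck.idealStart m))] ++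
        (List.range P.θ).flatMap fun k =>
          (List.range (ρ.rounds + 1)).map ((clientSess S k).act ImplicitCheck.icAnswer) := by
    refine congrArg₂ List.cons ?_ ?_
    · funext H m
      unfold Simulator.act clientSim
      rw [seqSim_lt _ (by omega)]
      simp only [List.map_nil, Prog.run_nil, PMF.pure_map, PMF.pure_bind]
    · refine Eq.trans ?_ (map_act_seqSim 1 P.θ (ρ.rounds + 1) (clientSess S) _)
      exact List.map_congr_left fun t _ => congrArg _ (Nat.add_comm t 1)
  rw [hsplit]
  refine (Simulates.accept (V₀ := [fun _ m => PMF.pure (ImplicitCheck.icAnswer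
      (ImplicitCheck.idealStart m))]) (W₀ := [ImplicitCheck.serverStart])
    (I := fun k m => ClientInv k (pull visReg m))
    (J₀ := fun m => EnvOnly (pull visReg m)) (D₀ := fun m => PMF.pure (pull visReg m))
    (D := fun _ m => overlay envView workMem (pull visReg m)) (fun e => ?_)
    (by rw [pull_blank]; exact EqOn.refl _ _) (congrArg PMF.pure (pull_blank _)) rfl
    (fun k hk e => ?_) (fun k _ => by simp [idealClient, length_sessionWorld])
    (fun q H m _ => ?_) e).symm
  · refine (simulates_serverStart e).comap (Hides.play (.cons (Hides.of_map fun H m => ?_) .nil) e)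
    rw [PMF.pure_map, pull_visReg_icAnswer, pull_visReg_idealStart]
  · refine (simulates_idealClient S ρ.rounds ⟨k, hk⟩ e).comap (Hides.play ?_ e)
    rw [List.forall₂_map_left_iff, List.forall₂_map_right_iff, List.forall₂_same]
    exact fun t _ => Hides.of_map (clientSess_spec S ⟨k, hk⟩ t).2
  -- The environment's registers are visible in the coupling and do not depend on the hidden shares
  -- and masks, so the latter are integrated out.
  · unfold overlay
    rw [PMF.bind_map]
    have h : ∀ w : Memory P Loc,
        (envRun H q (view w envView (pull visReg m))).map outBit = (envRun H q m).map outBit := by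
      intro w
      rw [show envRun H q (view w envView (pull visReg m)) = _ from
        (Prog.run_view pInj_envView envView_ereg H q _).symm,
        show Prog.run H (q.map (Instr.map EReg.loc)) (pull visReg m) = _ from
        (Prog.run_pull visReg_injective visReg_ereg H q m).symm, PMF.map_comp, PMF.map_comp]
      rfl
    simp only [Function.comp_def, h, PMF.bind_const]

theorem time_clientSess {n : ℕ} {P : Params n} (S : Simulator P) {k : ℕ} (hk : k < P.θ) (L : ℕ) :
    (clientSess S k).time L ≤ S.time L + L * (3 * n + 11 * P.θ + 80) := by
  refine (Finset.sum_le_sum fun t _ => (clientSess_spec S ⟨k, hk⟩ t).1).trans (le_of_eq ?_)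
  rw [Finset.sum_add_distrib, Finset.sum_const, Finset.card_range, smul_eq_mul]
  rfl

theorem length_clientReal {n : ℕ} {P : Params n} (ρ : OLEProtocol P) :
    (ImplicitCheck.worlds ρ).clientReal.length = 1 + P.θ * (ρ.rounds + 1) := by
  simp [ImplicitCheck.worlds, OLEProtocol.serverSession]
  ring

/-- Security against a malicious client. -/
theorem ImplicitCheck.client_secure {P : ∀ n, Params n} (hP : Feasible P)
    {ρ : ∀ n, OLEProtocol (P n)} (hρ : PolyBounded fun n => (ρ n).time)
    {S : ∀ n, Simulator (P n)}
    (hS : PolyBounded fun n => (S n).time (ρ n).worlds.clientReal.length)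
    (hind : Indist P (fun n => (ρ n).worlds.clientReal)
      (fun n => (ρ n).worlds.clientIdeal (S n))) :
    ∃ S : ∀ n, Simulator (P n),
      PolyBounded (fun n => (S n).time (ImplicitCheck.worlds (ρ n)).clientReal.length) ∧
      Indist P (fun n => (ImplicitCheck.worlds (ρ n)).clientReal)
        (fun n => (ImplicitCheck.worlds (ρ n)).clientIdeal (S n)) := by
  refine ⟨fun n => clientSim (S n) ((ρ n).rounds + 1), ?_, fun e he => ?_⟩
  · have hround : PolyBounded fun n => (ρ n).rounds := hρ.mono fun n => by
      unfold OLEProtocol.time; omega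
    refine (hP.2.1.mul (hS.add ((hround.add (.const 1)).mul ((((PolyBounded.const 3).mul .id).add
      ((PolyBounded.const 11).mul hP.2.1)).add (.const 80))))).mono fun n => ?_
    unfold clientSim
    rw [length_clientReal, time_seqSim, OLEProtocol.clientReal_eq, length_sessionWorld]
    refine (Finset.sum_le_sum fun k hk => time_clientSess (S n) (Finset.mem_range.1 hk) _).trans ?_
    rw [Finset.sum_const, Finset.card_range, smul_eq_mul]
  · refine (negligible_client hP hρ hS hind e he).mono fun n => le_of_eq ?_
    rw [clientIdeal_accept]

end

noncomputable section

section

variable {n : ℕ} {P : Params n}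

open Memory

/-! ### Both parties honest -/

/-- The sum of `acc` and the terms `coef k * o k`, `k ∈ l`, where `o k` is the output of `f` on `y' k`
and `(r k, s k - r k * y k)`. -/
def combineWith (f : P.Oracle → P.F → P.F → P.F → PMF P.F) (H : P.Oracle)
    (y' y s r : Fin P.θ → P.F) : List (Fin P.θ) → P.F → PMF P.F
  | [], acc => PMF.pure acc
  | k :: l, acc => (f H (y' k) (r k) (s k - r k * y k)).bind fun o =>
      combineWith f H y' y s r l (acc + P.coef k * o)

/-- The value that the client reconstructs if its OLE outputs are those of `f`. -/
def honestWith (f : P.Oracle → P.F → P.F → P.F → PMF P.F) (H : P.Oracle)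
    (x : Fin P.inputLen → Bool) (ke : Fin P.keyLen → Bool) (k : Fin P.prfKeyLen → Bool)
    (y : Fin P.θ → P.F) : PMF P.F :=
  (ImplicitCheck.serverRandomness k y).bind fun sr =>
    combineWith f H (P.token H ke x) y sr.1 sr.2 (List.finRange P.θ) 0

theorem combine_eq_combineWith (ρ : OLEProtocol P) (H : P.Oracle) (y' y s r : Fin P.θ → P.F)
    (l : List (Fin P.θ)) (acc : P.F) :
    ImplicitCheck.combine ρ H y' y s r l acc = combineWith ρ.honest H y' y s r l acc := by
  induction l generalizing acc with
  | nil => rfl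
  | cons k l ih => simp only [ImplicitCheck.combine, combineWith, ih]

theorem honest_eq_honestWith (ρ : OLEProtocol P) (H : P.Oracle) (x : Fin P.inputLen → Bool)
    (ke : Fin P.keyLen → Bool) (k : Fin P.prfKeyLen → Bool) (y : Fin P.θ → P.F) :
    ImplicitCheck.honest ρ H x ke k y = honestWith ρ.honest H x ke k y := by
  simp only [ImplicitCheck.honest, honestWith, combine_eq_combineWith]

/-- The functionality as a random function. -/
def idealOLE (_ : P.Oracle) (x u v : P.F) : PMF P.F := PMF.pure (P.fOLE x u v)

theorem combineWith_idealOLE (H : P.Oracle) (y' y s r : Fin P.θ → P.F) (l : List (Fin P.θ))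
    (acc : P.F) : combineWith idealOLE H y' y s r l acc =
      PMF.pure (acc + (l.map fun k => P.coef k * (s k + r k * (y' k - y k))).sum) := by
  induction l generalizing acc with
  | nil => simp [combineWith]
  | cons k l ih =>
    rw [combineWith, idealOLE, PMF.pure_bind, ih, List.map_cons, List.sum_cons, Params.fOLE]
    congr 1
    ring

/-- The output is the secret plus `∑ a_k r_k (y'_k - y_k)`. The second sum vanishes if `y' = y`, and
otherwise it is a nonzero linear form in the uniform masks. -/
theorem honestWith_idealOLE (H : P.Oracle) (x : Fin P.inputLen → Bool) (ke : Fin P.keyLen → Bool)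
    (k : Fin P.prfKeyLen → Bool) (y : Fin P.θ → P.F) :
    honestWith idealOLE H x ke k y = ImplicitCheck.honestOutput H x ke k y := by
  classical
  unfold honestWith ImplicitCheck.honestOutput
  set y' := P.token H ke x
  simp only [combineWith_idealOLE, zero_add]
  rw [ImplicitCheck.serverRandomness_eq_randomConsistent k y 0 0,
    Params.randomConsistent_of_nonempty (Params.consistent_nonempty _ _ _ _)]
  have hsum : ∀ s r : Fin P.θ → P.F,
      ((List.finRange P.θ).map fun k => P.coef k * (s k + r k * (y' k - y k))).sum =
        P.reconstruct s + ∑ k, P.coef k * (r k * (y' k - y k)) := fun s r => by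
    rw [← List.ofFn_eq_map, List.sum_ofFn, Params.reconstruct, ← Finset.sum_add_distrib]
    exact Finset.sum_congr rfl fun k _ => mul_add _ _ _
  simp only [hsum]
  by_cases hy : y = y'
  · rw [Params.fIC, if_pos hy, ← hy]
    refine (PMF.bind_congr_support (g := fun _ => PMF.pure (P.tok (P.prf k y)))
      fun sr hsr => ?_).trans (PMF.bind_const _ _)
    rw [PMF.mem_support_uniformOfFinset_iff, Params.mem_consistent] at hsr
    simp [hsr.1]
  · rw [Params.fIC, if_neg hy]
    obtain ⟨j, hj⟩ := Function.ne_iff.1 hy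
    have hsub : y' j - y j ≠ 0 := sub_ne_zero.2 (Ne.symm hj)
    -- Only the mask at a coordinate `j` with `y j ≠ y' j` is moved. The inverse is chosen such that
    -- the output grows by exactly one, and the shares, hence the secret, stay fixed.
    refine PMF.uniformOfFinset_map_of_translation (F := P.F) _ _
      ((0, Pi.single j (P.coef j * (y' j - y j))⁻¹) : (Fin P.θ → P.F) × (Fin P.θ → P.F))
      (fun a ha c => ?_) (fun a _ c => ?_)
    · rw [Params.mem_consistent] at ha ⊢
      simpa using ha.1
    · simp only [Prod.fst_add, Prod.snd_add, Prod.smul_fst, Prod.smul_snd, smul_zero, add_zero,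
        Pi.add_apply, Pi.smul_apply, smul_eq_mul, add_assoc, add_right_inj]
      have h1 : ∀ i, P.coef i * ((a.2 i + c * (Pi.single j (P.coef j * (y' j - y j))⁻¹ :
          Fin P.θ → P.F) i) * (y' i - y i)) =
          P.coef i * (a.2 i * (y' i - y i)) + if i = j then c else 0 := fun i => by
        split_ifs with hi
        · subst hi
          have := P.coef_ne i
          rw [Pi.single_eq_same]
          field_simp
        · rw [Pi.single_eq_of_ne hi]
          ring
      simp only [h1, Finset.sum_add_distrib, Finset.sum_ite_eq', Finset.mem_univ, if_true]

/-- The reconstruction coefficients, indexed by natural numbers. -/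
def Params.coefAt (P : Params n) (k : ℕ) : P.F := if h : k < P.θ then P.coef ⟨k, h⟩ else 0

/-- Where the inputs of session `k` are kept if both parties are honest. -/
def honestReg (P : Params n) (k : ℕ) : ℕ → Loc
  | 0 => .work (2 * P.θ + k)
  | i + 1 => .work (2 * k + i)

/-- Run `f` on the inputs of session `k`, and add the result to what has been reconstructed. -/
def honestSession (f : P.Oracle → P.F → P.F → P.F → PMF P.F) (k : ℕ) : Step P := fun H m =>
  (f H (m.fld (honestReg P k 0)) (m.fld (honestReg P k 1)) (m.fld (honestReg P k 2))).map fun o =>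
    m.setFld (.top 0) (m.fld (.top 0) + P.coefAt k * o)

/-- Prepare the inputs of all sessions. -/
def honestStart : Step P := fun H m => (serverShares H m).map fun m =>
  (m.setFlds (fun k => .work (2 * P.θ + k))
    (P.token H (ImplicitCheck.topKey m) (ImplicitCheck.topInput m))).setFld (.top 0) 0

theorem Memory.setFld_setFld {A : Type} (m : Memory P A) (a : A) (x y : P.F) :
    (m.setFld a x).setFld a y = m.setFld a y := by
  ext b
  · rfl
  · simp only [setFld_fld]; split_ifs <;> rfl

/-- The sessions communicate only through the accumulator `top 0`. Their inputs lie in `work`, so an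
idle environment lets the sum be formed step by step. -/
theorem play_honestSession (f : P.Oracle → P.F → P.F → P.F → PMF P.F) (H : P.Oracle)
    {y' y s r : Fin P.θ → P.F} (l : List (Fin P.θ)) (e : Env P) {m : Memory P Loc}
    (h0 : ∀ k : Fin P.θ, m.fld (honestReg P k 0) = y' k)
    (h1 : ∀ k : Fin P.θ, m.fld (honestReg P k 1) = r k)
    (h2 : ∀ k : Fin P.θ, m.fld (honestReg P k 2) = s k - r k * y k) :
    World.play H (l.map fun k : Fin P.θ => honestSession f k) (List.replicate l.length [] ++ e) m =
      (combineWith f H y' y s r l (m.fld (.top 0))).map (m.setFld (.top 0)) := by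
  induction l generalizing m with
  | nil =>
    rw [combineWith, PMF.pure_map, setFld_same]; rfl
  | cons k l ih =>
    have hne : ∀ (k i : ℕ) (v : P.F), (m.setFld (.top 0) v).fld (honestReg P k i) =
        m.fld (honestReg P k i) := fun k i v =>
      setFld_fld_of_ne _ _ (by cases i <;> simp [honestReg])
    rw [List.map_cons, List.length_cons, List.replicate_succ, List.cons_append, World.play,
      List.headD_cons, List.tail_cons, envRun_nil, PMF.pure_bind, honestSession, combineWith,
      h0, h1, h2, PMF.bind_map, PMF.map_bind]
    refine congrArg _ (funext fun o => ?_)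
    rw [Function.comp_apply, ih (fun j => (hne _ _ _).trans (h0 j)) (fun j => (hne _ _ _).trans (h1 j))
      (fun j => (hne _ _ _).trans (h2 j)), setFld_fld_self, Params.coefAt, dif_pos k.2]
    exact congrArg (PMF.map · _) (funext fun v => setFld_setFld m _ _ v)

theorem commutes_honestSession (f : P.Oracle → P.F → P.F → P.F → PMF P.F) (k : ℕ) :
    Commutes wipe (honestSession f k) := fun H m => by
  have h : ∀ i, (wipe m).fld (honestReg P k i) = m.fld (honestReg P k i) := fun i => by
    rw [wipe_fld, if_pos (by cases i <;> rfl)]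
  unfold honestSession
  rw [PMF.map_comp, h, h, h, wipe_fld, if_pos (show (Loc.top 0).isGlob = true from rfl)]
  refine congrArg (PMF.map · _) (funext fun o => ?_)
  exact view_setFld (w := blank P Loc) (pInj_glob (f := fun a => a) fun _ _ h => h) (if_pos rfl) m _

theorem Wipeable.of_commutes {W : World P} (h : ∀ g ∈ W, Commutes wipe g) : Wipeable W := by
  have key : ∀ H e g, playWipe W e H g = World.play H W e (wipe g) := fun H e g => by
    have := Commutes.play (φ := wipe) (μ := fun q => q) rfl envRun_wipe h H e g
    rwa [List.map_id'] at this
  intro H e g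
  rw [key, key, wipe_wipe]

/-- The environment that does nothing between the sessions. -/
def expandEnv (P : Params n) (e : Env P) : Env P :=
  e.headD [] :: (List.replicate P.θ [] ++ [e.tail.headD []])

theorem length_flatten_expandEnv (e : Env P) :
    (expandEnv P e).flatten.length ≤ e.flatten.length := by
  have h : (List.replicate P.θ ([] : Prog P EReg)).flatten = [] := by
    simp
  rcases e with - | ⟨a, - | ⟨b, e⟩⟩ <;> simp [expandEnv]

theorem envRun_outBit_congr {H : P.Oracle} (q : Prog P EReg) {m m' : Memory P Loc}
    (h : dropWork m = dropWork m') : (envRun H q m).map outBit = (envRun H q m').map outBit := by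
  have key : ∀ m : Memory P Loc, (envRun H q m).map outBit =
      (envRun H q (dropWork m)).map outBit := fun m => by
    rw [← envRun_dropWork, PMF.map_comp]; rfl
  rw [key m, key m', h]

/-- Serves to cut the single activation of the honest experiment into a start and `θ` sessions, so
that the hybrid argument can replace them one at a time. -/
theorem honestStart_bind {f : P.Oracle → P.F → P.F → P.F → PMF P.F} (H : P.Oracle)
    (q : Prog P EReg) (m : Memory P Loc) (e : Env P) :
    (((honestStart H m).bind (World.play H ((List.range P.θ).map (honestSession f))
      (List.replicate P.θ [] ++ e))).bind (envRun H q)).map outBit =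
    (((honestWith f H (ImplicitCheck.topInput m) (ImplicitCheck.topKey m)
      (ImplicitCheck.topPrfKey m) (ImplicitCheck.topToken m)).map (m.setFld (.top 0))).bind
        (envRun H q)).map outBit := by
  unfold honestStart serverShares honestWith
  rw [PMF.map_comp, PMF.bind_map, PMF.bind_bind, PMF.map_bind, PMF.map_bind, PMF.map_bind,
    PMF.bind_bind]
  refine congrArg _ (funext fun sr => ?_)
  simp only [Function.comp_apply]
  set m₁ := (m.setFlds (fun k => .work (2 * k)) sr.2).setFlds (fun k => .work (2 * k + 1))
    (fun k => sr.1 k - sr.2 k * ImplicitCheck.topToken m k) with hm₁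
  have hk : ImplicitCheck.topKey m₁ = ImplicitCheck.topKey m := by
    funext i
    simp only [ImplicitCheck.topKey, bits, hm₁, setFlds_bit]
  have hx : ImplicitCheck.topInput m₁ = ImplicitCheck.topInput m := by
    funext i
    simp only [ImplicitCheck.topInput, bits, hm₁, setFlds_bit]
  rw [hk, hx]
  have hmap : (List.range P.θ).map (honestSession f) =
      (List.finRange P.θ).map fun k : Fin P.θ => honestSession f k := by
    rw [← List.map_coe_finRange_eq_range, List.map_map]
    rfl
  have hlen : List.replicate P.θ ([] : Prog P EReg) =
      List.replicate (List.finRange P.θ).length [] := by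
    rw [List.length_finRange]
  rw [hmap, hlen, play_honestSession f H (y' := P.token H (ImplicitCheck.topKey m)
    (ImplicitCheck.topInput m)) (y := ImplicitCheck.topToken m) (s := sr.1) (r := sr.2),
    setFld_fld_self, PMF.bind_map, PMF.bind_map, PMF.map_bind]
  -- The two memories differ only in `work` registers, which the environment cannot read.
  · refine congrArg _ (funext fun v => envRun_outBit_congr q ?_)
    rw [setFld_setFld]
    ext a
    · cases a <;> simp [dropWork, view_bit, hm₁]
    · cases a with
      | work i => rfl
      | _ =>
        simp only [dropWork, view_fld, Option.elim_some, setFld_fld]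
        split_ifs <;> first
          | rfl
          | contradiction
          | rw [hm₁, setFlds_fld_of_ne _ _ _ (by simp), setFlds_fld_of_ne _ _ _ (by simp),
              setFlds_fld_of_ne _ _ _ (by simp)]
  · intro k
    rw [setFld_fld_of_ne _ _ (by simp [honestReg])]
    exact setFlds_fld_apply _ (fun k => Loc.work (2 * P.θ + k)) (fun i j h => by simpa using h) _ k
  · intro k
    have := k.2
    rw [setFld_fld_of_ne _ _ (by simp [honestReg]),
      setFlds_fld_of_ne _ _ _ (by simp [honestReg]; omega), hm₁,
      setFlds_fld_of_ne _ _ _ (by simp [honestReg]; omega)]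
    exact setFlds_fld_apply _ _ work_even_injective _ k
  · intro k
    have := k.2
    rw [setFld_fld_of_ne _ _ (by simp [honestReg]),
      setFlds_fld_of_ne _ _ _ (by simp [honestReg]; omega)]
    exact setFlds_fld_apply _ _ work_odd_injective _ k

/-- The environment's second program is postponed to the end and idle moves are put between the
sessions. It is stated for any `f`, so that it covers both the real protocol and `F_ole`. -/
theorem honest_accept (f : P.Oracle → P.F → P.F → P.F → PMF P.F) {R : ℕ → World P}
    (hR : ∀ k, R k = [honestSession f k]) (e : Env P) :
    World.accept [fun H m => (honestWith f H (ImplicitCheck.topInput m) (ImplicitCheck.topKey m)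
      (ImplicitCheck.topPrfKey m) (ImplicitCheck.topToken m)).map (m.setFld (.top 0))] e =
    acceptOf (chain (kernels ([honestStart] :: ((List.range P.θ).map R ++ [[]]))
      (expandEnv P e))) := by
  have hflat : ((List.range P.θ).map R ++ [[]]).flatten =
      (List.range P.θ).map (honestSession f) := by
    have : R = fun k => [honestSession f k] := funext hR
    rw [this, List.flatten_append, ← List.flatMap_def, List.flatten_singleton, List.append_nil]
    exact List.flatMap_pure_eq_map _ _
  rw [← accept_flatten, hflat, World.accept_eq, World.accept_eq]
  · refine acceptOf_congr fun H => ?_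
    change PMF.map outBit _ = PMF.map outBit _
    rw [World.run_eq, World.run_eq, World.play_append]
    have hdrop : ((expandEnv P e).drop ([honestStart] ++
        (List.range P.θ).map (honestSession f)).length).headD [] = e.tail.headD [] := by
      rw [expandEnv, List.length_append, List.length_singleton, Nat.add_comm, List.drop_succ_cons,
        List.length_map, List.length_range, List.drop_left' (by simp)]
      rfl
    rw [hdrop]
    simp only [World.play, expandEnv, List.length_singleton, List.headD_cons, List.drop_succ_cons,
      List.drop_zero, PMF.bind_bind, PMF.pure_bind, PMF.map_bind]
    refine congrArg _ (funext fun m => ?_)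
    have h := honestStart_bind (f := f) H (e.tail.headD []) m [e.tail.headD []]
    simp only [PMF.map_bind, PMF.bind_bind] at h
    rw [h]
    rcases e with - | ⟨a, e⟩ <;> rfl
  · intro W hW
    rw [List.mem_append, List.mem_map, List.mem_singleton] at hW
    rcases hW with ⟨k, _, rfl⟩ | rfl
    · rw [hR]
      exact Wipeable.of_commutes fun g hg => by
        rw [List.mem_singleton.1 hg]; exact commutes_honestSession f k
    · exact Wipeable.nil

end

end

noncomputable section

section

variable {n : ℕ} {P : Params n}

open Memory

/-! ### Programs for the sessions of two honest parties -/

theorem Impl.honestStart : Impl (honestStart (P := P))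
    (P.θ + P.θ + P.θ * (n + 4 * P.θ + 21) + (P.θ * (P.θ + 4) + 2)) := by
  have h1 : Impl (P := P) (A := Loc) (fun H m => PMF.pure (m.setFlds
      (fun k => .work (2 * P.θ + k))
      (P.token H (ImplicitCheck.topKey m) (ImplicitCheck.topInput m)))) (P.θ * (P.θ * 1 + 3 + 1)) :=
    Impl.setFlds _ fun i => ((FComp.emb i (fun i => Loc.top i)
      (fun i => Loc.top (P.keyLen + P.prfKeyLen + i))).add
      (FComp.hash (c := 1) i (fun i => Loc.top (P.keyLen + P.prfKeyLen + i))
        (fun i => FComp.emb i (fun i => Loc.top i)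
          (fun i => Loc.top (P.keyLen + P.prfKeyLen + i))) (fun i => Loc.top i))).mono (by omega)
  have h2 : Impl (P := P) (A := Loc) (fun _ m => PMF.pure (m.setFld (.top 0) 0)) (1 + 1) :=
    Impl.setFld _ (FComp.const _)
  have h := h1.pure_seq h2
  exact (Impl.serverShares.seq_pure h).mono (by rw [mul_one, add_assoc])

theorem Impl.honestSession_idealOLE (k : ℕ) :
    Impl (honestSession (idealOLE (P := P)) k) 10 := by
  have h : Impl (P := P) (A := Loc) (fun _ m => PMF.pure (m.setFld (.top 0)
      (m.fld (.top 0) + P.coefAt k * (m.fld (honestReg P k 1) * m.fld (honestReg P k 0) +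
        m.fld (honestReg P k 2))))) (1 + (1 + (1 + 1 + 1 + 1 + 1) + 1) + 1 + 1) :=
    Impl.setFld _ ((FComp.reg _).add ((FComp.const _).mul (((FComp.reg _).mul
      (FComp.reg _)).add (FComp.reg _))))
  refine (h.mono (by omega)).congr fun H m => ?_
  rw [honestSession, idealOLE, PMF.pure_map]
  rfl

/-- The programs of two honest parties. -/
def OLEProtocol.honestProg (ρ : OLEProtocol P) : Prog P Loc :=
  ((List.range ρ.rounds).flatMap fun t =>
    (ρ.client t).map (Instr.map (PReg.loc true)) ++
    (ρ.server t).map (Instr.map (PReg.loc false))) ++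
  (ρ.client ρ.rounds).map (Instr.map (PReg.loc true))

theorem OLEProtocol.length_honestProg (ρ : OLEProtocol P) : ρ.honestProg.length =
    ∑ t ∈ range (ρ.rounds + 1), (ρ.client t).length +
      ∑ t ∈ range ρ.rounds, (ρ.server t).length := by
  unfold honestProg
  rw [List.length_append, List.length_flatMap, sum_map_range, Finset.sum_range_succ]
  simp only [List.length_append, List.length_map, Finset.sum_add_distrib]
  omega

/-- The memory at the start of a run with two honest parties, for a set-up that has dealt `d`. -/
def OLEProtocol.honestMem (ρ : OLEProtocol P) (x u v : P.F) (d : Memory P DReg) : Memory P Loc :=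
  (((((((blank P Loc).setBits (.prv true) fun i : Fin ρ.setupLen => d.bit (.part true i)).setFlds
    (.prv true) fun i : Fin ρ.setupLen => d.fld (.part true i)).setBits
    (.prv false) fun i : Fin ρ.setupLen => d.bit (.part false i)).setFlds
    (.prv false) fun i : Fin ρ.setupLen => d.fld (.part false i)).setFld (.inp true 0) x).setFld
    (.inp false 0) u).setFld (.inp false 1) v

/-- The initial memory becomes a sequence of writes to the blank memory, a form that the reduction
can carry out. -/
theorem OLEProtocol.honest_eq (ρ : OLEProtocol P) (H : P.Oracle) (x u v : P.F) :
    ρ.honest H x u v = (Prog.run H ρ.dealer (blank P DReg)).bind fun d =>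
      (Prog.run H ρ.honestProg (ρ.honestMem x u v d)).map fun m => m.fld (.prv true 0) := by
  unfold OLEProtocol.honest
  refine congrArg _ (funext fun d => congrArg (fun m => PMF.map _ (Prog.run H _ m)) ?_)
  ext a
  · simp only [honestMem, setFld_bit, setFlds_bit]
    cases a with
    | prv c i =>
      cases c
      · rw [setBits_bit_ite _ (Loc.prv_injective false) _ fun i => d.bit (.part false i),
          setFlds_bit, setBits_bit_of_ne _ _ _ (by simp)]
        rfl
      · rw [setBits_bit_of_ne _ _ _ (by simp), setFlds_bit,
          setBits_bit_ite _ (Loc.prv_injective true) _ fun i => d.bit (.part true i)]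
        rfl
    | _ =>
      rw [setBits_bit_of_ne _ _ _ (by simp), setFlds_bit, setBits_bit_of_ne _ _ _ (by simp)]
      rfl
  · cases a with
    | prv c i =>
      rw [honestMem, setFld_fld_of_ne _ _ (by simp), setFld_fld_of_ne _ _ (by simp),
        setFld_fld_of_ne _ _ (by simp)]
      cases c
      · rw [setFlds_fld_ite _ (Loc.prv_injective false) _ fun i => d.fld (.part false i),
          setBits_fld, setFlds_fld_of_ne _ _ _ (by simp), setBits_fld]
        rfl
      · rw [setFlds_fld_of_ne _ _ _ (by simp), setBits_fld,
          setFlds_fld_ite _ (Loc.prv_injective true) _ fun i => d.fld (.part true i), setBits_fld]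
        rfl
    | inp c i =>
      have h : ((((((blank P Loc).setBits (.prv true)
          fun i : Fin ρ.setupLen => d.bit (.part true i)).setFlds
          (.prv true) fun i : Fin ρ.setupLen => d.fld (.part true i)).setBits
          (.prv false) fun i : Fin ρ.setupLen => d.bit (.part false i)).setFlds
          (.prv false) fun i : Fin ρ.setupLen => d.fld (.part false i))).fld (.inp c i) = 0 := by
        rw [setFlds_fld_of_ne _ _ _ (by simp), setBits_fld, setFlds_fld_of_ne _ _ _ (by simp),
          setBits_fld]
        rfl
      rw [honestMem]
      simp only [setFld_fld, h]
      rcases c with - | - <;> rcases i with - | - | i <;> simp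
    | _ =>
      rw [honestMem, setFld_fld_of_ne _ _ (by simp), setFld_fld_of_ne _ _ (by simp),
        setFld_fld_of_ne _ _ (by simp), setFlds_fld_of_ne _ _ _ (by simp), setBits_fld,
        setFlds_fld_of_ne _ _ _ (by simp), setBits_fld]
      rfl

/-- Start a run with two honest parties, with the inputs of session `k`. -/
def OLEProtocol.loadHonest (ρ : OLEProtocol P) (k : ℕ) (y : Memory P SessReg) :
    Memory P SessReg :=
  ((((((y.setBits (fun i => .inr (.inr (.prv true i)))
    fun i : Fin ρ.setupLen => y.bit (.inr (.inl (.part true i)))).setFlds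
    (fun i => .inr (.inr (.prv true i)))
    fun i : Fin ρ.setupLen => y.fld (.inr (.inl (.part true i)))).setBits
    (fun i => .inr (.inr (.prv false i)))
    fun i : Fin ρ.setupLen => y.bit (.inr (.inl (.part false i)))).setFlds
    (fun i => .inr (.inr (.prv false i)))
    fun i : Fin ρ.setupLen => y.fld (.inr (.inl (.part false i)))).setFld
    (.inr (.inr (.inp true 0))) (y.fld (.inl (honestReg P k 0)))).setFld
    (.inr (.inr (.inp false 0))) (y.fld (.inl (honestReg P k 1)))).setFld
    (.inr (.inr (.inp false 1))) (y.fld (.inl (honestReg P k 2)))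

theorem Impl.loadHonest (ρ : OLEProtocol P) (k : ℕ) :
    Impl (fun _ y => PMF.pure (ρ.loadHonest k y)) (14 * ρ.setupLen + 6) := by
  have h1 : ∀ c, Impl (P := P) (A := SessReg) (fun _ y => PMF.pure (y.setBits
      (fun i => .inr (.inr (.prv c i))) fun i : Fin ρ.setupLen => y.bit (.inr (.inl (.part c i)))))
      (ρ.setupLen * 5) := fun c => Impl.setBits _ fun i => BComp.reg _
  have h2 : ∀ c, Impl (P := P) (A := SessReg) (fun _ y => PMF.pure (y.setFlds
      (fun i => .inr (.inr (.prv c i))) fun i : Fin ρ.setupLen => y.fld (.inr (.inl (.part c i)))))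
      (ρ.setupLen * 2) := fun c => Impl.setFlds _ fun i => FComp.reg _
  have h3 : ∀ c j i, Impl (P := P) (A := SessReg) (fun _ y => PMF.pure (y.setFld
      (.inr (.inr (.inp c j))) (y.fld (.inl (honestReg P k i))))) 2 := fun c j i =>
    Impl.setFld _ (FComp.reg _)
  have h := (((((h1 true).pure_seq (h2 true)).pure_seq ((h1 false).pure_seq (h2 false))).pure_seq
    (h3 true 0 0)).pure_seq ((h3 false 0 1).pure_seq (h3 false 1 2)))
  refine (h.mono (by omega)).congr fun H y => congrArg PMF.pure ?_
  have e1 : ∀ (y : Memory P SessReg) (b : ℕ → Loc) {l : ℕ} (v : Fin l → Bool) (d : DReg),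
      (y.setBits (fun i => .inr (.inr (b i))) v).bit (.inr (.inl d)) = y.bit (.inr (.inl d)) :=
    fun y b l v d => setBits_bit_of_ne _ _ _ (by simp)
  have e2 : ∀ (y : Memory P SessReg) (b : ℕ → Loc) {l : ℕ} (v : Fin l → P.F) (d : DReg),
      (y.setFlds (fun i => .inr (.inr (b i))) v).fld (.inr (.inl d)) = y.fld (.inr (.inl d)) :=
    fun y b l v d => setFlds_fld_of_ne _ _ _ (by simp)
  have e3 : ∀ (y : Memory P SessReg) (b : ℕ → Loc) {l : ℕ} (v : Fin l → P.F) (a : Loc),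
      (y.setFlds (fun i => .inr (.inr (b i))) v).fld (.inl a) = y.fld (.inl a) :=
    fun y b l v d => setFlds_fld_of_ne _ _ _ (by simp)
  have e4 : ∀ (y : Memory P SessReg) (b : Loc) (v : P.F) (a : Loc),
      (y.setFld (.inr (.inr b)) v).fld (.inl a) = y.fld (.inl a) :=
    fun y b v a => setFld_fld_of_ne _ _ (by simp)
  simp only [setBits_fld, setFlds_bit, e1 _ (Loc.prv true), e2 _ (Loc.prv true),
    e3 _ (Loc.prv true), e3 _ (Loc.prv false), e4]
  rfl

theorem OLEProtocol.pull_loadHonest (ρ : OLEProtocol P) (k : ℕ) (y : Memory P SessReg) :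
    pull (fun a => .inl a) (ρ.loadHonest k y) = pull (fun a => .inl a) y := by
  simp only [pull_eq_view (blank P Loc)]
  unfold loadHonest
  rw [view_setFld_of_notMem (by simp), view_setFld_of_notMem (by simp),
    view_setFld_of_notMem (by simp), view_setFlds_of_notMem (by simp),
    view_setBits_of_notMem (by simp), view_setFlds_of_notMem (by simp),
    view_setBits_of_notMem (by simp)]

theorem OLEProtocol.pull_loadHonest_run (ρ : OLEProtocol P) (k : ℕ) {y : Memory P SessReg}
    (hy : pull (fun a => .inr (.inr a)) y = blank P Loc) :
    pull (fun a => .inr (.inr a)) (ρ.loadHonest k y) =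
      ρ.honestMem (y.fld (.inl (honestReg P k 0))) (y.fld (.inl (honestReg P k 1)))
        (y.fld (.inl (honestReg P k 2))) (pull (fun d => .inr (.inl d)) y) := by
  have hi : PInj fun a : Loc => some (.inr (.inr a) : SessReg) :=
    pInj_some (Sum.inr_injective.comp Sum.inr_injective)
  simp only [pull_eq_view (blank P Loc)] at hy ⊢
  unfold loadHonest
  rw [view_setFld hi (a := .inp false 1) rfl, view_setFld hi (a := .inp false 0) rfl,
    view_setFld hi (a := .inp true 0) rfl,
    view_setFlds hi (a := .prv false) fun _ => rfl, view_setBits hi (a := .prv false) fun _ => rfl,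
    view_setFlds hi (a := .prv true) fun _ => rfl, view_setBits hi (a := .prv true) fun _ => rfl,
    hy]
  rfl

/-- Both parties run in the third component of `SessReg`, a separate blank copy of the address
space, so that the run cannot disturb the experiment around it; only the output is carried over. -/
theorem FreshImpl.honestSession (ρ : OLEProtocol P) (k : ℕ) :
    FreshImpl (honestSession ρ.honest k) (14 * ρ.time + 12) := by
  have h0 := Impl.prog (ρ.dealer.map (Instr.map fun d => (.inr (.inl d) : SessReg)))
  have h1 := Impl.loadHonest ρ k
  have h2 := Impl.prog (ρ.honestProg.map (Instr.map fun a => (.inr (.inr a) : SessReg)))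
  have h3 : Impl (P := P) (A := SessReg) (fun _ y => PMF.pure (y.setFld (.inl (.top 0))
      (y.fld (.inl (.top 0)) + P.coefAt k * y.fld (.inr (.inr (.prv true 0))))))
      (1 + (1 + 1 + 1) + 1 + 1) :=
    Impl.setFld _ ((FComp.reg _).add ((FComp.const _).mul (FComp.reg _)))
  obtain ⟨p, hp, h⟩ := ((h0.seq h1).seq h2).seq h3
  refine ⟨p, hp.trans ?_, fun H m g hm hg => ?_⟩
  · rw [List.length_map, List.length_map, ρ.length_honestProg]
    unfold OLEProtocol.time
    omega
  rw [show (pull fun a : Loc => (.inl (.inl a) : SessReg ⊕ ℕ)) =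
    pull (P := P) (fun a => .inl a) ∘ pull Sum.inl from rfl, ← PMF.map_comp, h, hm]
  have hd : (Prog.run H (ρ.dealer.map (Instr.map fun d => (.inr (.inl d) : SessReg)))
      (freshSess g)).map (pull fun d => .inr (.inl d)) = Prog.run H ρ.dealer (blank P DReg) :=
    Prog.run_map_pull (f := fun d => (.inr (.inl d) : SessReg)) (fun _ _ h => by simpa using h) H
      ρ.dealer (freshSess g)
  unfold _root_.honestSession
  rw [ρ.honest_eq, ← hd, PMF.bind_map, PMF.map_bind]
  simp only [PMF.bind_bind, PMF.pure_bind, PMF.map_bind]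
  refine PMF.bind_congr_support fun y hy => ?_
  have hfr := Prog.run_frame H _ hy
  have hy1 : pull (fun a => .inl a) y = g := by
    ext b
    · exact ((hfr (.inl b) (by simp)).1).symm
    · exact ((hfr (.inl b) (by simp)).2).symm
  have hy2 : pull (fun a => .inr (.inr a)) y = blank P Loc := by
    ext b
    · exact ((hfr (.inr (.inr b)) (by simp)).1).symm
    · exact ((hfr (.inr (.inr b)) (by simp)).2).symm
  have hfl : ∀ b, y.fld (.inl b) = g.fld b := fun b => congrFun (congrArg Memory.fld hy1) b
  have hr := Prog.run_map_pull (f := fun a => (.inr (.inr a) : SessReg))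
    (fun _ _ h => by simpa using h) H ρ.honestProg (ρ.loadHonest k y)
  rw [ρ.pull_loadHonest_run k hy2, hfl, hfl, hfl] at hr
  rw [Function.comp_apply, ← hr, PMF.map_comp, PMF.map_comp]
  refine (PMF.bind_congr_support fun z hz => ?_ : _ = PMF.bind _ _)
  have hfz := Prog.run_frame H _ hz
  have hz1 : pull (fun a => .inl a) z = g := by
    rw [← hy1, ← ρ.pull_loadHonest k y]
    ext b
    · exact ((hfz (.inl b) (by simp)).1).symm
    · exact ((hfz (.inl b) (by simp)).2).symm
  have hi : PInj fun a : Loc => some (.inl a : SessReg) := pInj_some Sum.inl_injective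
  rw [PMF.pure_map, Function.comp_apply, pull_eq_view (blank P Loc),
    view_setFld hi (a := .top 0) (b := .inl (.top 0)) rfl, ← pull_eq_view, hz1,
    show z.fld (.inl (.top 0)) = g.fld (.top 0) from congrFun (congrArg Memory.fld hz1) _]
  rfl

theorem SessImpl.honestStart (e : Env P) : SessImpl (playWipe [honestStart (P := P)] e)
    (e.flatten.length + (P.θ + P.θ + P.θ * (n + 4 * P.θ + 21) + (P.θ * (P.θ + 4) + 2))) := by
  have h := SessImpl.world [()] (fun _ => _root_.honestStart (P := P)) _
    (fun _ => Impl.honestStart) e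
  simpa using h

theorem SessImpl.honestSession_idealOLE (k : ℕ) (e : Env P) :
    SessImpl (playWipe [honestSession (idealOLE (P := P)) k] e) (e.flatten.length + 10) := by
  have h := SessImpl.world [()] (fun _ => _root_.honestSession (idealOLE (P := P)) k) _
    (fun _ => Impl.honestSession_idealOLE k) e
  simpa using h

theorem SessImpl.honestSession (ρ : OLEProtocol P) (k : ℕ) (e : Env P) :
    SessImpl (playWipe [honestSession ρ.honest k] e) (e.flatten.length + (14 * ρ.time + 12)) :=
  SessImpl.session (FreshImpl.honestSession ρ k) ([] : List Unit) (fun _ _ => PMF.pure)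
    (fun _ => 0) (fun _ => Impl.id) e

end

end

noncomputable section

section

variable {n : ℕ} {P : Params n}

open Memory

/-! ### Playing a session of two honest parties in an OLE experiment -/

/-- The environment hands over the inputs of `f` and sees its output. -/
def evalWorld (f : P.Oracle → P.F → P.F → P.F → PMF P.F) : World P :=
  [fun H m => (f H (m.fld (.top 0)) (m.fld (.top 1)) (m.fld (.top 2))).map (m.setFld (.top 0))]

/-- Add the output of session `k` to what has been reconstructed. -/
def addOutput (P : Params n) (k : ℕ) : Prog P EReg :=
  [.fconst (.top 1) (P.coefAt k), .fmul (.top 1) (.top 1) (.top 0),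
    .fadd (globReg (.top 0)) (globReg (.top 0)) (.top 1)]

theorem globReg_ne_top (a : Loc) (i : ℕ) : (globReg a).loc ≠ .top i := by
  intro h
  rcases globReg_cases a with ⟨j, hj⟩ | hj
  · rw [hj] at h; simp [globReg, EReg.loc] at h
  · rw [hj] at h; simp [EReg.loc] at h

theorem run_addOutput (H : P.Oracle) (k : ℕ) (m : Memory P Loc) :
    ∃ m', envRun H (addOutput P k) m = PMF.pure (m'.setFld (globReg (.top 0)).loc
      (m.fld (globReg (.top 0)).loc + P.coefAt k * m.fld (.top 0))) ∧
      EqOn (Set.range Loc.top)ᶜ m m' := by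
  refine ⟨_, ?_, (EqOn.setFld m (a := .top 1) (by simp) (P.coefAt k)).trans
    (EqOn.setFld _ (a := .top 1) (by simp) (P.coefAt k * m.fld (.top 0)))⟩
  have h1 : ∀ (m : Memory P Loc) v, (m.setFld (.top 1) v).fld (.top 0) = m.fld (.top 0) :=
    fun m v => setFld_fld_of_ne _ _ (by simp)
  have h2 : ∀ (m : Memory P Loc) v, (m.setFld (.top 1) v).fld (globReg (.top 0)).loc =
      m.fld (globReg (.top 0)).loc := fun m v => setFld_fld_of_ne _ _ (globReg_ne_top _ _)
  simp only [envRun, addOutput, List.map_cons, List.map_nil, Prog.run_cons, Prog.run_nil,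
    Instr.map, Instr.step, PMF.pure_bind, show EReg.loc (.top 0) = .top 0 from rfl,
    show EReg.loc (.top 1) = .top 1 from rfl,
    setFld_fld_self, h1, h2]

theorem globView_congr {m m' : Memory P Loc} (h : EqOn (Set.range Loc.top)ᶜ m m') :
    globView m' = globView m := by
  rw [globView_eq_wipe, globView_eq_wipe, pull_outerReg_congr h]

theorem envRun_liftEnv_globView (H : P.Oracle) (q : Prog P EReg) (m : Memory P Loc) :
    (envRun H (liftEnv q) m).map globView = envRun H q (globView m) := by
  unfold envRun liftEnv
  rw [List.map_map, Instr.map_comp_map]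
  exact Prog.run_view (pInj_glob (EReg.loc_injective.comp globReg_injective))
    (fun a => if_pos a.isGlob_loc) H q m

theorem wipe_setFld_globView (m : Memory P Loc) (i : ℕ) (v : P.F) :
    wipe ((globView m).setFld (.top i) v) = (globView m).setFld (.top i) v := by
  conv_rhs => rw [← wipe_globView]
  exact view_setFld (w := blank P Loc) (pInj_glob (f := fun a => a) fun _ _ h => h) (if_pos rfl) _ v

theorem globView_setFld (m : Memory P Loc) (i : ℕ) (v : P.F) :
    globView (m.setFld (globReg (.top i)).loc v) = (globView m).setFld (.top i) v :=
  view_setFld (w := blank P Loc) (pInj_glob (EReg.loc_injective.comp globReg_injective))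
    (if_pos rfl) m v

theorem sessLocs_subset : sessLocs ⊆ (Set.range Loc.top)ᶜ := by
  rintro _ ⟨x, rfl⟩ ⟨j, hj⟩
  simp at hj

theorem not_mem_sessLocs_globReg (a : Loc) : (globReg a).loc ∉ sessLocs := by
  rintro ⟨⟨k, y⟩, h⟩
  exact globReg_ne_adv a (by omega) (EReg.loc_injective (a₂ := .adv (sessIdx k y)) h.symm)

/-- The OLE experiment takes its inputs from `top` and returns its output in `top 0`. The reduction
copies the inputs there and afterwards adds the weighted output to the emulated accumulator, which
is kept elsewhere. -/
theorem tracks_honestSession (f : P.Oracle → P.F → P.F → P.F → PMF P.F) (k i : ℕ) (e : Env P)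
    (H : P.Oracle) {m : Memory P Loc} (hm : Unused True i m) :
    Tracks globView (Unused False (i + 1))
      ((World.play H (evalWorld f) [liftEnv (e.headD []) ++ copyInputs P 3 (honestReg P k)] m).bind
        (envRun H (addOutput P k)))
      (playWipe [honestSession f k] e H (globView m)) := by
  refine ⟨?_, fun m' hm' => hm.of_eqOn ?_⟩
  · simp only [playWipe, evalWorld, World.play, List.headD_cons, PMF.bind_pure]
    rw [← envRun_liftEnv_globView, PMF.bind_map, envRun_append]
    simp only [PMF.bind_bind, PMF.map_bind]
    refine congrArg _ (funext fun m₁ => ?_)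
    obtain ⟨m₂, h1, h2, h3⟩ := run_copyInputs (P := P) H 3 (honestReg P k) m₁
    have hz : ∀ j < 3, (globView m₁).fld (honestReg P k j) = m₂.fld (.top j) := fun j hj => by
      rw [h2 j hj, globView_fld, if_pos (by cases j <;> rfl)]
    rw [h1, PMF.pure_bind, PMF.bind_map, Function.comp_apply, honestSession,
      hz 0 (by omega), hz 1 (by omega), hz 2 (by omega), PMF.map_comp]
    refine congrArg (PMF.bind _) (funext fun o => ?_)
    -- Apart from the addition itself only genuine `top` registers change, and these hold nothing of
    -- the emulated experiment.
    obtain ⟨m₃, h4, h5⟩ := run_addOutput H k (m₂.setFld (.top 0) o)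
    have h6 : globView m₃ = globView m₁ :=
      globView_congr (h3.trans ((EqOn.setFld m₂ (by simp) o).trans h5))
    have h7 : (globView m₁).fld (.top 0) = m₂.fld (globReg (.top 0)).loc := by
      rw [globView_fld, if_pos (show (Loc.top 0).isGlob = true from rfl)]
      exact (h3 _ fun ⟨j, hj⟩ => globReg_ne_top _ _ hj.symm).2
    rw [Function.comp_apply, h4, PMF.pure_map, globView_setFld, h6, setFld_fld_self,
      setFld_fld_of_ne _ _ (globReg_ne_top _ _), ← h7]
    exact congrArg PMF.pure (wipe_setFld_globView m₁ 0 _).symm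
  · rw [PMF.mem_support_bind_iff] at hm'
    obtain ⟨m₁, h1, h2⟩ := hm'
    obtain ⟨m₂, h3, h4⟩ := run_addOutput H k m₁
    rw [h3, PMF.support_pure, Set.mem_singleton_iff] at h2
    subst h2
    refine EqOn.trans (m' := m₁) ?_ ((h4.mono sessLocs_subset).trans
      (EqOn.setFld _ (not_mem_sessLocs_globReg _) _))
    refine Preserves.play (s := sessLocs) (fun h hh => ?_) (fun q hq => ?_) H m m₁ h1
    · rw [evalWorld, List.mem_singleton] at hh
      subst hh
      intro H m m' hm'
      rw [PMF.support_map] at hm'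
      obtain ⟨o, _, rfl⟩ := hm'
      exact EqOn.setFld m (fun h => sessLocs_subset h ⟨0, rfl⟩) o
    · rw [List.mem_singleton] at hq
      subst hq
      intro H m m' hm'
      dsimp only at hm'
      rw [envRun_append, PMF.mem_support_bind_iff] at hm'
      obtain ⟨m₁, h1, h2⟩ := hm'
      obtain ⟨m₂, h3, _, h4⟩ := run_copyInputs (P := P) H 3 (honestReg P k) m₁
      rw [h3, PMF.support_pure, Set.mem_singleton_iff] at h2
      subst h2
      exact (Preserves.liftEnv _ H m m₁ h1).trans (h4.mono sessLocs_subset)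

theorem Embeds.honest (ρ : OLEProtocol P) (k i : ℕ) (e : Env P) :
    Embeds ρ.worlds.honestReal ρ.worlds.honestIdeal (playWipe [honestSession ρ.honest k] e)
      (playWipe [honestSession idealOLE k] e) i (e.flatten.length + 6) := by
  have hW : ρ.worlds.honestIdeal = evalWorld idealOLE := by
    unfold evalWorld idealOLE
    simp only [PMF.pure_map]
    rfl
  rw [hW]
  -- The overhead of 6 consists of three copied inputs and three instructions to add the output.
  refine ⟨liftEnv (e.headD []) ++ copyInputs P 3 (honestReg P k), [], addOutput P k, rfl, rfl, ?_,
    fun H m hm => ⟨tracks_honestSession ρ.honest k i e H hm,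
      tracks_honestSession idealOLE k i e H hm⟩⟩
  have := length_headD_le e
  simp only [liftEnv, copyInputs, addOutput, List.length_append, List.length_map,
    List.length_range, List.flatten_nil, List.length_nil, List.length_cons]
  omega

end

/-- The output of an honest client is the right one. -/
theorem ImplicitCheck.honest_secure {P : ∀ n, Params n} (hP : Feasible P)
    {ρ : ∀ n, OLEProtocol (P n)} (hρ : PolyBounded fun n => (ρ n).time)
    (hind : Indist P (fun n => (ρ n).worlds.honestReal) (fun n => (ρ n).worlds.honestIdeal)) :
    Indist P (fun n => (ImplicitCheck.worlds (ρ n)).honestReal)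
      (fun n => (ImplicitCheck.worlds (ρ n)).honestIdeal) := by
  intro e he
  obtain ⟨-, hθ, -, -, -⟩ := hP
  let c : ℕ → ℕ := fun n => ((P n).θ + (P n).θ + (P n).θ * (n + 4 * (P n).θ + 21) +
    ((P n).θ * ((P n).θ + 4) + 2)) + (14 * (ρ n).time + 12) + 10
  have hc : PolyBounded c :=
    ((((hθ.add hθ).add (hθ.mul ((PolyBounded.id.add ((PolyBounded.const 4).mul hθ)).add
      (.const 21)))).add ((hθ.mul (hθ.add (.const 4))).add (.const 2))).add
      (((PolyBounded.const 14).mul hρ).add (.const 12))).add (.const 10)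
  have h := negligible_hybridWorlds hind hθ hc (pre := fun n => [honestStart (P := P n)])
    (post := fun _ => []) (R := fun n k => [honestSession (ρ n).honest k])
    (J := fun n k => [honestSession idealOLE k])
    (fun n e => (SessImpl.honestStart e).mono (by simp only [c]; omega))
    (fun n e => SessImpl.nil e _)
    (fun n k _ e => (SessImpl.honestSession (ρ n) k e).mono (by simp only [c]; omega))
    (fun n k _ e => (SessImpl.honestSession_idealOLE k e).mono (by simp only [c]; omega))
    (fun n k _ => rfl)
    (fun n k _ e => (Embeds.honest (ρ n) k (k + 1) e).mono (by simp only [c]; omega))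
    (fun n => expandEnv (P n) (e n)) (he.mono fun n => length_flatten_expandEnv (e n))
  refine h.mono fun n => le_of_eq ?_
  have hJ : (List.range (P n).θ).map (fun k => if k < (P n).θ then
      [honestSession (P := P n) idealOLE k] else [honestSession (ρ n).honest k]) =
      (List.range (P n).θ).map fun k => [honestSession idealOLE k] :=
    List.map_congr_left fun k hk => if_pos (List.mem_range.1 hk)
  simp only [hybridWorlds, Nat.not_lt_zero, if_false, List.cons_append, hJ]
  -- The first and the last hybrid are the split forms of the real experiment and of the same
  -- experiment with `F_ole`; the latter has the intended output exactly.
  rw [← honest_accept (ρ n).honest (fun _ => rfl), ← honest_accept idealOLE (fun _ => rfl)]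
  simp only [honestWith_idealOLE, ← honest_eq_honestWith]
  rfl

end

theorem mainTheorem4 (P : ∀ n : ℕ, Params n) (hP : Feasible P)
    (ρ : ∀ n : ℕ, OLEProtocol (P n)) (hρ : PolyBounded (fun n => (ρ n).time))
    (hole : SecurelyRealizes P (fun n => (ρ n).worlds)) :
    SecurelyRealizes P (fun n => ImplicitCheck.worlds (ρ n)) := by
  obtain ⟨h1, ⟨S, hS, h2⟩, T, hT, h3⟩ := hole
  exact ⟨ImplicitCheck.honest_secure hP hρ h1, ImplicitCheck.client_secure hP hρ hS h2,
    ImplicitCheck.server_secure hP hρ hT h3⟩
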